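/- **Setting.** Let $F$ be a connected oriented surface of genus $g$ with $b>0$ boundary circles $Z_1,\dots,Z_b$, each divided into closed arcs $S_i^+,S_i^-$ that meet only in their end points, with a base point $z_i\in S_i^+$. Let $\alpha_1,\dots,\alpha_{2(g+b-1)}$ be disjoint embedded arcs in $F$ with end points $a_i,a_i'$ in $\bigcup_j S_j^-$ such that $F\setminus\bigcup_i\alpha_i$ is a union of disks, the boundary of each of which contains exactly one $S_j^+$. The circles, the pairs $\{a_i,a_i'\}$ and the base points form an arc diagram $\mathcal Z$. Put $\mathbf k=\bigoplus_i\mathbb F_2$. *The algebra $\mathcal B(\mathcal Z)$* over $\mathbf k$ has as $\mathbb F_2$-basis one idempotent $I_i$ for each pair $\{a_i,a_i'\}$ and all chords, i.e. nontrivial intervals $\rho$ in some $Z_j\setminus\{z_j\}$ with end points among the $a_i,a_i'$, going from $\rho^-$ to $\rho^+$ along $Z_j$. The $I_i$ are orthogonal; $I_i\rho=\rho$ if $\rho^-\in\{a_i,a_i'\}$ and $0$ otherwise; $\rho I_i=\rho$ if $\rho^+\in\{a_i,a_i'\}$ and $0$ otherwise; $\rho\rho'$ is the concatenation if $\rho^+=(\rho')^-$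 and $0$ otherwise. The differential is zero. A chord between adjacent points is called short. *The identity diagram.* $F^\circ$ is the oriented surface obtained from the annuli $Z_j\times[0,1]$ by attaching a 1-handle along each pair $\{a_i,a_i'\}$ in the inner boundaries; $\alpha_i\subset F^\circ$ is the core of the $i$-th handle extended to the outer boundary, and $\eta_i$ is the cocore of the $i$-th handle, so that $\alpha_i$ and $\eta_j$ are disjoint for $i\ne j$ and meet transversally in one point $x_i$ for $i=j$. The end points of the $\eta_i$ on the inner boundary of $F^\circ$ form the dual arc diagram $\mathcal Z'$, whose base points lie opposite to the $z_j$. Both $\mathcal Z$ and $\mathcal Z'$ carry the boundary orientation of $F^\circ$. Each component of $F^\circ\setminus(\bigcup\alpha_i\cup\bigcup\eta_i)$ is a hexagon; if it has a short chord $\xi$ of $\mathcal Z$ on its boundary, then it has exactly one short chord $\xi'$ of $\mathcal Z'$ on its boundary. *Polygons.* Let $\mathbb D^2=\{v\in\mathbb C: \operatorname{Re}v\ge0,|v|\le1\}$, with left side $\gamma_L=\{\operatorname{Re} v=0\}$ and right side $\gamma_R=\{|v|=1\}$, both traversed from $-i$ to $i$. A polygon from $x$ to $y$ through chords $(\sigma_1,\dots,\sigma_m)$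 of $\mathcal Z'$ and $(\rho_1,\dots,\rho_n)$ of $\mathcal Z$ is a continuous map $Q:\mathbb D^2\to F^\circ$ with $Q(-i)=x$, $Q(i)=y$, $Q(\gamma_L)\subset\bigcup\eta_i\cup\partial F^\circ$, $Q(\gamma_R)\subset\bigcup\alpha_i\cup\partial F^\circ$, for which there are distinct points $p_1,\dots,p_{2m}\in\gamma_L$ and $q_1,\dots,q_{2n}\in\gamma_R$, in this order along the sides, such that $Q$ is a smooth orientation preserving immersion away from them, $Q([p_{2i-1},p_{2i}])=\sigma_i$, $Q([q_{2i-1},q_{2i}])=\rho_i$, and $Q$ maps the rest of $\mathbb D^2$ to the interior of $F^\circ$. Polygons that differ by a homeomorphism of $\mathbb D^2$ which is a diffeomorphism away from these points are identified, and $n(x,y,(\sigma_i),(\rho_i))\in\mathbb F_2$ is the number of classes modulo 2. *The bimodules.* $M(\mathbb I)$ is the $A_\infty$-bimodule over $\mathcal B(\mathcal Z')$ and $\mathcal B(\mathcal Z)$ generated over $\mathbb F_2$ by the points $x_i$, with $$m(\sigma_m,\dots,\sigma_1,x,\rho_1,\dots,\rho_n)=\sum_y n(x,y,(\sigma_1,\dots,\sigma_m),(\rho_1,\dots,\rho_n))\,y$$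 on chords; the idempotents of the $\alpha$-arc and of the $\eta$-arc through $x$ act as the identity on $x$ from the right and from the left respectively, all other idempotents act by $0$, and all operations with at least two algebra inputs vanish if one of these is an idempotent. $DD(\mathbb I/2)$ is the type $DD$ bimodule over $\mathcal B(\mathcal Z)$ and $\mathcal B(\mathcal Z')$ with generators $w_i=I_iw_iJ_i$ (one for each $x_i$, where $J_i$ is the idempotent of $\eta_i$) and $$\delta^1(w_i)=\sum_j\sum_{\xi\ \text{short}} I_i\xi\otimes w_j\otimes\xi'J_i .$$ The type $DA$ bimodule $DD(\mathbb I/2)\boxtimes M(\mathbb I)$ is $DD(\mathbb I/2)\otimes_{\mathbf k}M(\mathbb I)$, with the structure map that applies $\delta_{DD}=\sum_{n\ge0}\delta^n_{DD}$ to the first factor ($\delta^0_{DD}=\mathrm{id}$, $\delta^{n+1}_{DD}=(\mathrm{id}\otimes\delta^{n}_{DD}\otimes\mathrm{id})\circ\delta^1$), multiplies the outputs in $\mathcal B(\mathcal Z)$ together and feeds the outputs in $\mathcal B(\mathcal Z')$ to $m$ from the left. The identity type $DA$ bimodule ${}^{\mathcal A}\mathbb I_{\mathcal A}$ over $\mathcal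 A=\mathcal B(\mathcal Z)$ is $\mathbf k$ with generator $\iota$ and the only operation $\delta^{1,2}(\iota,a)=a\otimes\iota$. **Theorem.** For every arc diagram $\mathcal Z$, only finitely many $\delta^n_{DD}$ contribute to $DD(\mathbb I/2)\boxtimes M(\mathbb I)$, both it and ${}^{\mathcal A}\mathbb I_{\mathcal A}$ satisfy the structure equations of a type $DA$ bimodule over $\mathcal A=\mathcal B(\mathcal Z)$, and $DD(\mathbb I/2)\boxtimes M(\mathbb I)$ is isomorphic to ${}^{\mathcal A}\mathbb I_{\mathcal A}$ as a type $DA$ bimodule, by an isomorphism of $\mathbf k$-bimodules that intertwines the structure maps. -/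

import Mathlib

open scoped TensorProduct ContDiff

set_option linter.unusedSectionVars false

namespace Bordered

/-! ## Algebra over the ground ring `k = ⨁_{i : ι} 𝔽₂`

All algebras below have zero differential, so that as `A∞`-algebras their only operation is the
product `μ₂`.  Everything is linear over `𝔽₂`; the ground ring `k` enters through its
idempotents `e_i`. -/

section Algebra

/-- The field with two elements. -/
abbrev F2 := ZMod 2

/-- A `k`-bimodule structure on an `𝔽₂`-vector space, for `k = ⨁_{i : ι} 𝔽₂`:
`left i v = e_i v` and `right i v = v e_i` for the standard idempotents `e_i` of `k`. -/
class KBimodule (ι : Type*) [Fintype ι] [DecidableEq ι] (V : Type*) [AddCommGroup V]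
    [Module F2 V] where
  left : ι → V →ₗ[F2] V
  right : ι → V →ₗ[F2] V
  left_left : ∀ i j v, left i (left j v) = if i = j then left i v else 0
  sum_left : ∀ v, ∑ i, left i v = v
  right_right : ∀ i j v, right i (right j v) = if i = j then right i v else 0
  sum_right : ∀ v, ∑ i, right i v = v
  left_right : ∀ i j v, left i (right j v) = right j (left i v)

/-- A (not necessarily central) algebra over `k = ⨁_{i : ι} 𝔽₂`, with `e i` the image of the
`i`-th idempotent of `k`. -/
class KAlgebra (ι : Type*) [Fintype ι] [DecidableEq ι] (A : Type*) [Ring A]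
    [Algebra F2 A] where
  e : ι → A
  complete : CompleteOrthogonalIdempotents e

variable (ι : Type*) [Fintype ι] [DecidableEq ι]

/-- A `k`-algebra is a `k`-bimodule by left and right multiplication. -/
instance KAlgebra.toKBimodule (A : Type*) [Ring A] [Algebra F2 A] [KAlgebra ι A] :
    KBimodule ι A where
  left i := LinearMap.mulLeft F2 (KAlgebra.e i)
  right i := LinearMap.mulRight F2 (KAlgebra.e i)
  left_left i j v := by
    have h := (KAlgebra.complete (ι := ι) (A := A)).mul_eq i j
    simp only [LinearMap.mulLeft_apply, ← mul_assoc, h]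
    split_ifs <;> simp
  sum_left v := by
    simp only [LinearMap.mulLeft_apply, ← Finset.sum_mul,
      (KAlgebra.complete (ι := ι) (A := A)).complete, one_mul]
  right_right i j v := by
    have h := (KAlgebra.complete (ι := ι) (A := A)).mul_eq j i
    simp only [LinearMap.mulRight_apply, mul_assoc, h]
    by_cases hij : i = j
    · simp [hij]
    · simp [hij, Ne.symm hij]
  sum_right v := by
    simp only [LinearMap.mulRight_apply, ← Finset.mul_sum,
      (KAlgebra.complete (ι := ι) (A := A)).complete, mul_one]
  left_right i j v := by simp [mul_assoc]

/-- The ground ring `k` is an algebra over itself. -/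
instance groundKAlgebra : KAlgebra ι (ι → F2) where
  e i := Pi.single i 1
  complete := CompleteOrthogonalIdempotents.single (fun _ => F2)

/-- The structure map `k → A` of a `k`-algebra. -/
noncomputable def groundMap (A : Type*) [Ring A] [Algebra F2 A] [KAlgebra ι A] :
    (ι → F2) →ₗ[F2] A :=
  Fintype.linearCombination F2 (KAlgebra.e : ι → A)

/-- The `k`-bimodule with `𝔽₂`-basis `X`, where the basis element `x` satisfies
`e_{l x} x = x = x e_{r x}`. -/
def FreeKB {X : Type*} (_l _r : X → ι) : Type _ := X →₀ F2

section FreeKB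
variable {ι} {X : Type*} (l r : X → ι)

noncomputable instance : AddCommGroup (FreeKB ι l r) := inferInstanceAs (AddCommGroup (X →₀ F2))
noncomputable instance : Module F2 (FreeKB ι l r) := inferInstanceAs (Module F2 (X →₀ F2))

/-- The defining basis of `FreeKB`. -/
noncomputable def FreeKB.basis : Module.Basis X F2 (FreeKB ι l r) :=
  .ofRepr (LinearEquiv.refl F2 (X →₀ F2))

theorem FreeKB.ext_apply {f g : FreeKB ι l r →ₗ[F2] FreeKB ι l r}
    (h : ∀ x, f (basis l r x) = g (basis l r x)) (v : FreeKB ι l r) : f v = g v :=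
  LinearMap.congr_fun ((basis l r).ext h) v

/-- The projection to the span of the basis elements with a given label. -/
noncomputable def FreeKB.proj (c : X → ι) (i : ι) : FreeKB ι l r →ₗ[F2] FreeKB ι l r :=
  (basis l r).constr F2 fun x => if c x = i then basis l r x else 0

theorem FreeKB.proj_basis (c : X → ι) (i : ι) (x : X) :
    proj l r c i (basis l r x) = if c x = i then basis l r x else 0 :=
  (basis l r).constr_basis F2 _ x

theorem FreeKB.proj_proj (c : X → ι) (i j : ι) (v : FreeKB ι l r) :
    proj l r c i (proj l r c j v) = if i = j then proj l r c i v else 0 := by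
  by_cases hij : i = j
  · subst hij
    rw [if_pos rfl]
    refine ext_apply l r (f := (proj l r c i).comp (proj l r c i)) (fun x => ?_) v
    simp only [LinearMap.comp_apply, proj_basis]
    split_ifs with h
    · rw [proj_basis, if_pos h]
    · rw [map_zero]
  · rw [if_neg hij]
    refine ext_apply l r (f := (proj l r c i).comp (proj l r c j)) (g := 0) (fun x => ?_) v
    simp only [LinearMap.comp_apply, proj_basis, LinearMap.zero_apply]
    split_ifs with h
    · rw [proj_basis, if_neg (fun h' => hij (h'.symm.trans h))]
    · rw [map_zero]

theorem FreeKB.sum_proj (c : X → ι) (v : FreeKB ι l r) : ∑ i, proj l r c i v = v := by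
  have := ext_apply l r (f := ∑ i, proj l r c i) (g := LinearMap.id)
    (fun x => by simp [LinearMap.sum_apply, proj_basis]) v
  simpa [LinearMap.sum_apply] using this

noncomputable instance : KBimodule ι (FreeKB ι l r) where
  left := FreeKB.proj l r l
  right := FreeKB.proj l r r
  left_left := FreeKB.proj_proj l r l
  sum_left := FreeKB.sum_proj l r l
  right_right := FreeKB.proj_proj l r r
  sum_right := FreeKB.sum_proj l r r
  left_right i j v := by
    refine FreeKB.ext_apply l r (f := (FreeKB.proj l r l i).comp (FreeKB.proj l r r j))
      (g := (FreeKB.proj l r r j).comp (FreeKB.proj l r l i)) (fun x => ?_) v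
    simp only [LinearMap.comp_apply, FreeKB.proj_basis]
    by_cases h : l x = i <;> by_cases h' : r x = j <;> simp [h, h', FreeKB.proj_basis]

end FreeKB

section KTensor

variable (V W : Type*) [AddCommGroup V] [Module F2 V] [AddCommGroup W] [Module F2 W]
  [KBimodule ι V] [KBimodule ι W]

/-- The subspace of `V ⊗ W` spanned by the elements `v e_i ⊗ w - v ⊗ e_i w`. -/
def balancing : Submodule F2 (V ⊗[F2] W) :=
  Submodule.span F2 {t | ∃ (i : ι) (v : V) (w : W),
    t = KBimodule.right i v ⊗ₜ[F2] w - v ⊗ₜ[F2] KBimodule.left i w}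

/-- The tensor product `V ⊗_k W` of `k`-bimodules. -/
def KTensor : Type _ := (V ⊗[F2] W) ⧸ balancing ι V W

noncomputable instance : AddCommGroup (KTensor ι V W) :=
  inferInstanceAs (AddCommGroup ((V ⊗[F2] W) ⧸ balancing ι V W))
noncomputable instance : Module F2 (KTensor ι V W) :=
  inferInstanceAs (Module F2 ((V ⊗[F2] W) ⧸ balancing ι V W))

/-- The quotient map `V ⊗ W → V ⊗_k W`. -/
noncomputable def KTensor.mk : V ⊗[F2] W →ₗ[F2] KTensor ι V W := (balancing ι V W).mkQ

theorem KTensor.mk_surjective : Function.Surjective (KTensor.mk ι V W) :=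
  (balancing ι V W).mkQ_surjective

theorem KTensor.mk_right_tmul (i : ι) (v : V) (w : W) :
    KTensor.mk ι V W (KBimodule.right i v ⊗ₜ[F2] w) =
      KTensor.mk ι V W (v ⊗ₜ[F2] KBimodule.left i w) := by
  rw [← sub_eq_zero, ← map_sub]
  exact (Submodule.Quotient.mk_eq_zero _).2 (Submodule.subset_span ⟨i, v, w, rfl⟩)

variable {V W} {U : Type*} [AddCommGroup U] [Module F2 U]

/-- The map on `V ⊗_k W` induced by a balanced map on `V ⊗ W`. -/
noncomputable def KTensor.lift (f : V ⊗[F2] W →ₗ[F2] U)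
    (h : ∀ (i : ι) v w, f (KBimodule.right i v ⊗ₜ[F2] w) = f (v ⊗ₜ[F2] KBimodule.left i w)) :
    KTensor ι V W →ₗ[F2] U :=
  (balancing ι V W).liftQ f (Submodule.span_le.2 (by
    rintro _ ⟨i, v, w, rfl⟩
    rw [SetLike.mem_coe, LinearMap.mem_ker, map_sub, h, sub_self]))

theorem KTensor.lift_mk (f : V ⊗[F2] W →ₗ[F2] U) (h) (t : V ⊗[F2] W) :
    KTensor.lift ι f h (KTensor.mk ι V W t) = f t :=
  (balancing ι V W).liftQ_apply f t

theorem KTensor.ext_apply {f g : KTensor ι V W →ₗ[F2] U}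
    (h : ∀ v w, f (KTensor.mk ι V W (v ⊗ₜ w)) = g (KTensor.mk ι V W (v ⊗ₜ w)))
    (t : KTensor ι V W) : f t = g t := by
  obtain ⟨t, rfl⟩ := KTensor.mk_surjective ι V W t
  exact LinearMap.congr_fun
    (TensorProduct.ext' (g := f.comp (mk ι V W)) (h := g.comp (mk ι V W)) h) t

variable (V W)

/-- The canonical section `v ⊗ w ↦ ∑ i, v e_i ⊗ e_i w` of the quotient map
`V ⊗ W → V ⊗_k W`.  If a linear map `f` on `V ⊗ W` is `k`-balanced, then `f ∘ unpack` is the map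
induced by `f` on `V ⊗_k W` (see `comp_unpack`). -/
noncomputable def KTensor.unpack : KTensor ι V W →ₗ[F2] V ⊗[F2] W :=
  KTensor.lift ι
    (∑ i, TensorProduct.map (KBimodule.right (ι := ι) i) (KBimodule.left (ι := ι) i))
    (fun i v w => by
      simp only [LinearMap.sum_apply, TensorProduct.map_tmul, KBimodule.right_right,
        KBimodule.left_left]
      refine Finset.sum_congr rfl fun j _ => ?_
      split_ifs with h <;> simp)

theorem KTensor.unpack_mk (v : V) (w : W) :
    KTensor.unpack ι V W (KTensor.mk ι V W (v ⊗ₜ w)) =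
      ∑ i : ι, KBimodule.right i v ⊗ₜ[F2] KBimodule.left i w := by
  simp only [unpack, KTensor.lift_mk, LinearMap.sum_apply, TensorProduct.map_tmul]

theorem KTensor.comp_unpack (f : V ⊗[F2] W →ₗ[F2] U)
    (h : ∀ (i : ι) v w, f (KBimodule.right i v ⊗ₜ[F2] w) = f (v ⊗ₜ[F2] KBimodule.left i w)) :
    f ∘ₗ KTensor.unpack ι V W = KTensor.lift ι f h := by
  refine LinearMap.ext (KTensor.ext_apply ι fun v w => ?_)
  have : ∀ i : ι, f (KBimodule.right i v ⊗ₜ[F2] KBimodule.left i w) =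
      f (v ⊗ₜ[F2] KBimodule.left i w) := fun i => by
    rw [h, KBimodule.left_left, if_pos rfl]
  rw [LinearMap.comp_apply, KTensor.unpack_mk, KTensor.lift_mk, map_sum,
    Finset.sum_congr rfl fun i _ => this i, ← map_sum, ← TensorProduct.tmul_sum,
    KBimodule.sum_left]

/-- The left action of an idempotent on `V ⊗_k W`. -/
noncomputable def KTensor.left (i : ι) : KTensor ι V W →ₗ[F2] KTensor ι V W :=
  KTensor.lift ι (KTensor.mk ι V W ∘ₗ LinearMap.rTensor W (KBimodule.left i)) (fun j v w => by
    simp only [LinearMap.comp_apply, LinearMap.rTensor_tmul, KBimodule.left_right,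
      KTensor.mk_right_tmul])

/-- The right action of an idempotent on `V ⊗_k W`. -/
noncomputable def KTensor.right (i : ι) : KTensor ι V W →ₗ[F2] KTensor ι V W :=
  KTensor.lift ι (KTensor.mk ι V W ∘ₗ LinearMap.lTensor V (KBimodule.right i)) (fun j v w => by
    simp only [LinearMap.comp_apply, LinearMap.lTensor_tmul, ← KBimodule.left_right,
      KTensor.mk_right_tmul])

theorem KTensor.left_mk (i : ι) (v : V) (w : W) :
    KTensor.left ι V W i (KTensor.mk ι V W (v ⊗ₜ w)) =
      KTensor.mk ι V W (KBimodule.left i v ⊗ₜ w) := by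
  rw [KTensor.left]
  exact KTensor.lift_mk ι _ _ _

theorem KTensor.right_mk (i : ι) (v : V) (w : W) :
    KTensor.right ι V W i (KTensor.mk ι V W (v ⊗ₜ w)) =
      KTensor.mk ι V W (v ⊗ₜ KBimodule.right i w) := by
  rw [KTensor.right]
  exact KTensor.lift_mk ι _ _ _

/-- `k` acts on `V ⊗_k W` on the left through `V` and on the right through `W`. -/
noncomputable instance : KBimodule ι (KTensor ι V W) where
  left := KTensor.left ι V W
  right := KTensor.right ι V W
  left_left i j t := by
    by_cases hij : i = j
    · rw [if_pos hij]
      refine KTensor.ext_apply ι (f := (KTensor.left ι V W i).comp (KTensor.left ι V W j))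
        (fun v w => ?_) t
      simp only [LinearMap.comp_apply, KTensor.left_mk, KBimodule.left_left, if_pos hij]
    · rw [if_neg hij]
      refine KTensor.ext_apply ι (f := (KTensor.left ι V W i).comp (KTensor.left ι V W j))
        (g := 0) (fun v w => ?_) t
      simp only [LinearMap.comp_apply, KTensor.left_mk, KBimodule.left_left, if_neg hij,
        TensorProduct.zero_tmul, map_zero, LinearMap.zero_apply]
  sum_left t := by
    rw [← LinearMap.sum_apply]
    refine KTensor.ext_apply ι (g := LinearMap.id) (fun v w => ?_) t
    simp only [LinearMap.sum_apply, KTensor.left_mk, ← map_sum, ← TensorProduct.sum_tmul,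
      KBimodule.sum_left, LinearMap.id_apply]
  right_right i j t := by
    by_cases hij : i = j
    · rw [if_pos hij]
      refine KTensor.ext_apply ι (f := (KTensor.right ι V W i).comp (KTensor.right ι V W j))
        (fun v w => ?_) t
      simp only [LinearMap.comp_apply, KTensor.right_mk, KBimodule.right_right, if_pos hij]
    · rw [if_neg hij]
      refine KTensor.ext_apply ι (f := (KTensor.right ι V W i).comp (KTensor.right ι V W j))
        (g := 0) (fun v w => ?_) t
      simp only [LinearMap.comp_apply, KTensor.right_mk, KBimodule.right_right, if_neg hij,
        TensorProduct.tmul_zero, map_zero, LinearMap.zero_apply]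
  sum_right t := by
    rw [← LinearMap.sum_apply]
    refine KTensor.ext_apply ι (g := LinearMap.id) (fun v w => ?_) t
    simp only [LinearMap.sum_apply, KTensor.right_mk, ← map_sum, ← TensorProduct.tmul_sum,
      KBimodule.sum_right, LinearMap.id_apply]
  left_right i j t := by
    refine KTensor.ext_apply ι (f := (KTensor.left ι V W i).comp (KTensor.right ι V W j))
      (g := (KTensor.right ι V W j).comp (KTensor.left ι V W i)) (fun v w => ?_) t
    simp only [LinearMap.comp_apply, KTensor.right_mk, KTensor.left_mk]

end KTensor

/-! ## Type `AA`, `DD` and `DA` bimodules -/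

section Bimodules

/-- `T*(B)`. -/
abbrev T (B : Type*) [Ring B] [Algebra F2 B] := TensorAlgebra F2 B

/-- The element `b₁ ⊗ ⋯ ⊗ bₙ` of `T*(B)`. -/
noncomputable def word {B : Type*} [Ring B] [Algebra F2 B] (bs : List B) : T B :=
  (bs.map (TensorAlgebra.ι F2)).prod

/-- The map `D̄` of `T*(B)`, for an algebra `B` whose only operation is `μ₂`:
`b₁ ⊗ ⋯ ⊗ bₙ ↦ ∑ l, b₁ ⊗ ⋯ ⊗ b_l b_{l+1} ⊗ ⋯ ⊗ bₙ`. -/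
noncomputable def barD {B : Type*} [Ring B] [Algebra F2 B] : List B → T B
  | [] => 0
  | [_] => 0
  | b :: c :: bs => word ((b * c) :: bs) + TensorAlgebra.ι F2 b * barD (c :: bs)

section AA
variable (A N B : Type*) [Ring A] [Algebra F2 A] [Ring B] [Algebra F2 B]
  [AddCommGroup N] [Module F2 N]

/-- The total structure map `m : T*(A) ⊗ N ⊗ T*(B) → N` of an `A∞`-bimodule (type `AA`
bimodule). -/
structure AAMap where
  m : T A →ₗ[F2] N →ₗ[F2] T B →ₗ[F2] N

end AA

section DD
variable (A X B : Type*) [Ring A] [Algebra F2 A] [KAlgebra ι A] [Ring B] [Algebra F2 B]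
  [KAlgebra ι B] [AddCommGroup X] [Module F2 X] [KBimodule ι X]

/-- The structure map `δ¹ : X → A ⊗_k X ⊗_k B` of a type `DD` bimodule. -/
structure DDMap where
  δ : X →ₗ[F2] KTensor ι (KTensor ι A X) B

variable {ι A X B}

/-- The multiplication `A ⊗ T*(A) ⊗ X ⊗ T*(B) ⊗ B → T*(A) ⊗ X ⊗ T*(B)`. -/
noncomputable def outerMul :
    (A ⊗[F2] ((T A ⊗[F2] X) ⊗[F2] T B)) ⊗[F2] B →ₗ[F2] (T A ⊗[F2] X) ⊗[F2] T B :=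
  TensorProduct.map
      ((TensorProduct.lift ((LinearMap.mul F2 (T A)).comp (TensorAlgebra.ι F2))).rTensor X)
      (TensorProduct.lift ((LinearMap.mul F2 (T B)).compl₂ (TensorAlgebra.ι F2)))
    ∘ₗ (TensorProduct.assoc F2 _ _ _).toLinearMap
    ∘ₗ (((TensorProduct.assoc F2 A (T A) X).symm.toLinearMap.rTensor (T B)).rTensor B)
    ∘ₗ ((TensorProduct.assoc F2 A (T A ⊗[F2] X) (T B)).symm.toLinearMap.rTensor B)

/-- The iterates `δⁿ : X → T*(A) ⊗ X ⊗ T*(B)` of `δ¹`: `δ⁰ = 𝕀` and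
`δⁿ⁺¹ = (𝕀 ⊗ δⁿ ⊗ 𝕀) ∘ δ¹`. -/
noncomputable def DDMap.iter (D : DDMap ι A X B) : ℕ → X →ₗ[F2] (T A ⊗[F2] X) ⊗[F2] T B
  | 0 => (TensorProduct.mk F2 (T A ⊗[F2] X) (T B)).flip 1 ∘ₗ TensorProduct.mk F2 (T A) X 1
  | n + 1 => outerMul ∘ₗ ((D.iter n).lTensor A).rTensor B
      ∘ₗ (KTensor.unpack ι A X).rTensor B ∘ₗ KTensor.unpack ι (KTensor ι A X) B ∘ₗ D.δ

end DD

section DA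
variable (A M B : Type*) [Ring A] [Algebra F2 A] [KAlgebra ι A] [Ring B] [Algebra F2 B]
  [KAlgebra ι B] [AddCommGroup M] [Module F2 M] [KBimodule ι M]

/-- The total structure map `δ¹ : M ⊗ T*(B) → A ⊗_k M` of a type `DA` bimodule. -/
structure DAMap where
  δ : M →ₗ[F2] T B →ₗ[F2] KTensor ι A M

variable {ι A M B}

/-- The map `(μ₂ ⊗ 𝕀) ∘ (𝕀 ⊗ δ¹( · , t)) : A ⊗_k M → A ⊗_k M`. -/
noncomputable def DAMap.mulδ (D : DAMap ι A M B) (t : T B) :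
    KTensor ι A M →ₗ[F2] KTensor ι A M :=
  KTensor.mk ι A M
    ∘ₗ (TensorProduct.lift (LinearMap.mul F2 A)).rTensor M
    ∘ₗ (TensorProduct.assoc F2 A A M).symm.toLinearMap
    ∘ₗ (KTensor.unpack ι A M ∘ₗ D.δ.flip t).lTensor A
    ∘ₗ KTensor.unpack ι A M

/-- `δ¹` is the structure map of a type `DA` bimodule over the algebras `A` and `B`: it is a map
of `k`-bimodules defined on `M ⊗_k B ⊗_k ⋯ ⊗_k B`, and it satisfies the structure equation.
As `A` and `B` have only the operation `μ₂`, the structure equation in `T*(A) ⊗ M` amounts to its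
component in `A ⊗ M`, which is the equation stated here. -/
structure DAMap.IsTypeDA (D : DAMap ι A M B) : Prop where
  left_linear : ∀ (i : ι) x t, D.δ (KBimodule.left i x) t = KBimodule.left i (D.δ x t)
  right_linear_nil : ∀ (i : ι) x, D.δ (KBimodule.right i x) 1 = KBimodule.right i (D.δ x 1)
  right_linear : ∀ (i : ι) x t (b : B),
    D.δ x (t * TensorAlgebra.ι F2 (KBimodule.right i b)) =
      KBimodule.right i (D.δ x (t * TensorAlgebra.ι F2 b))
  balanced_nil : ∀ (i : ι) x (b : B) t,
    D.δ (KBimodule.right i x) (TensorAlgebra.ι F2 b * t) =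
      D.δ x (TensorAlgebra.ι F2 (KBimodule.left i b) * t)
  balanced : ∀ (i : ι) x t (b c : B) t',
    D.δ x (t * TensorAlgebra.ι F2 (KBimodule.right i b) * TensorAlgebra.ι F2 c * t') =
      D.δ x (t * TensorAlgebra.ι F2 b * TensorAlgebra.ι F2 (KBimodule.left i c) * t')
  structure_eq : ∀ x (bs : List B),
    D.δ x (barD bs) +
      ∑ k ∈ Finset.range (bs.length + 1),
        D.mulδ (word (bs.drop k)) (D.δ x (word (bs.take k))) = 0

variable {N : Type*} [AddCommGroup N] [Module F2 N] [KBimodule ι N]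

/-- An isomorphism of type `DA` bimodules: an isomorphism of `k`-bimodules which intertwines the
structure maps. -/
structure DAIso (D : DAMap ι A M B) (E : DAMap ι A N B) where
  toEquiv : M ≃ₗ[F2] N
  map_left : ∀ (i : ι) x, toEquiv (KBimodule.left i x) = KBimodule.left i (toEquiv x)
  map_right : ∀ (i : ι) x, toEquiv (KBimodule.right i x) = KBimodule.right i (toEquiv x)
  map_δ : ∀ x t, E.δ (toEquiv x) t =
    KTensor.mk ι A N (toEquiv.toLinearMap.lTensor A (KTensor.unpack ι A M (D.δ x t)))

end DA

section Identity
variable (A : Type*) [Ring A] [Algebra F2 A] [KAlgebra ι A]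

/-- The identity type `DA` bimodule: its underlying `k`-bimodule is `k`, generated by `ι = 1`, and
its only operation is `δ^{1,2}(ι, a) = a ⊗ ι`, that is `δ^{1,2}(c, a) = c a ⊗ ι` for `c` in `k`. -/
noncomputable def identityDA : DAMap ι A (ι → F2) A where
  δ := ((LinearMap.mul F2 A).comp (groundMap ι A)).compr₂
      (KTensor.mk ι A (ι → F2) ∘ₗ (TensorProduct.mk F2 A (ι → F2)).flip 1)
    |>.compl₂ TensorAlgebra.ιInv

end Identity

section Box
variable {ι} {A X B N C : Type*} [Ring A] [Algebra F2 A] [KAlgebra ι A] [Ring B] [Algebra F2 B]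
  [KAlgebra ι B] [Ring C] [Algebra F2 C] [KAlgebra ι C]
  [AddCommGroup X] [Module F2 X] [KBimodule ι X] [AddCommGroup N] [Module F2 N] [KBimodule ι N]

/-- The map `(X ⊗_k N) ⊗ T*(C) → A ⊗_k (X ⊗_k N)` which applies `δⁿ_DD` to `X`, then
multiplies its `n` outputs in `A` together, and feeds its `n` outputs in `B` to `m`. -/
noncomputable def boxTerm (D : DDMap ι A X B) (E : AAMap B N C) (n : ℕ) :
    KTensor ι X N →ₗ[F2] T C →ₗ[F2] KTensor ι A (KTensor ι X N) :=
  LinearMap.flip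
    { toFun := fun t =>
        KTensor.mk ι A (KTensor ι X N)
          ∘ₗ TensorProduct.map (TensorAlgebra.lift F2 (LinearMap.id : A →ₗ[F2] A)).toLinearMap
            (KTensor.mk ι X N)
          ∘ₗ (TensorProduct.assoc F2 (T A) X N).toLinearMap
          ∘ₗ (TensorProduct.lift (E.m.compr₂ (LinearMap.applyₗ t))).lTensor (T A ⊗[F2] X)
          ∘ₗ (TensorProduct.assoc F2 (T A ⊗[F2] X) (T B) N).toLinearMap
          ∘ₗ (D.iter n).rTensor N
          ∘ₗ KTensor.unpack ι X N
      map_add' := fun s t => by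
        have : TensorProduct.lift (E.m.compr₂ (LinearMap.applyₗ (s + t))) =
            TensorProduct.lift (E.m.compr₂ (LinearMap.applyₗ s)) +
            TensorProduct.lift (E.m.compr₂ (LinearMap.applyₗ t)) := by
          ext; simp
        simp only [this, LinearMap.lTensor_add, LinearMap.add_comp, LinearMap.comp_add]
      map_smul' := fun a t => by
        have : TensorProduct.lift (E.m.compr₂ (LinearMap.applyₗ (a • t))) =
            a • TensorProduct.lift (E.m.compr₂ (LinearMap.applyₗ t)) := by
          ext; simp
        simp only [this, LinearMap.lTensor_smul, LinearMap.smul_comp, LinearMap.comp_smul,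
          RingHom.id_apply] }

/-- The terms `δⁿ_DD` contribute to the box product only for finitely many `n`. -/
def BoxFinite (D : DDMap ι A X B) (E : AAMap B N C) : Prop :=
  {n | boxTerm D E n ≠ 0}.Finite

/-- The box product of a type `DD` and a type `AA` bimodule, with structure map
`(Π ⊗ 𝕀 ⊗ m) ∘ (δ_DD ⊗ 𝕀 ⊗ 𝕀)` for `δ_DD = ∑ n, δⁿ_DD`. -/
noncomputable def box (D : DDMap ι A X B) (E : AAMap B N C) : DAMap ι A (KTensor ι X N) C where
  δ := ∑ᶠ n, boxTerm D E n

end Box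

end Bimodules

end Algebra

/-! ## Arc diagrams and their algebras -/

/-- An arc diagram of a connected oriented surface `F` with nonempty boundary.

`P` is the set of end points of the arcs `α_i`, which lie on the boundary circles `Z_1, …, Z_b`.
`s p` is the point that follows `p` on its (oriented) circle, so that the circles `Z_j` are the
cycles of `s`; `m p` is the other end point of the arc `α_i` that ends at `p`; and `z p` says that
the interval from `p` to `s p` contains a base point.  Each circle contains one base point.  Going
around a component of `F \ ⋃ α_i`, one follows in turn a circle from `p` to `s p` and an arc
from `s p` to `m (s p)`; so the components of `F \ ⋃ α_i` are the cycles of `m ∘ s`, and each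
of them contains one base point.  (The disk without arcs corresponds to an empty `P`.) -/
structure ArcDiagram (P : Type*) where
  s : Equiv.Perm P
  m : Equiv.Perm P
  z : P → Prop
  m_m : ∀ p, m (m p) = p
  m_ne : ∀ p, m p ≠ p
  circle : ∀ p, ∃! q, s.SameCycle p q ∧ z q
  disk : ∀ p, ∃! q, (m * s).SameCycle p q ∧ z q
  connected : ∀ p q, ∃ g ∈ Subgroup.closure {s, m}, g p = q

namespace ArcDiagram

variable {P : Type*}

/-- The dual arc diagram.  Its circles are the inner boundary circles of the surface
`F°` (see `Surface`), with the boundary orientation.  Each point `p` of the diagram yields an end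
point of the arc dual to the arc through `p`, namely the one which precedes `p` in the direction
of its circle `Z_j` (it has the coordinate `-i/4` in the chart of `p`), and this end point is
also called `p`.  The interval of the dual circle which follows the dual point `p` lies opposite
to the interval from `s⁻¹ p` to `p`, and it ends at the dual point `m (s⁻¹ p)`. -/
@[reducible] def dual (Z : ArcDiagram P) : ArcDiagram P where
  s := Z.m * Z.s⁻¹
  m := Z.m
  z p := Z.z (Z.s⁻¹ p)
  m_m := Z.m_m
  m_ne := Z.m_ne
  circle p := by
    have h : Z.m * Z.s⁻¹ = (Z.s * (Z.m * Z.s) * Z.s⁻¹)⁻¹ := by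
      have : Z.m⁻¹ = Z.m := inv_eq_of_mul_eq_one_left (Equiv.ext Z.m_m)
      simp [mul_assoc, this]
    obtain ⟨q, ⟨h1, h2⟩, h3⟩ := Z.disk (Z.s⁻¹ p)
    refine ⟨Z.s q, ⟨?_, by simpa using h2⟩, fun r hr => ?_⟩
    · rw [h, Equiv.Perm.sameCycle_inv, Equiv.Perm.sameCycle_conj]
      simpa using h1
    · rw [h, Equiv.Perm.sameCycle_inv, Equiv.Perm.sameCycle_conj] at hr
      rw [← h3 (Z.s⁻¹ r) hr]
      simp
  disk p := by
    have h : Z.m * (Z.m * Z.s⁻¹) = Z.s⁻¹ := by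
      have : Z.m * Z.m = 1 := Equiv.ext Z.m_m
      rw [← mul_assoc, this, one_mul]
    obtain ⟨q, ⟨h1, h2⟩, h3⟩ := Z.circle p
    rw [h]
    refine ⟨Z.s q, ⟨?_, by simpa using h2⟩, fun r hr => ?_⟩
    · rw [Equiv.Perm.sameCycle_inv, Equiv.Perm.sameCycle_apply_right]
      exact h1
    · replace hr : Z.s⁻¹.SameCycle p r ∧ Z.z (Z.s⁻¹ r) := hr
      rw [Equiv.Perm.sameCycle_inv] at hr
      have h4 : Z.s.SameCycle p (Z.s⁻¹ r) := by
        have h5 := hr.1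
        rw [← Equiv.Perm.sameCycle_symm_apply_right] at h5
        exact h5
      rw [← h3 (Z.s⁻¹ r) ⟨h4, hr.2⟩]
      simp
  connected p q := by
    have hm : Z.m ∈ Subgroup.closure {Z.m * Z.s⁻¹, Z.m} :=
      Subgroup.subset_closure (Or.inr rfl)
    have h : Subgroup.closure {Z.s, Z.m} ≤ Subgroup.closure {Z.m * Z.s⁻¹, Z.m} := by
      refine (Subgroup.closure_le _).2 ?_
      rintro _ (rfl | rfl)
      · have h1 : Z.m * Z.s⁻¹ ∈ Subgroup.closure {Z.m * Z.s⁻¹, Z.m} :=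
          Subgroup.subset_closure (Or.inl rfl)
        have h2 := Subgroup.mul_mem _ (Subgroup.inv_mem _ h1) hm
        simpa using h2
      · exact hm
    obtain ⟨g, hg, hgp⟩ := Z.connected p q
    exact ⟨g, h hg, hgp⟩

variable (Z : ArcDiagram P)

/-- The two end points of an arc are identified. -/
def arcSetoid : Setoid P where
  r p q := q = p ∨ q = Z.m p
  iseqv :=
    { refl := fun _ => Or.inl rfl
      symm := by
        rintro p q (rfl | rfl)
        · exact Or.inl rfl
        · exact Or.inr (Z.m_m p).symm
      trans := by
        rintro p q r (rfl | rfl) (rfl | rfl)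
        · exact Or.inl rfl
        · exact Or.inr rfl
        · exact Or.inr rfl
        · exact Or.inl (Z.m_m p) }

/-- The set of arcs `α_i`, that is of pairs `{a_i, a_i'}`.  The dual diagram has the same arcs:
`α_i` corresponds to its dual arc `η_i`. -/
def Arc : Type _ := Quotient Z.arcSetoid

/-- The arc which ends at a given point. -/
def arc (p : P) : Z.Arc := Quotient.mk Z.arcSetoid p

instance [Finite P] : Finite Z.Arc := Quotient.finite _
noncomputable instance [Finite P] : Fintype Z.Arc := Fintype.ofFinite _
noncomputable instance : DecidableEq Z.Arc := Classical.decEq _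

/-- A chord: the interval which starts at the point `start`, follows the orientation of its
circle, and consists of `len ≥ 1` intervals between adjacent points, none of them containing the
base point. -/
@[ext] structure Chord where
  start : P
  len : ℕ
  pos : 0 < len
  avoid : ∀ i < len, ¬ Z.z ((Z.s ^ i) start)

namespace Chord
variable {Z}

/-- The terminal point of a chord. -/
def terminal (ρ : Z.Chord) : P := (Z.s ^ ρ.len) ρ.start

/-- The concatenation of two chords. -/
def concat (ρ σ : Z.Chord) (h : ρ.terminal = σ.start) : Z.Chord where
  start := ρ.start
  len := ρ.len + σ.len
  pos := Nat.add_pos_left ρ.pos _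
  avoid i hi := by
    by_cases hi' : i < ρ.len
    · exact ρ.avoid i hi'
    · obtain ⟨j, rfl⟩ := Nat.exists_eq_add_of_le (not_lt.1 hi')
      have := σ.avoid j (by omega)
      rwa [← h, terminal, ← Equiv.Perm.mul_apply, ← pow_add, add_comm] at this

end Chord

/-- The basis of `𝓑(Z)`: the idempotents `I_i` and the chords. -/
inductive Gen : Type _
  | idem (i : Z.Arc) : Gen
  | chord (ρ : Z.Chord) : Gen

/-- The algebra `𝓑(Z)`. -/
def Alg : Type _ := Z.Gen →₀ F2

noncomputable instance algAddCommGroup : AddCommGroup Z.Alg := inferInstanceAs (AddCommGroup (Z.Gen →₀ F2))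
noncomputable instance : Module F2 Z.Alg := inferInstanceAs (Module F2 (Z.Gen →₀ F2))

/-- The defining basis of `𝓑(Z)`. -/
noncomputable def basis : Module.Basis Z.Gen F2 Z.Alg :=
  .ofRepr (LinearEquiv.refl F2 (Z.Gen →₀ F2))

open Classical in
/-- The products of the basis elements of `𝓑(Z)`. -/
noncomputable def genMul : Z.Gen → Z.Gen → Z.Alg
  | .idem i, .idem j => if i = j then Z.basis (.idem i) else 0
  | .idem i, .chord ρ => if Z.arc ρ.start = i then Z.basis (.chord ρ) else 0
  | .chord ρ, .idem j => if Z.arc ρ.terminal = j then Z.basis (.chord ρ) else 0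
  | .chord ρ, .chord σ =>
      if h : ρ.terminal = σ.start then Z.basis (.chord (ρ.concat σ h)) else 0

/-- The product of `𝓑(Z)`. -/
noncomputable def mulHom : Z.Alg →ₗ[F2] Z.Alg →ₗ[F2] Z.Alg :=
  Z.basis.constr F2 fun a => Z.basis.constr F2 fun b => Z.genMul a b

theorem mulHom_basis (a b : Z.Gen) : Z.mulHom (Z.basis a) (Z.basis b) = Z.genMul a b := by
  simp [mulHom]

theorem alg_induction {p : Z.Alg → Prop} (zero : p 0) (add : ∀ x y, p x → p y → p (x + y))
    (single : ∀ a, p (Z.basis a)) (x : Z.Alg) : p x := by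
  refine Finsupp.induction_linear (motive := p) x zero add fun a c => ?_
  have h : c = 0 ∨ c = 1 := by revert c; decide
  rcases h with rfl | rfl
  · rw [Finsupp.single_zero]; exact zero
  · exact single a

theorem terminal_concat (ρ σ : Z.Chord) (h : ρ.terminal = σ.start) : (ρ.concat σ h).terminal = σ.terminal := by
  simp only [Chord.terminal, Chord.concat] at h ⊢
  rw [← h, ← Equiv.Perm.mul_apply, ← pow_add, add_comm]

theorem start_concat (ρ σ : Z.Chord) (h : ρ.terminal = σ.start) :
    (ρ.concat σ h).start = ρ.start := rfl

theorem concat_assoc (ρ σ τ : Z.Chord) (h : ρ.terminal = σ.start) (h' : σ.terminal = τ.start) :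
    (ρ.concat σ h).concat τ ((Z.terminal_concat ρ σ h).trans h') =
      ρ.concat (σ.concat τ h') h :=
  Chord.ext rfl (Nat.add_assoc _ _ _)

theorem genMul_assoc (a b c : Z.Gen) : Z.mulHom (Z.genMul a b) (Z.basis c) =
    Z.mulHom (Z.basis a) (Z.genMul b c) := by
  rcases a with i | ρ <;> rcases b with j | σ <;> rcases c with k | τ <;>
    simp only [genMul] <;> split_ifs <;>
    simp only [mulHom_basis, genMul, terminal_concat, start_concat, map_zero,
      LinearMap.zero_apply] <;>
    grind [concat_assoc, terminal_concat]

theorem mulHom_assoc (x y w : Z.Alg) :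
    Z.mulHom (Z.mulHom x y) w = Z.mulHom x (Z.mulHom y w) := by
  induction x using Z.alg_induction with
  | zero => simp
  | add x x' hx hx' => simp only [map_add, LinearMap.add_apply, hx, hx']
  | single a =>
    induction y using Z.alg_induction with
    | zero => simp
    | add y y' hy hy' => simp only [map_add, LinearMap.add_apply, hy, hy']
    | single b =>
      induction w using Z.alg_induction with
      | zero => simp
      | add w w' hw hw' => simp only [map_add, hw, hw']
      | single c => simp only [mulHom_basis, genMul_assoc]

/-- The idempotent `I_i` of `𝓑(Z)`. -/
noncomputable def idem (i : Z.Arc) : Z.Alg := Z.basis (.idem i)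

theorem idem_mul_idem (i j : Z.Arc) :
    Z.mulHom (Z.idem i) (Z.idem j) = if i = j then Z.idem i else 0 := by
  simp only [idem, mulHom_basis, genMul]

section Finite
variable [Finite P]

theorem sum_idem_mul (x : Z.Alg) : Z.mulHom (∑ i, Z.idem i) x = x := by
  induction x using Z.alg_induction with
  | zero => simp
  | add x x' hx hx' => rw [map_add, hx, hx']
  | single a => rcases a with i | ρ <;> simp [idem, mulHom_basis, genMul, map_sum]

theorem mul_sum_idem (x : Z.Alg) : Z.mulHom x (∑ i, Z.idem i) = x := by
  induction x using Z.alg_induction with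
  | zero => simp
  | add x x' hx hx' => rw [map_add, LinearMap.add_apply, hx, hx']
  | single a => rcases a with i | ρ <;> simp [idem, mulHom_basis, genMul, map_sum]

noncomputable instance : Ring Z.Alg where
  __ := Z.algAddCommGroup
  mul x y := Z.mulHom x y
  one := ∑ i, Z.idem i
  mul_assoc := Z.mulHom_assoc
  one_mul := Z.sum_idem_mul
  mul_one := Z.mul_sum_idem
  left_distrib x y w := (Z.mulHom x).map_add y w
  right_distrib x y w := by
    change Z.mulHom (x + y) w = Z.mulHom x w + Z.mulHom y w
    rw [map_add, LinearMap.add_apply]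
  zero_mul x := by
    change Z.mulHom 0 x = 0
    rw [map_zero, LinearMap.zero_apply]
  mul_zero x := (Z.mulHom x).map_zero

noncomputable instance : Algebra F2 Z.Alg :=
  Algebra.ofModule (fun c x y => by
    change Z.mulHom (c • x) y = c • Z.mulHom x y
    rw [map_smul, LinearMap.smul_apply]) (fun c x y => (Z.mulHom x).map_smul c y)

noncomputable instance : KAlgebra Z.Arc Z.Alg where
  e := Z.idem
  complete := by
    refine ⟨⟨fun i => ?_, fun i j hij => ?_⟩, rfl⟩
    · exact (Z.idem_mul_idem i i).trans (if_pos rfl)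
    · exact (Z.idem_mul_idem i j).trans (if_neg hij)

/-- The algebra of the dual diagram is an algebra over the same ground ring. -/
noncomputable instance : KAlgebra Z.Arc Z.dual.Alg :=
  inferInstanceAs (KAlgebra Z.dual.Arc Z.dual.Alg)

end Finite

/-! ## The surface `F°` with its arcs -/

open Complex (I)

/-- The rectangle `|x| ≤ 1`, `|y| < 3/4` without the open disks of radius `1/4` around `±i/2`.

The segment `y = 0` is an arc `α_i`, and the segment `x = 0` (on which `|y| ≤ 1/4`) is the dual
arc `η_i`.  The sides `x = ±1` lie on the outer boundary of `F°`, and the arcs of the two circles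
lie on its inner boundary.  The part `|x| < 1/2`, `|y| < 1/4` belongs to the 1-handle of `α_i`, the
rest to the annuli `Z_j × [0,1]`. -/
def chartDomain : Set ℂ :=
  {w | |w.re| ≤ 1 ∧ |w.im| < 3 / 4 ∧ 1 / 4 ≤ ‖w - I / 2‖ ∧ 1 / 4 ≤ ‖w + I / 2‖}

/-- The gluing of the copies of `chartDomain`, one for each point `p`.  The copy of `p`
contains the arc `α_i` which ends at `p`, and `p` corresponds to the point `1` of the copy.  The
copies of `p` and of `m p` are identified by the rotation by `π`.  The copies of `p` and of `s p`
overlap in the annulus `Z_j × [0,1]` along the interval from `p` to `s p`, where they differ by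
the translation by `i`. -/
inductive Glue : (Σ _ : P, chartDomain) → (Σ _ : P, chartDomain) → Prop
  | rotate (p : P) (w w' : chartDomain) (h : (w' : ℂ) = -w) : Glue ⟨p, w⟩ ⟨Z.m p, w'⟩
  | translate (p : P) (w w' : chartDomain) (hw : 0 < (w : ℂ).re) (h : (w' : ℂ) = w - I) :
      Glue ⟨p, w⟩ ⟨Z.s p, w'⟩

/-- The surface `F°(Z)`: the annuli `Z_j × [0,1]` with a 1-handle attached along each pair
`{a_i, a_i'}` in their inner boundaries.  All transition maps between its charts have the form
`w ↦ ±w + c`, so the charts define a smooth structure and an orientation. -/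
def Surface : Type _ := Quot Z.Glue

instance : TopologicalSpace Z.Surface :=
  letI : TopologicalSpace (Σ _ : P, chartDomain) := instTopologicalSpaceSigma
  inferInstanceAs (TopologicalSpace (Quot Z.Glue))

/-- The point `x` of `F°` has the coordinate `w` in the chart of `p`. -/
def HasCoord (p : P) (w : ℂ) (x : Z.Surface) : Prop :=
  ∃ h : w ∈ chartDomain, x = Quot.mk Z.Glue ⟨p, ⟨w, h⟩⟩

/-- The arc `α_i` in `F°`. -/
def alpha (i : Z.Arc) : Set Z.Surface :=
  {x | ∃ p w, Z.arc p = i ∧ w.im = 0 ∧ Z.HasCoord p w x}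

/-- The dual arc `η_i` in `F°`. -/
def eta (i : Z.Arc) : Set Z.Surface :=
  {x | ∃ p w, Z.arc p = i ∧ w.re = 0 ∧ Z.HasCoord p w x}

/-- The boundary of `F°`. -/
def boundary : Set Z.Surface :=
  {x | ∃ p w, Z.HasCoord p w x ∧ (|w.re| = 1 ∨ ‖w - I / 2‖ = 1 / 4 ∨ ‖w + I / 2‖ = 1 / 4)}

/-- The interval of the outer boundary of `F°` from `p` to `s p`. -/
def outerInterval (p : P) : Set Z.Surface :=
  {x | ∃ w : ℂ, w.re = 1 ∧ ((0 ≤ w.im ∧ w.im ≤ 1 / 2 ∧ Z.HasCoord p w x) ∨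
    (-(1 / 2) ≤ w.im ∧ w.im ≤ 0 ∧ Z.HasCoord (Z.s p) w x))}

/-- The interval of the inner boundary of `F°` opposite to the interval from `p` to `s p`: these
two intervals are sides of the same component (a hexagon) of `F° \ (⋃ α_i ∪ ⋃ η_i)`.  It
connects the end points of dual arcs with coordinates `-i/4` in the chart of `s p` and `i/4`
in the chart of `p`. -/
def innerInterval (p : P) : Set Z.Surface :=
  {x | ∃ w : ℂ, 0 ≤ w.re ∧
    ((‖w - I / 2‖ = 1 / 4 ∧ w.im ≤ 1 / 2 ∧ Z.HasCoord p w x) ∨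
      (‖w + I / 2‖ = 1 / 4 ∧ -(1 / 2) ≤ w.im ∧ Z.HasCoord (Z.s p) w x))}

/-- A chord of `Z` as a subset of the outer boundary of `F°`. -/
def chordImage (ρ : Z.Chord) : Set Z.Surface :=
  ⋃ i < ρ.len, Z.outerInterval ((Z.s ^ i) ρ.start)

/-- A chord of the dual diagram as a subset of the inner boundary of `F°`. -/
def dualChordImage (σ : Z.dual.Chord) : Set Z.Surface :=
  ⋃ i < σ.len, Z.innerInterval (Z.s⁻¹ ((Z.dual.s ^ i) σ.start))

/-! ## Polygons -/

/-- The half disk `𝔻²`. -/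
def halfDisk : Set ℂ := {v | 0 ≤ v.re ∧ ‖v‖ ≤ 1}

/-- The left side `γ_L` of the half disk. -/
def leftSide : Set ℂ := {v | v.re = 0 ∧ ‖v‖ ≤ 1}

/-- The right side `γ_R` of the half disk. -/
def rightSide : Set ℂ := {v | 0 ≤ v.re ∧ ‖v‖ = 1}

/-- The part of a side of the half disk between two of its points.  Both sides are traversed from
`-i` to `i`, so the imaginary part increases. -/
def between (side : Set ℂ) (a b : ℂ) : Set ℂ := {v | v ∈ side ∧ a.im ≤ v.im ∧ v.im ≤ b.im}

/-- A map `f` from the half disk to `F°` is, near `v`, smooth with an injective and orientation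
preserving differential at `v`.  As usual, smoothness at a boundary point means that `f` has a
smooth extension in charts. -/
def ImmersionAt (f : halfDisk → Z.Surface) (v : ℂ) : Prop :=
  ∃ (p : P) (V : Set ℂ) (g : ℂ → ℂ), IsOpen V ∧ v ∈ V ∧ ContDiffOn ℝ ∞ g V ∧
    (∀ u : halfDisk, (u : ℂ) ∈ V → Z.HasCoord p (g u) (f u)) ∧ 0 < (fderiv ℝ g v).det

/-- A self-map of the half disk is smooth near `v`. -/
def SmoothAt (f : halfDisk → halfDisk) (v : ℂ) : Prop :=
  ∃ (V : Set ℂ) (g : ℂ → ℂ), IsOpen V ∧ v ∈ V ∧ ContDiffOn ℝ ∞ g V ∧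
    ∀ u : halfDisk, (u : ℂ) ∈ V → (f u : ℂ) = g u

/-- A polygon in `(F°, α, β)` connecting `x` to `y` through `(σ_1, …, σ_m)` and
`(ρ_1, …, ρ_n)`.  (The lists are indexed from `0`.)  The left side traverses the chords `σ_i`
against the orientation of the dual diagram. -/
structure Polygon (β : Z.Arc → Set Z.Surface) (x y : Z.Surface)
    (σ : List Z.dual.Chord) (ρ : List Z.Chord) where
  toFun : halfDisk → Z.Surface
  p : Fin (2 * σ.length) → ℂ
  q : Fin (2 * ρ.length) → ℂ
  continuous : Continuous toFun
  p_mem : ∀ i, p i ∈ leftSide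
  q_mem : ∀ i, q i ∈ rightSide
  p_mono : StrictMono fun i => (p i).im
  q_mono : StrictMono fun i => (q i).im
  left : ∀ v : halfDisk, (v : ℂ) ∈ leftSide → toFun v ∈ (⋃ i, β i) ∪ Z.boundary
  right : ∀ v : halfDisk, (v : ℂ) ∈ rightSide → toFun v ∈ (⋃ i, Z.alpha i) ∪ Z.boundary
  immersion : ∀ v ∈ halfDisk \ (Set.range p ∪ Set.range q), Z.ImmersionAt toFun v
  start : ∀ v : halfDisk, (v : ℂ) = -I → toFun v = x
  terminal : ∀ v : halfDisk, (v : ℂ) = I → toFun v = y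
  left_chord : ∀ i : Fin σ.length,
    toFun '' {v | (v : ℂ) ∈ between leftSide (p ⟨2 * i, by omega⟩) (p ⟨2 * i + 1, by omega⟩)} =
      Z.dualChordImage (σ.get i)
  right_chord : ∀ i : Fin ρ.length,
    toFun '' {v | (v : ℂ) ∈ between rightSide (q ⟨2 * i, by omega⟩) (q ⟨2 * i + 1, by omega⟩)} =
      Z.chordImage (ρ.get i)
  interior : ∀ v : halfDisk,
    (∀ i : Fin σ.length,
      (v : ℂ) ∉ between leftSide (p ⟨2 * i, by omega⟩) (p ⟨2 * i + 1, by omega⟩)) →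
    (∀ i : Fin ρ.length,
      (v : ℂ) ∉ between rightSide (q ⟨2 * i, by omega⟩) (q ⟨2 * i + 1, by omega⟩)) →
    toFun v ∉ Z.boundary

section Polygon
variable {Z} {β : Z.Arc → Set Z.Surface} {x y : Z.Surface} {σ : List Z.dual.Chord}
  {ρ : List Z.Chord}

/-- The points of the half disk at which a polygon need not be an immersion. -/
def Polygon.marked (Q : Z.Polygon β x y σ ρ) : Set ℂ := Set.range Q.p ∪ Set.range Q.q

/-- Two polygons are equivalent if they differ by a homeomorphism of the half disk which is a
diffeomorphism away from the points at which the polygons need not be immersions. -/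
def Polygon.Equivalent (Q R : Z.Polygon β x y σ ρ) : Prop :=
  ∃ h : halfDisk ≃ₜ halfDisk, (∀ v, R.toFun v = Q.toFun (h v)) ∧
    (∀ v ∈ halfDisk \ R.marked, SmoothAt h v) ∧ (∀ v ∈ halfDisk \ Q.marked, SmoothAt h.symm v)

end Polygon

/-- The number modulo two of equivalence classes of polygons. -/
noncomputable def polygonCount (β : Z.Arc → Set Z.Surface) (x y : Z.Surface)
    (σ : List Z.dual.Chord) (ρ : List Z.Chord) : F2 :=
  (Nat.card (Quot (Polygon.Equivalent (Z := Z) (β := β) (x := x) (y := y) (σ := σ) (ρ := ρ))) : F2)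

/-! ## The bimodules `M` and `DD(𝕀/2)` -/

/-- The intersection points of the arcs `α_i` and `β_j`, together with the arcs on which they
lie. -/
structure Crossing (β : Z.Arc → Set Z.Surface) where
  a : Z.Arc
  b : Z.Arc
  pt : Z.Surface
  mem_alpha : pt ∈ Z.alpha a
  mem_beta : pt ∈ β b

/-- The chords in a list of basis elements, provided that it contains no idempotents. -/
def chords? : List Z.Gen → Option (List Z.Chord) :=
  List.mapM fun g => match g with
    | .idem _ => none
    | .chord ρ => some ρ

section Modules
variable [Finite P] (β : Z.Arc → Set Z.Surface)

/-- The underlying `k`-bimodule of the bimodule `M` of the diagram `(F°, α, β)`. -/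
abbrev MSpace : Type _ := FreeKB Z.Arc (X := Z.Crossing β) Crossing.b Crossing.a

open Classical in
/-- The operations of `M` on basis elements: `MOp L x R` is `m(l_m, …, l_1, x, r_1, …, r_n)` for
`L = [l_m, …, l_1]` and `R = [r_1, …, r_n]`. -/
noncomputable def MOp (L : List Z.dual.Gen) (x : Z.Crossing β) (R : List Z.Gen) : Z.MSpace β :=
  match L, R with
  | [.idem j], [] => if x.b = j then FreeKB.basis _ _ x else 0
  | [], [.idem i] => if x.a = i then FreeKB.basis _ _ x else 0
  | L, R =>
    match Z.dual.chords? L.reverse, Z.chords? R with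
    | some σ, some ρ => ∑ᶠ y : Z.Crossing β, Z.polygonCount β x.pt y.pt σ ρ • FreeKB.basis _ _ y
    | _, _ => 0

/-- The type `AA` bimodule `M` over `𝓑(Z')` and `𝓑(Z)` of the diagram `(F°, α, β)`. -/
noncomputable def M : AAMap Z.dual.Alg (Z.MSpace β) Z.Alg where
  m := Z.dual.basis.tensorAlgebra.constr F2 fun L =>
    (FreeKB.basis _ _).constr F2 fun x =>
      Z.basis.tensorAlgebra.constr F2 fun R => Z.MOp β (FreeMonoid.toList L) x (FreeMonoid.toList R)

/-- The bimodule `M(𝕀)` of the identity diagram `(F°, α, η)`. -/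
noncomputable def MId : AAMap Z.dual.Alg (Z.MSpace Z.eta) Z.Alg := Z.M Z.eta

/-- The short chord `ξ` from `p` to `s p`. -/
def short (p : {p : P // ¬ Z.z p}) : Z.Chord where
  start := p
  len := 1
  pos := one_pos
  avoid i hi := by
    obtain rfl : i = 0 := by omega
    exact p.2

/-- The short chord `ξ'` of the dual diagram which corresponds to `ξ = short p`, that is which lies
on the boundary of the same component of the identity diagram: its image is `innerInterval p`. -/
def dualShort (p : {p : P // ¬ Z.z p}) : Z.dual.Chord where
  start := Z.s p
  len := 1
  pos := one_pos
  avoid i hi := by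
    obtain rfl : i = 0 := by omega
    simpa using p.2

theorem chordImage_short (p : {p : P // ¬ Z.z p}) :
    Z.chordImage (Z.short p) = Z.outerInterval p := by
  simp [chordImage, short]

theorem dualChordImage_dualShort (p : {p : P // ¬ Z.z p}) :
    Z.dualChordImage (Z.dualShort p) = Z.innerInterval p := by
  simp [dualChordImage, dualShort]

/-- The underlying `k`-bimodule of `DD(𝕀/2)`, generated by the `x_i` with
`x_i = I(x_i) x_i J(x_i)`. -/
abbrev DDSpace : Type _ := FreeKB Z.Arc (X := Z.Crossing Z.eta) Crossing.a Crossing.b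

/-- The type `DD` bimodule `DD(𝕀/2)` over `𝓑(Z)` and `𝓑(Z')`:
`δ¹(x_i) = ∑ j, ∑ ξ, I(x_i) ξ ⊗ x_j ⊗ ξ' J(x_i)`, where `ξ` ranges over the short chords. -/
noncomputable def DDHalfId : DDMap Z.Arc Z.Alg Z.DDSpace Z.dual.Alg where
  δ := (FreeKB.basis _ _).constr F2 fun x =>
    ∑ᶠ (y : Z.Crossing Z.eta) (p : {p : P // ¬ Z.z p}),
      KTensor.mk Z.Arc (KTensor Z.Arc Z.Alg Z.DDSpace) Z.dual.Alg
        (KTensor.mk Z.Arc Z.Alg Z.DDSpace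
            ((Z.idem x.a * Z.basis (.chord (Z.short p))) ⊗ₜ FreeKB.basis _ _ y) ⊗ₜ
          (Z.dual.basis (.chord (Z.dualShort p)) * Z.dual.idem x.b))

end Modules

end ArcDiagram

end Bordered

namespace Bordered.ArcDiagram

open Complex (I)
open Set Filter Topology

variable {P : Type*} (Z : ArcDiagram P)

/-! ## Normal forms of the points of the surface -/

/-! Both bimodules have one generator for each arc, so the task is to compute the structure map of
the box product on the generators `w_i ⊗ x_i`. The term `δ⁰` feeds nothing to `m` from the left.
There are no polygons without left chords, so only the action of `I_i` survives (`MOp_nil`). The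
term `δⁿ` with `n > 0` is a sum over the end points `p` of the arc `i` which are followed by `n`
intervals without base points: the short chords multiply to the chord of length `n` from `p`, while
the opposite short dual chords appear in reverse order (`iterMul_DDHalfId`). No such run exceeds the
number of points, which gives finiteness (`boxFinite`). The geometric input is the count
`sum_polygonCount`: for these dual chords there is exactly one polygon which starts at the crossing
of `p`; it passes through the single chord of length `n` and ends at the crossing of `s^n p`. Hence
a chord `ρ` from arc `i` to arc `j` acts by `w_i ⊗ x_i ↦ ρ ⊗ (w_j ⊗ x_j)`, and words of length other
than one act by zero, as in the identity bimodule.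

The count holds because such a polygon must cover a strip of `n` adjacent hexagons exactly once. A
hexagon is covered by the interior of the half disk completely or not at all (`hexSet_subset`). A
covered hexagon has the middle of its inner interval in the image, and only the left side can reach
this point; so the covered hexagons are those of `p, s p, …` (`exists_of_hexSet`). Along a chord the
polygon is an immersion of the side, so the middle has just one preimage, and by connectedness every
point of the hexagon has just one (`eq_of_mem_hexSet`). The interior cannot cross a dual arc: it
would contain the whole half arc up to the inner boundary, but the left side runs along that half
arc near its end (`notMem_eta`). It must cross the arcs between consecutive hexagons, because the
image is connected (`image_inner`). A tangent computation at `i` then locates the terminal point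
(`hasCoord_terminal`).

Two polygons with the same strip are injective with the same image on the interior. The resulting
homeomorphism of the interior extends to the closed half disk (`exists_homeomorph`) and is smooth
away from the marked points (`Polygon.equivalent`). The comparison does not involve the chords of
`Z`, so it also determines them (`eq_longChord`). For existence an explicit homeomorphism flattens
the strip to the half disk (`flatten`, `stripPolygon`).

The structure equations are elementary for the identity bimodule (`identityDA_isTypeDA`). They pass
to the box product along the isomorphism (`DAIso.isTypeDA`), so no degeneration argument for
polygons is needed. -/

theorem arc_m (p : P) : Z.arc (Z.m p) = Z.arc p :=
  Quotient.sound (Or.inr (Z.m_m p).symm)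

theorem arc_eq_arc {p q : P} : Z.arc p = Z.arc q ↔ q = p ∨ q = Z.m p :=
  ⟨fun h => Quotient.exact h, fun h => Quotient.sound h⟩

/-- Squaring the norms gives polynomial inequalities in the real and imaginary part, the form that
`nlinarith` can use. -/
theorem mem_chartDomain {w : ℂ} : w ∈ chartDomain ↔
    |w.re| ≤ 1 ∧ |w.im| < 3 / 4 ∧ 1 / 16 ≤ w.re ^ 2 + (w.im - 1 / 2) ^ 2 ∧
      1 / 16 ≤ w.re ^ 2 + (w.im + 1 / 2) ^ 2 := by
  have key : ∀ z : ℂ, 1 / 4 ≤ ‖z‖ ↔ 1 / 16 ≤ z.re ^ 2 + z.im ^ 2 := fun z => by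
    rw [← abs_of_nonneg (norm_nonneg z), ← abs_of_pos (show (0 : ℝ) < 1 / 4 by norm_num),
      ← sq_le_sq, ← Complex.normSq_eq_norm_sq, Complex.normSq_apply]
    constructor <;> intro h <;> linarith
  simp only [chartDomain, mem_ofPred_eq, key]
  simp

theorem norm_sub_half {w : ℂ} : ‖w - I / 2‖ = 1 / 4 ↔ w.re ^ 2 + (w.im - 1 / 2) ^ 2 = 1 / 16 := by
  rw [← sq_eq_sq₀ (norm_nonneg _) (by norm_num), ← Complex.normSq_eq_norm_sq,
    Complex.normSq_apply]
  simp only [Complex.sub_re, Complex.sub_im, Complex.div_ofNat_re, Complex.I_re,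
    Complex.div_ofNat_im, Complex.I_im, zero_div, sub_zero]
  constructor <;> intro h <;> linarith

theorem norm_add_half {w : ℂ} : ‖w + I / 2‖ = 1 / 4 ↔ w.re ^ 2 + (w.im + 1 / 2) ^ 2 = 1 / 16 := by
  have := norm_sub_half (w := -w)
  rw [← norm_neg, neg_sub, sub_neg_eq_add, add_comm] at this
  rw [this]
  simp only [Complex.neg_re, Complex.neg_im]
  constructor <;> intro h <;> linarith

theorem neg_mem_chartDomain {w : ℂ} (h : w ∈ chartDomain) : -w ∈ chartDomain := by
  rw [mem_chartDomain] at *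
  obtain ⟨h1, h2, h3, h4⟩ := h
  simp only [Complex.neg_re, Complex.neg_im, abs_neg]
  exact ⟨h1, h2, by linarith, by linarith⟩

/-- The upper removed disk becomes the lower one after the translation; the bound `1 / 4 < w.im`
keeps the new height above `-3/4`. -/
theorem sub_mem_chartDomain {w : ℂ} (h : w ∈ chartDomain) (h' : 1 / 4 < w.im) :
    w - I ∈ chartDomain := by
  rw [mem_chartDomain, abs_le, abs_lt] at *
  obtain ⟨h1, h2, h3, h4⟩ := h
  simp only [Complex.sub_re, Complex.I_re, Complex.sub_im, Complex.I_im, sub_zero]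
  refine ⟨h1, ⟨by linarith, by linarith⟩, ?_, by linarith⟩
  nlinarith [sq_nonneg w.re]

theorem zero_mem_chartDomain : (0 : ℂ) ∈ chartDomain := by
  rw [mem_chartDomain]; norm_num

/-- The parametrization of the chart of `p`. -/
def chart (p : P) (w : chartDomain) : Z.Surface := Quot.mk Z.Glue ⟨p, w⟩

variable {Z}

theorem HasCoord.mem {p : P} {w : ℂ} {x : Z.Surface} (h : Z.HasCoord p w x) : w ∈ chartDomain :=
  h.1

theorem hasCoord_chart (p : P) (w : chartDomain) : Z.HasCoord p w (Z.chart p w) := ⟨w.2, rfl⟩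

theorem exists_hasCoord (x : Z.Surface) : ∃ p w, Z.HasCoord p w x := by
  induction x using Quot.ind with
  | mk a => exact ⟨a.1, a.2, a.2.2, rfl⟩

theorem HasCoord.neg {p : P} {w : ℂ} {x : Z.Surface} (h : Z.HasCoord p w x) :
    Z.HasCoord (Z.m p) (-w) x := by
  obtain ⟨h, rfl⟩ := h
  exact ⟨neg_mem_chartDomain h, Quot.sound (.rotate p _ _ rfl)⟩

theorem HasCoord.sub {p : P} {w : ℂ} {x : Z.Surface} (h : Z.HasCoord p w x) (h0 : 0 < w.re)
    (h1 : 1 / 4 < w.im) : Z.HasCoord (Z.s p) (w - I) x := by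
  obtain ⟨h, rfl⟩ := h
  exact ⟨sub_mem_chartDomain h h1, Quot.sound (.translate p _ _ h0 rfl)⟩

theorem HasCoord.add {p : P} {w : ℂ} {x : Z.Surface} (h : Z.HasCoord p w x) (h0 : 0 < w.re)
    (h1 : w.im < -(1 / 4)) : Z.HasCoord (Z.s⁻¹ p) (w + I) x := by
  obtain ⟨h, rfl⟩ := h
  have h' : w + I ∈ chartDomain := by
    have := neg_mem_chartDomain (sub_mem_chartDomain (neg_mem_chartDomain h)
      (by rw [Complex.neg_im]; linarith))
    rwa [neg_sub, sub_neg_eq_add, add_comm] at this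
  refine ⟨h', ?_⟩
  -- `Glue.translate` ends in a chart of the form `Z.s q`; proving the claim for every such `q`
  -- avoids rewriting `p` as `Z.s (Z.s⁻¹ p)` inside dependent terms.
  have key : ∀ q, Z.s q = p → Z.chart p ⟨w, h⟩ = Z.chart q ⟨w + I, h'⟩ := by
    rintro q rfl
    exact (Quot.sound (Glue.translate q ⟨w + I, h'⟩ ⟨w, h⟩ (by simpa using h0) (by simp))).symm
  exact key _ (by simp)

variable (Z)

open Classical in
/-- The normal form of a coordinate in the right half of a chart. -/
noncomputable def normalRight (p : P) (w : ℂ) : (P × ℂ) ⊕ Z.Arc :=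
  if 0 < w.re ∧ w.im < 0 then .inl (Z.s⁻¹ p, w + I) else .inl (p, w)

open Classical in
/-- The normal form of a coordinate: coordinates with `re > 0` and `0 ≤ im < 1`, or on an arc
`η_i` with `im > 0`, or the crossing of an arc with its dual arc. -/
noncomputable def normal (p : P) (w : ℂ) : (P × ℂ) ⊕ Z.Arc :=
  if w = 0 then .inr (Z.arc p)
  else if 0 < w.re ∨ w.re = 0 ∧ 0 < w.im then Z.normalRight p w
  else Z.normalRight (Z.m p) (-w)

variable {Z}

/-- For `w ≠ 0` exactly one of `w` and `-w` lies in the half plane selected by `normal`, so both are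
reduced to the same coordinate. Together with `normal_translate` this covers the generators of the
gluing: `nf` descends to the quotient, and the generated equivalence relation never has to be
described. -/
theorem normal_neg (p : P) (w : ℂ) : Z.normal (Z.m p) (-w) = Z.normal p w := by
  unfold normal
  by_cases h : w = 0
  · simp [h, arc_m]
  · have h' : w.re ≠ 0 ∨ w.im ≠ 0 := by
      by_contra hc
      push Not at hc
      exact h (Complex.ext hc.1 hc.2)
    simp only [neg_eq_zero, h, if_false, Complex.neg_re, Complex.neg_im, Z.m_m, neg_neg]
    split_ifs with h1 h2 h2 <;> first | rfl | skip
    · exfalso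
      rcases h1 with h1 | h1 <;> rcases h2 with h2 | h2 <;> linarith [h2, h1]
    · exfalso
      push Not at h1 h2
      rcases lt_trichotomy w.re 0 with h3 | h3 | h3
      · linarith
      · have := h1.2 (by linarith)
        have := h2.2 h3
        rcases h' with h' | h'
        · exact h' h3
        · exact h' (by linarith)
      · linarith

/-- Both heights lie between `-3/4` and `3/4`, so `w` has positive and `w - I` negative height. The
first coordinate is already normal, and the second is shifted back to it. -/
theorem normal_translate (p : P) {w : ℂ} (h : w ∈ chartDomain) (h' : w - I ∈ chartDomain)
    (h0 : 0 < w.re) : Z.normal (Z.s p) (w - I) = Z.normal p w := by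
  have h1 := (abs_lt.1 (mem_chartDomain.1 h).2.1)
  have h2 := (abs_lt.1 (mem_chartDomain.1 h').2.1)
  simp only [Complex.sub_im, Complex.I_im] at h2
  have hw : w ≠ 0 := fun h => by simp [h] at h0
  have hw' : w - I ≠ 0 := fun h => by
    have := congrArg Complex.re h
    simp at this
    linarith
  unfold normal normalRight
  simp only [hw, hw', if_false, Complex.sub_re, Complex.I_re, sub_zero, h0, true_or, if_true,
    Complex.sub_im, Complex.I_im, true_and]
  rw [if_pos (by linarith), if_neg (by linarith)]
  simp

variable (Z) in
/-- The normal form of a point of the surface. -/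
noncomputable def nf : Z.Surface → (P × ℂ) ⊕ Z.Arc :=
  Quot.lift (fun a => Z.normal a.1 a.2) (by
    rintro _ _ (⟨p, w, w', h⟩ | ⟨p, w, w', h0, h⟩)
    · simp only [h, normal_neg]
    · simp only [h]
      exact (normal_translate p w.2 (h ▸ w'.2) h0).symm)

theorem HasCoord.nf {p : P} {w : ℂ} {x : Z.Surface} (h : Z.HasCoord p w x) :
    Z.nf x = Z.normal p w := by
  obtain ⟨h, rfl⟩ := h
  rfl

theorem nf_chart (p : P) (w : chartDomain) : Z.nf (Z.chart p w) = Z.normal p w := rfl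

theorem normal_zero (p : P) : Z.normal p 0 = .inr (Z.arc p) := by simp [normal]

theorem normal_right {p : P} {w : ℂ} (h : 0 < w.re) (h' : 0 ≤ w.im) :
    Z.normal p w = .inl (p, w) := by
  have hw : w ≠ 0 := fun h => by simp_all
  simp [normal, normalRight, hw, h, not_lt.2 h']

theorem normal_right' {p : P} {w : ℂ} (h : 0 < w.re) (h' : w.im < 0) :
    Z.normal p w = .inl (Z.s⁻¹ p, w + I) := by
  have hw : w ≠ 0 := fun h => by simp_all
  simp [normal, normalRight, hw, h, h']

theorem normal_axis {p : P} {w : ℂ} (h : w.re = 0) (h' : 0 < w.im) :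
    Z.normal p w = .inl (p, w) := by
  have hw : w ≠ 0 := fun h => by simp_all
  simp [normal, normalRight, hw, h, h']

/-- A coordinate lies in the closed right half of a chart, without the lower half axis. -/
def IsRight (w : ℂ) : Prop := 0 < w.re ∨ w.re = 0 ∧ 0 ≤ w.im

theorem isRight_or_neg (w : ℂ) : IsRight w ∨ IsRight (-w) := by
  simp only [IsRight, Complex.neg_re, Complex.neg_im]
  rcases lt_trichotomy w.re 0 with h | h | h
  · right; left; linarith
  · rcases le_total 0 w.im with h' | h'
    · exact .inl (.inr ⟨h, h'⟩)
    · exact .inr (.inr ⟨by linarith, by linarith⟩)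
  · exact .inl (.inl h)

/-- Every point has a coordinate in the right half of a chart. -/
theorem exists_isRight (x : Z.Surface) : ∃ p w, Z.HasCoord p w x ∧ IsRight w := by
  obtain ⟨p, w, h⟩ := exists_hasCoord x
  rcases isRight_or_neg w with h' | h'
  · exact ⟨p, w, h, h'⟩
  · exact ⟨_, _, h.neg, h'⟩

/-- The possible pairs of coordinates in the right half of charts of the same point. -/
inductive SameRight (Z : ArcDiagram P) : P → ℂ → P → ℂ → Prop
  | refl (p w) : SameRight Z p w p w
  | rotate (p) : SameRight Z p 0 (Z.m p) 0
  | sub (p w) (h : 0 < w.re) : SameRight Z p w (Z.s p) (w - I)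
  | add (p w) (h : 0 < w.re) : SameRight Z (Z.s p) (w - I) p w

/-- A normal form is produced by the crossing, by a shift by `I`, or by no change at all. Comparing
two of them leaves the identity, the half turn at a crossing and the two unit translations. -/
theorem sameRight_of_normal {p q : P} {w w' : ℂ} (hw : IsRight w) (hw' : IsRight w')
    (h : Z.normal p w = Z.normal q w') : SameRight Z p w q w' := by
  have key : ∀ (p : P) {w : ℂ}, IsRight w → (w = 0 ∧ Z.normal p w = .inr (Z.arc p)) ∨
      (0 < w.re ∧ w.im < 0 ∧ Z.normal p w = .inl (Z.s⁻¹ p, w + I)) ∨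
      (Z.normal p w = .inl (p, w)) := by
    intro p w hw
    by_cases h0 : w = 0
    · exact .inl ⟨h0, by rw [h0, normal_zero]⟩
    rcases hw with hw | hw
    · by_cases h1 : w.im < 0
      · exact .inr (.inl ⟨hw, h1, normal_right' hw h1⟩)
      · exact .inr (.inr (normal_right hw (not_lt.1 h1)))
    · refine .inr (.inr (normal_axis hw.1 (lt_of_le_of_ne hw.2 fun h => h0 ?_)))
      exact Complex.ext hw.1 h.symm
  rcases key p hw with ⟨rfl, h1⟩ | ⟨h1, h2, h3⟩ | h3 <;>
    rcases key q hw' with ⟨rfl, h1'⟩ | ⟨h1', h2', h3'⟩ | h3'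
  · rw [h1, h1', Sum.inr.injEq] at h
    rcases Z.arc_eq_arc.1 h with rfl | rfl
    · exact .refl _ _
    · exact .rotate _
  · simp [h1, h3'] at h
  · simp [h1, h3'] at h
  · simp [h1', h3] at h
  · rw [h3, h3', Sum.inl.injEq, Prod.mk.injEq, Z.s⁻¹.injective.eq_iff, add_left_inj] at h
    obtain ⟨rfl, rfl⟩ := h
    exact .refl _ _
  · rw [h3, h3', Sum.inl.injEq, Prod.mk.injEq] at h
    obtain ⟨rfl, rfl⟩ := h
    have := SameRight.add (Z := Z) (Z.s⁻¹ p) (w + I) (by simpa using h1)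
    simpa using this
  · simp [h1', h3] at h
  · rw [h3, h3', Sum.inl.injEq, Prod.mk.injEq] at h
    obtain ⟨rfl, rfl⟩ := h
    have := SameRight.sub (Z := Z) (Z.s⁻¹ q) (w' + I) (by simpa using h1')
    simpa using this
  · rw [h3, h3', Sum.inl.injEq, Prod.mk.injEq] at h
    obtain ⟨rfl, rfl⟩ := h
    exact .refl _ _

theorem eq_of_sameRight {p q : P} {w w' : ℂ} {x y : Z.Surface} (h : SameRight Z p w q w')
    (hx : Z.HasCoord p w x) (hy : Z.HasCoord q w' y) : x = y := by
  obtain ⟨hx, rfl⟩ := hx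
  obtain ⟨hy, rfl⟩ := hy
  induction h with
  | refl => rfl
  | rotate p => exact Quot.sound (.rotate p _ _ (by simp))
  | sub p w h => exact Quot.sound (.translate p _ _ h rfl)
  | add p w h => exact (Quot.sound (.translate p _ _ h rfl)).symm

/-- Points with the same normal form agree. -/
theorem nf_injective : Function.Injective Z.nf := by
  intro x y h
  obtain ⟨p, w, hx, hw⟩ := exists_isRight x
  obtain ⟨q, w', hy, hw'⟩ := exists_isRight y
  rw [hx.nf, hy.nf] at h
  exact eq_of_sameRight (sameRight_of_normal hw hw' h) hx hy

/-- Coordinates of the same point differ by `±`, and possibly by a translation. -/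
theorem HasCoord.sameRight {p q : P} {w w' : ℂ} {x : Z.Surface} (h : Z.HasCoord p w x)
    (h' : Z.HasCoord q w' x) : ∃ p₁ w₁ q₁ w₁', ((p₁ = p ∧ w₁ = w) ∨ (p₁ = Z.m p ∧ w₁ = -w)) ∧
      ((q₁ = q ∧ w₁' = w') ∨ (q₁ = Z.m q ∧ w₁' = -w')) ∧ SameRight Z p₁ w₁ q₁ w₁' := by
  have key : ∀ {p w}, Z.HasCoord p w x → ∃ p₁ w₁, ((p₁ = p ∧ w₁ = w) ∨ (p₁ = Z.m p ∧ w₁ = -w)) ∧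
      IsRight w₁ ∧ Z.HasCoord p₁ w₁ x := by
    intro p w h
    rcases isRight_or_neg w with h' | h'
    · exact ⟨p, w, .inl ⟨rfl, rfl⟩, h', h⟩
    · exact ⟨_, _, .inr ⟨rfl, rfl⟩, h', h.neg⟩
  obtain ⟨p₁, w₁, h1, h2, h3⟩ := key h
  obtain ⟨q₁, w₁', h1', h2', h3'⟩ := key h'
  exact ⟨p₁, w₁, q₁, w₁', h1, h1', sameRight_of_normal h2 h2' (h3.nf.symm.trans h3'.nf)⟩

/-! ## The topology of the surface -/

theorem isOpen_surface {U : Set Z.Surface} : IsOpen U ↔ ∀ p, IsOpen (Z.chart p ⁻¹' U) := by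
  have h1 : IsOpen U ↔ IsOpen (Quot.mk Z.Glue ⁻¹' U) := Iff.rfl
  rw [h1, isOpen_sigma_iff]
  rfl

theorem continuous_chart (p : P) : Continuous (Z.chart p) :=
  continuous_def.2 fun _ hU => isOpen_surface.1 hU p

/-- Two coordinates of a point differ by an affine map, which relates the coordinates of all nearby
points. -/
theorem HasCoord.exists_affine {p q : P} {a b : ℂ} {x : Z.Surface} (h : Z.HasCoord p a x)
    (h' : Z.HasCoord q b x) : ∃ ε c : ℂ, (ε = 1 ∨ ε = -1) ∧ b = ε * a + c ∧
      ∀ᶠ a' in 𝓝 a, ∀ y, Z.HasCoord p a' y → Z.HasCoord q (ε * a' + c) y := by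
  obtain ⟨p₁, w₁, q₁, w₁', h3, h4, h5⟩ := h.sameRight h'
  have key : ∃ ε c : ℂ, (ε = 1 ∨ ε = -1) ∧ w₁' = ε * w₁ + c ∧
      ∀ᶠ a' in 𝓝 w₁, ∀ y, Z.HasCoord p₁ a' y → Z.HasCoord q₁ (ε * a' + c) y := by
    have mem1 : w₁ ∈ chartDomain := by
      rcases h3 with ⟨rfl, rfl⟩ | ⟨rfl, rfl⟩
      exacts [h.mem, h.neg.mem]
    have mem2 : w₁' ∈ chartDomain := by
      rcases h4 with ⟨rfl, rfl⟩ | ⟨rfl, rfl⟩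
      exacts [h'.mem, h'.neg.mem]
    have him1 := abs_lt.1 (mem_chartDomain.1 mem1).2.1
    have him2 := abs_lt.1 (mem_chartDomain.1 mem2).2.1
    clear h3 h4
    induction h5 with
    | refl p w => exact ⟨1, 0, .inl rfl, by simp, .of_forall fun a' y hy => by simpa using hy⟩
    | rotate p => exact ⟨-1, 0, .inr rfl, by simp, .of_forall fun a' y hy => by simpa using hy.neg⟩
    | sub p w h =>
      simp only [Complex.sub_im, Complex.I_im] at him2
      refine ⟨1, -I, .inl rfl, by ring, ?_⟩
      filter_upwards [Complex.continuous_re.continuousAt.eventually_const_lt h,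
        Complex.continuous_im.continuousAt.eventually_const_lt
          (show 1 / 4 < w.im by linarith)] with a' h1 h2 y hy
      rw [one_mul, ← sub_eq_add_neg]
      exact hy.sub h1 h2
    | add p w h =>
      simp only [Complex.sub_im, Complex.I_im] at him1
      refine ⟨1, I, .inl rfl, by ring, ?_⟩
      filter_upwards [Complex.continuous_re.continuousAt.eventually_const_lt
          (show 0 < (w - I).re by simpa using h),
        Complex.continuous_im.continuousAt.eventually_lt_const
          (show (w - I).im < - (1 / 4) by simp; linarith)] with a' h1 h2 y hy
      rw [one_mul]
      simpa using hy.add h1 h2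
  obtain ⟨ε, c, h6, h7, h8⟩ := key
  -- Undo the possible half turns: one in the source changes the sign of `ε`, one in the target
  -- changes the signs of `ε` and `c`.
  rcases h3 with ⟨rfl, rfl⟩ | ⟨rfl, rfl⟩ <;> rcases h4 with ⟨rfl, rfl⟩ | ⟨rfl, rfl⟩
  · exact ⟨ε, c, h6, h7, h8⟩
  · refine ⟨-ε, -c, by rcases h6 with rfl | rfl <;> simp, by linear_combination -h7, ?_⟩
    filter_upwards [h8] with a' h9 y hy
    have := (h9 y hy).neg
    rw [Z.m_m] at this
    convert this using 1
    ring
  · refine ⟨-ε, c, by rcases h6 with rfl | rfl <;> simp, by linear_combination h7, ?_⟩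
    filter_upwards [continuousAt_neg.eventually h8] with a' h9 y hy
    convert h9 y hy.neg using 1
    ring
  · refine ⟨ε, -c, h6, by linear_combination -h7, ?_⟩
    filter_upwards [continuousAt_neg.eventually h8] with a' h9 y hy
    have := (h9 y hy.neg).neg
    rw [Z.m_m] at this
    convert this using 1
    ring

/-- Seen in another chart, the image of an open set is locally its preimage under an affine
transition map. So charts serve as local coordinates although they need not be injective. -/
theorem isOpenMap_chart (p : P) : IsOpenMap (Z.chart p) := by
  intro U hU
  rw [isOpen_surface]
  intro q
  obtain ⟨U', hU', rfl⟩ := isOpen_induced_iff.1 hU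
  rw [isOpen_iff_mem_nhds]
  rintro ⟨b, hb⟩ ⟨⟨a, ha⟩, haU, hab⟩
  obtain ⟨ε, c, -, h2, h3⟩ := HasCoord.exists_affine (Z := Z) (p := q) (a := b) (q := p) (b := a)
    (hasCoord_chart q ⟨b, hb⟩) ⟨ha, hab.symm⟩
  have h4 : ∀ᶠ b' in 𝓝 b, ε * b' + c ∈ U' := by
    refine ContinuousAt.eventually_mem (by fun_prop) ?_
    rw [← h2]
    exact hU'.mem_nhds haU
  rw [nhds_subtype_eq_comap]
  refine ⟨_, h3.and h4, ?_⟩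
  rintro ⟨b', hb'⟩ ⟨h5, h6⟩
  obtain ⟨h7, h8⟩ := h5 _ (hasCoord_chart q ⟨b', hb'⟩)
  exact ⟨⟨_, h7⟩, h6, h8.symm⟩

/-- A pair of coordinates of the same point lies in one of four closed sets. -/
def sameClosed (Z : ArcDiagram P) (p q : P) : Set (ℂ × ℂ) :=
  {x | (q = p ∧ x.2 = x.1) ∨ (q = Z.m p ∧ x.1 = 0 ∧ x.2 = 0) ∨
    (q = Z.s p ∧ x.2 = x.1 - I ∧ 0 ≤ x.1.re) ∨ (p = Z.s q ∧ x.1 = x.2 - I ∧ 0 ≤ x.2.re)}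

theorem isClosed_sameClosed (p q : P) : IsClosed (Z.sameClosed p q) := by
  have h1 : IsClosed {x : ℂ × ℂ | x.2 = x.1} := isClosed_eq (by fun_prop) (by fun_prop)
  have h2 : IsClosed {x : ℂ × ℂ | x.1 = 0 ∧ x.2 = 0} :=
    (isClosed_eq (by fun_prop) (by fun_prop)).inter (isClosed_eq (by fun_prop) (by fun_prop))
  have h3 : IsClosed {x : ℂ × ℂ | x.2 = x.1 - I ∧ 0 ≤ x.1.re} :=
    (isClosed_eq (by fun_prop) (by fun_prop)).inter
      (isClosed_le (by fun_prop) (Complex.continuous_re.comp continuous_fst))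
  have h4 : IsClosed {x : ℂ × ℂ | x.1 = x.2 - I ∧ 0 ≤ x.2.re} :=
    (isClosed_eq (by fun_prop) (by fun_prop)).inter
      (isClosed_le (by fun_prop) (Complex.continuous_re.comp continuous_snd))
  have key : ∀ (c : Prop) {s : Set (ℂ × ℂ)}, IsClosed s → IsClosed {x | c ∧ x ∈ s} := by
    intro c s hs
    by_cases hc : c
    · simpa [hc] using hs
    · simp [hc]
  exact (key _ h1).union ((key _ h2).union ((key _ h3).union (key _ h4)))

/-- Closedness of the relation is bought by weakening `0 < re` to `0 ≤ re`. Nothing is added: if `w`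
and `w - I` both lie in the chart domain with `re = 0`, then `w` has height between `1/4` and `3/4`
and lies in the removed disk. -/
theorem HasCoord.eq_of_sameClosed {p q : P} {w w' : ℂ} {x y : Z.Surface} (hx : Z.HasCoord p w x)
    (hy : Z.HasCoord q w' y) (h : (w, w') ∈ Z.sameClosed p q) : x = y := by
  have key : ∀ w : ℂ, w ∈ chartDomain → w - I ∈ chartDomain → 0 ≤ w.re → 0 < w.re := by
    intro w h1 h2 h0
    refine lt_of_le_of_ne h0 fun h3 => ?_
    rw [mem_chartDomain, abs_lt] at h1 h2
    simp only [Complex.sub_im, Complex.I_im, ← h3, Complex.sub_re, Complex.I_re] at h1 h2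
    nlinarith
  rcases h with ⟨rfl, h⟩ | ⟨rfl, h, h'⟩ | ⟨rfl, h, h'⟩ | ⟨rfl, h, h'⟩ <;> dsimp only at *
  · subst h; exact eq_of_sameRight (.refl _ _) hx hy
  · subst h; subst h'; exact eq_of_sameRight (.rotate _) hx hy
  · subst h; exact eq_of_sameRight (.sub _ _ (key _ hx.mem hy.mem h')) hx hy
  · subst h; exact eq_of_sameRight (.add _ _ (key _ hy.mem hx.mem h')) hx hy

/-- Representing a common point is, up to half turns, a closed condition on pairs of coordinates.
Distinct points therefore have coordinate neighbourhoods without common points, and charts are open.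
This is what makes images of compact sets closed later. -/
instance : T2Space Z.Surface := by
  refine ⟨fun x y hxy => ?_⟩
  obtain ⟨p, a, hx⟩ := exists_hasCoord x
  obtain ⟨q, b, hy⟩ := exists_hasCoord y
  have key : ∃ C : Set (ℂ × ℂ), IsClosed C ∧ (a, b) ∉ C ∧ ∀ a' b' z, Z.HasCoord p a' z →
      Z.HasCoord q b' z → (a', b') ∈ C := by
    refine ⟨Z.sameClosed p q ∪ (fun x => (-x.1, x.2)) ⁻¹' Z.sameClosed (Z.m p) q ∪
      (fun x => (x.1, -x.2)) ⁻¹' Z.sameClosed p (Z.m q) ∪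
      (fun x => (-x.1, -x.2)) ⁻¹' Z.sameClosed (Z.m p) (Z.m q), ?_, ?_, ?_⟩
    · refine ((IsClosed.union ?_ ?_).union ?_).union ?_
      · exact isClosed_sameClosed _ _
      all_goals exact (isClosed_sameClosed _ _).preimage (by fun_prop)
    · rintro (((h | h) | h) | h)
      · exact hxy (hx.eq_of_sameClosed hy h)
      · exact hxy (hx.neg.eq_of_sameClosed hy h)
      · exact hxy (hx.eq_of_sameClosed hy.neg h)
      · exact hxy (hx.neg.eq_of_sameClosed hy.neg h)
    · intro a' b' z h1 h2
      obtain ⟨p₁, w₁, q₁, w₁', h3, h4, h5⟩ := h1.sameRight h2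
      have h6 : (w₁, w₁') ∈ Z.sameClosed p₁ q₁ := by
        clear h3 h4
        induction h5 with
        | refl => exact .inl ⟨rfl, rfl⟩
        | rotate => exact .inr (.inl ⟨rfl, rfl, rfl⟩)
        | sub p w h => exact .inr (.inr (.inl ⟨rfl, rfl, h.le⟩))
        | add p w h => exact .inr (.inr (.inr ⟨rfl, rfl, h.le⟩))
      rcases h3 with ⟨rfl, rfl⟩ | ⟨rfl, rfl⟩ <;> rcases h4 with ⟨rfl, rfl⟩ | ⟨rfl, rfl⟩
      · exact .inl (.inl (.inl h6))
      · exact .inl (.inr h6)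
      · exact .inl (.inl (.inr h6))
      · exact .inr h6
  obtain ⟨C, hC, hab, hC'⟩ := key
  obtain ⟨U, V, hU, hV, haU, hbV, hUV⟩ :=
    isOpen_prod_iff.1 hC.isOpen_compl a b hab
  refine ⟨_, _, isOpenMap_chart p _ (hU.preimage continuous_subtype_val),
    isOpenMap_chart q _ (hV.preimage continuous_subtype_val), ⟨⟨a, hx.mem⟩, haU, hx.2.symm⟩,
    ⟨⟨b, hy.mem⟩, hbV, hy.2.symm⟩, ?_⟩
  rw [Set.disjoint_left]
  rintro _ ⟨a', ha', rfl⟩ ⟨b', hb', hab'⟩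
  exact hUV (mk_mem_prod ha' hb') (hC' _ _ _ (hasCoord_chart p a') (hab' ▸ hasCoord_chart q b'))

theorem SameRight.cases' {p q : P} {w w' : ℂ} (h : SameRight Z p w q w') :
    (q = p ∧ w' = w) ∨ (q = Z.m p ∧ w = 0 ∧ w' = 0) ∨ w' = w - I ∨ w' = w + I := by
  induction h with
  | refl => exact .inl ⟨rfl, rfl⟩
  | rotate => exact .inr (.inl ⟨rfl, rfl, rfl⟩)
  | sub => exact .inr (.inr (.inl rfl))
  | add => exact .inr (.inr (.inr (by ring)))

/-- A chart is injective on small sets. -/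
theorem HasCoord.eq_or_le_dist {p : P} {w w' : ℂ} {x : Z.Surface} (h : Z.HasCoord p w x)
    (h' : Z.HasCoord p w' x) : w' = w ∨ 1 / 2 ≤ dist w' w := by
  obtain ⟨p₁, w₁, q₁, w₁', h3, h4, h5⟩ := h.sameRight h'
  have hm := Z.m_ne p
  have h1 : w' = w - I → 1 / 2 ≤ dist w' w := by
    rintro rfl; rw [dist_eq_norm]; norm_num
  have h2 : w' = w + I → 1 / 2 ≤ dist w' w := by
    rintro rfl; rw [dist_eq_norm]; norm_num
  -- Now `w'` is the reflection of `w` in the centre `I / 2` of a removed disk, so their distance is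
  -- twice the distance of `w` from that centre.
  have h6 : w' = -w + I → 1 / 2 ≤ dist w' w := by
    rintro rfl
    rw [dist_eq_norm, show -w + I - w = -(2 * (w - I / 2)) by ring, norm_neg, norm_mul]
    have := h.mem.2.2.1
    norm_num
    linarith
  have h7 : w' = -w - I → 1 / 2 ≤ dist w' w := by
    rintro rfl
    rw [dist_eq_norm, show -w - I - w = -(2 * (w + I / 2)) by ring, norm_neg, norm_mul]
    have := h.mem.2.2.2
    norm_num
    linarith
  rcases h3 with ⟨rfl, rfl⟩ | ⟨rfl, rfl⟩ <;> rcases h4 with ⟨rfl, rfl⟩ | ⟨rfl, rfl⟩ <;>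
    rcases h5.cases' with ⟨h8, h9⟩ | ⟨h8, h9, h10⟩ | h9 | h9
  · exact .inl h9
  · exact absurd h8.symm hm
  · exact .inr (h1 h9)
  · exact .inr (h2 h9)
  · exact absurd h8 hm
  · exact .inl (by rw [h9, ← neg_eq_zero, h10])
  · exact .inr (h6 (by linear_combination -h9))
  · exact .inr (h7 (by linear_combination -h9))
  · exact absurd h8.symm hm
  · exact .inl (by rw [h10, ← neg_eq_zero.1 h9])
  · exact .inr (h7 h9)
  · exact .inr (h6 h9)
  · exact .inl (neg_injective h9)
  · exact .inl (by rw [neg_eq_zero.1 h9, neg_eq_zero.1 h10])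
  · exact .inr (h2 (by linear_combination -h9))
  · exact .inr (h1 (by linear_combination -h9))

/-- Two coordinates of a point differ by an affine map, and so do all nearby coordinates of nearby
points. -/
theorem HasCoord.transition {p q : P} {a b : ℂ} {x : Z.Surface} (h : Z.HasCoord p a x)
    (h' : Z.HasCoord q b x) : ∃ ε c : ℂ, (ε = 1 ∨ ε = -1) ∧ b = ε * a + c ∧
      ∀ᶠ u in 𝓝 (a, b), ∀ y, Z.HasCoord p u.1 y → Z.HasCoord q u.2 y → u.2 = ε * u.1 + c := by
  obtain ⟨ε, c, h1, h2, h3⟩ := h.exists_affine h'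
  refine ⟨ε, c, h1, h2, ?_⟩
  -- The affine image of `u.1` and `u.2` are coordinates of one point in one chart at distance less
  -- than `1 / 2`, so they agree by `eq_or_le_dist`.
  have h4 : ∀ᶠ u : ℂ × ℂ in 𝓝 (a, b), dist u.2 (ε * u.1 + c) < 1 / 2 := by
    have hc : Continuous fun u : ℂ × ℂ => dist u.2 (ε * u.1 + c) := by fun_prop
    refine (hc.tendsto (a, b)).eventually_lt_const ?_
    rw [← h2, dist_self]
    norm_num
  filter_upwards [h4, continuousAt_fst.eventually h3] with u h5 h6 y h7 h8
  rcases (h6 y h7).eq_or_le_dist h8 with h9 | h9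
  · exact h9
  · linarith

end Bordered.ArcDiagram

namespace Bordered.ArcDiagram

open Complex (I)
open Set Filter Topology

variable {P : Type*} {Z : ArcDiagram P}

/-! ## The parts of the surface in terms of normal forms -/

/-- The region of the normal forms away from the arcs `η_i`. -/
def hexagon : Set ℂ :=
  {w | 0 < w.re ∧ w.re ≤ 1 ∧ 0 ≤ w.im ∧ w.im < 1 ∧ 1 / 16 ≤ w.re ^ 2 + (w.im - 1 / 2) ^ 2}

/-- A normal form may have height up to `1`, where it is no coordinate in the chart of `p`. The last
clause records where it can be read: below `3/4` in the chart of `p`, above `1/4` in the chart of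
`Z.s p`, with an overlap. -/
theorem nf_cases (x : Z.Surface) :
    (∃ p, Z.HasCoord p 0 x ∧ Z.nf x = .inr (Z.arc p)) ∨
    (∃ p w, Z.HasCoord p w x ∧ w.re = 0 ∧ 0 < w.im ∧ w.im ≤ 1 / 4 ∧ Z.nf x = .inl (p, w)) ∨
    (∃ p w, w ∈ hexagon ∧ Z.nf x = .inl (p, w) ∧ (w.im < 3 / 4 → Z.HasCoord p w x) ∧
      (1 / 4 < w.im → Z.HasCoord (Z.s p) (w - I) x)) := by
  obtain ⟨p, w, h, hw⟩ := exists_isRight x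
  by_cases h0 : w = 0
  · subst h0
    exact .inl ⟨p, h, by rw [h.nf, normal_zero]⟩
  obtain ⟨h1, h2, h3, h4⟩ := mem_chartDomain.1 h.mem
  rw [abs_le] at h1
  rw [abs_lt] at h2
  rcases hw with hw | ⟨hw, hw'⟩
  · refine .inr (.inr ?_)
    rcases le_or_gt 0 w.im with h5 | h5
    · exact ⟨p, w, ⟨hw, h1.2, h5, by linarith, h3⟩, by rw [h.nf, normal_right hw h5],
        fun _ => h, fun h6 => h.sub hw h6⟩
    · refine ⟨Z.s⁻¹ p, w + I, ⟨by simpa using hw, by simpa using h1.2, by simp; linarith,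
        by simpa using h5, ?_⟩, by rw [h.nf, normal_right' hw h5], fun h6 => ?_, fun _ => ?_⟩
      · simp only [Complex.add_re, Complex.I_re, Complex.add_im, Complex.I_im, add_zero]
        linarith
      · exact h.add hw (by simp at h6; linarith)
      · simpa using h
  · have h5 : 0 < w.im := lt_of_le_of_ne hw' fun h => h0 (Complex.ext hw h.symm)
    refine .inr (.inl ⟨p, w, h, hw, h5, ?_, by rw [h.nf, normal_axis hw h5]⟩)
    rw [hw] at h3
    nlinarith

/-- The definition allows an arbitrary coordinate of the point; through the normal form membership
is decided by any single one. The next four lemmas serve the same purpose. -/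
theorem mem_boundary_iff {x : Z.Surface} : x ∈ Z.boundary ↔
    ∃ q w, Z.nf x = .inl (q, w) ∧ (w.re = 1 ∨ w.re ^ 2 + (w.im - 1 / 2) ^ 2 = 1 / 16) := by
  constructor
  · rintro ⟨p, w, h, hw⟩
    rw [norm_sub_half, norm_add_half] at hw
    have key : ∃ p w, Z.HasCoord p w x ∧ IsRight w ∧ (|w.re| = 1 ∨
        w.re ^ 2 + (w.im - 1 / 2) ^ 2 = 1 / 16 ∨ w.re ^ 2 + (w.im + 1 / 2) ^ 2 = 1 / 16) := by
      rcases isRight_or_neg w with h' | h'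
      · exact ⟨p, w, h, h', hw⟩
      · refine ⟨_, _, h.neg, h', ?_⟩
        simp only [Complex.neg_re, Complex.neg_im, abs_neg]
        rcases hw with hw | hw | hw
        · exact .inl hw
        · exact .inr (.inr (by linarith))
        · exact .inr (.inl (by linarith))
    obtain ⟨p, w, h, h', hw⟩ := key
    have h2 := abs_lt.1 (mem_chartDomain.1 h.mem).2.1
    rw [h.nf]
    rcases h' with h' | ⟨h', h''⟩
    · rw [abs_of_pos h'] at hw
      rcases le_or_gt 0 w.im with h5 | h5
      · refine ⟨p, w, normal_right h' h5, ?_⟩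
        rcases hw with hw | hw | hw
        · exact .inl hw
        · exact .inr hw
        · nlinarith
      · refine ⟨_, _, normal_right' h' h5, ?_⟩
        simp only [Complex.add_re, Complex.I_re, Complex.add_im, Complex.I_im, add_zero]
        rcases hw with hw | hw | hw
        · exact .inl hw
        · nlinarith
        · exact .inr (by linarith)
    · have h5 : 0 < w.im := lt_of_le_of_ne h'' fun h => by
        rw [h', ← h] at hw
        norm_num at hw
      refine ⟨p, w, normal_axis h' h5, ?_⟩
      rcases hw with hw | hw | hw
      · rw [h'] at hw; norm_num at hw
      · exact .inr hw
      · nlinarith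
  · rintro ⟨q, w, h, hw⟩
    rcases nf_cases x with ⟨p, h1, h2⟩ | ⟨p, w', h1, h2, h3, h4, h5⟩ | ⟨p, w', h1, h2, h3, h4⟩
    · simp [h] at h2
    · rw [h, Sum.inl.injEq, Prod.mk.injEq] at h5
      obtain ⟨rfl, rfl⟩ := h5
      refine ⟨q, w, h1, ?_⟩
      rw [norm_sub_half]
      rcases hw with hw | hw
      · left; rw [hw]; norm_num
      · exact .inr (.inl hw)
    · rw [h, Sum.inl.injEq, Prod.mk.injEq] at h2
      obtain ⟨rfl, rfl⟩ := h2
      rcases lt_or_ge w.im (3 / 4) with h5 | h5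
      · refine ⟨q, w, h3 h5, ?_⟩
        rw [norm_sub_half]
        rcases hw with hw | hw
        · left; rw [hw]; norm_num
        · exact .inr (.inl hw)
      · refine ⟨_, _, h4 (by linarith), ?_⟩
        rw [norm_add_half]
        simp only [Complex.sub_re, Complex.I_re, Complex.sub_im, Complex.I_im, sub_zero]
        rcases hw with hw | hw
        · left; rw [hw]; norm_num
        · exact .inr (.inr (by linarith))

theorem mem_alpha_iff {x : Z.Surface} {a : Z.Arc} : x ∈ Z.alpha a ↔
    Z.nf x = .inr a ∨ ∃ q w, Z.nf x = .inl (q, w) ∧ w.im = 0 ∧ Z.arc q = a := by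
  constructor
  · rintro ⟨p, w, rfl, hw, h⟩
    rcases eq_or_ne w 0 with rfl | h0
    · exact .inl (by rw [h.nf, normal_zero])
    · right
      have h1 : w.re ≠ 0 := fun h => h0 (Complex.ext h hw)
      rcases lt_or_gt_of_ne h1 with h1 | h1
      · exact ⟨_, _, by rw [h.neg.nf, normal_right (by simpa using h1) (by simp [hw])],
          by simp [hw], Z.arc_m p⟩
      · exact ⟨_, _, by rw [h.nf, normal_right h1 hw.ge], hw, rfl⟩
  · rintro (h | ⟨q, w, h, hw, rfl⟩)
    · rcases nf_cases x with ⟨p, h1, h2⟩ | ⟨p, w', h1, h2, h3, h4, h5⟩ | ⟨p, w', h1, h2, h3, h4⟩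
      · rw [h, Sum.inr.injEq] at h2
        exact ⟨p, 0, h2.symm, rfl, h1⟩
      all_goals simp_all
    · rcases nf_cases x with ⟨p, h1, h2⟩ | ⟨p, w', h1, h2, h3, h4, h5⟩ | ⟨p, w', h1, h2, h3, h4⟩
      · simp [h] at h2
      · rw [h, Sum.inl.injEq, Prod.mk.injEq] at h5
        obtain ⟨rfl, rfl⟩ := h5
        exact absurd hw h3.ne'
      · rw [h, Sum.inl.injEq, Prod.mk.injEq] at h2
        obtain ⟨rfl, rfl⟩ := h2
        exact ⟨q, w, rfl, hw, h3 (by linarith)⟩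

theorem mem_eta_iff {x : Z.Surface} {a : Z.Arc} : x ∈ Z.eta a ↔
    Z.nf x = .inr a ∨ ∃ q w, Z.nf x = .inl (q, w) ∧ w.re = 0 ∧ Z.arc q = a := by
  constructor
  · rintro ⟨p, w, rfl, hw, h⟩
    rcases eq_or_ne w 0 with rfl | h0
    · exact .inl (by rw [h.nf, normal_zero])
    · right
      have h1 : w.im ≠ 0 := fun h => h0 (Complex.ext hw h)
      rcases lt_or_gt_of_ne h1 with h1 | h1
      · exact ⟨_, _, by rw [h.neg.nf, normal_axis (by simp [hw]) (by simpa using h1)],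
          by simp [hw], Z.arc_m p⟩
      · exact ⟨_, _, by rw [h.nf, normal_axis hw h1], hw, rfl⟩
  · rintro (h | ⟨q, w, h, hw, rfl⟩)
    · rcases nf_cases x with ⟨p, h1, h2⟩ | ⟨p, w', h1, h2, h3, h4, h5⟩ | ⟨p, w', h1, h2, h3, h4⟩
      · rw [h, Sum.inr.injEq] at h2
        exact ⟨p, 0, h2.symm, rfl, h1⟩
      all_goals simp_all
    · rcases nf_cases x with ⟨p, h1, h2⟩ | ⟨p, w', h1, h2, h3, h4, h5⟩ | ⟨p, w', h1, h2, h3, h4⟩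
      · simp [h] at h2
      · rw [h, Sum.inl.injEq, Prod.mk.injEq] at h5
        obtain ⟨rfl, rfl⟩ := h5
        exact ⟨q, w, rfl, hw, h1⟩
      · rw [h, Sum.inl.injEq, Prod.mk.injEq] at h2
        obtain ⟨rfl, rfl⟩ := h2
        exact absurd hw h1.1.ne'

/-- The upper end of the half circle lies on a dual arc and below the centre of its chart, so a half
turn carries its normal form to the chart of `Z.m (Z.s q)`. This accounts for the separate second
case. -/
theorem mem_innerInterval_iff {x : Z.Surface} {q : P} : x ∈ Z.innerInterval q ↔
    (∃ w, Z.nf x = .inl (q, w) ∧ w.re ^ 2 + (w.im - 1 / 2) ^ 2 = 1 / 16) ∨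
      Z.nf x = .inl (Z.m (Z.s q), I / 4) := by
  constructor
  · rintro ⟨w, h0, ⟨h1, h2, h3⟩ | ⟨h1, h2, h3⟩⟩
    · rw [norm_sub_half] at h1
      have h4 : 0 < w.im := by nlinarith
      left
      rw [h3.nf]
      rcases h0.eq_or_lt with h0 | h0
      · exact ⟨w, normal_axis h0.symm h4, h1⟩
      · exact ⟨w, normal_right h0 h4.le, h1⟩
    · rw [norm_add_half] at h1
      have h4 : w.im < 0 := by nlinarith
      rcases h0.eq_or_lt with h0 | h0
      · right
        have h5 : w = -(I / 4) := by
          apply Complex.ext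
          · simp [← h0]
          · simp
            rw [← h0] at h1
            nlinarith
        rw [h3.neg.nf, h5, neg_neg, normal_axis (by simp) (by simp)]
      · left
        refine ⟨w + I, ?_, ?_⟩
        · rw [h3.nf, normal_right' h0 h4]
          simp
        · simp only [Complex.add_re, Complex.I_re, Complex.add_im, Complex.I_im, add_zero]
          linarith
  · rintro (⟨w, h, hw⟩ | h)
    · rcases nf_cases x with ⟨p, h1, h2⟩ | ⟨p, w', h1, h2, h3, h4, h5⟩ | ⟨p, w', h1, h2, h3, h4⟩
      · simp [h] at h2
      · rw [h, Sum.inl.injEq, Prod.mk.injEq] at h5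
        obtain ⟨rfl, rfl⟩ := h5
        exact ⟨w, h2.ge, .inl ⟨norm_sub_half.2 hw, by linarith, h1⟩⟩
      · rw [h, Sum.inl.injEq, Prod.mk.injEq] at h2
        obtain ⟨rfl, rfl⟩ := h2
        rcases le_or_gt w.im (1 / 2) with h5 | h5
        · exact ⟨w, h1.1.le, .inl ⟨norm_sub_half.2 hw, h5, h3 (by linarith)⟩⟩
        · refine ⟨w - I, by simpa using h1.1.le, .inr ⟨norm_add_half.2 ?_, ?_, h4 (by linarith)⟩⟩
          · simp only [Complex.sub_re, Complex.I_re, Complex.sub_im, Complex.I_im, sub_zero]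
            linarith
          · simp; linarith
    · rcases nf_cases x with ⟨p, h1, h2⟩ | ⟨p, w', h1, h2, h3, h4, h5⟩ | ⟨p, w', h1, h2, h3, h4⟩
      · simp [h] at h2
      · rw [h, Sum.inl.injEq, Prod.mk.injEq] at h5
        obtain ⟨rfl, rfl⟩ := h5
        refine ⟨-(I / 4), by simp, .inr ⟨norm_add_half.2 (by norm_num), by simp; norm_num, ?_⟩⟩
        have := h1.neg
        rwa [Z.m_m] at this
      · rw [h, Sum.inl.injEq, Prod.mk.injEq] at h2
        obtain ⟨rfl, rfl⟩ := h2
        simp [hexagon] at h1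

theorem mem_outerInterval_iff {x : Z.Surface} {q : P} : x ∈ Z.outerInterval q ↔
    (∃ w, Z.nf x = .inl (q, w) ∧ w.re = 1) ∨ Z.nf x = .inl (Z.s q, 1) := by
  constructor
  · rintro ⟨w, h0, ⟨h1, h2, h3⟩ | ⟨h1, h2, h3⟩⟩
    · exact .inl ⟨w, by rw [h3.nf, normal_right (by linarith) h1], h0⟩
    · rcases h2.eq_or_lt with h2 | h2
      · right
        rw [h3.nf, normal_right (by linarith) h2.ge, show w = 1 from Complex.ext h0 h2]
      · refine .inl ⟨w + I, ?_, by simpa using h0⟩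
        rw [h3.nf, normal_right' (by linarith) h2]
        simp
  · rintro (⟨w, h, hw⟩ | h)
    · rcases nf_cases x with ⟨p, h1, h2⟩ | ⟨p, w', h1, h2, h3, h4, h5⟩ | ⟨p, w', h1, h2, h3, h4⟩
      · simp [h] at h2
      · rw [h, Sum.inl.injEq, Prod.mk.injEq] at h5
        obtain ⟨rfl, rfl⟩ := h5
        linarith
      · rw [h, Sum.inl.injEq, Prod.mk.injEq] at h2
        obtain ⟨rfl, rfl⟩ := h2
        obtain ⟨-, -, h6, h7, -⟩ := h1
        rcases le_or_gt w.im (1 / 2) with h5 | h5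
        · exact ⟨w, hw, .inl ⟨h6, h5, h3 (by linarith)⟩⟩
        · exact ⟨w - I, by simpa using hw,
            .inr ⟨by simp; linarith, by simp; linarith, h4 (by linarith)⟩⟩
    · rcases nf_cases x with ⟨p, h1, h2⟩ | ⟨p, w', h1, h2, h3, h4, h5⟩ | ⟨p, w', h1, h2, h3, h4⟩
      · simp [h] at h2
      · rw [h, Sum.inl.injEq, Prod.mk.injEq] at h5
        obtain ⟨rfl, rfl⟩ := h5
        simp at h2
      · rw [h, Sum.inl.injEq, Prod.mk.injEq] at h2
        obtain ⟨rfl, rfl⟩ := h2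
        exact ⟨1, by simp, .inr ⟨by simp, by simp, h3 (by simp)⟩⟩

end Bordered.ArcDiagram

namespace Bordered.ArcDiagram

open Complex (I)
open Set Filter Topology

variable {P : Type*} {Z : ArcDiagram P}

/-! ## Strips of hexagons -/

/-- The union of `n` adjacent closed hexagons. -/
def region (n : ℕ) : Set ℂ :=
  {w | 0 ≤ w.re ∧ w.re ≤ 1 ∧ 0 ≤ w.im ∧ w.im ≤ n ∧
    ∀ k : ℕ, 1 / 16 ≤ w.re ^ 2 + (w.im - k - 1 / 2) ^ 2}

/-- The interior of `region n`. -/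
def regionInt (n : ℕ) : Set ℂ :=
  {w | 0 < w.re ∧ w.re < 1 ∧ 0 < w.im ∧ w.im < n ∧
    ∀ k : ℕ, 1 / 16 < w.re ^ 2 + (w.im - k - 1 / 2) ^ 2}

theorem regionInt_subset (n : ℕ) : regionInt n ⊆ region n :=
  fun _ h => ⟨h.1.le, h.2.1.le, h.2.2.1.le, h.2.2.2.1.le, fun k => (h.2.2.2.2 k).le⟩

/-- For `k ≥ n` the condition on the circle follows from `w.im < n`, so a finite intersection of
open sets remains. -/
theorem isOpen_regionInt (n : ℕ) : IsOpen (regionInt n) := by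
  have h : regionInt n = {w | 0 < w.re} ∩ {w | w.re < 1} ∩ {w | 0 < w.im} ∩ {w : ℂ | w.im < n} ∩
      ⋂ k ∈ Finset.range n, {w : ℂ | 1 / 16 < w.re ^ 2 + (w.im - k - 1 / 2) ^ 2} := by
    ext w
    simp only [regionInt, mem_ofPred_eq, mem_inter_iff, mem_iInter, Finset.mem_range]
    constructor
    · rintro ⟨h1, h2, h3, h4, h5⟩
      exact ⟨⟨⟨⟨h1, h2⟩, h3⟩, h4⟩, fun k _ => h5 k⟩
    · rintro ⟨⟨⟨⟨h1, h2⟩, h3⟩, h4⟩, h5⟩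
      refine ⟨h1, h2, h3, h4, fun k => ?_⟩
      rcases lt_or_ge k n with hk | hk
      · exact h5 k hk
      · have : (n : ℝ) ≤ k := by exact_mod_cast hk
        nlinarith
  rw [h]
  refine ((((isOpen_lt continuous_const Complex.continuous_re).inter
    (isOpen_lt Complex.continuous_re continuous_const)).inter
    (isOpen_lt continuous_const Complex.continuous_im)).inter
    (isOpen_lt Complex.continuous_im continuous_const)).inter
    (isOpen_biInter_finset fun k _ => isOpen_lt continuous_const ?_)
  exact (Complex.continuous_re.pow 2).add
    (((Complex.continuous_im.sub continuous_const).sub continuous_const).pow 2)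

theorem isClosed_region (n : ℕ) : IsClosed (region n) := by
  have h : region n = {w | 0 ≤ w.re} ∩ {w | w.re ≤ 1} ∩ {w | 0 ≤ w.im} ∩ {w : ℂ | w.im ≤ n} ∩
      ⋂ k : ℕ, {w : ℂ | 1 / 16 ≤ w.re ^ 2 + (w.im - k - 1 / 2) ^ 2} := by
    ext w
    simp only [region, mem_ofPred_eq, mem_inter_iff, mem_iInter]
    tauto
  rw [h]
  refine ((((isClosed_le continuous_const Complex.continuous_re).inter
    (isClosed_le Complex.continuous_re continuous_const)).inter
    (isClosed_le continuous_const Complex.continuous_im)).inter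
    (isClosed_le Complex.continuous_im continuous_const)).inter
    (isClosed_iInter fun k => isClosed_le continuous_const ?_)
  exact (Complex.continuous_re.pow 2).add
    (((Complex.continuous_im.sub continuous_const).sub continuous_const).pow 2)

theorem isCompact_region (n : ℕ) : IsCompact (region n) := by
  refine (Metric.isCompact_iff_isClosed_bounded).2 ⟨isClosed_region n, ?_⟩
  refine (Metric.isBounded_closedBall (x := (0 : ℂ)) (r := 1 + n)).subset fun w hw => ?_
  rw [mem_closedBall_zero_iff]
  obtain ⟨h1, h2, h3, h4, -⟩ := hw
  refine (Complex.norm_le_abs_re_add_abs_im w).trans ?_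
  rw [abs_of_nonneg h1, abs_of_nonneg h3]
  linarith

/-- The lower disk of the `k`-th chart is the upper disk of the one before; for `k = 0` it is
avoided because `0 ≤ w.im`. -/
theorem sub_mem_chartDomain_of_region {n : ℕ} {w : ℂ} (hw : w ∈ region n) {k : ℕ}
    (hk : |w.im - k| < 3 / 4) : w - k * I ∈ chartDomain := by
  obtain ⟨h1, h2, h3, h4, h5⟩ := hw
  rw [mem_chartDomain]
  simp only [Complex.sub_re, Complex.mul_re, Complex.natCast_re, Complex.I_re, mul_zero,
    Complex.natCast_im, Complex.I_im, mul_one, sub_self, sub_zero, Complex.sub_im, Complex.mul_im,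
    add_zero]
  rw [abs_of_nonneg h1]
  refine ⟨h2, hk, h5 k, ?_⟩
  rcases k with _ | k
  · simp only [Nat.cast_zero, sub_zero]
    nlinarith
  · have := h5 k
    push_cast
    convert this using 3
    ring

open Classical in
variable (Z) in
/-- The immersion of the strip of the hexagons of `p, s p, s² p, …` in the surface. -/
noncomputable def strip (p : P) (w : ℂ) : Z.Surface :=
  if h : w - (⌊w.im + 1 / 2⌋₊ : ℕ) * I ∈ chartDomain then
    Z.chart ((Z.s ^ ⌊w.im + 1 / 2⌋₊) p) ⟨_, h⟩ else Z.chart p ⟨0, zero_mem_chartDomain⟩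

/-- `strip` chooses its chart by rounding the height, which is not locally constant. Any chart
within `3/4` of the height gives the same point: neighbouring charts are related by the gluing
translation, which applies since `re` is positive at heights strictly between `1/4` and `3/4` of a
hexagon. Local statements can thus be proved in one fixed chart. -/
theorem strip_hasCoord (p : P) {n : ℕ} {w : ℂ} (hw : w ∈ region n) {k : ℕ}
    (hk : |w.im - k| < 3 / 4) : Z.HasCoord ((Z.s ^ k) p) (w - k * I) (Z.strip p w) := by
  have him : 0 ≤ w.im := hw.2.2.1
  have hj := Nat.floor_le (show 0 ≤ w.im + 1 / 2 by linarith)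
  have hj' := Nat.lt_floor_add_one (w.im + 1 / 2)
  have h0 : ∀ j : ℕ, j = ⌊w.im + 1 / 2⌋₊ →
      Z.HasCoord ((Z.s ^ j) p) (w - j * I) (Z.strip p w) := by
    rintro j rfl
    have h1 : w - (⌊w.im + 1 / 2⌋₊ : ℕ) * I ∈ chartDomain :=
      sub_mem_chartDomain_of_region hw (by rw [abs_lt]; constructor <;> linarith)
    rw [strip, dif_pos h1]
    exact ⟨h1, rfl⟩
  have hre : ∀ j : ℕ, 1 / 4 < w.im - j → w.im - j < 3 / 4 → 0 < w.re := by
    intro j h1 h2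
    have := hw.2.2.2.2 j
    refine lt_of_le_of_ne hw.1 fun h => ?_
    rw [← h] at this
    nlinarith
  generalize ⌊w.im + 1 / 2⌋₊ = j at *
  rw [abs_lt] at hk
  rcases lt_trichotomy k j with h | h | h
  · obtain rfl : j = k + 1 := by
      have : (j : ℝ) < k + 2 := by linarith
      have : j < k + 2 := by exact_mod_cast this
      omega
    have h2 := h0 _ rfl
    rw [Nat.cast_succ] at *
    have h3 := h2.add (by simpa using hre k (by linarith) (by linarith)) (by simp; linarith)
    convert h3 using 1
    · rw [pow_succ']; simp
    · ring
  · exact h0 k h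
  · obtain rfl : k = j + 1 := by
      have : (k : ℝ) < j + 2 := by linarith
      have : k < j + 2 := by exact_mod_cast this
      omega
    have h2 := h0 _ rfl
    rw [Nat.cast_succ] at *
    have h3 := h2.sub (by simpa using hre j (by linarith) (by linarith)) (by simp; linarith)
    convert h3 using 1
    · rw [pow_succ']; simp
    · ring

theorem exists_abs_sub_lt {w : ℂ} (h : 0 ≤ w.im) : ∃ k : ℕ, |w.im - k| < 3 / 4 := by
  have hj := Nat.floor_le (show 0 ≤ w.im + 1 / 2 by linarith)
  have hj' := Nat.lt_floor_add_one (w.im + 1 / 2)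
  exact ⟨⌊w.im + 1 / 2⌋₊, by rw [abs_lt]; constructor <;> linarith⟩

theorem eventually_abs_sub_lt {w : ℂ} {k : ℕ} (hk : |w.im - k| < 3 / 4) :
    ∀ᶠ w' : ℂ in 𝓝 w, |w'.im - k| < 3 / 4 :=
  ((Complex.continuous_im.sub continuous_const).abs.tendsto w).eventually_lt_const hk

theorem continuousOn_strip (p : P) (n : ℕ) : ContinuousOn (Z.strip p) (region n) := by
  intro w hw
  obtain ⟨k, hk⟩ := exists_abs_sub_lt hw.2.2.1
  have h0 : ∀ w' : region n, |(w' : ℂ).im - k| < 3 / 4 → (w' : ℂ) - k * I ∈ chartDomain :=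
    fun w' h => sub_mem_chartDomain_of_region w'.2 h
  have h1 : Continuous fun w' : {w' : region n // |(w' : ℂ).im - k| < 3 / 4} =>
      Z.chart ((Z.s ^ k) p) ⟨(w' : ℂ) - k * I, h0 w'.1 w'.2⟩ :=
    (continuous_chart _).comp (by fun_prop)
  rw [continuousWithinAt_iff_continuousAt_domRestrict _ hw]
  have h2 : IsOpen {w' : region n | |(w' : ℂ).im - k| < 3 / 4} :=
    isOpen_lt ((Complex.continuous_im.comp continuous_subtype_val).sub continuous_const).abs
      continuous_const
  refine ContinuousOn.continuousAt (s := {w' : region n | |(w' : ℂ).im - k| < 3 / 4}) ?_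
    (h2.mem_nhds hk)
  rw [continuousOn_iff_continuous_domRestrict]
  exact h1.congr fun w' => ((strip_hasCoord p w'.1.2 w'.2).2).symm

theorem isOpen_strip_image (p : P) {n : ℕ} {U : Set ℂ} (hU : IsOpen U) (hU' : U ⊆ region n) :
    IsOpen (Z.strip p '' U) := by
  rw [isOpen_iff_forall_mem_open]
  rintro _ ⟨w, hw, rfl⟩
  obtain ⟨k, hk⟩ := exists_abs_sub_lt (hU' hw).2.2.1
  have h1 : IsOpen {u : chartDomain | (u : ℂ) + k * I ∈ U ∧ |(u : ℂ).im| < 3 / 4} :=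
    (hU.preimage (by fun_prop)).inter
      (isOpen_lt (Complex.continuous_im.comp continuous_subtype_val).abs continuous_const)
  refine ⟨_, ?_, isOpenMap_chart ((Z.s ^ k) p) _ h1, ?_⟩
  · rintro _ ⟨u, ⟨h2, h3⟩, rfl⟩
    refine ⟨_, h2, ?_⟩
    have h4 := strip_hasCoord (Z := Z) p (hU' h2) (k := k) (by simpa using h3)
    simp only [add_sub_cancel_right] at h4
    exact h4.2
  · have h4 := strip_hasCoord (Z := Z) p (hU' hw) hk
    exact ⟨⟨_, h4.1⟩, ⟨by simpa using hw, by simpa using hk⟩, h4.2.symm⟩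

/-- Off the left axis the normal form recovers both the number of the hexagon and the position
inside it; injectivity of the strip rests on this. -/
theorem nf_strip (p : P) {n : ℕ} {w : ℂ} (hw : w ∈ region n) (h0 : 0 < w.re) {k : ℕ}
    (hk : k ≤ w.im) (hk' : w.im < k + 1) :
    Z.nf (Z.strip p w) = .inl ((Z.s ^ k) p, w - k * I) := by
  rcases lt_or_ge w.im (k + 3 / 4) with h | h
  · rw [(strip_hasCoord p hw (k := k) (by rw [abs_lt]; constructor <;> linarith)).nf,
      normal_right (by simpa using h0) (by simpa using hk)]
  · rw [(strip_hasCoord p hw (k := k + 1)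
      (by rw [abs_lt]; push_cast; constructor <;> linarith)).nf,
      normal_right' (by simpa using h0) (by simp; linarith), pow_succ']
    rw [Equiv.Perm.mul_apply, Equiv.Perm.inv_def, Equiv.symm_apply_apply, Nat.cast_succ]
    ring_nf

variable (Z) in
/-- The open hexagon of `q`: the component of the complement of all `α_i` and `η_i` between `q` and
`s q`. -/
def hexSet (q : P) : Set Z.Surface := {x | ∃ w ∈ regionInt 1, Z.nf x = .inl (q, w)}

theorem hexSet_eq (q : P) : Z.hexSet q = Z.strip q '' regionInt 1 := by
  have key : ∀ w ∈ regionInt 1, Z.nf (Z.strip q w) = .inl (q, w) := fun w hw => by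
    rw [nf_strip q (regionInt_subset 1 hw) hw.1 (k := 0) (by simpa using hw.2.2.1.le)
      (by simpa using hw.2.2.2.1)]
    simp
  ext x
  constructor
  · rintro ⟨w, hw, h⟩
    exact ⟨w, hw, nf_injective ((key w hw).trans h.symm)⟩
  · rintro ⟨w, hw, rfl⟩
    exact ⟨w, hw, key w hw⟩

/-- On each horizontal line the hexagon is an interval, so it is the image of the open unit square
under an affine stretch of the horizontal lines. -/
theorem isPreconnected_regionInt_one : IsPreconnected (regionInt 1) := by
  -- The left end of the line at height `t`. Where the line misses the removed disk the radicand is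
  -- not positive, and the square root takes the desired value `0`.
  let b : ℝ → ℝ := fun t => √(1 / 16 - (t - 1 / 2) ^ 2)
  have hb : Continuous b := by fun_prop
  have h1 : IsPreconnected (Ioo (0 : ℝ) 1 ×ˢ Ioo (0 : ℝ) 1) :=
    isPreconnected_Ioo.prod isPreconnected_Ioo
  have h2 := h1.image (fun u : ℝ × ℝ => (⟨b u.2 + u.1 * (1 - b u.2), u.2⟩ : ℂ)) (by
    refine Continuous.continuousOn ?_
    have : (fun u : ℝ × ℝ => (⟨b u.2 + u.1 * (1 - b u.2), u.2⟩ : ℂ)) =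
        fun u => ((b u.2 + u.1 * (1 - b u.2) : ℝ) : ℂ) + (u.2 : ℝ) * I := by
      ext u; apply Complex.ext <;> simp
    rw [this]
    fun_prop)
  convert h2
  have hb0 : ∀ t, 0 ≤ b t := fun t => Real.sqrt_nonneg _
  have hb1 : ∀ t, b t < 1 := fun t => by
    rw [Real.sqrt_lt' one_pos]
    nlinarith [sq_nonneg (t - 1 / 2)]
  have hb2 : ∀ t x, 0 < x → (1 / 16 < x ^ 2 + (t - 1 / 2) ^ 2 ↔ b t < x) := fun t x hx => by
    rw [Real.sqrt_lt' hx]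
    constructor <;> intro h <;> linarith
  ext w
  simp only [regionInt, mem_ofPred_eq, mem_image, mem_prod, mem_Ioo, Prod.exists, Nat.cast_one]
  constructor
  · rintro ⟨h3, h4, h5, h6, h7⟩
    have h8 := (hb2 w.im w.re h3).1 (by simpa using h7 0)
    have h9 : 0 < 1 - b w.im := by linarith [hb1 w.im]
    refine ⟨(w.re - b w.im) / (1 - b w.im), w.im, ⟨⟨div_pos (by linarith) h9, ?_⟩, h5, h6⟩, ?_⟩
    · rw [div_lt_one h9]; linarith
    · apply Complex.ext
      · simp only
        field_simp
        ring
      · rfl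
  · rintro ⟨l, t, ⟨⟨h3, h4⟩, h5, h6⟩, rfl⟩
    have h9 : 0 < 1 - b t := by linarith [hb1 t]
    have h10 : b t < b t + l * (1 - b t) := by nlinarith
    refine ⟨by linarith [hb0 t], by nlinarith, h5, h6, fun k => ?_⟩
    rcases k with _ | k
    · simpa using (hb2 t _ (by linarith [hb0 t])).2 h10
    · push_cast
      have : 0 ≤ (k : ℝ) := k.cast_nonneg
      nlinarith [hb0 t]

theorem isPreconnected_hexSet (q : P) : IsPreconnected (Z.hexSet q) := by
  rw [hexSet_eq]
  exact isPreconnected_regionInt_one.image _ ((continuousOn_strip q 1).mono (regionInt_subset 1))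

end Bordered.ArcDiagram

namespace Bordered.ArcDiagram

open Complex (I)
open Set Filter Topology

variable {P : Type*} {Z : ArcDiagram P}

/-! ## Neighbourhoods of the points of the surface -/

/-- The coordinates of boundary points. -/
def BoundaryCoord (w : ℂ) : Prop :=
  |w.re| = 1 ∨ w.re ^ 2 + (w.im - 1 / 2) ^ 2 = 1 / 16 ∨ w.re ^ 2 + (w.im + 1 / 2) ^ 2 = 1 / 16

theorem boundaryCoord_neg {w : ℂ} : BoundaryCoord (-w) ↔ BoundaryCoord w := by
  have h1 : (-w.im - 1 / 2) ^ 2 = (w.im + 1 / 2) ^ 2 := by ring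
  have h2 : (-w.im + 1 / 2) ^ 2 = (w.im - 1 / 2) ^ 2 := by ring
  simp only [BoundaryCoord, Complex.neg_re, Complex.neg_im, abs_neg, h1, h2, neg_sq]
  tauto

theorem boundaryCoord_sub {w : ℂ} (h : w ∈ chartDomain) (h' : w - I ∈ chartDomain) :
    BoundaryCoord (w - I) ↔ BoundaryCoord w := by
  have h1 := abs_lt.1 (mem_chartDomain.1 h).2.1
  have h2 := abs_lt.1 (mem_chartDomain.1 h').2.1
  simp only [BoundaryCoord, Complex.sub_re, Complex.sub_im, Complex.I_re, Complex.I_im,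
    sub_zero] at *
  have h3 : (w.im - 1 + 1 / 2) ^ 2 = (w.im - 1 / 2) ^ 2 := by ring
  have h4 : w.re ^ 2 + (w.im - 1 - 1 / 2) ^ 2 ≠ 1 / 16 := by nlinarith [sq_nonneg w.re]
  have h5 : w.re ^ 2 + (w.im + 1 / 2) ^ 2 ≠ 1 / 16 := by nlinarith [sq_nonneg w.re]
  rw [h3]
  tauto

/-- The boundary condition is invariant under half turns and under translations, so it can be tested
in any chart containing the point. -/
theorem HasCoord.mem_boundary_iff {p : P} {w : ℂ} {x : Z.Surface} (h : Z.HasCoord p w x) :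
    x ∈ Z.boundary ↔ BoundaryCoord w := by
  refine ⟨?_, fun h' => ⟨p, w, h, by rwa [norm_sub_half, norm_add_half]⟩⟩
  rintro ⟨q, w', h', hb⟩
  rw [norm_sub_half, norm_add_half] at hb
  change BoundaryCoord w' at hb
  obtain ⟨p₁, w₁, q₁, w₁', h3, h4, h5⟩ := h.sameRight h'
  have key : BoundaryCoord w₁' → BoundaryCoord w₁ := by
    have mem1 : w₁ ∈ chartDomain := by
      rcases h3 with ⟨rfl, rfl⟩ | ⟨rfl, rfl⟩
      exacts [h.mem, h.neg.mem]
    have mem2 : w₁' ∈ chartDomain := by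
      rcases h4 with ⟨rfl, rfl⟩ | ⟨rfl, rfl⟩
      exacts [h'.mem, h'.neg.mem]
    clear h3 h4
    induction h5 with
    | refl => exact id
    | rotate => exact id
    | sub => exact (boundaryCoord_sub mem1 mem2).1
    | add => exact (boundaryCoord_sub mem2 mem1).2
  rcases h3 with ⟨rfl, rfl⟩ | ⟨rfl, rfl⟩ <;> rcases h4 with ⟨rfl, rfl⟩ | ⟨rfl, rfl⟩ <;>
    (try simp only [boundaryCoord_neg] at key) <;> exact key hb

/-- Local statements pass from coordinates to the surface because charts are open; for
`HasCoord.frequently` continuity of charts is used instead. -/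
theorem HasCoord.eventually {p : P} {w : ℂ} {x : Z.Surface} (h : Z.HasCoord p w x)
    {R : Z.Surface → Prop} (hR : ∀ᶠ w' in 𝓝 w, ∀ y, Z.HasCoord p w' y → R y) :
    ∀ᶠ y in 𝓝 x, R y := by
  obtain ⟨U, hU, hUo, hwU⟩ := eventually_nhds_iff.1 hR
  have h1 := isOpenMap_chart (Z := Z) p _ (hUo.preimage continuous_subtype_val)
  filter_upwards [h1.mem_nhds ⟨⟨w, h.1⟩, hwU, h.2.symm⟩]
  rintro _ ⟨w', hw', rfl⟩
  exact hU _ hw' _ (hasCoord_chart _ _)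

theorem HasCoord.frequently {p : P} {w : ℂ} {x : Z.Surface} (h : Z.HasCoord p w x)
    {R : Z.Surface → Prop} (hR : ∃ᶠ w' in 𝓝 w, ∃ y, Z.HasCoord p w' y ∧ R y) :
    ∃ᶠ y in 𝓝 x, R y := by
  intro hn
  obtain ⟨hm, rfl⟩ := h
  have h2 := (continuous_chart p).continuousAt.eventually hn
  rw [nhds_subtype_eq_comap, eventually_comap] at h2
  refine hR (h2.mono fun w' h3 => ?_)
  rintro ⟨y, ⟨h4, rfl⟩, h5⟩
  exact h3 ⟨w', h4⟩ rfl h5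

theorem frequently_of_ray {w d : ℂ} {R : ℂ → Prop} (h : ∀ᶠ t : ℝ in 𝓝[>] 0, R (w + t * d)) :
    ∃ᶠ w' in 𝓝 w, R w' := by
  have h1 : Tendsto (fun t : ℝ => w + t * d) (𝓝[>] 0) (𝓝 w) := by
    have : Continuous fun t : ℝ => w + t * d := by fun_prop
    have h2 := this.tendsto 0
    simp only [Complex.ofReal_zero, zero_mul, add_zero] at h2
    exact h2.mono_left nhdsWithin_le_nhds
  exact h1.frequently h.frequently

theorem isClosed_boundary : IsClosed Z.boundary := by
  rw [← isOpen_compl_iff, isOpen_iff_mem_nhds]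
  intro x hx
  obtain ⟨p, w, h⟩ := exists_hasCoord x
  refine h.eventually ?_
  have h1 : IsClosed {w | BoundaryCoord w} := by
    refine (isClosed_eq Complex.continuous_re.abs continuous_const).union
      ((isClosed_eq ?_ continuous_const).union (isClosed_eq ?_ continuous_const))
    · exact (Complex.continuous_re.pow 2).add ((Complex.continuous_im.sub continuous_const).pow 2)
    · exact (Complex.continuous_re.pow 2).add ((Complex.continuous_im.add continuous_const).pow 2)
  filter_upwards [h1.isOpen_compl.mem_nhds (fun hb => hx (h.mem_boundary_iff.2 hb))] with w' h2 y hy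
  exact fun hb => h2 (hy.mem_boundary_iff.1 hb)

/-- A neighbourhood of a coordinate of an interior point consists of coordinates. -/
theorem HasCoord.eventually_mem {p : P} {w : ℂ} {x : Z.Surface} (h : Z.HasCoord p w x)
    (hx : x ∉ Z.boundary) : ∀ᶠ w' in 𝓝 w, w' ∈ chartDomain := by
  rw [h.mem_boundary_iff] at hx
  obtain ⟨h1, h2, h3, h4⟩ := mem_chartDomain.1 h.mem
  simp only [BoundaryCoord, not_or] at hx
  obtain ⟨h5, h6, h7⟩ := hx
  have c1 : Continuous fun w : ℂ => w.re ^ 2 + (w.im - 1 / 2) ^ 2 :=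
    (Complex.continuous_re.pow 2).add ((Complex.continuous_im.sub continuous_const).pow 2)
  have c2 : Continuous fun w : ℂ => w.re ^ 2 + (w.im + 1 / 2) ^ 2 :=
    (Complex.continuous_re.pow 2).add ((Complex.continuous_im.add continuous_const).pow 2)
  filter_upwards [(Complex.continuous_re.abs.tendsto w).eventually_lt_const (lt_of_le_of_ne h1 h5),
    (Complex.continuous_im.abs.tendsto w).eventually_lt_const h2,
    (c1.tendsto w).eventually_const_lt (lt_of_le_of_ne h3 (Ne.symm h6)),
    (c2.tendsto w).eventually_const_lt (lt_of_le_of_ne h4 (Ne.symm h7))] with w' g1 g2 g3 g4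
  exact mem_chartDomain.2 ⟨g1.le, g2, g3.le, g4.le⟩

theorem HasCoord.mem_hexSet {p : P} {w : ℂ} {x : Z.Surface} (h : Z.HasCoord p w x)
    (hx : x ∉ Z.boundary) (h0 : 0 < w.re) (h1 : 0 < w.im) : x ∈ Z.hexSet p := by
  obtain ⟨h2, h3, h4, h5⟩ := mem_chartDomain.1 h.mem
  rw [abs_of_pos h0] at h2
  rw [abs_of_pos h1] at h3
  rw [h.mem_boundary_iff, BoundaryCoord, abs_of_pos h0] at hx
  push Not at hx
  refine ⟨w, ⟨h0, lt_of_le_of_ne h2 hx.1, h1, by rw [Nat.cast_one]; linarith, fun k => ?_⟩,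
    by rw [h.nf, normal_right h0 h1.le]⟩
  rcases k with _ | k
  · simpa using lt_of_le_of_ne h4 (Ne.symm hx.2.1)
  · have : (0 : ℝ) ≤ k := k.cast_nonneg
    push_cast
    nlinarith

theorem HasCoord.mem_hexSet' {p : P} {w : ℂ} {x : Z.Surface} (h : Z.HasCoord p w x)
    (hx : x ∉ Z.boundary) (h0 : 0 < w.re) (h1 : w.im < 0) : x ∈ Z.hexSet (Z.s⁻¹ p) := by
  obtain ⟨h2, h3, h4, h5⟩ := mem_chartDomain.1 h.mem
  rw [abs_of_pos h0] at h2
  rw [abs_of_neg h1] at h3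
  rw [h.mem_boundary_iff, BoundaryCoord, abs_of_pos h0] at hx
  push Not at hx
  refine ⟨w + I, ⟨by simpa using h0, by simpa using lt_of_le_of_ne h2 hx.1, by simp; linarith,
    by simpa using h1, fun k => ?_⟩, by rw [h.nf, normal_right' h0 h1]⟩
  simp only [Complex.add_re, Complex.I_re, Complex.add_im, Complex.I_im, add_zero]
  rcases k with _ | k
  · have := lt_of_le_of_ne h5 (Ne.symm hx.2.2)
    norm_num at *
    linarith
  · have : (0 : ℝ) ≤ k := k.cast_nonneg
    push_cast
    nlinarith

theorem hexSet_disjoint_boundary {p : P} {x : Z.Surface} (h : x ∈ Z.hexSet p) :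
    x ∉ Z.boundary := by
  obtain ⟨w, hw, h⟩ := h
  rw [ArcDiagram.mem_boundary_iff]
  rintro ⟨q, w', h', h''⟩
  rw [h, Sum.inl.injEq, Prod.mk.injEq] at h'
  obtain ⟨rfl, rfl⟩ := h'
  obtain ⟨h1, h2, h3, h4, h5⟩ := hw
  have := h5 0
  rcases h'' with h'' | h''
  · linarith
  · norm_num at *
    linarith

theorem hexSet_disjoint_alpha {p : P} {x : Z.Surface} (h : x ∈ Z.hexSet p) (a : Z.Arc) :
    x ∉ Z.alpha a := by
  obtain ⟨w, hw, h⟩ := h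
  rw [mem_alpha_iff, h]
  rintro (h' | ⟨q, w', h', h'', -⟩)
  · simp at h'
  · simp only [Sum.inl.injEq, Prod.mk.injEq] at h'
    exact hw.2.2.1.ne' (h'.2 ▸ h'')

theorem hexSet_disjoint_eta {p : P} {x : Z.Surface} (h : x ∈ Z.hexSet p) (a : Z.Arc) :
    x ∉ Z.eta a := by
  obtain ⟨w, hw, h⟩ := h
  rw [mem_eta_iff, h]
  rintro (h' | ⟨q, w', h', h'', -⟩)
  · simp at h'
  · simp only [Sum.inl.injEq, Prod.mk.injEq] at h'
    exact hw.1.ne' (h'.2 ▸ h'')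

theorem eventually_notMem_boundary {x : Z.Surface} (hx : x ∉ Z.boundary) :
    ∀ᶠ y in 𝓝 x, y ∉ Z.boundary := isClosed_boundary.isOpen_compl.mem_nhds hx

theorem HasCoord.frequently_of_ray {p : P} {w : ℂ} {x : Z.Surface} (h : Z.HasCoord p w x) (d : ℂ)
    {R : Z.Surface → Prop}
    (hm : ∀ᶠ t : ℝ in 𝓝[>] 0, w + t * d ∈ chartDomain)
    (hR : ∀ᶠ t : ℝ in 𝓝[>] 0, ∀ y, Z.HasCoord p (w + t * d) y → R y) :
    ∃ᶠ y in 𝓝 x, R y := by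
  refine h.frequently (ArcDiagram.frequently_of_ray (d := d) ?_)
  filter_upwards [hm, hR] with t h1 h2
  exact ⟨_, ⟨h1, rfl⟩, h2 _ ⟨h1, rfl⟩⟩

theorem HasCoord.frequently_of_ray' {p : P} {w : ℂ} {x : Z.Surface} (h : Z.HasCoord p w x)
    (hx : x ∉ Z.boundary) (d : ℂ) {R : Z.Surface → Prop}
    (hR : ∀ᶠ t : ℝ in 𝓝[>] 0, ∀ y, Z.HasCoord p (w + t * d) y → y ∉ Z.boundary → R y) :
    ∃ᶠ y in 𝓝 x, R y := by
  have hc : Continuous fun t : ℝ => w + t * d := by fun_prop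
  have h2 := hc.tendsto 0
  simp only [Complex.ofReal_zero, zero_mul, add_zero] at h2
  have h3 := h2.mono_left (nhdsWithin_le_nhds (s := Ioi 0))
  have h1 : ∃ᶠ y in 𝓝 x, (y ∉ Z.boundary → R y) := by
    refine h.frequently_of_ray d (h3.eventually (h.eventually_mem hx)) ?_
    filter_upwards [hR] with t h1 y h2 h3
    exact h1 y h2 h3
  exact (h1.and_eventually (eventually_notMem_boundary hx)).mono fun y hy => hy.1 hy.2

/-- The hexagons are dense. -/
theorem frequently_mem_hexSet {x : Z.Surface} (hx : x ∉ Z.boundary) :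
    ∃ᶠ y in 𝓝 x, ∃ q, y ∈ Z.hexSet q := by
  obtain ⟨p, w, h, hw⟩ := exists_isRight x
  -- Moving in the direction `1 + I` makes the real part positive and the imaginary part nonzero for
  -- small `t`, so both kinds of arcs are left at once.
  refine h.frequently_of_ray' hx (1 + I) ?_
  have h0 : 0 ≤ w.re := by rcases hw with hw | hw; exacts [hw.le, hw.1.ge]
  have hc : Continuous fun t : ℝ => (w + t * (1 + I)).im := by fun_prop
  have h2 := hc.tendsto 0
  have h3 := h2.mono_left (nhdsWithin_le_nhds (s := Ioi 0))
  have h4 : ∀ᶠ t : ℝ in 𝓝[>] 0, (w + t * (1 + I)).im ≠ 0 := by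
    by_cases hi : w.im = 0
    · filter_upwards [self_mem_nhdsWithin] with t ht
      simp only [mem_Ioi] at ht
      simp [hi, ht.ne']
    · refine h3.eventually_ne ?_
      simpa using hi
  filter_upwards [h4, self_mem_nhdsWithin] with t h5 ht y hy hyb
  have h6 : 0 < (w + t * (1 + I)).re := by
    simp only [mem_Ioi] at ht
    simp
    linarith
  rcases lt_or_gt_of_ne h5 with h5 | h5
  · exact ⟨_, hy.mem_hexSet' hyb h6 h5⟩
  · exact ⟨_, hy.mem_hexSet hyb h6 h5⟩

/-! ### The edges of the hexagons -/

variable (Z) in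
/-- The half of a dual arc from its crossing to the inner boundary. -/
def etaEdge (q : P) : Set Z.Surface := {x | ∃ y : ℝ, 0 < y ∧ y < 1 / 4 ∧ Z.HasCoord q (y * I) x}

variable (Z) in
/-- The half of an arc from its crossing to the outer boundary. -/
def alphaEdge (q : P) : Set Z.Surface := {x | ∃ r : ℝ, 0 < r ∧ r < 1 ∧ Z.HasCoord q r x}

theorem notMem_boundary_of_mem_etaEdge {q : P} {x : Z.Surface} (h : x ∈ Z.etaEdge q) :
    x ∉ Z.boundary := by
  obtain ⟨y, h1, h2, h⟩ := h
  rw [h.mem_boundary_iff, BoundaryCoord]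
  simp
  norm_num
  constructor <;> nlinarith

theorem notMem_boundary_of_mem_alphaEdge {q : P} {x : Z.Surface} (h : x ∈ Z.alphaEdge q) :
    x ∉ Z.boundary := by
  obtain ⟨y, h1, h2, h⟩ := h
  rw [h.mem_boundary_iff, BoundaryCoord]
  simp
  norm_num
  exact ⟨by rw [abs_of_pos h1]; linarith, by nlinarith⟩

theorem real_mem_region {r : ℝ} (h : 0 ≤ r) (h' : r ≤ 1) : (r : ℂ) ∈ region 1 := by
  refine ⟨by simpa using h, by simpa using h', by simp, by simp, fun k => ?_⟩
  have : (0 : ℝ) ≤ k := k.cast_nonneg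
  simp
  nlinarith

theorem frequently_hexSet_of_mem_etaEdge {q : P} {x : Z.Surface} (h : x ∈ Z.etaEdge q) :
    ∃ᶠ y in 𝓝 x, y ∈ Z.hexSet q := by
  have hb := notMem_boundary_of_mem_etaEdge h
  obtain ⟨y, h1, h2, h⟩ := h
  refine h.frequently_of_ray' hb 1 ?_
  filter_upwards [self_mem_nhdsWithin] with t ht x hx hxb
  exact hx.mem_hexSet hxb (by simpa using ht) (by simpa using h1)

theorem frequently_hexSet_of_mem_alphaEdge {q : P} {x : Z.Surface} (h : x ∈ Z.alphaEdge q) :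
    ∃ᶠ y in 𝓝 x, y ∈ Z.hexSet q := by
  have hb := notMem_boundary_of_mem_alphaEdge h
  obtain ⟨y, h1, h2, h⟩ := h
  refine h.frequently_of_ray' hb I ?_
  filter_upwards [self_mem_nhdsWithin] with t ht x hx hxb
  exact hx.mem_hexSet hxb (by simpa using h1) (by simpa using ht)

/-- The edge borders the hexagon of `q` above it and that of `Z.s⁻¹ q` below it. Both neighbours are
needed to see that a covered edge separates consecutive hexagons. -/
theorem frequently_hexSet_of_mem_alphaEdge' {q : P} {x : Z.Surface} (h : x ∈ Z.alphaEdge q) :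
    ∃ᶠ y in 𝓝 x, y ∈ Z.hexSet (Z.s⁻¹ q) := by
  have hb := notMem_boundary_of_mem_alphaEdge h
  obtain ⟨y, h1, h2, h⟩ := h
  refine h.frequently_of_ray' hb (-I) ?_
  filter_upwards [self_mem_nhdsWithin] with t ht x hx hxb
  exact hx.mem_hexSet' hxb (by simpa using h1) (by simpa using ht)

/-- The points of the interior of the surface. -/
theorem interior_cases {x : Z.Surface} (hx : x ∉ Z.boundary) :
    (∃ p, Z.HasCoord p 0 x) ∨ (∃ p, x ∈ Z.etaEdge p) ∨ (∃ p, x ∈ Z.alphaEdge p) ∨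
      ∃ p, x ∈ Z.hexSet p := by
  obtain ⟨p, w, h, hw⟩ := exists_isRight x
  obtain ⟨h2, h3, h4, h5⟩ := mem_chartDomain.1 h.mem
  have hb := hx
  rw [h.mem_boundary_iff, BoundaryCoord] at hb
  push Not at hb
  rw [abs_le] at h2
  rw [abs_lt] at h3
  rcases hw with hw | hw
  · rcases lt_trichotomy w.im 0 with hi | hi | hi
    · exact .inr (.inr (.inr ⟨_, h.mem_hexSet' hx hw hi⟩))
    · refine .inr (.inr (.inl ⟨p, w.re, hw, ?_, ?_⟩))
      · rw [abs_of_pos hw] at hb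
        exact lt_of_le_of_ne h2.2 hb.1
      · rwa [show (w.re : ℂ) = w from Complex.ext rfl (by simp [hi])]
    · exact .inr (.inr (.inr ⟨_, h.mem_hexSet hx hw hi⟩))
  · rcases hw.2.eq_or_lt with hi | hi
    · left
      rw [show w = 0 from Complex.ext hw.1 hi.symm] at h
      exact ⟨p, h⟩
    · refine .inr (.inl ⟨p, w.im, hi, ?_, ?_⟩)
      · rw [hw.1] at h4 hb
        have : w.im ≠ 1 / 4 := fun h => hb.2.1 (by rw [h]; norm_num)
        refine lt_of_le_of_ne ?_ this
        nlinarith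
      · rwa [show ((w.im : ℝ) : ℂ) * I = w from Complex.ext (by simp [hw.1]) (by simp)]

theorem frequently_etaEdge {p : P} {x : Z.Surface} (h : Z.HasCoord p 0 x) :
    ∃ᶠ y in 𝓝 x, y ∈ Z.etaEdge p := by
  refine h.frequently_of_ray' ?_ I ?_
  · rw [h.mem_boundary_iff, BoundaryCoord]; norm_num
  · filter_upwards [Ioo_mem_nhdsGT (show (0 : ℝ) < 1 / 4 by norm_num)] with t ht x hx hxb
    exact ⟨t, ht.1, ht.2, by simpa using hx⟩

theorem mem_eta_cases {x : Z.Surface} {a : Z.Arc} (h : x ∈ Z.eta a) (hx : x ∉ Z.boundary) :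
    (∃ p, Z.HasCoord p 0 x) ∨ ∃ p, x ∈ Z.etaEdge p := by
  rcases interior_cases hx with h1 | h1 | ⟨p, r, h1, h2, h3⟩ | ⟨p, h1⟩
  · exact .inl h1
  · exact .inr h1
  · exfalso
    rw [mem_eta_iff, h3.nf, normal_right (by simpa using h1) (by simp)] at h
    rcases h with h | ⟨q, w, h, h', -⟩
    · simp at h
    · simp only [Sum.inl.injEq, Prod.mk.injEq] at h
      rw [← h.2] at h'
      simp at h'
      linarith
  · exact absurd h (hexSet_disjoint_eta h1 a)

theorem alphaEdge_disjoint_eta {q : P} {x : Z.Surface} (h : x ∈ Z.alphaEdge q) (a : Z.Arc) :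
    x ∉ Z.eta a := by
  obtain ⟨r, h1, h2, h3⟩ := h
  intro h
  rw [mem_eta_iff, h3.nf, normal_right (by simpa using h1) (by simp)] at h
  rcases h with h | ⟨q, w, h, h', -⟩
  · simp at h
  · simp only [Sum.inl.injEq, Prod.mk.injEq] at h
    rw [← h.2] at h'
    simp at h'
    linarith

/-- Near the end point of a dual arc there are no points of other dual arcs. -/
theorem eventually_etaEdge_of_corner {q : P} {x : Z.Surface} (h : Z.HasCoord q (I / 4) x) :
    ∀ᶠ y in 𝓝 x, ∀ a, y ∈ Z.eta a → y ∉ Z.boundary → y ∈ Z.etaEdge q := by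
  refine h.eventually ?_
  filter_upwards [(Complex.continuous_im.tendsto (I / 4)).eventually_const_lt
    (show 0 < (I / 4).im by simp)] with w hw y hy a hya hyb
  have h1 : w.re = 0 := by
    rcases lt_trichotomy w.re 0 with h0 | h0 | h0
    · exact absurd hya (hexSet_disjoint_eta (hy.neg.mem_hexSet' hyb (by simpa using h0)
        (by simpa using hw)) a)
    · exact h0
    · exact absurd hya (hexSet_disjoint_eta (hy.mem_hexSet hyb h0 hw) a)
  have h4 := (mem_chartDomain.1 hy.mem).2.2.1
  have h3 := abs_lt.1 (mem_chartDomain.1 hy.mem).2.1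
  rw [hy.mem_boundary_iff, BoundaryCoord] at hyb
  push Not at hyb
  rw [h1] at h4 hyb
  refine ⟨w.im, hw, ?_, ?_⟩
  · have : w.im ≠ 1 / 4 := fun h => hyb.2.1 (by rw [h]; norm_num)
    refine lt_of_le_of_ne ?_ this
    nlinarith
  · rwa [show ((w.im : ℝ) : ℂ) * I = w from Complex.ext (by simp [h1]) (by simp)]

/-! ### The middle of an inner interval -/

theorem mid_mem : (1 / 4 + I / 2 : ℂ) ∈ chartDomain := by
  rw [mem_chartDomain]
  norm_num

variable (Z) in
/-- The middle of the inner interval of a hexagon. -/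
noncomputable def innerMid (q : P) : Z.Surface := Z.chart q ⟨1 / 4 + I / 2, mid_mem⟩

theorem hasCoord_innerMid (q : P) : Z.HasCoord q (1 / 4 + I / 2) (Z.innerMid q) := ⟨mid_mem, rfl⟩

theorem nf_innerMid (q : P) : Z.nf (Z.innerMid q) = .inl (q, 1 / 4 + I / 2) := by
  rw [(hasCoord_innerMid q).nf, normal_right (by norm_num) (by norm_num)]

theorem innerMid_mem_boundary (q : P) : Z.innerMid q ∈ Z.boundary := by
  rw [(hasCoord_innerMid q).mem_boundary_iff, BoundaryCoord]
  norm_num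

theorem innerMid_mem_innerInterval {q q' : P} (h : Z.innerMid q ∈ Z.innerInterval q') :
    q' = q := by
  rw [mem_innerInterval_iff, nf_innerMid] at h
  rcases h with ⟨w, h, -⟩ | h
  · simp only [Sum.inl.injEq, Prod.mk.injEq] at h
    exact h.1.symm
  · simp only [Sum.inl.injEq, Prod.mk.injEq] at h
    have := congrArg Complex.re h.2
    norm_num at this

theorem inner_disjoint_outer {x : Z.Surface} {q q' : P} (h : x ∈ Z.innerInterval q)
    (h' : x ∈ Z.outerInterval q') : False := by
  have key : ∃ p w, Z.nf x = .inl (p, w) ∧ w.re = 1 := by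
    rw [mem_outerInterval_iff] at h'
    rcases h' with ⟨w, h, hw⟩ | h
    · exact ⟨_, w, h, hw⟩
    · exact ⟨_, _, h, by simp⟩
  obtain ⟨p, w, h1, h2⟩ := key
  rw [mem_innerInterval_iff, h1] at h
  rcases h with ⟨w', h, h3⟩ | h
  · simp only [Sum.inl.injEq, Prod.mk.injEq] at h
    obtain ⟨rfl, rfl⟩ := h
    rw [h2] at h3
    nlinarith [sq_nonneg (w.im - 1 / 2)]
  · simp only [Sum.inl.injEq, Prod.mk.injEq] at h
    rw [h.2] at h2
    norm_num at h2

theorem innerMid_frequently (q : P) : ∃ᶠ y in 𝓝 (Z.innerMid q), y ∈ Z.hexSet q := by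
  have key : ∀ t : ℝ, t ∈ Ioo 0 (1 / 4) → (1 / 4 + I / 2 + t * 1 : ℂ) ∈ chartDomain ∧
      ¬ BoundaryCoord (1 / 4 + I / 2 + t * 1 : ℂ) := by
    intro t ht
    obtain ⟨h1, h2⟩ := ht
    rw [mem_chartDomain, BoundaryCoord]
    norm_num
    rw [abs_of_pos (by linarith)]
    refine ⟨⟨by linarith, by nlinarith, by nlinarith⟩, by linarith, ?_, ?_⟩ <;> nlinarith
  refine (hasCoord_innerMid q).frequently_of_ray 1 ?_ ?_
  · filter_upwards [Ioo_mem_nhdsGT (show (0 : ℝ) < 1 / 4 by norm_num)] with t ht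
    exact (key t ht).1
  · filter_upwards [Ioo_mem_nhdsGT (show (0 : ℝ) < 1 / 4 by norm_num)] with t ht y hy
    refine hy.mem_hexSet ?_ ?_ ?_
    · rw [hy.mem_boundary_iff]
      exact (key t ht).2
    · have := ht.1
      norm_num
      linarith
    · norm_num

theorem innerMid_eventually (q : P) :
    ∀ᶠ y in 𝓝 (Z.innerMid q), y ∉ Z.boundary → y ∈ Z.hexSet q := by
  refine (hasCoord_innerMid q).eventually ?_
  filter_upwards [(Complex.continuous_im.tendsto (1 / 4 + I / 2 : ℂ)).eventually_const_lt
    (show 0 < (1 / 4 + I / 2 : ℂ).im by norm_num),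
    (Complex.continuous_re.tendsto (1 / 4 + I / 2 : ℂ)).eventually_const_lt
    (show 0 < (1 / 4 + I / 2 : ℂ).re by norm_num)] with w h1 h2 y hy hyb
  exact hy.mem_hexSet hyb h2 h1

end Bordered.ArcDiagram

namespace Bordered.ArcDiagram

open Complex (I)
open Set Filter Topology

variable {P : Type*} {Z : ArcDiagram P}

/-! ## The half disk -/

theorem isCompact_halfDisk : IsCompact halfDisk := by
  refine Metric.isCompact_iff_isClosed_bounded.2 ⟨?_, ?_⟩
  · exact (isClosed_le continuous_const Complex.continuous_re).inter
      (isClosed_le continuous_norm continuous_const)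
  · exact (Metric.isBounded_closedBall (x := (0 : ℂ)) (r := 1)).subset fun w hw =>
      mem_closedBall_zero_iff.2 hw.2

instance : CompactSpace halfDisk := isCompact_iff_compactSpace.1 isCompact_halfDisk

/-- The interior of the half disk. -/
def inner : Set halfDisk := {v | 0 < (v : ℂ).re ∧ ‖(v : ℂ)‖ < 1}

/-- The interior of the half disk in the plane. -/
def innerPlane : Set ℂ := {v | 0 < v.re ∧ ‖v‖ < 1}

theorem isOpen_innerPlane : IsOpen innerPlane :=
  (isOpen_lt continuous_const Complex.continuous_re).inter
    (isOpen_lt continuous_norm continuous_const)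

theorem innerPlane_subset : innerPlane ⊆ halfDisk := fun _ h => ⟨h.1.le, h.2.le⟩

theorem isOpen_inner : IsOpen inner := isOpen_innerPlane.preimage continuous_subtype_val

theorem convex_innerPlane : Convex ℝ innerPlane := by
  have : innerPlane = {v : ℂ | 0 < v.re} ∩ Metric.ball 0 1 := by
    ext v; simp [innerPlane]
  rw [this]
  exact (convex_halfSpace_re_gt 0).inter (convex_ball 0 1)

theorem notMem_inner {v : halfDisk} : v ∉ inner ↔ (v : ℂ) ∈ leftSide ∨ (v : ℂ) ∈ rightSide := by
  have h1 := v.2.1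
  have h2 := v.2.2
  simp only [inner, leftSide, rightSide, mem_ofPred_eq, not_and_or, not_lt]
  constructor
  · rintro (h | h)
    · exact .inl ⟨le_antisymm h h1, h2⟩
    · exact .inr ⟨h1, le_antisymm h2 h⟩
  · rintro (h | h)
    · exact .inl h.1.le
    · exact .inr h.2.ge

/-- An intersection of convex sets. Applied at boundary points, this local connectedness of the
interior is what lets `graphClosure_unique` extend a homeomorphism to the boundary. -/
theorem isPreconnected_inner_inter_ball (v : halfDisk) (r : ℝ) :
    IsPreconnected (inner ∩ Metric.ball v r) := by
  rw [← IsInducing.subtypeVal.isPreconnected_image]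
  have : ((↑) : halfDisk → ℂ) '' (inner ∩ Metric.ball v r) = innerPlane ∩ Metric.ball (v : ℂ) r := by
    ext u
    constructor
    · rintro ⟨u, ⟨h1, h2⟩, rfl⟩
      exact ⟨h1, h2⟩
    · rintro ⟨h1, h2⟩
      exact ⟨⟨u, innerPlane_subset h1⟩, ⟨h1, h2⟩, rfl⟩
  rw [this]
  exact (convex_innerPlane.inter (convex_ball _ _)).isPreconnected

theorem isPreconnected_inner : IsPreconnected inner := by
  rw [← IsInducing.subtypeVal.isPreconnected_image]
  have : ((↑) : halfDisk → ℂ) '' inner = innerPlane := by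
    ext u
    constructor
    · rintro ⟨u, h1, rfl⟩
      exact h1
    · intro h1
      exact ⟨⟨u, innerPlane_subset h1⟩, h1, rfl⟩
  rw [this]
  exact convex_innerPlane.isPreconnected

theorem frequently_inner (v : halfDisk) : ∃ᶠ u in 𝓝 v, u ∈ inner := by
  -- The segment from any point of the half disk to the interior point `1 / 2` enters the interior
  -- at once.
  have hz : (1 / 2 : ℂ) ∈ innerPlane := by norm_num [innerPlane]
  have h1 : ∀ t : Ioo (0 : ℝ) 1, (1 - t : ℝ) • (v : ℂ) + (t : ℝ) • (1 / 2 : ℂ) ∈ innerPlane := by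
    intro t
    have h2 := v.2.1
    have h3 := v.2.2
    have ht := t.2.1
    have ht' := t.2.2
    constructor
    · simp
      nlinarith
    · refine (norm_add_le _ _).trans_lt ?_
      rw [norm_smul, norm_smul, Real.norm_of_nonneg (by linarith), Real.norm_of_nonneg ht.le]
      norm_num
      nlinarith
  have h2 : ∃ᶠ t : ℝ in 𝓝[>] 0, t ∈ Ioo (0 : ℝ) 1 :=
    Eventually.frequently (Ioo_mem_nhdsGT one_pos)
  intro hn
  rw [nhds_subtype_eq_comap, eventually_comap] at hn
  have hc : Continuous fun t : ℝ => (1 - t : ℝ) • (v : ℂ) + (t : ℝ) • (1 / 2 : ℂ) := by fun_prop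
  have h3 := hc.tendsto 0
  simp only [sub_zero, one_smul, zero_smul, add_zero] at h3
  refine h2 (((h3.mono_left nhdsWithin_le_nhds).eventually hn).mono fun t ht ht' => ?_)
  exact ht ⟨_, innerPlane_subset (h1 ⟨t, ht'⟩)⟩ rfl (h1 ⟨t, ht'⟩)

/-! ## Immersions -/

/-- A smooth map with a positive Jacobian is locally a diffeomorphism. -/
theorem exists_openPartialHomeomorph {g : ℂ → ℂ} {V : Set ℂ} {v : ℂ} (hV : IsOpen V) (hv : v ∈ V)
    (hg : ContDiffOn ℝ ∞ g V) (hd : 0 < (fderiv ℝ g v).det) :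
    ∃ e : OpenPartialHomeomorph ℂ ℂ, v ∈ e.source ∧ e.source ⊆ V ∧ ⇑e = g ∧
      ∀ a ∈ e.target, ContDiffAt ℝ ∞ e.symm a := by
  have hg' : ∀ a ∈ V, ContDiffAt ℝ ∞ g a := fun a ha => hg.contDiffAt (hV.mem_nhds ha)
  have hg1 : ContinuousOn (fderiv ℝ g) V := hg.continuousOn_fderiv_of_isOpen hV (by simp)
  -- Restricting to points with positive Jacobian makes the inverse smooth on the whole target, not
  -- merely at the image of `v`.
  have hW : IsOpen (V ∩ (fun a => (fderiv ℝ g a).det) ⁻¹' Ioi 0) :=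
    (ContinuousLinearMap.continuous_det.comp_continuousOn hg1).isOpen_inter_preimage hV isOpen_Ioi
  let L : ∀ a, 0 < (fderiv ℝ g a).det → (ℂ ≃L[ℝ] ℂ) := fun a ha =>
    (fderiv ℝ g a).toContinuousLinearEquivOfDetNeZero ha.ne'
  have hL : ∀ a ha, ((L a ha : ℂ ≃L[ℝ] ℂ) : ℂ →L[ℝ] ℂ) = fderiv ℝ g a := fun a ha =>
    ContinuousLinearMap.coe_toContinuousLinearEquivOfDetNeZero _ _
  have hs : HasStrictFDerivAt g ((L v hd : ℂ ≃L[ℝ] ℂ) : ℂ →L[ℝ] ℂ) v := by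
    rw [hL v hd]
    exact (hg' v hv).hasStrictFDerivAt (by simp)
  let e₀ := hs.toOpenPartialHomeomorph g
  have he₀ : ⇑e₀ = g := hs.toOpenPartialHomeomorph_coe
  let e := e₀.restrOpen _ hW
  have he : ⇑e = g := he₀
  have hsource : e.source ⊆ V ∩ (fun a => (fderiv ℝ g a).det) ⁻¹' Ioi 0 := fun a ha => ha.2
  refine ⟨e, ⟨hs.mem_toOpenPartialHomeomorph_source, hv, hd⟩, fun a ha => (hsource ha).1, he, ?_⟩
  intro a ha
  have h1 := hsource (e.map_target ha)
  refine e.contDiffAt_symm (f₀' := L _ h1.2) ha ?_ ?_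
  · rw [hL _ h1.2, he]
    exact ((hg' _ h1.1).differentiableAt (by simp)).hasFDerivAt
  · rw [he]
    exact hg' _ h1.1

/-- An immersion is locally the restriction of a diffeomorphism in charts. -/
theorem ImmersionAt.exists_diffeo {f : halfDisk → Z.Surface} {v : ℂ} (h : Z.ImmersionAt f v) :
    ∃ (p : P) (e : OpenPartialHomeomorph ℂ ℂ), v ∈ e.source ∧ 0 < (fderiv ℝ e v).det ∧
      (∀ a ∈ e.source, ContDiffAt ℝ ∞ e a) ∧ (∀ a ∈ e.target, ContDiffAt ℝ ∞ e.symm a) ∧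
      ∀ u : halfDisk, (u : ℂ) ∈ e.source → Z.HasCoord p (e u) (f u) := by
  obtain ⟨p, V, g, hV, hv, hg, hf, hd⟩ := h
  obtain ⟨e, hve, heV, rfl, he⟩ := exists_openPartialHomeomorph hV hv hg hd
  exact ⟨p, e, hve, hd, fun a ha => hg.contDiffAt (hV.mem_nhds (heV ha)), he,
    fun u hu => hf u (heV hu)⟩

theorem HasCoord.unique {p : P} {w : ℂ} {x y : Z.Surface} (h : Z.HasCoord p w x)
    (h' : Z.HasCoord p w y) : x = y := h.2.trans h'.2.symm

/-- An immersion is locally injective. -/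
theorem ImmersionAt.injOn {f : halfDisk → Z.Surface} {v : halfDisk} (h : Z.ImmersionAt f v) :
    ∃ N ∈ 𝓝 v, InjOn f N := by
  obtain ⟨p, e, hv, -, he, -, hf⟩ := h.exists_diffeo
  have h1 : ∀ᶠ u : ℂ in 𝓝 v, u ∈ e.source ∧ dist (e u) (e v) < 1 / 4 :=
    (e.open_source.eventually_mem hv).and
      ((he _ hv).continuousAt.eventually (Metric.ball_mem_nhds _ (by norm_num)))
  refine ⟨_, continuous_subtype_val.continuousAt.eventually h1, ?_⟩
  rintro u ⟨hu, hu'⟩ u' ⟨hu1, hu1'⟩ huu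
  rcases (hf u hu).eq_or_le_dist (huu ▸ hf u' hu1) with h2 | h2
  · exact Subtype.ext (e.injOn hu hu1 h2.symm)
  · have := dist_triangle_right (e u') (e u) (e v)
    linarith

/-- An immersion is open at interior points. -/
theorem ImmersionAt.nhds_le {f : halfDisk → Z.Surface} {v : halfDisk} (h : Z.ImmersionAt f v)
    (hv : v ∈ inner) : 𝓝 (f v) ≤ map f (𝓝 v) := by
  obtain ⟨p, e, hve, -, -, he, hf⟩ := h.exists_diffeo
  intro S hS
  refine (hf v hve).eventually ?_
  have h1 : Tendsto e.symm (𝓝 (e v)) (𝓝 v) := by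
    have := (he _ (e.map_source hve)).continuousAt.tendsto
    rwa [e.left_inv hve] at this
  have h2 : ∀ᶠ u : ℂ in 𝓝 (v : ℂ), ∃ h : u ∈ halfDisk, f ⟨u, h⟩ ∈ S := by
    have h3 : f ⁻¹' S ∈ 𝓝 v := hS
    rw [nhds_subtype_eq_comap, mem_comap] at h3
    obtain ⟨T, hT, hTS⟩ := h3
    filter_upwards [hT, isOpen_innerPlane.mem_nhds hv] with u hu hu'
    exact ⟨innerPlane_subset hu', hTS hu⟩
  filter_upwards [h1.eventually h2, e.open_target.mem_nhds (e.map_source hve)] with w hw hw' y hy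
  obtain ⟨h4, h5⟩ := hw
  have h6 := hf ⟨_, h4⟩ (e.map_target hw')
  rw [e.right_inv hw'] at h6
  rwa [hy.unique h6]

/-- From the outer sides one leaves the domain by moving outwards, from a circle by moving towards
its centre. -/
theorem frequently_notMem_chartDomain {w : ℂ} (h : BoundaryCoord w) :
    ∃ᶠ w' in 𝓝 w, w' ∉ chartDomain := by
  rcases h with h | h | h
  · refine frequently_of_ray (d := w.re) ?_
    filter_upwards [self_mem_nhdsWithin] with t ht
    simp only [mem_Ioi] at ht
    rw [mem_chartDomain]
    have h1 : |w.re + t * w.re| = 1 + t := by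
      rw [show w.re + t * w.re = (1 + t) * w.re by ring, abs_mul, h, mul_one, abs_of_pos]
      linarith
    simp [h1, ht]
  · refine frequently_of_ray (d := I / 2 - w) ?_
    filter_upwards [Ioo_mem_nhdsGT one_pos] with t ht hc
    obtain ⟨-, -, h3, -⟩ := mem_chartDomain.1 hc
    have h4 : (w + t * (I / 2 - w)).re = (1 - t) * w.re := by simp; ring
    have h5 : (w + t * (I / 2 - w)).im - 1 / 2 = (1 - t) * (w.im - 1 / 2) := by simp; ring
    rw [h4, h5, mul_pow, mul_pow, ← mul_add, h] at h3
    nlinarith [ht.1, ht.2]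
  · refine frequently_of_ray (d := - (I / 2) - w) ?_
    filter_upwards [Ioo_mem_nhdsGT one_pos] with t ht hc
    obtain ⟨-, -, -, h3⟩ := mem_chartDomain.1 hc
    have h4 : (w + t * (-(I / 2) - w)).re = (1 - t) * w.re := by simp; ring
    have h5 : (w + t * (-(I / 2) - w)).im + 1 / 2 = (1 - t) * (w.im + 1 / 2) := by simp; ring
    rw [h4, h5, mul_pow, mul_pow, ← mul_add, h] at h3
    nlinarith [ht.1, ht.2]

/-- An immersion maps interior points to interior points. -/
theorem ImmersionAt.notMem_boundary {f : halfDisk → Z.Surface} {v : halfDisk}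
    (h : Z.ImmersionAt f v) (hv : v ∈ inner) : f v ∉ Z.boundary := by
  obtain ⟨p, e, hve, -, -, he, hf⟩ := h.exists_diffeo
  rw [(hf v hve).mem_boundary_iff]
  intro hb
  -- The local diffeomorphism covers a full neighbourhood of `e v`, and all its points near `e v`
  -- would be coordinates.
  refine frequently_notMem_chartDomain hb ?_
  have h1 : Tendsto e.symm (𝓝 (e v)) (𝓝 v) := by
    have := (he _ (e.map_source hve)).continuousAt.tendsto
    rwa [e.left_inv hve] at this
  filter_upwards [h1.eventually (isOpen_innerPlane.mem_nhds hv),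
    e.open_target.mem_nhds (e.map_source hve)] with w hw hw'
  have h6 := hf ⟨_, innerPlane_subset hw⟩ (e.map_target hw')
  rw [e.right_inv hw'] at h6
  simpa using h6.mem

/-! ## The sides of a polygon -/

theorem leftSide_ext {a b : ℂ} (ha : a ∈ leftSide) (hb : b ∈ leftSide) (h : a.im = b.im) :
    a = b := Complex.ext (ha.1.trans hb.1.symm) h

theorem rightSide_ext {a b : ℂ} (ha : a ∈ rightSide) (hb : b ∈ rightSide) (h : a.im = b.im) :
    a = b := by
  refine Complex.ext ?_ h
  have h1 := Complex.sq_norm a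
  have h2 := Complex.sq_norm b
  rw [ha.2, Complex.normSq_apply] at h1
  rw [hb.2, Complex.normSq_apply] at h2
  rw [h] at h1
  have h3 := ha.1
  have h4 := hb.1
  nlinarith

theorem im_le_one {v : ℂ} (h : v ∈ halfDisk) : -1 ≤ v.im ∧ v.im ≤ 1 :=
  abs_le.1 ((Complex.abs_im_le_norm v).trans h.2)

theorem leftSide_subset : leftSide ⊆ halfDisk := fun _ h => ⟨h.1.ge, h.2⟩

theorem rightSide_subset : rightSide ⊆ halfDisk := fun _ h => ⟨h.1, h.2.le⟩

theorem leftSide_norm {v : ℂ} (h : v ∈ leftSide) : ‖v‖ = |v.im| :=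
  (Complex.abs_im_eq_norm.2 h.1).symm

/-- The point of the left side with a given imaginary part. -/
noncomputable def leftPoint (t : ℝ) : ℂ := t * I

/-- The point of the right side with a given imaginary part. -/
noncomputable def rightPoint (t : ℝ) : ℂ := √(1 - t ^ 2) + t * I

theorem continuous_leftPoint : Continuous leftPoint := by unfold leftPoint; fun_prop

theorem continuous_rightPoint : Continuous rightPoint := by unfold rightPoint; fun_prop

theorem leftPoint_im (t : ℝ) : (leftPoint t).im = t := by simp [leftPoint]

theorem rightPoint_im (t : ℝ) : (rightPoint t).im = t := by simp [rightPoint]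

theorem leftPoint_mem {t : ℝ} (h : t ∈ Icc (-1) 1) : leftPoint t ∈ leftSide :=
  ⟨by simp [leftPoint], by simpa [leftPoint, abs_le] using h⟩

theorem rightPoint_mem {t : ℝ} (h : t ∈ Icc (-1) 1) : rightPoint t ∈ rightSide := by
  have h1 : 0 ≤ 1 - t ^ 2 := by nlinarith [h.1, h.2]
  refine ⟨by simp [rightPoint], ?_⟩
  rw [← sq_eq_sq₀ (norm_nonneg _) zero_le_one, Complex.sq_norm, Complex.normSq_apply]
  simp [rightPoint]
  nlinarith [Real.mul_self_sqrt h1]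

theorem leftPoint_of_mem {v : ℂ} (h : v ∈ leftSide) : leftPoint v.im = v :=
  Complex.ext (by simp [leftPoint, h.1]) (by simp [leftPoint])

theorem rightPoint_of_mem {v : ℂ} (h : v ∈ rightSide) : rightPoint v.im = v :=
  rightSide_ext (rightPoint_mem (im_le_one (rightSide_subset h))) h (rightPoint_im _)

/-- Near an end point of one of finitely many disjoint intervals there are points outside of the
intervals. -/
theorem frequently_notMem_intervals {m : ℕ} {s : Fin (2 * m) → ℝ} (hs : StrictMono s)
    (j : Fin (2 * m)) : ∃ᶠ t in 𝓝 (s j),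
      ∀ i : Fin m, ¬ (s ⟨2 * i, by omega⟩ ≤ t ∧ t ≤ s ⟨2 * i + 1, by omega⟩) := by
  -- Points with even index begin an interval, so it is left downwards; points with odd index end
  -- one, so it is left upwards.
  obtain ⟨k, hk | hk⟩ : ∃ k, (j : ℕ) = 2 * k ∨ (j : ℕ) = 2 * k + 1 := ⟨j / 2, by omega⟩
  · have h1 : ∀ᶠ t in 𝓝[<] (s j), ∀ i, s i < s j → s i < t := by
      rw [eventually_all]
      intro i
      by_cases h : s i < s j
      · filter_upwards [Ioo_mem_nhdsLT h] with t ht _ using ht.1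
      · exact .of_forall fun t h' => absurd h' h
    have h2 : ∃ᶠ t in 𝓝[<] (s j), ∀ i : Fin m,
        ¬ (s ⟨2 * i, by omega⟩ ≤ t ∧ t ≤ s ⟨2 * i + 1, by omega⟩) := by
      refine Eventually.frequently ?_
      filter_upwards [h1, self_mem_nhdsWithin] with t ht htj i hi
      have h3 := hs.lt_iff_lt.1 (hi.1.trans_lt htj)
      rw [Fin.lt_def] at h3
      have h4 := ht ⟨2 * i + 1, by omega⟩ (hs (by rw [Fin.lt_def]; dsimp only at *; omega))
      linarith [hi.2]
    exact h2.filter_mono nhdsWithin_le_nhds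
  · have h1 : ∀ᶠ t in 𝓝[>] (s j), ∀ i, s j < s i → t < s i := by
      rw [eventually_all]
      intro i
      by_cases h : s j < s i
      · filter_upwards [Ioo_mem_nhdsGT h] with t ht _ using ht.2
      · exact .of_forall fun t h' => absurd h' h
    have h2 : ∃ᶠ t in 𝓝[>] (s j), ∀ i : Fin m,
        ¬ (s ⟨2 * i, by omega⟩ ≤ t ∧ t ≤ s ⟨2 * i + 1, by omega⟩) := by
      refine Eventually.frequently ?_
      filter_upwards [h1, self_mem_nhdsWithin] with t ht htj i hi
      have h3 := hs.lt_iff_lt.1 (lt_of_lt_of_le htj hi.2)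
      rw [Fin.lt_def] at h3
      have h4 := ht ⟨2 * i, by omega⟩ (hs (by rw [Fin.lt_def]; dsimp only at *; omega))
      linarith [hi.1]
    exact h2.filter_mono nhdsWithin_le_nhds

theorem innerInterval_subset (p : P) : Z.innerInterval p ⊆ Z.boundary := by
  rintro x ⟨w, -, ⟨h, -, h'⟩ | ⟨h, -, h'⟩⟩
  exacts [⟨_, w, h', .inr (.inl h)⟩, ⟨_, w, h', .inr (.inr h)⟩]

theorem outerInterval_subset (p : P) : Z.outerInterval p ⊆ Z.boundary := by
  rintro x ⟨w, hw, ⟨h, -, h'⟩ | ⟨h, -, h'⟩⟩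
  exacts [⟨_, w, h', .inl (by simp [hw])⟩, ⟨_, w, h', .inl (by simp [hw])⟩]

theorem chordImage_subset (ρ : Z.Chord) : Z.chordImage ρ ⊆ Z.boundary :=
  iUnion₂_subset fun _ _ => outerInterval_subset _

theorem dualChordImage_subset (σ : Z.dual.Chord) : Z.dualChordImage σ ⊆ Z.boundary :=
  iUnion₂_subset fun _ _ => innerInterval_subset _

namespace Polygon

variable {β : Z.Arc → Set Z.Surface} {x y : Z.Surface} {σ : List Z.dual.Chord} {ρ : List Z.Chord}
  (Q : Z.Polygon β x y σ ρ)

theorem marked_subset {v : halfDisk} (h : (v : ℂ) ∈ Q.marked) : v ∉ inner := by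
  rw [notMem_inner]
  rcases h with ⟨i, h⟩ | ⟨i, h⟩
  · exact .inl (h ▸ Q.p_mem i)
  · exact .inr (h ▸ Q.q_mem i)

theorem immersionAt {v : halfDisk} (h : (v : ℂ) ∉ Q.marked) : Z.ImmersionAt Q.toFun v :=
  Q.immersion v ⟨v.2, h⟩

theorem immersionAt_inner {v : halfDisk} (h : v ∈ inner) : Z.ImmersionAt Q.toFun v :=
  Q.immersionAt fun h' => Q.marked_subset h' h

theorem notMem_boundary_of_inner {v : halfDisk} (h : v ∈ inner) : Q.toFun v ∉ Z.boundary :=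
  (Q.immersionAt_inner h).notMem_boundary h

/-- The `i`-th segment of the left side which is mapped to a chord. -/
def leftSegment (i : Fin σ.length) : Set ℂ :=
  between leftSide (Q.p ⟨2 * i, by omega⟩) (Q.p ⟨2 * i + 1, by omega⟩)

/-- The `i`-th segment of the right side which is mapped to a chord. -/
def rightSegment (i : Fin ρ.length) : Set ℂ :=
  between rightSide (Q.q ⟨2 * i, by omega⟩) (Q.q ⟨2 * i + 1, by omega⟩)

theorem image_leftSegment {i : Fin σ.length} {v : halfDisk} (h : (v : ℂ) ∈ Q.leftSegment i) :
    Q.toFun v ∈ Z.dualChordImage (σ.get i) := Q.left_chord i ▸ mem_image_of_mem _ h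

theorem image_rightSegment {i : Fin ρ.length} {v : halfDisk} (h : (v : ℂ) ∈ Q.rightSegment i) :
    Q.toFun v ∈ Z.chordImage (ρ.get i) := Q.right_chord i ▸ mem_image_of_mem _ h

theorem mem_boundary_iff {v : halfDisk} : Q.toFun v ∈ Z.boundary ↔
    (∃ i, (v : ℂ) ∈ Q.leftSegment i) ∨ ∃ i, (v : ℂ) ∈ Q.rightSegment i := by
  constructor
  · intro h
    by_contra! hn
    exact Q.interior v hn.1 hn.2 h
  · rintro (⟨i, h⟩ | ⟨i, h⟩)
    · exact dualChordImage_subset _ (Q.image_leftSegment h)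
    · exact chordImage_subset _ (Q.image_rightSegment h)

theorem p_mem_leftSegment (j : Fin (2 * σ.length)) : ∃ i, Q.p j ∈ Q.leftSegment i := by
  have hj := j.2
  obtain ⟨k, hk | hk⟩ : ∃ k, (j : ℕ) = 2 * k ∨ (j : ℕ) = 2 * k + 1 := ⟨j / 2, by omega⟩
  · refine ⟨⟨k, by omega⟩, Q.p_mem j, ?_, ?_⟩ <;>
      exact Q.p_mono.monotone (by rw [Fin.le_def]; dsimp only; omega)
  · refine ⟨⟨k, by omega⟩, Q.p_mem j, ?_, ?_⟩ <;>
      exact Q.p_mono.monotone (by rw [Fin.le_def]; dsimp only; omega)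

theorem q_mem_rightSegment (j : Fin (2 * ρ.length)) : ∃ i, Q.q j ∈ Q.rightSegment i := by
  have hj := j.2
  obtain ⟨k, hk | hk⟩ : ∃ k, (j : ℕ) = 2 * k ∨ (j : ℕ) = 2 * k + 1 := ⟨j / 2, by omega⟩
  · refine ⟨⟨k, by omega⟩, Q.q_mem j, ?_, ?_⟩ <;>
      exact Q.q_mono.monotone (by rw [Fin.le_def]; dsimp only; omega)
  · refine ⟨⟨k, by omega⟩, Q.q_mem j, ?_, ?_⟩ <;>
      exact Q.q_mono.monotone (by rw [Fin.le_def]; dsimp only; omega)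

theorem marked_mem_boundary {v : halfDisk} (h : (v : ℂ) ∈ Q.marked) : Q.toFun v ∈ Z.boundary := by
  rw [Q.mem_boundary_iff]
  rcases h with ⟨j, h⟩ | ⟨j, h⟩
  · exact .inl (h ▸ Q.p_mem_leftSegment j)
  · exact .inr (h ▸ Q.q_mem_rightSegment j)

/-- The points of the half disk at heights `-1` and `1` are `-i` and `i`, and these go to `x` and
`y`, which are interior points of the surface. -/
theorem im_lt_one (hx : x ∉ Z.boundary) (hy : y ∉ Z.boundary) {v : halfDisk}
    (h : Q.toFun v ∈ Z.boundary) : -1 < (v : ℂ).im ∧ (v : ℂ).im < 1 := by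
  have hn := v.2.2
  have h1 := im_le_one v.2
  have key : |(v : ℂ).im| = 1 → (v : ℂ).re = 0 := fun h2 => by
    rw [← Complex.abs_im_eq_norm.trans (Iff.rfl)]
    exact le_antisymm (Complex.abs_im_le_norm _) (h2 ▸ hn)
  refine ⟨lt_of_le_of_ne h1.1 fun h2 => hx ?_, lt_of_le_of_ne h1.2 fun h2 => hy ?_⟩
  · rw [← Q.start v (Complex.ext (by rw [key (by rw [← h2]; simp)]; simp) (by simp [← h2]))]
    exact h
  · rw [← Q.terminal v (Complex.ext (by rw [key (by rw [h2]; simp)]; simp) (by simp [h2]))]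
    exact h

theorem frequently_left (hx : x ∉ Z.boundary) (hy : y ∉ Z.boundary) {v : halfDisk}
    (h : (v : ℂ) ∈ range Q.p) :
    ∃ᶠ u : halfDisk in 𝓝 v, (u : ℂ) ∈ leftSide ∧ Q.toFun u ∉ Z.boundary := by
  have h1 := Q.im_lt_one hx hy (Q.marked_mem_boundary (.inl h))
  obtain ⟨j, hj⟩ := h
  intro hn
  refine frequently_notMem_intervals Q.p_mono j ?_
  rw [nhds_subtype_eq_comap, eventually_comap] at hn
  have h2 : Tendsto leftPoint (𝓝 (Q.p j).im) (𝓝 v) := by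
    have := continuous_leftPoint.tendsto (Q.p j).im
    rw [leftPoint_of_mem (Q.p_mem j)] at this
    rwa [← hj]
  rw [← hj] at h1
  filter_upwards [h2.eventually hn, Ioo_mem_nhds h1.1 h1.2] with t ht ht' hi
  have h3 := leftPoint_mem ⟨ht'.1.le, ht'.2.le⟩
  refine ht ⟨_, leftSide_subset h3⟩ rfl ⟨h3, ?_⟩
  rw [Q.mem_boundary_iff]
  rintro (⟨i, hi'⟩ | ⟨i, hi'⟩)
  · refine hi i ?_
    have := hi'.2
    simpa [leftPoint_im] using this
  · have := hi'.1.2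
    rw [leftSide_norm h3, leftPoint_im, abs_eq zero_le_one] at this
    rcases this with h | h <;> linarith [ht'.1, ht'.2]

theorem frequently_right (hx : x ∉ Z.boundary) (hy : y ∉ Z.boundary) {v : halfDisk}
    (h : (v : ℂ) ∈ range Q.q) :
    ∃ᶠ u : halfDisk in 𝓝 v, (u : ℂ) ∈ rightSide ∧ Q.toFun u ∉ Z.boundary := by
  have h1 := Q.im_lt_one hx hy (Q.marked_mem_boundary (.inr h))
  obtain ⟨j, hj⟩ := h
  intro hn
  refine frequently_notMem_intervals Q.q_mono j ?_
  rw [nhds_subtype_eq_comap, eventually_comap] at hn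
  have h2 : Tendsto rightPoint (𝓝 (Q.q j).im) (𝓝 v) := by
    have := continuous_rightPoint.tendsto (Q.q j).im
    rw [rightPoint_of_mem (Q.q_mem j)] at this
    rwa [← hj]
  rw [← hj] at h1
  filter_upwards [h2.eventually hn, Ioo_mem_nhds h1.1 h1.2] with t ht ht' hi
  have h3 := rightPoint_mem ⟨ht'.1.le, ht'.2.le⟩
  refine ht ⟨_, rightSide_subset h3⟩ rfl ⟨h3, ?_⟩
  rw [Q.mem_boundary_iff]
  rintro (⟨i, hi'⟩ | ⟨i, hi'⟩)
  · have := leftSide_norm hi'.1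
    rw [h3.2, rightPoint_im, eq_comm, abs_eq zero_le_one] at this
    rcases this with h | h <;> linarith [ht'.1, ht'.2]
  · refine hi i ?_
    have := hi'.2
    simpa [rightPoint_im] using this

/-- The marked points of a polygon are the end points of the parts of the boundary of the half disk
which are mapped to the boundary of the surface. -/
theorem mem_marked_iff (hx : x ∉ Z.boundary) (hy : y ∉ Z.boundary) {v : halfDisk} :
    (v : ℂ) ∈ Q.marked ↔ Q.toFun v ∈ Z.boundary ∧
      ∃ᶠ u in 𝓝 v, u ∉ inner ∧ Q.toFun u ∉ Z.boundary := by
  constructor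
  · intro h
    refine ⟨Q.marked_mem_boundary h, ?_⟩
    rcases h with h | h
    · exact (Q.frequently_left hx hy h).mono fun u hu => ⟨notMem_inner.2 (.inl hu.1), hu.2⟩
    · exact (Q.frequently_right hx hy h).mono fun u hu => ⟨notMem_inner.2 (.inr hu.1), hu.2⟩
  -- Conversely, an unmarked boundary point is interior to one of the segments, so all nearby points
  -- of the rim stay in that segment and are mapped to the boundary.
  · rintro ⟨h, hf⟩
    by_contra hm
    refine hf ?_
    have him := Q.im_lt_one hx hy h
    have c1 : Continuous fun u : halfDisk => (u : ℂ).im :=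
      Complex.continuous_im.comp continuous_subtype_val
    have c2 : Continuous fun u : halfDisk => (u : ℂ).re :=
      Complex.continuous_re.comp continuous_subtype_val
    have c3 : Continuous fun u : halfDisk => ‖(u : ℂ)‖ :=
      continuous_norm.comp continuous_subtype_val
    rcases Q.mem_boundary_iff.1 h with ⟨i, h1⟩ | ⟨i, h1⟩
    · have h2 := lt_of_le_of_ne h1.2.1 fun h' =>
        hm (.inl ⟨_, leftSide_ext (Q.p_mem _) h1.1 h'⟩)
      have h3 := lt_of_le_of_ne h1.2.2 fun h' =>
        hm (.inl ⟨_, (leftSide_ext h1.1 (Q.p_mem _) h').symm⟩)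
      have h4 : ‖(v : ℂ)‖ < 1 := by rw [leftSide_norm h1.1, abs_lt]; exact him
      filter_upwards [(c1.tendsto v).eventually_const_lt h2, (c1.tendsto v).eventually_lt_const h3,
        (c3.tendsto v).eventually_lt_const h4] with u g1 g2 g3 hu
      refine hu.2 (Q.mem_boundary_iff.2 (.inl ⟨i, ?_, g1.le, g2.le⟩))
      rcases notMem_inner.1 hu.1 with h5 | h5
      · exact h5
      · exact absurd h5.2 g3.ne
    · have h2 := lt_of_le_of_ne h1.2.1 fun h' =>
        hm (.inr ⟨_, rightSide_ext (Q.q_mem _) h1.1 h'⟩)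
      have h3 := lt_of_le_of_ne h1.2.2 fun h' =>
        hm (.inr ⟨_, (rightSide_ext h1.1 (Q.q_mem _) h').symm⟩)
      have h4 : 0 < (v : ℂ).re := by
        refine lt_of_le_of_ne h1.1.1 fun h' => ?_
        have h5 := leftSide_norm ⟨h'.symm, h1.1.2.le⟩
        rw [h1.1.2, eq_comm, abs_eq zero_le_one] at h5
        rcases h5 with h5 | h5 <;> linarith
      filter_upwards [(c1.tendsto v).eventually_const_lt h2, (c1.tendsto v).eventually_lt_const h3,
        (c2.tendsto v).eventually_const_lt h4] with u g1 g2 g3 hu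
      refine hu.2 (Q.mem_boundary_iff.2 (.inr ⟨i, ?_, g1.le, g2.le⟩))
      rcases notMem_inner.1 hu.1 with h5 | h5
      · exact absurd h5.1 g3.ne'
      · exact h5

end Polygon

end Bordered.ArcDiagram

namespace Bordered.ArcDiagram

open Complex (I)
open Set Filter Topology

variable {P : Type*} {Z : ArcDiagram P}

/-! ## The inner interval of a hexagon -/

/-- The parametrization by height of the circular arc on the boundary of a hexagon. -/
noncomputable def arcPoint (t : ℝ) : ℂ := √(1 / 16 - (t - 1 / 2) ^ 2) + t * I

theorem continuous_arcPoint : Continuous arcPoint := by unfold arcPoint; fun_prop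

theorem arcPoint_im (t : ℝ) : (arcPoint t).im = t := by simp [arcPoint]

theorem arcPoint_re_nonneg (t : ℝ) : 0 ≤ (arcPoint t).re := by simp [arcPoint]

theorem arcPoint_circle {t : ℝ} (ht : t ∈ Icc (1 / 4 : ℝ) (3 / 4)) :
    (arcPoint t).re ^ 2 + (t - 1 / 2) ^ 2 = 1 / 16 := by
  have h : 0 ≤ 1 / 16 - (t - 1 / 2) ^ 2 := by nlinarith [ht.1, ht.2]
  simp [arcPoint] at h ⊢
  rw [Real.sq_sqrt (by linarith)]
  ring

theorem arcPoint_re_pos {t : ℝ} (ht : t ∈ Ioo (1 / 4 : ℝ) (3 / 4)) : 0 < (arcPoint t).re := by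
  have h : 0 < 1 / 16 - (t - 1 / 2) ^ 2 := by nlinarith [ht.1, ht.2]
  simpa [arcPoint] using h

theorem arcPoint_mem_region {t : ℝ} (ht : t ∈ Icc (1 / 4 : ℝ) (3 / 4)) : arcPoint t ∈ region 1 := by
  have h := arcPoint_circle ht
  have h0 := arcPoint_re_nonneg t
  refine ⟨h0, by nlinarith, by rw [arcPoint_im]; linarith [ht.1],
    by rw [arcPoint_im, Nat.cast_one]; linarith [ht.2], fun k => ?_⟩
  rw [arcPoint_im]
  rcases k with _ | k
  · simpa using h.ge
  · have : (0 : ℝ) ≤ k := k.cast_nonneg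
    push_cast
    nlinarith [ht.1, ht.2]

theorem arcPoint_unique {w : ℂ} (h0 : 0 ≤ w.re) (h : w.re ^ 2 + (w.im - 1 / 2) ^ 2 = 1 / 16) :
    w.im ∈ Icc (1 / 4 : ℝ) (3 / 4) ∧ arcPoint w.im = w := by
  have h1 : w.im ∈ Icc (1 / 4 : ℝ) (3 / 4) := ⟨by nlinarith, by nlinarith⟩
  refine ⟨h1, Complex.ext ?_ (arcPoint_im _)⟩
  have h2 := arcPoint_circle h1
  have h3 := arcPoint_re_nonneg w.im
  nlinarith

variable (Z) in
/-- The parametrization by height of an inner interval. -/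
noncomputable def innerPath (q : P) (t : ℝ) : Z.Surface := Z.strip q (arcPoint t)

theorem innerPath_hasCoord (q : P) {t : ℝ} (ht : t ∈ Icc (1 / 4 : ℝ) (3 / 4)) {k : ℕ}
    (hk : |t - k| < 3 / 4) : Z.HasCoord ((Z.s ^ k) q) (arcPoint t - k * I) (Z.innerPath q t) :=
  strip_hasCoord q (arcPoint_mem_region ht) (by rwa [arcPoint_im])

theorem continuousOn_innerPath (q : P) : ContinuousOn (Z.innerPath q) (Icc (1 / 4) (3 / 4)) :=
  (continuousOn_strip q 1).comp continuous_arcPoint.continuousOn fun _ => arcPoint_mem_region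

theorem nf_innerPath (q : P) {t : ℝ} (ht : t ∈ Ico (1 / 4 : ℝ) (3 / 4)) :
    Z.nf (Z.innerPath q t) = .inl (q, arcPoint t) := by
  have h := innerPath_hasCoord (Z := Z) q ⟨ht.1, ht.2.le⟩ (k := 0) (by
    rw [abs_lt]; constructor <;> simp <;> linarith [ht.1, ht.2])
  simp only [Nat.cast_zero, zero_mul, sub_zero, pow_zero, Equiv.Perm.coe_one, id_eq] at h
  rw [h.nf]
  rcases ht.1.eq_or_lt with h1 | h1
  · refine normal_axis ?_ (by rw [arcPoint_im]; linarith)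
    have := arcPoint_circle ⟨ht.1, ht.2.le⟩
    rw [← h1] at this ⊢
    nlinarith
  · exact normal_right (arcPoint_re_pos ⟨h1, ht.2⟩) (by rw [arcPoint_im]; linarith)

theorem nf_innerPath_end (q : P) : Z.nf (Z.innerPath q (3 / 4)) = .inl (Z.m (Z.s q), I / 4) := by
  have h := innerPath_hasCoord (Z := Z) q (t := 3 / 4) ⟨by norm_num, le_rfl⟩ (k := 1) (by
    rw [abs_lt]; constructor <;> norm_num)
  have h1 : arcPoint (3 / 4) - (1 : ℕ) * I = - (I / 4) := by
    have h2 := arcPoint_circle (t := 3 / 4) ⟨by norm_num, le_rfl⟩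
    apply Complex.ext
    · simp
      nlinarith
    · simp [arcPoint_im]
      norm_num
  rw [h1, pow_one] at h
  rw [h.neg.nf, neg_neg, normal_axis (by simp) (by simp)]

/-- Below height `3/4` the normal form contains the height. The upper end point has its normal form
in another chart exactly because of the hypothesis. -/
theorem innerPath_injOn {q : P} (hq : Z.m (Z.s q) ≠ q) :
    InjOn (Z.innerPath q) (Icc (1 / 4) (3 / 4)) := by
  have key : ∀ t ∈ Icc (1 / 4 : ℝ) (3 / 4), t = 3 / 4 ∨ t ∈ Ico (1 / 4 : ℝ) (3 / 4) := fun t ht => by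
    rcases ht.2.eq_or_lt with h | h
    exacts [.inl h, .inr ⟨ht.1, h⟩]
  intro t ht t' ht' h
  rcases key t ht with rfl | h1 <;> rcases key t' ht' with rfl | h2
  · rfl
  · have := congrArg Z.nf h
    rw [nf_innerPath_end, nf_innerPath q h2] at this
    simp only [Sum.inl.injEq, Prod.mk.injEq] at this
    exact absurd this.1 hq
  · have := congrArg Z.nf h
    rw [nf_innerPath_end, nf_innerPath q h1] at this
    simp only [Sum.inl.injEq, Prod.mk.injEq] at this
    exact absurd this.1.symm hq
  · have := congrArg Z.nf h
    rw [nf_innerPath q h1, nf_innerPath q h2] at this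
    simp only [Sum.inl.injEq, Prod.mk.injEq, true_and] at this
    rw [← arcPoint_im t, this, arcPoint_im]

theorem innerInterval_eq (q : P) :
    Z.innerInterval q = Z.innerPath q '' Icc (1 / 4) (3 / 4) := by
  ext x
  constructor
  · intro h
    rcases mem_innerInterval_iff.1 h with ⟨w, h1, h2⟩ | h1
    · have h0 : 0 ≤ w.re := by
        rcases nf_cases x with ⟨p, h3, h4⟩ | ⟨p, w', -, h3, -, -, h4⟩ | ⟨p, w', h3, h4, -⟩ <;>
          rw [h1] at h4
        · simp at h4
        · simp only [Sum.inl.injEq, Prod.mk.injEq] at h4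
          rw [h4.2, h3]
        · simp only [Sum.inl.injEq, Prod.mk.injEq] at h4
          rw [h4.2]
          exact h3.1.le
      obtain ⟨h3, h4⟩ := arcPoint_unique h0 h2
      have h5 : w.im ≠ 3 / 4 ∨ w.im = 3 / 4 := (em _).symm
      rcases h5 with h5 | h5
      · exact ⟨w.im, h3, nf_injective (by
          rw [nf_innerPath q ⟨h3.1, lt_of_le_of_ne h3.2 h5⟩, h1, h4])⟩
      · exfalso
        rw [h5] at h2
        have h6 : w.re = 0 := by nlinarith
        rcases nf_cases x with ⟨p, h3, h4⟩ | ⟨p, w', -, h3, h7, h8, h4⟩ | ⟨p, w', h3, h4, -⟩ <;>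
          rw [h1] at h4
        · simp at h4
        · simp only [Sum.inl.injEq, Prod.mk.injEq] at h4
          rw [← h4.2, h5] at h8
          norm_num at h8
        · simp only [Sum.inl.injEq, Prod.mk.injEq] at h4
          have := h3.1
          rw [← h4.2, h6] at this
          exact lt_irrefl _ this
    · exact ⟨3 / 4, ⟨by norm_num, le_rfl⟩, nf_injective (by rw [nf_innerPath_end, h1])⟩
  · rintro ⟨t, ht, rfl⟩
    rw [mem_innerInterval_iff]
    rcases ht.2.eq_or_lt with rfl | h
    · exact .inr (nf_innerPath_end q)
    · exact .inl ⟨_, nf_innerPath q ⟨ht.1, h⟩, by rw [arcPoint_im]; exact arcPoint_circle ht⟩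

theorem innerPath_half (q : P) : Z.innerPath q (1 / 2) = Z.innerMid q := by
  refine nf_injective ?_
  rw [nf_innerPath q ⟨by norm_num, by norm_num⟩, nf_innerMid]
  have h2 := arcPoint_circle (t := 1 / 2) ⟨by norm_num, by norm_num⟩
  have h3 := arcPoint_re_nonneg (1 / 2)
  congr 2
  apply Complex.ext
  · norm_num at *
    nlinarith
  · simp [arcPoint_im]

theorem innerPath_start (q : P) : Z.HasCoord q (I / 4) (Z.innerPath q (1 / 4)) := by
  have h := innerPath_hasCoord (Z := Z) q (t := 1 / 4) ⟨le_rfl, by norm_num⟩ (k := 0) (by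
    rw [abs_lt]; constructor <;> norm_num)
  have h1 : arcPoint (1 / 4) - (0 : ℕ) * I = I / 4 := by
    have h2 := arcPoint_circle (t := 1 / 4) ⟨le_rfl, by norm_num⟩
    apply Complex.ext
    · simp
      nlinarith
    · simp [arcPoint_im]
  rwa [h1] at h

/-! ## The segments of the left side -/

namespace Polygon

variable {β : Z.Arc → Set Z.Surface} {x y : Z.Surface} {σ : List Z.dual.Chord} {ρ : List Z.Chord}
  (Q : Z.Polygon β x y σ ρ)

/-- The path along the left side. -/
noncomputable def leftPath (t : ℝ) : Z.Surface :=
  Q.toFun ⟨leftPoint (projIcc (-1 : ℝ) 1 (by norm_num) t),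
    leftSide_subset (leftPoint_mem (projIcc (-1 : ℝ) 1 (by norm_num) t).2)⟩

theorem continuous_leftPath : Continuous Q.leftPath :=
  Q.continuous.comp ((continuous_leftPoint.comp
    (continuous_subtype_val.comp continuous_projIcc)).subtype_mk _)

theorem leftPath_eq {v : halfDisk} (h : (v : ℂ) ∈ leftSide) : Q.leftPath (v : ℂ).im = Q.toFun v := by
  unfold leftPath
  congr 1
  ext
  dsimp only
  rw [projIcc_of_mem _ (im_le_one v.2), leftPoint_of_mem h]

theorem leftPath_eq' {t : ℝ} (h : t ∈ Icc (-1) 1) :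
    Q.leftPath t = Q.toFun ⟨leftPoint t, leftSide_subset (leftPoint_mem h)⟩ := by
  rw [← Q.leftPath_eq (leftPoint_mem h), leftPoint_im]

/-- The height along a segment of the left side which is mapped to the inner interval of `q`. -/
noncomputable def height (q : P) (t : ℝ) : ℝ :=
  Function.invFunOn (Z.innerPath q) (Icc (1 / 4) (3 / 4)) (Q.leftPath t)

variable {i : Fin σ.length} {q : P}

/-- The interval of the imaginary parts of a segment of the left side. -/
def leftIcc (i : Fin σ.length) : Set ℝ :=
  Icc (Q.p ⟨2 * i, by omega⟩).im (Q.p ⟨2 * i + 1, by omega⟩).im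

/-- The interior of `leftIcc`. -/
def leftIoo (i : Fin σ.length) : Set ℝ :=
  Ioo (Q.p ⟨2 * i, by omega⟩).im (Q.p ⟨2 * i + 1, by omega⟩).im

theorem leftIcc_subset : Q.leftIcc i ⊆ Icc (-1) 1 := fun _ ht =>
  ⟨(im_le_one (leftSide_subset (Q.p_mem _))).1.trans ht.1,
    ht.2.trans (im_le_one (leftSide_subset (Q.p_mem _))).2⟩

theorem leftIoo_subset : Q.leftIoo i ⊆ Ioo (-1) 1 := fun _ ht =>
  ⟨(im_le_one (leftSide_subset (Q.p_mem _))).1.trans_lt ht.1,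
    ht.2.trans_le (im_le_one (leftSide_subset (Q.p_mem _))).2⟩

theorem leftPath_image (hσ : Z.dualChordImage (σ.get i) = Z.innerInterval q) :
    Q.leftPath '' Q.leftIcc i = Z.innerInterval q := by
  rw [← hσ, ← Q.left_chord i]
  ext x
  constructor
  · rintro ⟨t, ht, rfl⟩
    have h := leftPoint_mem (Q.leftIcc_subset ht)
    refine ⟨⟨leftPoint t, leftSide_subset h⟩, ⟨h, ?_, ?_⟩, (Q.leftPath_eq' (Q.leftIcc_subset ht)).symm⟩
    · rw [leftPoint_im]; exact ht.1
    · rw [leftPoint_im]; exact ht.2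
  · rintro ⟨v, hv, rfl⟩
    exact ⟨(v : ℂ).im, hv.2, Q.leftPath_eq hv.1⟩

theorem height_mem (hσ : Z.dualChordImage (σ.get i) = Z.innerInterval q) {t : ℝ}
    (ht : t ∈ Q.leftIcc i) : Q.height q t ∈ Icc (1 / 4 : ℝ) (3 / 4) ∧
      Z.innerPath q (Q.height q t) = Q.leftPath t := by
  have h : Q.leftPath t ∈ Z.innerPath q '' Icc (1 / 4) (3 / 4) := by
    rw [← innerInterval_eq, ← Q.leftPath_image hσ]
    exact mem_image_of_mem _ ht
  exact ⟨Function.invFunOn_mem h, Function.invFunOn_eq h⟩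

/-- The parametrization of the inner interval is a closed embedding of a compact interval, and the
height is the path read through its inverse. -/
theorem continuousOn_height (hσ : Z.dualChordImage (σ.get i) = Z.innerInterval q)
    (hq : Z.m (Z.s q) ≠ q) : ContinuousOn (Q.height q) (Q.leftIcc i) := by
  have h1 : Topology.IsClosedEmbedding fun t : Icc (1 / 4 : ℝ) (3 / 4) => Z.innerPath q t :=
    (continuousOn_iff_continuous_domRestrict.1 (continuousOn_innerPath q)).isClosedEmbedding
      (injOn_iff_injective.1 (innerPath_injOn hq))
  rw [continuousOn_iff_continuous_domRestrict]
  have h2 : Continuous fun t : Q.leftIcc i =>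
      (⟨Q.height q t, (Q.height_mem hσ t.2).1⟩ : Icc (1 / 4 : ℝ) (3 / 4)) := by
    rw [h1.isInducing.continuous_iff]
    refine (Q.continuous_leftPath.comp continuous_subtype_val).congr fun t => ?_
    exact (Q.height_mem hσ t.2).2.symm
  exact continuous_subtype_val.comp h2

theorem leftPoint_notMem_marked {t : ℝ} (ht : t ∈ Q.leftIoo i) : leftPoint t ∉ Q.marked := by
  have h1 := Q.leftIoo_subset ht
  rintro (⟨j, hj⟩ | ⟨j, hj⟩)
  · have h2 : (Q.p j).im = t := by rw [hj, leftPoint_im]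
    have h3 := Q.p_mono.lt_iff_lt.1 (h2.symm ▸ ht.1)
    have h4 := Q.p_mono.lt_iff_lt.1 (h2.symm ▸ ht.2)
    rw [Fin.lt_def] at h3 h4
    dsimp only at h3 h4
    omega
  · have h2 := (Q.q_mem j).2
    rw [hj, leftSide_norm (leftPoint_mem ⟨h1.1.le, h1.2.le⟩), leftPoint_im,
      abs_eq zero_le_one] at h2
    rcases h2 with h2 | h2 <;> linarith [h1.1, h1.2]

/-- The path along the side has nonzero velocity, since the polygon is an immersion there. At an
extremum of the height the vertical component of the velocity vanishes. The horizontal one vanishes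
as well: if `re` is zero then it has a minimum, and otherwise the equation of the circle can be
differentiated. This is a contradiction. -/
theorem not_isLocalExtr_height (hσ : Z.dualChordImage (σ.get i) = Z.innerInterval q)
    (hq : Z.m (Z.s q) ≠ q) {t : ℝ} (ht : t ∈ Q.leftIoo i) : ¬ IsLocalExtr (Q.height q) t := by
  intro hext
  have hnhds : Q.leftIcc i ∈ 𝓝 t := Icc_mem_nhds ht.1 ht.2
  have ht' : t ∈ Q.leftIcc i := Ioo_subset_Icc_self ht
  have hcont : ContinuousAt (Q.height q) t := (Q.continuousOn_height hσ hq).continuousAt hnhds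
  obtain ⟨p, e, hv, hdet, he, -, hf⟩ := (Q.immersionAt (v := ⟨leftPoint t,
    leftSide_subset (leftPoint_mem (Q.leftIcc_subset ht'))⟩)
    (Q.leftPoint_notMem_marked ht)).exists_diffeo
  dsimp only at hv hdet
  set L := fderiv ℝ e (leftPoint t) with hL
  have hinj : L I ≠ 0 := by
    intro h0
    have h1 : LinearMap.det (L : ℂ →ₗ[ℝ] ℂ) ≠ 0 := hdet.ne'
    have h2 := (LinearMap.equivOfDetNeZero (L : ℂ →ₗ[ℝ] ℂ) h1).map_eq_zero_iff (x := I)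
    have h3 : LinearMap.equivOfDetNeZero (L : ℂ →ₗ[ℝ] ℂ) h1 I = L I := rfl
    rw [h3] at h2
    exact Complex.I_ne_zero (h2.1 h0)
  have hder : HasDerivAt (fun s : ℝ => e (leftPoint s)) (L I) t := by
    have h1 : HasFDerivAt e L (leftPoint t) :=
      ((he _ hv).differentiableAt (by simp)).hasFDerivAt
    have h2 : HasDerivAt leftPoint I t := by
      have h3 := (hasDerivAt_id t).ofReal_comp.mul_const I
      rw [Complex.ofReal_one, one_mul] at h3
      exact h3
    exact h1.comp_hasDerivAt t h2
  -- The upper end has height exactly `3/4`, just outside the range of chart `0`, and is read in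
  -- chart `1`.
  obtain ⟨k, hk⟩ : ∃ k : ℕ, |Q.height q t - k| < 3 / 4 := by
    have h1 := (Q.height_mem hσ ht').1
    rcases h1.2.eq_or_lt with h2 | h2
    · exact ⟨1, by rw [h2]; norm_num [abs_lt]⟩
    · exact ⟨0, by rw [abs_lt]; constructor <;> simp <;> linarith [h1.1]⟩
  have hk' : ∀ᶠ s in 𝓝 t, |Q.height q s - k| < 3 / 4 :=
    ((hcont.sub continuousAt_const).abs.tendsto).eventually_lt_const hk
  have hc1 : ∀ s ∈ Q.leftIcc i, |Q.height q s - k| < 3 / 4 →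
      Z.HasCoord ((Z.s ^ k) q) (arcPoint (Q.height q s) - k * I) (Q.leftPath s) := fun s hs hs' => by
    rw [← (Q.height_mem hσ hs).2]
    exact innerPath_hasCoord q (Q.height_mem hσ hs).1 hs'
  have hc2 : ∀ s ∈ Q.leftIcc i, leftPoint s ∈ e.source →
      Z.HasCoord p (e (leftPoint s)) (Q.leftPath s) := fun s hs hs' => by
    rw [Q.leftPath_eq' (Q.leftIcc_subset hs)]
    exact hf ⟨leftPoint s, _⟩ hs'
  obtain ⟨ε, c, hε, -, htr⟩ := (hc2 t ht' hv).transition (hc1 t ht' hk)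
  have hpair : ContinuousAt (fun s : ℝ => (e (leftPoint s), arcPoint (Q.height q s) - k * I)) t :=
    hder.continuousAt.prodMk
      ((continuous_arcPoint.continuousAt.comp hcont).sub continuousAt_const)
  have hsrc : ∀ᶠ s in 𝓝 t, leftPoint s ∈ e.source :=
    continuous_leftPoint.continuousAt.eventually (e.open_source.eventually_mem hv)
  have heq : ∀ᶠ s in 𝓝 t, arcPoint (Q.height q s) = ε * e (leftPoint s) + c + k * I := by
    filter_upwards [hpair.eventually htr, hsrc, hk', hnhds] with s h1 h2 h3 h4
    linear_combination h1 _ (hc2 s h4 h2) (hc1 s h4 h3)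
  have hG : HasDerivAt (fun s => arcPoint (Q.height q s)) (ε * L I) t :=
    (((hder.const_mul ε).add_const c).add_const (k * I)).congr_of_eventuallyEq heq
  have hne : ε * L I ≠ 0 := by
    rcases hε with rfl | rfl <;> simpa
  have him : HasDerivAt (Q.height q) (ε * L I).im t := by
    have h1 := Complex.imCLM.hasFDerivAt.comp_hasDerivAt t hG
    refine h1.congr_of_eventuallyEq (.of_forall fun s => ?_)
    exact (arcPoint_im _).symm
  have hre : HasDerivAt (fun s => (arcPoint (Q.height q s)).re) (ε * L I).re t :=
    Complex.reCLM.hasFDerivAt.comp_hasDerivAt t hG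
  have him0 : (ε * L I).im = 0 := hext.hasDerivAt_eq_zero him
  refine hne (Complex.ext ?_ him0)
  rcases (arcPoint_re_nonneg (Q.height q t)).eq_or_lt with h0 | h0
  · refine IsLocalMin.hasDerivAt_eq_zero (f := fun s => (arcPoint (Q.height q s)).re) ?_ hre
    refine .of_forall fun s => ?_
    change (arcPoint (Q.height q t)).re ≤ _
    rw [← h0]
    exact arcPoint_re_nonneg _
  · have h1 : HasDerivAt (fun s => (arcPoint (Q.height q s)).re ^ 2 + (Q.height q s - 1 / 2) ^ 2)
        (2 * (arcPoint (Q.height q t)).re * (ε * L I).re) t := by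
      refine HasDerivAt.congr_deriv ((hre.pow 2).add ((him.sub_const (1 / 2)).pow 2)) ?_
      rw [him0]
      ring
    have h2 : HasDerivAt (fun s => (arcPoint (Q.height q s)).re ^ 2 + (Q.height q s - 1 / 2) ^ 2)
        0 t := by
      refine (hasDerivAt_const t (1 / 16 : ℝ)).congr_of_eventuallyEq ?_
      filter_upwards [hnhds] with s hs
      exact arcPoint_circle (Q.height_mem hσ hs).1
    have h3 := h1.unique h2
    simpa [h0.ne'] using h3

/-- By Rolle's argument, two equal values would force a local extremum in between. -/
theorem height_injOn (hσ : Z.dualChordImage (σ.get i) = Z.innerInterval q)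
    (hq : Z.m (Z.s q) ≠ q) : InjOn (Q.height q) (Q.leftIcc i) := by
  have key : ∀ s ∈ Q.leftIcc i, ∀ t ∈ Q.leftIcc i, s < t → Q.height q s ≠ Q.height q t := by
    intro s hs t ht hst h
    obtain ⟨c, hc, hc'⟩ := exists_isLocalExtr_Ioo hst
      ((Q.continuousOn_height hσ hq).mono (Icc_subset_Icc hs.1 ht.2)) h
    exact Q.not_isLocalExtr_height hσ hq ⟨hs.1.trans_lt hc.1, hc.2.trans_le ht.2⟩ hc'
  intro s hs t ht h
  rcases lt_trichotomy s t with h1 | h1 | h1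
  · exact absurd h (key s hs t ht h1)
  · exact h1
  · exact absurd h.symm (key t ht s hs h1)

theorem exists_height (hσ : Z.dualChordImage (σ.get i) = Z.innerInterval q)
    (hq : Z.m (Z.s q) ≠ q) {r : ℝ} (hr : r ∈ Icc (1 / 4 : ℝ) (3 / 4)) :
    ∃ t ∈ Q.leftIcc i, Q.height q t = r := by
  have h : Z.innerPath q r ∈ Q.leftPath '' Q.leftIcc i := by
    rw [Q.leftPath_image hσ, innerInterval_eq]
    exact mem_image_of_mem _ hr
  obtain ⟨t, ht, h⟩ := h
  refine ⟨t, ht, innerPath_injOn hq (Q.height_mem hσ ht).1 hr ?_⟩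
  rw [(Q.height_mem hσ ht).2, h]

/-- The values `1/4` and `3/4` are the extreme possible heights, so inside the segment they would be
local extrema. -/
theorem height_end (hσ : Z.dualChordImage (σ.get i) = Z.innerInterval q)
    (hq : Z.m (Z.s q) ≠ q) {t : ℝ} (ht : t ∈ Q.leftIcc i)
    (h : Q.height q t = 1 / 4 ∨ Q.height q t = 3 / 4) :
    t = (Q.p ⟨2 * i, by omega⟩).im ∨ t = (Q.p ⟨2 * i + 1, by omega⟩).im := by
  by_contra! hn
  have h1 : t ∈ Q.leftIoo i := ⟨lt_of_le_of_ne ht.1 hn.1.symm, lt_of_le_of_ne ht.2 hn.2⟩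
  refine Q.not_isLocalExtr_height hσ hq h1 ?_
  have hnhds : Q.leftIcc i ∈ 𝓝 t := Icc_mem_nhds h1.1 h1.2
  rcases h with h | h
  · left
    filter_upwards [hnhds] with s hs
    rw [h]
    exact (Q.height_mem hσ hs).1.1
  · right
    filter_upwards [hnhds] with s hs
    rw [h]
    exact (Q.height_mem hσ hs).1.2

/-- The start of an inner interval which is a chord of a polygon is the image of a marked point. -/
theorem exists_corner (hσ : Z.dualChordImage (σ.get i) = Z.innerInterval q)
    (hq : Z.m (Z.s q) ≠ q) :
    ∃ v : halfDisk, (v : ℂ) ∈ range Q.p ∧ Z.HasCoord q (I / 4) (Q.toFun v) := by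
  obtain ⟨t, ht, h⟩ := Q.exists_height hσ hq (r := 1 / 4) ⟨le_rfl, by norm_num⟩
  have h1 := (Q.height_mem hσ ht).2
  rw [h] at h1
  have key : ∀ j, t = (Q.p j).im → ∃ v : halfDisk, (v : ℂ) ∈ range Q.p ∧
      Z.HasCoord q (I / 4) (Q.toFun v) := by
    rintro j rfl
    refine ⟨⟨Q.p j, leftSide_subset (Q.p_mem j)⟩, ⟨j, rfl⟩, ?_⟩
    rw [← Q.leftPath_eq (Q.p_mem j), ← h1]
    exact innerPath_start q
  rcases Q.height_end hσ hq ht (.inl h) with h2 | h2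
  exacts [key _ h2, key _ h2]

/-- The middle of an inner interval is the image of only one point of the corresponding
segment. -/
theorem exists_unique_mid (hσ : Z.dualChordImage (σ.get i) = Z.innerInterval q)
    (hq : Z.m (Z.s q) ≠ q) : ∃ v : halfDisk, (v : ℂ) ∈ Q.leftSegment i ∧ (v : ℂ) ∉ Q.marked ∧
      Q.toFun v = Z.innerMid q ∧
      ∀ u : halfDisk, (u : ℂ) ∈ Q.leftSegment i → Q.toFun u = Z.innerMid q → u = v := by
  obtain ⟨t, ht, h⟩ := Q.exists_height hσ hq (r := 1 / 2) ⟨by norm_num, by norm_num⟩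
  obtain ⟨t1, ht1, h1⟩ := Q.exists_height hσ hq (r := 1 / 4) ⟨le_rfl, by norm_num⟩
  obtain ⟨t2, ht2, h2⟩ := Q.exists_height hσ hq (r := 3 / 4) ⟨by norm_num, le_rfl⟩
  have h3 := Q.height_end hσ hq ht1 (.inl h1)
  have h4 := Q.height_end hσ hq ht2 (.inr h2)
  have h5 : t ≠ t1 := by rintro rfl; rw [h] at h1; norm_num at h1
  have h6 : t ≠ t2 := by rintro rfl; rw [h] at h2; norm_num at h2
  have h7 : t1 ≠ t2 := by rintro rfl; rw [h1] at h2; norm_num at h2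
  -- The two ends of the segment are already used up by the heights `1/4` and `3/4`, so `1/2` is
  -- attained strictly inside.
  have h8 : t ∈ Q.leftIoo i := by
    refine ⟨lt_of_le_of_ne ht.1 ?_, lt_of_le_of_ne ht.2 ?_⟩ <;> grind
  have hm := leftPoint_mem (Q.leftIcc_subset ht)
  refine ⟨⟨leftPoint t, leftSide_subset hm⟩, ⟨hm, ?_, ?_⟩, Q.leftPoint_notMem_marked h8, ?_, ?_⟩
  · rw [leftPoint_im]; exact ht.1
  · rw [leftPoint_im]; exact ht.2
  · rw [← Q.leftPath_eq' (Q.leftIcc_subset ht), ← (Q.height_mem hσ ht).2, h, innerPath_half]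
  · intro u hu hu'
    have h9 : (u : ℂ).im ∈ Q.leftIcc i := hu.2
    ext
    dsimp only
    rw [← leftPoint_of_mem hu.1]
    congr 1
    refine Q.height_injOn hσ hq h9 ht (innerPath_injOn hq (Q.height_mem hσ h9).1
      (Q.height_mem hσ ht).1 ?_)
    rw [(Q.height_mem hσ h9).2, Q.leftPath_eq hu.1, hu', h, innerPath_half]

end Polygon

end Bordered.ArcDiagram

namespace Bordered.ArcDiagram

open Complex (I)
open Set Filter Topology

variable {P : Type*} {Z : ArcDiagram P}

/-! ## Chords without base points -/

/-- If `m ∘ s` fixed `q`, then `q` alone would form a cycle and would have to carry its base point.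
-/
theorem m_s_ne {q : P} (h : ¬ Z.z q) : Z.m (Z.s q) ≠ q := by
  intro h'
  obtain ⟨r, ⟨h1, h2⟩, -⟩ := Z.disk q
  have h3 : Function.IsFixedPt (Z.m * Z.s) q := h'
  obtain ⟨i, rfl⟩ := h1
  rw [Equiv.Perm.zpow_apply_eq_self_of_apply_eq_self h3] at h2
  exact h h2

/-- If the run returned to an earlier point, the whole circle would consist of points of the run
before the return, none of which carries a base point, although every circle has one. -/
theorem pow_injOn {p : P} {n : ℕ} (h : ∀ i < n, ¬ Z.z ((Z.s ^ i) p)) {i j : ℕ} (hi : i ≤ n)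
    (hj : j ≤ n) (hij : (Z.s ^ i) p = (Z.s ^ j) p) : i = j := by
  by_contra hne
  wlog hlt : i < j generalizing i j
  · exact this hj hi hij.symm (Ne.symm hne) (by omega)
  obtain ⟨d, rfl⟩ := Nat.exists_eq_add_of_lt hlt
  set q := (Z.s ^ i) p with hq
  have h1 : (Z.s ^ (d + 1)) q = q := by
    rw [hq, ← Equiv.Perm.mul_apply, ← pow_add, show d + 1 + i = i + d + 1 by omega]
    exact hij.symm
  obtain ⟨r, ⟨⟨k, hk⟩, hz⟩, -⟩ := Z.circle q
  have h2 : ((Z.s ^ (d + 1)) ^ (k / ((d + 1 : ℕ) : ℤ))) q = q :=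
    Equiv.Perm.zpow_apply_eq_self_of_apply_eq_self h1 _
  have h3 : (Z.s ^ (k % ((d + 1 : ℕ) : ℤ))) q = r := by
    rw [← hk, ← Int.emod_add_mul_ediv k ((d + 1 : ℕ) : ℤ), zpow_add, Equiv.Perm.mul_apply, zpow_mul,
      zpow_natCast, h2, Int.add_mul_emod_self_left, Int.emod_emod]
  have h4 := Int.emod_nonneg k (show ((d + 1 : ℕ) : ℤ) ≠ 0 by omega)
  have h5 := Int.emod_lt_of_pos k (show 0 < ((d + 1 : ℕ) : ℤ) by omega)
  obtain ⟨l, hl⟩ := Int.eq_ofNat_of_zero_le h4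
  rw [hl, zpow_natCast, hq, ← Equiv.Perm.mul_apply, ← pow_add] at h3
  rw [← h3] at hz
  exact h _ (by omega) hz

variable (Z) in
/-- The dual chords in a list are the short chords which lie opposite to the points
`p, s p, s² p, …`, and there are no base points between these. -/
structure Follows (p : P) (σ : List Z.dual.Chord) : Prop where
  image : ∀ i : Fin σ.length, Z.dualChordImage (σ.get i) = Z.innerInterval ((Z.s ^ (i : ℕ)) p)
  avoid : ∀ i < σ.length, ¬ Z.z ((Z.s ^ i) p)

theorem HasCoord.re_eq_zero {p : P} {w : ℂ} {x : Z.Surface} (h : Z.HasCoord p w x) {a : Z.Arc}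
    (hx : x ∈ Z.eta a) : w.re = 0 := by
  have key : ∀ {p : P} {w : ℂ}, Z.HasCoord p w x → ¬ 0 < w.re := by
    intro p w h h0
    rw [mem_eta_iff, h.nf] at hx
    have h1 : ∃ q w', Z.normal p w = .inl (q, w') ∧ 0 < w'.re := by
      rcases le_or_gt 0 w.im with h2 | h2
      · exact ⟨_, _, normal_right h0 h2, h0⟩
      · exact ⟨_, _, normal_right' h0 h2, by simpa using h0⟩
    obtain ⟨q, w', h2, h3⟩ := h1
    rw [h2] at hx
    rcases hx with hx | ⟨q', w'', hx, h4, -⟩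
    · simp at hx
    · simp only [Sum.inl.injEq, Prod.mk.injEq] at hx
      rw [hx.2] at h3
      exact h3.ne' h4
  have h1 := key h
  have h2 := key h.neg
  simp only [Complex.neg_re] at h2
  linarith

theorem HasCoord.im_eq_zero {p : P} {w : ℂ} {x : Z.Surface} (h : Z.HasCoord p w x) {a : Z.Arc}
    (hx : x ∈ Z.alpha a) (hb : x ∉ Z.boundary) (hw : 0 < w.re) : w.im = 0 := by
  rcases lt_trichotomy w.im 0 with h1 | h1 | h1
  · exact absurd hx (hexSet_disjoint_alpha (h.mem_hexSet' hb hw h1) a)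
  · exact h1
  · exact absurd hx (hexSet_disjoint_alpha (h.mem_hexSet hb hw h1) a)

/-! ## The hexagons covered by a polygon -/

theorem innerMid_mem (q : P) : Z.innerMid q ∈ Z.innerInterval q := by
  rw [mem_innerInterval_iff]
  refine Or.inl ⟨_, nf_innerMid q, ?_⟩
  norm_num

namespace Polygon

variable {x y : Z.Surface} {σ : List Z.dual.Chord} {ρ : List Z.Chord}
  (Q : Z.Polygon Z.eta x y σ ρ)

theorem notMem_hexSet_of_notMem_inner {v : halfDisk} (hv : v ∉ inner) (q : P) :
    Q.toFun v ∉ Z.hexSet q := by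
  intro h
  rcases notMem_inner.1 hv with h1 | h1
  · rcases Q.left v h1 with h2 | h2
    · obtain ⟨a, ha⟩ := mem_iUnion.1 h2
      exact hexSet_disjoint_eta h a ha
    · exact hexSet_disjoint_boundary h h2
  · rcases Q.right v h1 with h2 | h2
    · obtain ⟨a, ha⟩ := mem_iUnion.1 h2
      exact hexSet_disjoint_alpha h a ha
    · exact hexSet_disjoint_boundary h h2

theorem image_mem_nhds {U : Set halfDisk} (hU : IsOpen U) {v : halfDisk} (hv : v ∈ U)
    (hv' : v ∈ inner) : Q.toFun '' (U ∩ inner) ∈ 𝓝 (Q.toFun v) :=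
  (Q.immersionAt_inner hv').nhds_le hv'
    (image_mem_map ((hU.inter isOpen_inner).mem_nhds ⟨hv, hv'⟩))

theorem isOpen_image_inner : IsOpen (Q.toFun '' inner) := by
  rw [isOpen_iff_mem_nhds]
  rintro _ ⟨v, hv, rfl⟩
  simpa using Q.image_mem_nhds isOpen_univ (mem_univ v) hv

theorem isClosed_range : IsClosed (range Q.toFun) := (isCompact_range Q.continuous).isClosed

/-- The rim of the half disk never meets the hexagon. Inside it, therefore, the image of the
interior equals the compact range and is both open and relatively closed; the hexagon is connected.
-/
theorem hexSet_subset {q : P} (h : (Z.hexSet q ∩ Q.toFun '' inner).Nonempty) :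
    Z.hexSet q ⊆ Q.toFun '' inner := by
  refine (isPreconnected_hexSet q).subset_left_of_subset_union Q.isOpen_image_inner
    Q.isClosed_range.isOpen_compl ?_ ?_ h
  · exact disjoint_compl_right.mono_left (image_subset_range _ _)
  · intro z hz
    by_cases h1 : z ∈ range Q.toFun
    · obtain ⟨v, rfl⟩ := h1
      by_cases h2 : v ∈ inner
      · exact Or.inl ⟨v, h2, rfl⟩
      · exact absurd hz (Q.notMem_hexSet_of_notMem_inner h2 q)
    · exact Or.inr h1

variable {p : P} (hF : Z.Follows p σ)
include hF

/-- The middle of an inner interval lies on the boundary, but on no outer interval and on no other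
inner interval. So it detects the segment of the left side which is mapped to it. -/
theorem mem_leftSegment_of_innerMid {v : halfDisk} {q : P} (h : Q.toFun v = Z.innerMid q) :
    ∃ i : Fin σ.length, (v : ℂ) ∈ Q.leftSegment i ∧ q = (Z.s ^ (i : ℕ)) p := by
  have h1 : Q.toFun v ∈ Z.boundary := h ▸ innerMid_mem_boundary q
  rcases Q.mem_boundary_iff.1 h1 with ⟨i, hi⟩ | ⟨i, hi⟩
  · refine ⟨i, hi, ?_⟩
    have h2 := Q.image_leftSegment hi
    rw [hF.image, h] at h2
    exact (innerMid_mem_innerInterval h2).symm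
  · have h2 := Q.image_rightSegment hi
    rw [h, chordImage] at h2
    simp only [mem_iUnion] at h2
    obtain ⟨j, -, hj⟩ := h2
    exact (inner_disjoint_outer (innerMid_mem q) hj).elim

/-- The compact range contains the closure of a covered hexagon, hence the middle of its inner
interval, and that point is reached only through a chord of the list. -/
theorem exists_of_hexSet {q : P} (h : (Z.hexSet q ∩ Q.toFun '' inner).Nonempty) :
    ∃ i < σ.length, q = (Z.s ^ i) p := by
  have h1 : Z.innerMid q ∈ closure (Z.hexSet q) :=
    mem_closure_iff_frequently.2 (innerMid_frequently q)
  have h2 : closure (Z.hexSet q) ⊆ range Q.toFun :=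
    closure_minimal ((Q.hexSet_subset h).trans (image_subset_range _ _)) Q.isClosed_range
  obtain ⟨v, hv⟩ := h2 h1
  obtain ⟨i, -, hi⟩ := Q.mem_leftSegment_of_innerMid hF hv
  exact ⟨i, i.2, hi⟩

/-- `pow_injOn` determines the segment, and strict monotonicity of the height determines the point
in the segment. -/
theorem exists_innerMid {i : ℕ} (hi : i < σ.length) : ∃ v : halfDisk, (v : ℂ) ∉ Q.marked ∧
    Q.toFun v = Z.innerMid ((Z.s ^ i) p) ∧
    ∀ u : halfDisk, Q.toFun u = Z.innerMid ((Z.s ^ i) p) → u = v := by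
  obtain ⟨v, -, h1, h2, h3⟩ := Q.exists_unique_mid (hF.image ⟨i, hi⟩) (m_s_ne (hF.avoid i hi))
  refine ⟨v, h1, h2, fun u hu => ?_⟩
  obtain ⟨j, hj, hij⟩ := Q.mem_leftSegment_of_innerMid hF hu
  have h4 : i = j := pow_injOn hF.avoid hi.le j.2.le hij
  obtain rfl : j = ⟨i, hi⟩ := Fin.ext h4.symm
  exact h3 u hj hu

/-- Inner points of the half disk near the preimage of the middle are mapped to interior points of
the surface near the middle, and these all lie in the hexagon. -/
theorem hexSet_subset_image {i : ℕ} (hi : i < σ.length) :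
    Z.hexSet ((Z.s ^ i) p) ⊆ Q.toFun '' inner := by
  obtain ⟨v, -, hv, -⟩ := Q.exists_innerMid hF hi
  have h1 := Q.continuous.continuousAt.tendsto.eventually
    (hv ▸ innerMid_eventually ((Z.s ^ i) p) : ∀ᶠ y in 𝓝 (Q.toFun v), _)
  obtain ⟨u, hu, hu'⟩ := ((frequently_inner v).and_eventually h1).exists
  exact Q.hexSet_subset ⟨_, hu' (Q.notMem_boundary_of_inner hu), u, hu, rfl⟩

/-- A point in a hexagon has at most one preimage. -/
theorem eq_of_mem_hexSet {i : ℕ} (hi : i < σ.length) {u u' : halfDisk}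
    (hu : Q.toFun u ∈ Z.hexSet ((Z.s ^ i) p)) (h : Q.toFun u = Q.toFun u') : u = u' := by
  -- `A` consists of the points covered twice and is open since the interior is mapped openly. `B`
  -- consists of the points whose preimages all lie in an open set of injectivity and is open since
  -- the image of the compact complement is closed. They are disjoint and cover the hexagon.
  set A : Set Z.Surface := {z | ∃ u ∈ inner, ∃ u' ∈ inner, u ≠ u' ∧ Q.toFun u = z ∧ Q.toFun u' = z}
    with hA
  set B : Set Z.Surface := {z | ∃ U : Set halfDisk, IsOpen U ∧ InjOn Q.toFun U ∧ z ∉ Q.toFun '' Uᶜ}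
    with hB
  have hinner : ∀ {w : halfDisk}, Q.toFun w ∈ Z.hexSet ((Z.s ^ i) p) → w ∈ inner := fun {w} hw => by
    by_contra h1
    exact Q.notMem_hexSet_of_notMem_inner h1 _ hw
  have hAo : IsOpen A := by
    rw [isOpen_iff_mem_nhds]
    rintro z ⟨u, hu, u', hu', hne, h1, h2⟩
    obtain ⟨U, U', hU, hU', hUu, hUu', hd⟩ := t2_separation hne
    have h3 := Q.image_mem_nhds hU hUu hu
    have h4 := Q.image_mem_nhds hU' hUu' hu'
    rw [h1] at h3
    rw [h2] at h4
    filter_upwards [h3, h4]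
    rintro _ ⟨w, ⟨hw1, hw2⟩, rfl⟩ ⟨w', ⟨hw1', hw2'⟩, hww'⟩
    exact ⟨w, hw2, w', hw2', fun h => hd.le_bot ⟨hw1, h ▸ hw1'⟩, rfl, hww'⟩
  have hBo : IsOpen B := by
    rw [isOpen_iff_mem_nhds]
    rintro z ⟨U, hU, hUi, hz⟩
    have h1 : IsClosed (Q.toFun '' Uᶜ) := (hU.isClosed_compl.isCompact.image Q.continuous).isClosed
    filter_upwards [h1.isOpen_compl.mem_nhds hz] with z' hz'
    exact ⟨U, hU, hUi, hz'⟩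
  have hAB : Disjoint B A := by
    rw [Set.disjoint_left]
    rintro z ⟨U, hU, hUi, hz⟩ ⟨w, hw, w', hw', hne, h1, h2⟩
    have h3 : ∀ {w}, Q.toFun w = z → w ∈ U := fun {w} hw => by
      by_contra h4
      exact hz ⟨w, h4, hw⟩
    exact hne (hUi (h3 h1) (h3 h2) (h1.trans h2.symm))
  have hcov : Z.hexSet ((Z.s ^ i) p) ⊆ B ∪ A := by
    intro z hz
    obtain ⟨w, hw, rfl⟩ := Q.hexSet_subset_image hF hi hz
    by_cases h1 : ∀ w', Q.toFun w' = Q.toFun w → w' = w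
    · left
      obtain ⟨N, hN, hNi⟩ := (Q.immersionAt_inner hw).injOn
      refine ⟨_root_.interior N, isOpen_interior, hNi.mono interior_subset, ?_⟩
      rintro ⟨w', hw', h2⟩
      rw [h1 w' h2] at hw'
      exact hw' (mem_interior_iff_mem_nhds.2 hN)
    · right
      push Not at h1
      obtain ⟨w', h2, h3⟩ := h1
      exact ⟨w, hw, w', hinner (h2 ▸ hz), h3.symm, rfl, h2⟩
  -- The middle of the inner interval has a single, unmarked preimage, where the polygon is locally
  -- injective; so it lies in `B`, and so do nearby points of the hexagon.
  have hne : (Z.hexSet ((Z.s ^ i) p) ∩ B).Nonempty := by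
    obtain ⟨v, hv, hv', huniq⟩ := Q.exists_innerMid hF hi
    obtain ⟨N, hN, hNi⟩ := (Q.immersionAt hv).injOn
    have h1 : Z.innerMid ((Z.s ^ i) p) ∈ B := by
      refine ⟨_root_.interior N, isOpen_interior, hNi.mono interior_subset, ?_⟩
      rintro ⟨w', hw', h2⟩
      rw [huniq w' h2] at hw'
      exact hw' (mem_interior_iff_mem_nhds.2 hN)
    exact ((innerMid_frequently _).and_eventually (hBo.mem_nhds h1)).exists
  by_contra hne'
  have h1 := (isPreconnected_hexSet _).subset_left_of_subset_union hBo hAo hAB hcov hne hu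
  exact hAB.le_bot ⟨h1, u, hinner hu, u', hinner (h ▸ hu), hne', rfl, h.symm⟩

/-- A double point would produce an open set of doubly covered points, which meets the dense union
of the hexagons. -/
theorem injOn_inner : InjOn Q.toFun inner := by
  intro u hu u' hu' h
  by_contra hne
  obtain ⟨U, U', hU, hU', hUu, hUu', hd⟩ := t2_separation hne
  have h3 := Q.image_mem_nhds hU hUu hu
  have h4 := Q.image_mem_nhds hU' hUu' hu'
  rw [← h] at h4
  obtain ⟨z, ⟨q, hq⟩, ⟨w, ⟨hw1, hw2⟩, rfl⟩, ⟨w', ⟨hw1', hw2'⟩, hww'⟩⟩ :=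
    ((frequently_mem_hexSet (Q.notMem_boundary_of_inner hu)).and_eventually
      (inter_mem h3 h4)).exists
  obtain ⟨i, hi, rfl⟩ := Q.exists_of_hexSet hF ⟨_, hq, w, hw2, rfl⟩
  exact hd.le_bot ⟨hw1, Q.eq_of_mem_hexSet hF hi hq hww'.symm ▸ hw1'⟩

/-- Inner points close to `v` are mapped into the open image of a neighbourhood of `u`; so they have
a second inner preimage, against `injOn_inner`. -/
theorem disjoint_image_inner {u v : halfDisk} (hu : u ∈ inner) (hv : v ∉ inner) :
    Q.toFun u ≠ Q.toFun v := by
  intro h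
  have hne : u ≠ v := fun h => hv (h ▸ hu)
  obtain ⟨U, U', hU, hU', hUu, hUv, hd⟩ := t2_separation hne
  have h3 := Q.image_mem_nhds hU hUu hu
  rw [h] at h3
  obtain ⟨w, hw, ⟨w', ⟨hw1, hw2⟩, h4⟩, h5⟩ := ((frequently_inner v).and_eventually
    ((Q.continuous.continuousAt.tendsto.eventually h3).and (hU'.mem_nhds hUv))).exists
  rw [Q.injOn_inner hF hw2 hw h4] at hw1
  exact hd.le_bot ⟨hw1, h5⟩

end Polygon

end Bordered.ArcDiagram

namespace Bordered.ArcDiagram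

open Complex (I)
open Set Filter Topology

variable {P : Type*} {Z : ArcDiagram P}

/-! ## Edges -/

theorem HasCoord.eq_zero {p q : P} {w : ℂ} {x : Z.Surface} (h : Z.HasCoord p w x)
    (h0 : Z.HasCoord q 0 x) : w = 0 := by
  have h1 : w.re = 0 := h.re_eq_zero (a := Z.arc q) ⟨q, 0, rfl, rfl, h0⟩
  have key : ∀ {p : P} {w : ℂ}, Z.HasCoord p w x → w.re = 0 → ¬ 0 < w.im := by
    intro p w h h1 h2
    have h3 := h.nf.symm.trans h0.nf
    rw [normal_axis h1 h2, normal_zero] at h3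
    simp at h3
  have h2 := key h h1
  have h3 := key h.neg (by simpa using h1)
  simp only [Complex.neg_im] at h3
  exact Complex.ext h1 (by simp only [Complex.zero_im]; linarith)

theorem HasCoord.im_eq_zero_of_alpha {p : P} {w : ℂ} {x : Z.Surface} (h : Z.HasCoord p w x)
    {a : Z.Arc} (hx : x ∈ Z.alpha a) (hb : x ∉ Z.boundary) : w.im = 0 := by
  rcases lt_trichotomy w.re 0 with h1 | h1 | h1
  · simpa using h.neg.im_eq_zero hx hb (by simpa using h1)
  · have key : ∀ {p : P} {w : ℂ}, Z.HasCoord p w x → w.re = 0 → ¬ 0 < w.im := by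
      intro p w h h1 h2
      rw [mem_alpha_iff, h.nf, normal_axis h1 h2] at hx
      rcases hx with h3 | ⟨q, w', h3, h4, -⟩
      · simp at h3
      · simp only [Sum.inl.injEq, Prod.mk.injEq] at h3
        rw [← h3.2] at h4
        exact h2.ne' h4
    have h2 := key h h1
    have h3 := key h.neg (by simpa using h1)
    simp only [Complex.neg_im] at h3
    linarith
  · exact h.im_eq_zero hx hb h1

theorem etaEdge_disjoint_alpha {q : P} {x : Z.Surface} (h : x ∈ Z.etaEdge q) (a : Z.Arc) :
    x ∉ Z.alpha a := by
  intro h1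
  have h4 := notMem_boundary_of_mem_etaEdge h
  obtain ⟨r, h2, -, h3⟩ := h
  have := h3.im_eq_zero_of_alpha h1 h4
  simp at this
  exact h2.ne' this

theorem etaEdge_subset_eta {q : P} : Z.etaEdge q ⊆ Z.eta (Z.arc q) := by
  rintro x ⟨r, -, -, h⟩
  exact ⟨q, _, rfl, by simp, h⟩

theorem hasCoord_strip_zero (q : P) {w : ℂ} (hw : w ∈ region 1) (h : w.im < 3 / 4) :
    Z.HasCoord q w (Z.strip q w) := by
  have := strip_hasCoord (Z := Z) q hw (k := 0) (by
    rw [Nat.cast_zero, sub_zero, abs_of_nonneg hw.2.2.1]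
    exact h)
  simpa using this

theorem mulI_mem_region {r : ℝ} (h : 0 ≤ r) (h' : r ≤ 1 / 4) : (r * I : ℂ) ∈ region 1 := by
  refine ⟨by simp, by simp, by simpa using h, by simp; linarith, fun k => ?_⟩
  have : (0 : ℝ) ≤ k := k.cast_nonneg
  simp
  nlinarith

theorem hasCoord_etaPath (q : P) {r : ℝ} (h : r ∈ Ioo (0 : ℝ) (1 / 4)) :
    Z.HasCoord q (r * I) (Z.strip q (r * I)) :=
  hasCoord_strip_zero q (mulI_mem_region h.1.le h.2.le) (by simp; linarith [h.2])

theorem hasCoord_alphaPath (q : P) {r : ℝ} (h : r ∈ Ioo (0 : ℝ) 1) :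
    Z.HasCoord q r (Z.strip q r) :=
  hasCoord_strip_zero q (real_mem_region h.1.le h.2.le) (by simp)

theorem continuousOn_etaPath (q : P) :
    ContinuousOn (fun r : ℝ => Z.strip q (r * I)) (Ioo 0 (1 / 4)) :=
  (continuousOn_strip q 1).comp (by fun_prop) fun _ h => mulI_mem_region h.1.le h.2.le

theorem continuousOn_alphaPath (q : P) :
    ContinuousOn (fun r : ℝ => Z.strip q r) (Ioo 0 1) :=
  (continuousOn_strip q 1).comp (by fun_prop) fun _ h => real_mem_region h.1.le h.2.le

theorem injOn_etaPath (q : P) : InjOn (fun r : ℝ => Z.strip q (r * I)) (Ioo 0 (1 / 4)) := by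
  intro r hr r' hr' h
  have h1 := (hasCoord_etaPath (Z := Z) q hr).nf
  have h2 := (hasCoord_etaPath (Z := Z) q hr').nf
  dsimp only at h
  rw [h, h2, normal_axis (by simp) (by simpa using hr'.1),
    normal_axis (by simp) (by simpa using hr.1)] at h1
  simpa using h1.symm

theorem injOn_alphaPath (q : P) : InjOn (fun r : ℝ => Z.strip q r) (Ioo 0 1) := by
  intro r hr r' hr' h
  have h1 := (hasCoord_alphaPath (Z := Z) q hr).nf
  have h2 := (hasCoord_alphaPath (Z := Z) q hr').nf
  dsimp only at h
  rw [h, h2, normal_right (by simpa using hr'.1) (by simp),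
    normal_right (by simpa using hr.1) (by simp)] at h1
  simpa using h1.symm

/-- Near a point of the edge the edge is the only piece of a dual arc, so a side of the half disk
which passes there must run along it. -/
theorem eventually_etaPath {q : P} {r : ℝ} (hr : r ∈ Ioo (0 : ℝ) (1 / 4)) {s : Set ℝ}
    (hs : s ∈ 𝓝 r) : ∀ᶠ y in 𝓝 (Z.strip q (r * I)), ∀ a, y ∈ Z.eta a →
      y ∈ (fun r : ℝ => Z.strip q (r * I)) '' s := by
  refine (hasCoord_etaPath q hr).eventually ?_
  have h1 : ∀ᶠ w : ℂ in 𝓝 (r * I), w.im ∈ s ∩ Ioo 0 (1 / 4) :=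
    Complex.continuous_im.continuousAt.eventually_mem
      (by simpa using inter_mem hs (Ioo_mem_nhds hr.1 hr.2))
  filter_upwards [h1] with w hw y hy a ha
  refine ⟨w.im, hw.1, ?_⟩
  have h2 : w = w.im * I := Complex.ext (by simp [hy.re_eq_zero ha]) (by simp)
  rw [h2] at hy
  exact (hasCoord_etaPath q hw.2).unique hy

theorem eventually_alphaPath {q : P} {r : ℝ} (hr : r ∈ Ioo (0 : ℝ) 1) {s : Set ℝ}
    (hs : s ∈ 𝓝 r) : ∀ᶠ y in 𝓝 (Z.strip q r), ∀ a, y ∈ Z.alpha a →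
      y ∈ (fun r : ℝ => Z.strip q r) '' s := by
  have hc := hasCoord_alphaPath (Z := Z) q hr
  have hb : ∀ᶠ y in 𝓝 (Z.strip q r), y ∉ Z.boundary :=
    eventually_notMem_boundary (notMem_boundary_of_mem_alphaEdge ⟨r, hr.1, hr.2, hc⟩)
  have h1 : ∀ᶠ w : ℂ in 𝓝 (r : ℂ), w.re ∈ s ∩ Ioo 0 1 :=
    Complex.continuous_re.continuousAt.eventually_mem
      (by simpa using inter_mem hs (Ioo_mem_nhds hr.1 hr.2))
  have h2 : ∀ᶠ y in 𝓝 (Z.strip q r), ∃ w, Z.HasCoord q w y ∧ w.re ∈ s ∩ Ioo 0 1 :=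
    hc.eventually (by filter_upwards [h1] with w hw y hy using ⟨w, hy, hw⟩)
  filter_upwards [hb, h2] with y hyb hy a ha
  obtain ⟨w, hy, hw⟩ := hy
  refine ⟨w.re, hw.1, ?_⟩
  have h3 : w = w.re := Complex.ext (by simp) (by simp [hy.im_eq_zero ha hyb hw.2.1])
  rw [h3] at hy
  exact (hasCoord_alphaPath q hw.2).unique hy

/-- Read through the inverse of the embedded arc `γ`, the curve `c` becomes an injective continuous
real function. It is strictly monotone, so its image is a neighbourhood of each value taken in the
interior. -/
theorem eventually_mem_image_curve {X : Type*} [TopologicalSpace X] [T2Space X] {γ c : ℝ → X}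
    {a b t₁ t₂ r t : ℝ} (hγ : ContinuousOn γ (Icc a b)) (hγi : InjOn γ (Icc a b))
    (hc : ContinuousOn c (Icc t₁ t₂)) (hci : InjOn c (Icc t₁ t₂)) (hr : r ∈ Ioo a b)
    (ht : t ∈ Ioo t₁ t₂) (h : MapsTo c (Icc t₁ t₂) (γ '' Icc a b)) (h0 : c t = γ r) :
    ∀ᶠ r' in 𝓝 r, γ r' ∈ c '' Icc t₁ t₂ := by
  have hab : (Icc a b).Nonempty := ⟨r, Ioo_subset_Icc_self hr⟩
  have ht12 : t₁ ≤ t₂ := (ht.1.trans ht.2).le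
  have h' : ∀ s ∈ Icc t₁ t₂, ∃ g ∈ Icc a b, γ g = c s := fun s hs => h hs
  choose! g hg hgc using h'
  have h1 : Topology.IsClosedEmbedding fun s : Icc a b => γ s :=
    (continuousOn_iff_continuous_domRestrict.1 hγ).isClosedEmbedding (injOn_iff_injective.1 hγi)
  have hgcont : ContinuousOn g (Icc t₁ t₂) := by
    rw [continuousOn_iff_continuous_domRestrict]
    have h2 : Continuous fun s : Icc t₁ t₂ => (⟨g s, hg s s.2⟩ : Icc a b) := by
      rw [h1.isInducing.continuous_iff]
      refine (continuousOn_iff_continuous_domRestrict.1 hc).congr fun s => ?_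
      exact (hgc s s.2).symm
    exact continuous_subtype_val.comp h2
  have hgi : InjOn g (Icc t₁ t₂) := fun s hs s' hs' h => hci hs hs' (by
    rw [← hgc _ hs, ← hgc _ hs', h])
  have hgt : g t = r := hγi (hg _ (Ioo_subset_Icc_self ht)) (Ioo_subset_Icc_self hr)
    ((hgc _ (Ioo_subset_Icc_self ht)).trans h0)
  have h1' := left_mem_Icc.2 ht12
  have h2' := right_mem_Icc.2 ht12
  have key : ∃ u v, u < r ∧ r < v ∧ Icc u v ⊆ g '' Icc t₁ t₂ := by
    rcases hgcont.strictMonoOn_of_injOn_Icc' ht12 hgi with hm | hm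
    · exact ⟨g t₁, g t₂, hgt ▸ hm h1' (Ioo_subset_Icc_self ht) ht.1,
        hgt ▸ hm (Ioo_subset_Icc_self ht) h2' ht.2, intermediate_value_Icc ht12 hgcont⟩
    · exact ⟨g t₂, g t₁, hgt ▸ hm (Ioo_subset_Icc_self ht) h2' ht.2,
        hgt ▸ hm h1' (Ioo_subset_Icc_self ht) ht.1, intermediate_value_Icc' ht12 hgcont⟩
  obtain ⟨u, v, hu, hv, huv⟩ := key
  filter_upwards [Icc_mem_nhds hu hv] with r' hr'
  obtain ⟨s, hs, rfl⟩ := huv hr'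
  exact ⟨s, hs, (hgc _ hs).symm⟩

/-- The left side of the half disk, as a curve. -/
noncomputable def leftCurve (t : ℝ) : halfDisk :=
  ⟨leftPoint (projIcc (-1 : ℝ) 1 (by norm_num) t),
    leftSide_subset (leftPoint_mem (Subtype.coe_prop _))⟩

/-- The right side of the half disk, as a curve. -/
noncomputable def rightCurve (t : ℝ) : halfDisk :=
  ⟨rightPoint (projIcc (-1 : ℝ) 1 (by norm_num) t),
    rightSide_subset (rightPoint_mem (Subtype.coe_prop _))⟩

theorem continuous_leftCurve : Continuous leftCurve :=
  (continuous_leftPoint.comp (continuous_subtype_val.comp continuous_projIcc)).subtype_mk _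

theorem continuous_rightCurve : Continuous rightCurve :=
  (continuous_rightPoint.comp (continuous_subtype_val.comp continuous_projIcc)).subtype_mk _

theorem leftCurve_mem (t : ℝ) : (leftCurve t : ℂ) ∈ leftSide := leftPoint_mem (Subtype.coe_prop _)

theorem rightCurve_mem (t : ℝ) : (rightCurve t : ℂ) ∈ rightSide :=
  rightPoint_mem (Subtype.coe_prop _)

theorem leftCurve_im {t : ℝ} (h : t ∈ Icc (-1 : ℝ) 1) : (leftCurve t : ℂ).im = t := by
  rw [leftCurve, leftPoint_im, projIcc_of_mem _ h]

theorem rightCurve_im {t : ℝ} (h : t ∈ Icc (-1 : ℝ) 1) : (rightCurve t : ℂ).im = t := by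
  rw [rightCurve, rightPoint_im, projIcc_of_mem _ h]

theorem leftCurve_of_mem {v : halfDisk} (h : (v : ℂ) ∈ leftSide) : leftCurve (v : ℂ).im = v :=
  Subtype.ext (leftSide_ext (leftCurve_mem _) h (leftCurve_im (im_le_one v.2)))

theorem rightCurve_of_mem {v : halfDisk} (h : (v : ℂ) ∈ rightSide) : rightCurve (v : ℂ).im = v :=
  Subtype.ext (rightSide_ext (rightCurve_mem _) h (rightCurve_im (im_le_one v.2)))

/-- If an immersion maps a side of the half disk to a curve, then it covers a neighbourhood of the
image of an inner point of the side. -/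
theorem ImmersionAt.eventually_curve {f : halfDisk → Z.Surface} (hf : Continuous f)
    {c : ℝ → halfDisk} (hc : Continuous c) (hci : ∀ t ∈ Icc (-1 : ℝ) 1, (c t : ℂ).im = t)
    {t : ℝ} (ht : t ∈ Ioo (-1 : ℝ) 1) (him : Z.ImmersionAt f (c t)) {γ : ℝ → Z.Surface}
    {s : Set ℝ} (hs : IsOpen s) (hγ : ContinuousOn γ s) (hγi : InjOn γ s) {r : ℝ} (hr : r ∈ s)
    (h0 : f (c t) = γ r) (h : ∀ s' ∈ 𝓝 r, ∀ᶠ t' in 𝓝 t, f (c t') ∈ γ '' s') :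
    ∀ᶠ r' in 𝓝 r, ∃ t', f (c t') = γ r' := by
  obtain ⟨N, hN, hNi⟩ := him.injOn
  obtain ⟨ε, hε, hεs⟩ := Metric.nhds_basis_closedBall.mem_iff.1 (hs.mem_nhds hr)
  rw [Real.closedBall_eq_Icc] at hεs
  have h1 := h _ (Icc_mem_nhds (sub_lt_self r hε) (lt_add_of_pos_right r hε))
  obtain ⟨δ, hδ, hδs⟩ := Metric.nhds_basis_closedBall.mem_iff.1 (inter_mem (inter_mem h1
    (hc.continuousAt.preimage_mem_nhds hN)) (Ioo_mem_nhds ht.1 ht.2))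
  rw [Real.closedBall_eq_Icc] at hδs
  filter_upwards [eventually_mem_image_curve (hγ.mono hεs) (hγi.mono hεs)
    (hf.comp hc).continuousOn (fun a ha b hb hab => by
      rw [← hci a (Ioo_subset_Icc_self (hδs ha).2), ← hci b (Ioo_subset_Icc_self (hδs hb).2),
        hNi (hδs ha).1.2 (hδs hb).1.2 hab])
    ⟨sub_lt_self r hε, lt_add_of_pos_right r hε⟩ ⟨sub_lt_self t hδ, lt_add_of_pos_right t hδ⟩
    (fun a ha => (hδs ha).1.1) h0] with r' hr'
  obtain ⟨t', -, ht'⟩ := hr'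
  exact ⟨t', ht'⟩

theorem notMem_inner_of_left {v : halfDisk} (h : (v : ℂ) ∈ leftSide) : v ∉ inner :=
  notMem_inner.2 (Or.inl h)

theorem notMem_inner_of_right {v : halfDisk} (h : (v : ℂ) ∈ rightSide) : v ∉ inner :=
  notMem_inner.2 (Or.inr h)

theorem eq_I_of_im {v : halfDisk} (h : (v : ℂ).im = 1) : (v : ℂ) = I := by
  have h1 := v.2.2
  have h2 : (v : ℂ).re ^ 2 + (v : ℂ).im ^ 2 ≤ 1 := by
    have := Complex.sq_norm (v : ℂ)
    rw [Complex.normSq_apply] at this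
    nlinarith [norm_nonneg (v : ℂ)]
  exact Complex.ext (by simp; nlinarith) (by simpa using h)

theorem eq_neg_I_of_im {v : halfDisk} (h : (v : ℂ).im = -1) : (v : ℂ) = -I := by
  have h1 := v.2.2
  have h2 : (v : ℂ).re ^ 2 + (v : ℂ).im ^ 2 ≤ 1 := by
    have := Complex.sq_norm (v : ℂ)
    rw [Complex.normSq_apply] at this
    nlinarith [norm_nonneg (v : ℂ)]
  exact Complex.ext (by simp; nlinarith) (by simpa using h)

theorem notMem_boundary_of_zero {q : P} {x : Z.Surface} (h : Z.HasCoord q 0 x) :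
    x ∉ Z.boundary := by
  rw [h.mem_boundary_iff, BoundaryCoord]
  norm_num

namespace Polygon

variable {x y : Z.Surface} {σ : List Z.dual.Chord} {ρ : List Z.Chord}
  (Q : Z.Polygon Z.eta x y σ ρ)

theorem im_mem_Ioo {p q : P} (hx : Z.HasCoord p 0 x) (hy : Z.HasCoord q 0 y) {v : halfDisk}
    {q' : P} (h : Q.toFun v ∈ Z.etaEdge q' ∪ Z.alphaEdge q') : (v : ℂ).im ∈ Ioo (-1 : ℝ) 1 := by
  have key : ∀ {q : P}, ¬ Z.HasCoord q 0 (Q.toFun v) := by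
    intro q h0
    rcases h with ⟨r, h1, h2, h⟩ | ⟨r, h1, h2, h⟩
    · have := h.eq_zero h0
      simp [h1.ne'] at this
    · have := h.eq_zero h0
      simp [h1.ne'] at this
  have h1 := im_le_one v.2
  refine ⟨lt_of_le_of_ne h1.1 fun h2 => ?_, lt_of_le_of_ne h1.2 fun h2 => ?_⟩
  · exact key (Q.start v (eq_neg_I_of_im h2.symm) ▸ hx)
  · exact key (Q.terminal v (eq_I_of_im h2) ▸ hy)

/-- A rim point mapped to the edge lies on the left side, is unmarked and is different from `±i`.
The polygon is an immersion there, and the left side sweeps out a neighbourhood in the edge. -/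
theorem eventually_etaEdge {p q : P} (hx : Z.HasCoord p 0 x) (hy : Z.HasCoord q 0 y)
    {v : halfDisk} (hv : v ∉ inner) {q' : P} {r : ℝ} (hr : r ∈ Ioo (0 : ℝ) (1 / 4))
    (h : Q.toFun v = Z.strip q' (r * I)) :
    ∀ᶠ r' : ℝ in 𝓝 r, ∃ u ∉ inner, Q.toFun u = Z.strip q' (r' * I) := by
  have hE : Q.toFun v ∈ Z.etaEdge q' := ⟨r, hr.1, hr.2, h ▸ hasCoord_etaPath q' hr⟩
  have hb := notMem_boundary_of_mem_etaEdge hE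
  have hl : (v : ℂ) ∈ leftSide := by
    rcases notMem_inner.1 hv with h1 | h1
    · exact h1
    · rcases Q.right v h1 with h2 | h2
      · obtain ⟨a, ha⟩ := mem_iUnion.1 h2
        exact absurd ha (etaEdge_disjoint_alpha hE a)
      · exact absurd h2 hb
  have hvc := leftCurve_of_mem hl
  have him : Z.ImmersionAt Q.toFun (leftCurve (v : ℂ).im) := by
    rw [hvc]
    exact Q.immersionAt fun h2 => hb (Q.marked_mem_boundary h2)
  have h1 := him.eventually_curve Q.continuous continuous_leftCurve (fun _ => leftCurve_im)
    (Q.im_mem_Ioo hx hy (Or.inl hE)) isOpen_Ioo (continuousOn_etaPath q') (injOn_etaPath q') hr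
    (by rw [hvc, h]) (fun s' hs' => by
      have h2 : Tendsto (fun t => Q.toFun (leftCurve t)) (𝓝 (v : ℂ).im) (𝓝 (Q.toFun v)) := by
        have := (Q.continuous.comp continuous_leftCurve).tendsto (v : ℂ).im
        rwa [Function.comp_apply, hvc] at this
      filter_upwards [h2.eventually (eventually_notMem_boundary hb),
        h2.eventually (h ▸ eventually_etaPath hr hs')] with t ht1 ht2
      rcases Q.left _ (leftCurve_mem t) with h3 | h3
      · obtain ⟨a, ha⟩ := mem_iUnion.1 h3
        exact ht2 a ha
      · exact absurd h3 ht1)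
  filter_upwards [h1] with r' hr'
  obtain ⟨t, ht⟩ := hr'
  exact ⟨_, notMem_inner_of_left (leftCurve_mem t), ht⟩

theorem eventually_alphaEdge {p q : P} (hx : Z.HasCoord p 0 x) (hy : Z.HasCoord q 0 y)
    {v : halfDisk} (hv : v ∉ inner) {q' : P} {r : ℝ} (hr : r ∈ Ioo (0 : ℝ) 1)
    (h : Q.toFun v = Z.strip q' r) :
    ∀ᶠ r' : ℝ in 𝓝 r, ∃ u ∉ inner, Q.toFun u = Z.strip q' r' := by
  have hE : Q.toFun v ∈ Z.alphaEdge q' := ⟨r, hr.1, hr.2, h ▸ hasCoord_alphaPath q' hr⟩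
  have hb := notMem_boundary_of_mem_alphaEdge hE
  have hl : (v : ℂ) ∈ rightSide := by
    rcases notMem_inner.1 hv with h1 | h1
    · rcases Q.left v h1 with h2 | h2
      · obtain ⟨a, ha⟩ := mem_iUnion.1 h2
        exact absurd ha (alphaEdge_disjoint_eta hE a)
      · exact absurd h2 hb
    · exact h1
  have hvc := rightCurve_of_mem hl
  have him : Z.ImmersionAt Q.toFun (rightCurve (v : ℂ).im) := by
    rw [hvc]
    exact Q.immersionAt fun h2 => hb (Q.marked_mem_boundary h2)
  have h1 := him.eventually_curve Q.continuous continuous_rightCurve (fun _ => rightCurve_im)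
    (Q.im_mem_Ioo hx hy (Or.inr hE)) isOpen_Ioo (continuousOn_alphaPath q') (injOn_alphaPath q') hr
    (by rw [hvc, h]) (fun s' hs' => by
      have h2 : Tendsto (fun t => Q.toFun (rightCurve t)) (𝓝 (v : ℂ).im) (𝓝 (Q.toFun v)) := by
        have := (Q.continuous.comp continuous_rightCurve).tendsto (v : ℂ).im
        rwa [Function.comp_apply, hvc] at this
      filter_upwards [h2.eventually (eventually_notMem_boundary hb),
        h2.eventually (h ▸ eventually_alphaPath hr hs')] with t ht1 ht2
      rcases Q.right _ (rightCurve_mem t) with h3 | h3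
      · obtain ⟨a, ha⟩ := mem_iUnion.1 h3
        exact ht2 a ha
      · exact absurd h3 ht1)
  filter_upwards [h1] with r' hr'
  obtain ⟨t, ht⟩ := hr'
  exact ⟨_, notMem_inner_of_right (rightCurve_mem t), ht⟩

variable {p : P} (hF : Z.Follows p σ)
include hF

/-- An edge which is covered by a polygon is covered either by inner points or by boundary
points of the half disk. -/
theorem edge_subset {γ : ℝ → Z.Surface} {L : ℝ} (hγ : ContinuousOn γ (Ioo 0 L))
    (hcov : ∀ r ∈ Ioo 0 L, γ r ∈ range Q.toFun)
    (hrim : ∀ r ∈ Ioo 0 L, ∀ v ∉ inner, Q.toFun v = γ r →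
      ∀ᶠ r' in 𝓝 r, ∃ u ∉ inner, Q.toFun u = γ r') {r₀ : ℝ} (h₀ : r₀ ∈ Ioo 0 L)
    (h : γ r₀ ∈ Q.toFun '' inner) : ∀ r ∈ Ioo 0 L, γ r ∈ Q.toFun '' inner := by
  -- The parameters covered by inner points and those covered by rim points form open sets: the
  -- first because the interior has open image, the second by `hrim`. They are disjoint and exhaust
  -- a connected interval.
  have hA : IsOpen (Ioo 0 L ∩ γ ⁻¹' (Q.toFun '' inner)) :=
    hγ.isOpen_inter_preimage isOpen_Ioo Q.isOpen_image_inner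
  have hB : IsOpen (Ioo 0 L ∩ γ ⁻¹' (Q.toFun '' innerᶜ)) := by
    rw [isOpen_iff_mem_nhds]
    rintro r ⟨hr, v, hv, hvr⟩
    filter_upwards [hrim r hr v hv hvr, Ioo_mem_nhds hr.1 hr.2] with r' hr' hr''
    exact ⟨hr'', hr'⟩
  have hAB : Disjoint (Ioo 0 L ∩ γ ⁻¹' (Q.toFun '' inner)) (Ioo 0 L ∩ γ ⁻¹' (Q.toFun '' innerᶜ)) := by
    rw [Set.disjoint_left]
    rintro r ⟨-, u, hu, hur⟩ ⟨-, v, hv, hvr⟩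
    exact Q.disjoint_image_inner hF hu hv (hur.trans hvr.symm)
  have h1 := isPreconnected_Ioo.subset_left_of_subset_union hA hB hAB (fun r hr => by
    obtain ⟨v, hv⟩ := hcov r hr
    by_cases h2 : v ∈ inner
    · exact Or.inl ⟨hr, v, h2, hv⟩
    · exact Or.inr ⟨hr, v, h2, hv⟩) ⟨r₀, h₀, h₀, h⟩
  exact fun r hr => (h1 hr).2

theorem mem_range_of_frequently {z : Z.Surface} {i : ℕ} (hi : i < σ.length)
    (h : ∃ᶠ y in 𝓝 z, y ∈ Z.hexSet ((Z.s ^ i) p)) : z ∈ range Q.toFun :=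
  closure_minimal ((Q.hexSet_subset_image hF hi).trans (image_subset_range _ _)) Q.isClosed_range
    (mem_closure_iff_frequently.2 h)

theorem exists_of_frequently {z : Z.Surface} (hz : z ∈ Q.toFun '' inner) {q : P}
    (h : ∃ᶠ y in 𝓝 z, y ∈ Z.hexSet q) : ∃ i < σ.length, q = (Z.s ^ i) p :=
  Q.exists_of_hexSet hF (h.and_eventually (Q.isOpen_image_inner.mem_nhds hz)).exists

/-- The inner points of a polygon do not lie on the dual arcs. -/
theorem notMem_eta {p₁ p₂ : P} (hx : Z.HasCoord p₁ 0 x) (hy : Z.HasCoord p₂ 0 y) {u : halfDisk}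
    (hu : u ∈ inner) (a : Z.Arc) : Q.toFun u ∉ Z.eta a := by
  intro h
  obtain ⟨q, z, hz, hz'⟩ : ∃ q, ∃ z ∈ Z.etaEdge q, z ∈ Q.toFun '' inner := by
    rcases mem_eta_cases h (Q.notMem_boundary_of_inner hu) with ⟨q, hq⟩ | ⟨q, hq⟩
    · exact ⟨q, ((frequently_etaEdge hq).and_eventually
        (Q.isOpen_image_inner.mem_nhds ⟨u, hu, rfl⟩)).exists⟩
    · exact ⟨q, _, hq, u, hu, rfl⟩
  obtain ⟨i, hi, rfl⟩ := Q.exists_of_frequently hF hz' (frequently_hexSet_of_mem_etaEdge hz)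
  obtain ⟨r, hr0, hr1, hr⟩ := hz
  have hr' : z = Z.strip ((Z.s ^ i) p) (r * I) := hr.unique (hasCoord_etaPath _ ⟨hr0, hr1⟩)
  -- One inner point on the half arc forces all of the half arc to be covered by inner points.
  have h1 := Q.edge_subset hF (continuousOn_etaPath ((Z.s ^ i) p)) (fun r hr =>
      Q.mem_range_of_frequently hF hi (frequently_hexSet_of_mem_etaEdge
        ⟨r, hr.1, hr.2, hasCoord_etaPath _ hr⟩))
    (fun r hr v hv h => Q.eventually_etaEdge hx hy hv hr h) ⟨hr0, hr1⟩ (hr' ▸ hz')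
  -- The end of this half arc is the image of a marked point of the left side. Nearby points of the
  -- left side which are not mapped to the boundary run along the same half arc, and rim and
  -- interior have disjoint images.
  obtain ⟨v, hv, hv'⟩ := Q.exists_corner (hF.image ⟨i, hi⟩) (m_s_ne (hF.avoid i hi))
  obtain ⟨w, ⟨hw1, hw2⟩, hw3⟩ := ((Q.frequently_left (notMem_boundary_of_zero hx)
    (notMem_boundary_of_zero hy) hv).and_eventually
      (Q.continuous.continuousAt.tendsto.eventually (eventually_etaEdge_of_corner hv'))).exists
  rcases Q.left w hw1 with h2 | h2
  · obtain ⟨b, hb⟩ := mem_iUnion.1 h2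
    obtain ⟨r', h3, h4, h5⟩ := hw3 b hb hw2
    obtain ⟨u', hu', h6⟩ := h1 r' ⟨h3, h4⟩
    exact Q.disjoint_image_inner hF hu' (notMem_inner_of_left hw1)
      (h6.trans ((hasCoord_etaPath _ ⟨h3, h4⟩).unique h5))
  · exact hw2 h2

end Polygon

end Bordered.ArcDiagram

namespace Bordered.ArcDiagram

open Complex (I)
open Set Filter Topology

variable {P : Type*} {Z : ArcDiagram P}

/-! ## The image of a polygon -/

theorem exists_floor {w : ℂ} (h : 0 ≤ w.im) : ∃ k : ℕ, k ≤ w.im ∧ w.im < k + 1 :=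
  ⟨⌊w.im⌋₊, Nat.floor_le h, Nat.lt_floor_add_one _⟩

theorem add_mem_regionInt {n i : ℕ} (hi : i < n) {w : ℂ} (h : w ∈ regionInt 1) :
    w + i * I ∈ regionInt n := by
  obtain ⟨h1, h2, h3, h4, h5⟩ := h
  have h6 : (i : ℝ) + 1 ≤ n := by exact_mod_cast hi
  have h7 : (0 : ℝ) ≤ i := i.cast_nonneg
  simp only [Nat.cast_one] at h4
  refine ⟨by simpa, by simpa, by simp; linarith, by simp; linarith, fun k => ?_⟩
  rcases Nat.lt_or_ge k i with h | h
  · have h8 : (k : ℝ) + 1 ≤ i := by exact_mod_cast h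
    have := h5 0
    simp at this ⊢
    nlinarith
  · obtain ⟨j, rfl⟩ := Nat.exists_eq_add_of_le h
    have := h5 j
    simp at this ⊢
    convert this using 3
    ring

theorem mem_strip_image_of_hexSet {n i : ℕ} (hi : i < n) {p : P} {x : Z.Surface}
    (h : x ∈ Z.hexSet ((Z.s ^ i) p)) :
    x ∈ Z.strip p '' {w | w ∈ regionInt n ∧ i < w.im ∧ w.im < i + 1} := by
  obtain ⟨w, hw, hx⟩ := h
  have h1 := add_mem_regionInt hi hw
  have h4 := hw.2.2.2.1
  simp only [Nat.cast_one] at h4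
  have h2 : (w + i * I).im = w.im + i := by simp
  refine ⟨w + i * I, ⟨h1, ?_, ?_⟩, nf_injective ?_⟩
  · rw [h2]; linarith [hw.2.2.1]
  · rw [h2]; linarith
  · rw [hx, nf_strip p (regionInt_subset n h1) h1.1 (k := i) (by rw [h2]; linarith [hw.2.2.1])
      (by rw [h2]; linarith)]
    simp

theorem mem_strip_image_of_alphaEdge {n i : ℕ} (h0 : 0 < i) (hi : i < n) {p : P} {x : Z.Surface}
    (h : x ∈ Z.alphaEdge ((Z.s ^ i) p)) :
    x ∈ Z.strip p '' {w | w ∈ regionInt n ∧ w.im = i} := by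
  obtain ⟨r, h1, h2, hr⟩ := h
  have h6 : (i : ℝ) + 1 ≤ n := by exact_mod_cast hi
  have h7 : (0 : ℝ) < i := by exact_mod_cast h0
  have hw : (r + i * I : ℂ) ∈ regionInt n := by
    refine ⟨by simpa, by simpa, by simpa, by simp; linarith, fun k => ?_⟩
    simp only [Complex.add_re, Complex.ofReal_re, Complex.mul_re, Complex.natCast_re, Complex.I_re,
      mul_zero, Complex.natCast_im, Complex.I_im, sub_zero, add_zero, Complex.add_im,
      Complex.ofReal_im, Complex.mul_im, mul_one, zero_add]
    have h8 : (1 / 4 : ℝ) ≤ ((i : ℝ) - k - 1 / 2) ^ 2 := by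
      rcases Nat.lt_or_ge k i with h | h
      · have : (k : ℝ) + 1 ≤ i := by exact_mod_cast h
        nlinarith
      · have : (i : ℝ) ≤ k := by exact_mod_cast h
        nlinarith
    nlinarith
  refine ⟨_, ⟨hw, by simp⟩, nf_injective ?_⟩
  rw [hr.nf, nf_strip p (regionInt_subset n hw) hw.1 (k := i) (by simp) (by simp),
    normal_right (by simpa) (by simp)]
  simp

theorem injOn_strip {p : P} {n : ℕ} (h : ∀ i < n, ¬ Z.z ((Z.s ^ i) p)) :
    InjOn (Z.strip p) (regionInt n) := by
  intro w hw w' hw' he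
  obtain ⟨k, hk, hk'⟩ := exists_floor hw.2.2.1.le
  obtain ⟨l, hl, hl'⟩ := exists_floor hw'.2.2.1.le
  have h1 := congrArg Z.nf he
  rw [nf_strip p (regionInt_subset n hw) hw.1 hk hk',
    nf_strip p (regionInt_subset n hw') hw'.1 hl hl'] at h1
  simp only [Sum.inl.injEq, Prod.mk.injEq] at h1
  have h2 : k < n := by exact_mod_cast hk.trans_lt hw.2.2.2.1
  have h3 : l < n := by exact_mod_cast hl.trans_lt hw'.2.2.2.1
  obtain rfl := pow_injOn h h2.le h3.le h1.1
  simpa using h1.2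

theorem clm_det (L : ℂ →L[ℝ] ℂ) : L.det = (L 1).re * (L I).im - (L I).re * (L 1).im := by
  rw [ContinuousLinearMap.det, ← LinearMap.det_toMatrix Complex.basisOneI, Matrix.det_fin_two]
  simp [LinearMap.toMatrix_apply, Complex.coe_basisOneI_repr]

namespace Polygon

variable {x y : Z.Surface} {σ : List Z.dual.Chord} {ρ : List Z.Chord}
  (Q : Z.Polygon Z.eta x y σ ρ)
variable {p p₁ p₂ : P} (hF : Z.Follows p σ) (hx : Z.HasCoord p₁ 0 x) (hy : Z.HasCoord p₂ 0 y)
include hF hx hy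

theorem alphaEdge_subset {q : P} {i : ℕ} (hi : i < σ.length)
    (hqi : q = (Z.s ^ i) p) {z : Z.Surface}
    (hz : z ∈ Z.alphaEdge q) (hz' : z ∈ Q.toFun '' inner) : Z.alphaEdge q ⊆ Q.toFun '' inner := by
  subst hqi
  obtain ⟨r, hr0, hr1, hr⟩ := hz
  have hr' : z = Z.strip ((Z.s ^ i) p) r := hr.unique (hasCoord_alphaPath _ ⟨hr0, hr1⟩)
  have h1 := Q.edge_subset hF (continuousOn_alphaPath ((Z.s ^ i) p)) (fun r hr =>
      Q.mem_range_of_frequently hF hi (frequently_hexSet_of_mem_alphaEdge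
        ⟨r, hr.1, hr.2, hasCoord_alphaPath _ hr⟩))
    (fun r hr v hv h => Q.eventually_alphaEdge hx hy hv hr h) ⟨hr0, hr1⟩ (hr' ▸ hz')
  rintro w ⟨r', h3, h4, h5⟩
  rw [h5.unique (hasCoord_alphaPath _ ⟨h3, h4⟩)]
  exact h1 r' ⟨h3, h4⟩

/-- Dual arcs and boundary being excluded, arcs and hexagons remain. The hexagons on the two sides
of a covered edge are both in the strip, so its index is the successor of another index and hence
positive. -/
theorem image_subset_cases {z : Z.Surface} (hz : z ∈ Q.toFun '' inner) :
    (∃ i, 0 < i ∧ i < σ.length ∧ z ∈ Z.alphaEdge ((Z.s ^ i) p)) ∨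
      ∃ i < σ.length, z ∈ Z.hexSet ((Z.s ^ i) p) := by
  have hη : ∀ a, z ∉ Z.eta a := by
    obtain ⟨u, hu, rfl⟩ := hz
    exact Q.notMem_eta hF hx hy hu
  have hb : z ∉ Z.boundary := by
    obtain ⟨u, hu, rfl⟩ := hz
    exact Q.notMem_boundary_of_inner hu
  rcases interior_cases hb with ⟨q, h⟩ | ⟨q, h⟩ | ⟨q, h⟩ | ⟨q, h⟩
  · exact absurd ⟨q, 0, rfl, rfl, h⟩ (hη (Z.arc q))
  · exact absurd (etaEdge_subset_eta h) (hη _)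
  · left
    obtain ⟨i, hi, rfl⟩ := Q.exists_of_frequently hF hz (frequently_hexSet_of_mem_alphaEdge h)
    obtain ⟨j, hj, hij⟩ := Q.exists_of_frequently hF hz (frequently_hexSet_of_mem_alphaEdge' h)
    have h1 : (Z.s ^ i) p = (Z.s ^ (j + 1)) p := by
      rw [pow_succ', Equiv.Perm.mul_apply, ← hij, Equiv.Perm.inv_def, Equiv.apply_symm_apply]
    have h2 := pow_injOn hF.avoid hi.le (show j + 1 ≤ σ.length from hj) h1
    exact ⟨i, by omega, hi, h⟩
  · right
    obtain ⟨i, hi, rfl⟩ := Q.exists_of_hexSet hF ⟨z, h, hz⟩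
    exact ⟨i, hi, h⟩

/-- The inner points of a polygon cover the interior of a strip. -/
theorem image_inner : Q.toFun '' inner = Z.strip p '' regionInt σ.length := by
  refine Subset.antisymm (fun z hz => ?_) ?_
  · rcases Q.image_subset_cases hF hx hy hz with ⟨i, h0, hi, h⟩ | ⟨i, hi, h⟩
    · exact image_mono (fun w hw => hw.1) (mem_strip_image_of_alphaEdge h0 hi h)
    · exact image_mono (fun w hw => hw.1) (mem_strip_image_of_hexSet hi h)
  rintro _ ⟨w, hw, rfl⟩
  obtain ⟨k, hk, hk'⟩ := exists_floor hw.2.2.1.le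
  have hkn : k < σ.length := by exact_mod_cast hk.trans_lt hw.2.2.2.1
  have hnf := nf_strip (Z := Z) p (regionInt_subset _ hw) hw.1 hk hk'
  rcases hk.lt_or_eq with hlt | heq
  · refine Q.hexSet_subset_image hF hkn ⟨w - k * I, ⟨?_, ?_, ?_, ?_, fun l => ?_⟩, hnf⟩
    · simpa using hw.1
    · simpa using hw.2.1
    · simpa using hlt
    · simp; linarith
    · have := hw.2.2.2.2 (k + l)
      simp at this ⊢
      convert this using 3
      ring
  · have hkpos : 0 < k := by
      have := hw.2.2.1
      rw [← heq] at this
      exact_mod_cast this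
    have hcoord : Z.HasCoord ((Z.s ^ k) p) (w - k * I) (Z.strip p w) :=
      strip_hasCoord p (regionInt_subset _ hw) (by rw [heq]; simp)
    have hedge : Z.strip p w ∈ Z.alphaEdge ((Z.s ^ k) p) := by
      refine ⟨w.re, hw.1, hw.2.1, ?_⟩
      rwa [show w - k * I = w.re from Complex.ext (by simp) (by simp [heq])] at hcoord
    -- An edge at height `k` that is not covered would split the image of the connected interior
    -- into the parts below and above height `k`. Both are nonempty, as the hexagons `k - 1` and `k`
    -- are covered.
    by_contra hcon
    have hdis : ∀ z ∈ Z.alphaEdge ((Z.s ^ k) p), z ∉ Q.toFun '' inner := fun z hz hz' =>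
      hcon (Q.alphaEdge_subset hF hx hy hkn rfl hz hz' hedge)
    have hopen : ∀ {V : Set ℂ}, IsOpen V → IsOpen (Z.strip p '' (regionInt σ.length ∩ V)) :=
      fun hV => isOpen_strip_image p ((isOpen_regionInt _).inter hV)
        (inter_subset_left.trans (regionInt_subset _))
    have h1 := hopen (isOpen_lt Complex.continuous_im continuous_const : IsOpen {w : ℂ | w.im < (k : ℝ)})
    have h2 := hopen (isOpen_lt continuous_const Complex.continuous_im : IsOpen {w : ℂ | (k : ℝ) < w.im})
    have hd : Disjoint (Z.strip p '' (regionInt σ.length ∩ {w | w.im < k}))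
        (Z.strip p '' (regionInt σ.length ∩ {w | k < w.im})) := by
      rw [Set.disjoint_left]
      rintro _ ⟨a, ⟨ha, ha'⟩, rfl⟩ ⟨b, ⟨hb, hb'⟩, hab⟩
      rw [injOn_strip hF.avoid hb ha hab] at hb'
      exact lt_asymm (show a.im < k from ha') hb'
    have hhex : ∀ {i}, i < σ.length → (i < k → Z.hexSet ((Z.s ^ i) p) ⊆
        Z.strip p '' (regionInt σ.length ∩ {w | w.im < k})) ∧ (k ≤ i → Z.hexSet ((Z.s ^ i) p) ⊆
        Z.strip p '' (regionInt σ.length ∩ {w | k < w.im})) := by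
      intro i hi
      refine ⟨fun hik z hz => image_mono ?_ (mem_strip_image_of_hexSet hi hz), fun hik z hz =>
        image_mono ?_ (mem_strip_image_of_hexSet hi hz)⟩
      · rintro a ⟨ha, -, ha'⟩
        have : (i : ℝ) + 1 ≤ k := by exact_mod_cast hik
        exact ⟨ha, show a.im < k by linarith⟩
      · rintro a ⟨ha, ha', -⟩
        have : (k : ℝ) ≤ i := by exact_mod_cast hik
        exact ⟨ha, show k < a.im by linarith⟩
    have hsub : Q.toFun '' inner ⊆ Z.strip p '' (regionInt σ.length ∩ {w | w.im < k}) ∪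
        Z.strip p '' (regionInt σ.length ∩ {w | k < w.im}) := by
      intro z hz
      rcases Q.image_subset_cases hF hx hy hz with ⟨i, h0, hi, h⟩ | ⟨i, hi, h⟩
      · have hik : i ≠ k := by
          rintro rfl
          exact hdis z h hz
        have h3 := mem_strip_image_of_alphaEdge h0 hi h
        rcases lt_or_gt_of_ne hik with h4 | h4
        · refine Or.inl (image_mono ?_ h3)
          rintro a ⟨ha, ha'⟩
          exact ⟨ha, show a.im < k by rw [ha']; exact_mod_cast h4⟩
        · refine Or.inr (image_mono ?_ h3)
          rintro a ⟨ha, ha'⟩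
          exact ⟨ha, show k < a.im by rw [ha']; exact_mod_cast h4⟩
      · rcases Nat.lt_or_ge i k with h4 | h4
        · exact Or.inl ((hhex hi).1 h4 h)
        · exact Or.inr ((hhex hi).2 h4 h)
    have hne : ∀ q : P, (Z.hexSet q).Nonempty := fun q => (innerMid_frequently q).exists
    obtain ⟨z, hz⟩ := hne ((Z.s ^ (k - 1)) p)
    obtain ⟨z', hz'⟩ := hne ((Z.s ^ k) p)
    have hk1 : k - 1 < σ.length := by omega
    have h5 := (isPreconnected_inner.image _ Q.continuous.continuousOn).subset_left_of_subset_union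
      h1 h2 hd hsub ⟨z, Q.hexSet_subset_image hF hk1 hz, (hhex hk1).1 (by omega) hz⟩
    exact hd.le_bot ⟨h5 (Q.hexSet_subset_image hF hkn hz'), (hhex hkn).2 le_rfl hz'⟩

include Q in
-- The strip of no hexagons has empty interior, while the half disk has inner points.
theorem length_pos : 0 < σ.length := by
  obtain ⟨v, hv⟩ := (frequently_inner ⟨I, by simp [halfDisk]⟩).exists
  have h := Q.image_inner hF hx hy ▸ mem_image_of_mem Q.toFun hv
  obtain ⟨w, hw, -⟩ := h
  exact_mod_cast hw.2.2.1.trans hw.2.2.2.1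

end Polygon

/-! ## The terminal point of a polygon -/

section Curve
variable {E : ℂ → ℂ} {L : ℂ →L[ℝ] ℂ} {v : ℂ} {c : ℝ → ℂ} {c' : ℂ}

theorem hasDerivAt_comp_curve (hE : HasFDerivAt E L v) (hc : HasDerivAt c c' 0) (h0 : c 0 = v)
    (φ : ℂ →L[ℝ] ℝ) : HasDerivAt (fun t => φ (E (c t))) (φ (L c')) 0 :=
  (φ.hasFDerivAt (x := E (c 0))).comp_hasDerivAt 0 ((h0.symm ▸ hE).comp_hasDerivAt 0 hc)

/-- One-sided limits suffice, and only they are available: the curves used below lie in the half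
disk for small positive parameters, while `E` is compared with the polygon only there. -/
theorem eq_zero_of_curve (hE : HasFDerivAt E L v) (hc : HasDerivAt c c' 0) (h0 : c 0 = v)
    (φ : ℂ →L[ℝ] ℝ) (hv : φ (E v) = 0) (h : ∀ᶠ t in 𝓝[>] 0, φ (E (c t)) = 0) :
    φ (L c') = 0 := by
  have h1 := (hasDerivAt_comp_curve hE hc h0 φ).hasDerivWithinAt (s := Ioi 0)
  have h2 : HasDerivWithinAt (fun t => φ (E (c t))) 0 (Ioi 0) 0 :=
    (hasDerivWithinAt_const (0 : ℝ) (Ioi (0 : ℝ)) (0 : ℝ)).congr_of_eventuallyEq h (by rw [h0, hv])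
  exact (uniqueDiffWithinAt_Ioi 0).eq_deriv _ h1 h2

theorem pos_of_curve (hE : HasFDerivAt E L v) (hc : HasDerivAt c c' 0) (h0 : c 0 = v)
    (φ : ℂ →L[ℝ] ℝ) (hv : φ (E v) = 0) (h : 0 < φ (L c')) :
    ∀ᶠ t in 𝓝[>] 0, 0 < φ (E (c t)) := by
  have h1 := hasDerivAt_iff_tendsto_slope.1 (hasDerivAt_comp_curve hE hc h0 φ)
  have h2 := (h1.eventually (lt_mem_nhds h)).filter_mono
    (nhdsWithin_mono 0 (fun t (ht : t ∈ Ioi (0 : ℝ)) => ht.ne'))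
  filter_upwards [h2, self_mem_nhdsWithin] with t ht ht'
  rw [slope_def_field, h0, hv, sub_zero, sub_zero] at ht
  exact (div_pos_iff_of_pos_right ht').1 ht

end Curve

theorem hasDerivAt_left : HasDerivAt (fun t : ℝ => ((1 - t : ℝ) : ℂ) * I) (-I) 0 := by
  have h1 := (((hasDerivAt_id (0 : ℝ)).const_sub 1).ofReal_comp).mul_const I
  simpa using h1

theorem hasDerivAt_right :
    HasDerivAt (fun t : ℝ => (Real.sin t : ℂ) + (Real.cos t : ℂ) * I) 1 0 := by
  have h1 := (Real.hasDerivAt_sin 0).ofReal_comp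
  have h2 := (Real.hasDerivAt_cos 0).ofReal_comp.mul_const I
  exact (h1.add h2).congr_deriv (by simp)

theorem hasDerivAt_diagonal : HasDerivAt (fun t : ℝ => I + (t : ℂ) * (1 - I)) (1 - I) 0 := by
  have h1 := ((hasDerivAt_id (0 : ℝ)).ofReal_comp.mul_const (1 - I)).const_add I
  simpa using h1

theorem left_mem : ∀ᶠ t : ℝ in 𝓝[>] 0, ((1 - t : ℝ) : ℂ) * I ∈ leftSide := by
  filter_upwards [Ioo_mem_nhdsGT (show (0 : ℝ) < 1 by norm_num)] with t ht
  exact leftPoint_mem ⟨by linarith [ht.2], by linarith [ht.1]⟩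

theorem right_mem : ∀ᶠ t : ℝ in 𝓝[>] 0, (Real.sin t : ℂ) + (Real.cos t : ℂ) * I ∈ rightSide := by
  filter_upwards [Ioo_mem_nhdsGT Real.pi_pos] with t ht
  refine ⟨?_, ?_⟩
  · simp only [Complex.add_re, Complex.ofReal_re, Complex.mul_re, Complex.I_re, mul_zero,
      Complex.ofReal_im, Complex.I_im, mul_one, sub_self, add_zero]
    exact (Real.sin_pos_of_mem_Ioo ht).le
  · rw [Complex.norm_add_mul_I, Real.sin_sq_add_cos_sq, Real.sqrt_one]

theorem diagonal_mem : ∀ᶠ t : ℝ in 𝓝[>] 0, I + (t : ℂ) * (1 - I) ∈ innerPlane := by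
  filter_upwards [Ioo_mem_nhdsGT (show (0 : ℝ) < 1 by norm_num)] with t ht
  refine ⟨by simpa using ht.1, ?_⟩
  have h1 : I + (t : ℂ) * (1 - I) = (t : ℂ) + ((1 - t : ℝ) : ℂ) * I := by push_cast; ring
  rw [h1, Complex.norm_add_mul_I, Real.sqrt_lt' one_pos]
  nlinarith [ht.1, ht.2]

namespace Polygon

variable {x y : Z.Surface} {σ : List Z.dual.Chord} {ρ : List Z.Chord}
  (Q : Z.Polygon Z.eta x y σ ρ)

/-- At `i` the right side is tangent to the direction `1` and is mapped into an arc, where the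
imaginary part of the coordinate vanishes; the left side is tangent to `-i` and is mapped into a
dual arc. So the differential is diagonal. -/
theorem exists_coord_terminal {q : P} (hy : Z.HasCoord q 0 y) :
    ∃ (p' : P) (E : ℂ → ℂ) (L : ℂ →L[ℝ] ℂ), HasFDerivAt E L I ∧ E I = 0 ∧
      (∀ᶠ u in 𝓝 I, ∀ h : u ∈ halfDisk, Z.HasCoord p' (E u) (Q.toFun ⟨u, h⟩)) ∧
      Z.HasCoord p' 0 y ∧ (L 1).im = 0 ∧ (L I).re = 0 ∧ 0 < (L 1).re ∧ 0 < (L I).im := by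
  have hI : (I : ℂ) ∈ halfDisk := by simp [halfDisk]
  have hQ : Q.toFun ⟨I, hI⟩ = y := Q.terminal _ rfl
  have hb : y ∉ Z.boundary := notMem_boundary_of_zero hy
  have hm : I ∉ Q.marked := fun h => hb (hQ ▸ Q.marked_mem_boundary (v := ⟨I, hI⟩) h)
  obtain ⟨p', e, hv, hdet, he, -, hf⟩ := (Q.immersionAt (v := ⟨I, hI⟩) hm).exists_diffeo
  dsimp only at hv hdet
  have hE : HasFDerivAt e (fderiv ℝ e I) I := ((he _ hv).differentiableAt (by simp)).hasFDerivAt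
  set L := fderiv ℝ e I
  have hcy : Z.HasCoord p' (e I) y := hQ ▸ hf ⟨I, hI⟩ hv
  have h0 : e I = 0 := hcy.eq_zero hy
  have hcoord : ∀ᶠ u in 𝓝 I, ∀ h : u ∈ halfDisk, Z.HasCoord p' (e u) (Q.toFun ⟨u, h⟩) := by
    filter_upwards [e.open_source.mem_nhds hv] with u hu h using hf ⟨u, h⟩ hu
  have hnb : ∀ᶠ u in 𝓝 I, ∀ h : u ∈ halfDisk, Q.toFun ⟨u, h⟩ ∉ Z.boundary := by
    have h1 := Q.continuous.continuousAt.tendsto.eventually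
      (eventually_notMem_boundary (hQ.symm ▸ hb))
    rw [nhds_subtype, eventually_comap] at h1
    filter_upwards [h1] with u hu h using hu ⟨u, h⟩ rfl
  have htend : ∀ {c : ℝ → ℂ} {c' : ℂ}, HasDerivAt c c' 0 → c 0 = I →
      Tendsto c (𝓝[>] 0) (𝓝 I) := fun hc h => by
    have := hc.continuousAt.tendsto
    rw [h] at this
    exact this.mono_left nhdsWithin_le_nhds
  have hL1 : (L 1).im = 0 := by
    have h00 : (Real.sin 0 : ℂ) + (Real.cos 0 : ℂ) * I = I := by simp
    refine eq_zero_of_curve hE hasDerivAt_right h00 Complex.imCLM (by simp [h0]) ?_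
    filter_upwards [right_mem, (htend hasDerivAt_right h00).eventually hcoord,
      (htend hasDerivAt_right h00).eventually hnb] with t ht h1 h2
    rcases Q.right ⟨_, rightSide_subset ht⟩ ht with h3 | h3
    · obtain ⟨a, ha⟩ := mem_iUnion.1 h3
      exact (h1 _).im_eq_zero_of_alpha ha (h2 _)
    · exact absurd h3 (h2 _)
  have hLI : (L I).re = 0 := by
    have h00 : ((1 - 0 : ℝ) : ℂ) * I = I := by simp
    have h4 : Complex.reCLM (L (-I)) = 0 := by
      refine eq_zero_of_curve hE hasDerivAt_left h00 Complex.reCLM (by simp [h0]) ?_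
      filter_upwards [left_mem, (htend hasDerivAt_left h00).eventually hcoord,
        (htend hasDerivAt_left h00).eventually hnb] with t ht h1 h2
      rcases Q.left ⟨_, leftSide_subset ht⟩ ht with h3 | h3
      · obtain ⟨a, ha⟩ := mem_iUnion.1 h3
        exact (h1 _).re_eq_zero ha
      · exact absurd h3 (h2 _)
    simpa using h4
  rw [clm_det, hLI, zero_mul, sub_zero] at hdet
  -- As the orientation is preserved, the diagonal entries have equal signs; if both are negative,
  -- the chart rotated by a half turn makes them positive.
  rcases pos_and_pos_or_neg_and_neg_of_mul_pos hdet with ⟨h1, h2⟩ | ⟨h1, h2⟩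
  · exact ⟨p', e, L, hE, h0, hcoord, h0 ▸ hcy, hL1, hLI, h1, h2⟩
  · refine ⟨Z.m p', fun u => -e u, -L, hE.neg, by simp [h0], ?_, ?_, by simpa using hL1,
      by simpa using hLI, by simpa using h1, by simpa using h2⟩
    · filter_upwards [hcoord] with u hu h using (hu h).neg
    · have := hcy.neg
      rwa [h0, neg_zero] at this

include Q in
-- Near `i` the right side runs along the edge of some `p'`, and the interior lies below that edge.
-- The edge thus bounds a covered hexagon from above, and it turns out to be the top edge of the
-- strip.
theorem hasCoord_terminal {p p₁ p₂ : P} (hF : Z.Follows p σ) (hx : Z.HasCoord p₁ 0 x)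
    (hy : Z.HasCoord p₂ 0 y) : Z.HasCoord ((Z.s ^ σ.length) p) 0 y := by
  obtain ⟨p', E, L, hE, h0, hcoord, hyc, hL1, hLI, h1, h2⟩ := Q.exists_coord_terminal hy
  have hb : y ∉ Z.boundary := notMem_boundary_of_zero hy
  have htend : ∀ {c : ℝ → ℂ} {c' : ℂ}, HasDerivAt c c' 0 → c 0 = I →
      Tendsto c (𝓝[>] 0) (𝓝 I) := fun hc h => by
    have := hc.continuousAt.tendsto
    rw [h] at this
    exact this.mono_left nhdsWithin_le_nhds
  have hI : (I : ℂ) ∈ halfDisk := by simp [halfDisk]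
  have hQ : Q.toFun ⟨I, hI⟩ = y := Q.terminal _ rfl
  have hnb : ∀ᶠ u in 𝓝 I, ∀ h : u ∈ halfDisk, Q.toFun ⟨u, h⟩ ∉ Z.boundary := by
    have h1 := Q.continuous.continuousAt.tendsto.eventually
      (eventually_notMem_boundary (hQ.symm ▸ hb))
    rw [nhds_subtype, eventually_comap] at h1
    filter_upwards [h1] with u hu h using hu ⟨u, h⟩ rfl
  obtain ⟨v, hv, hva⟩ : ∃ v : halfDisk, (v : ℂ) ∈ rightSide ∧ Q.toFun v ∈ Z.alphaEdge p' := by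
    have h00 : (Real.sin 0 : ℂ) + (Real.cos 0 : ℂ) * I = I := by simp
    have ht := htend hasDerivAt_right h00
    have h3 : ∀ᶠ t : ℝ in 𝓝[>] 0, (E ((Real.sin t : ℂ) + (Real.cos t : ℂ) * I)).re < 1 :=
      ((Complex.continuous_re.continuousAt.comp hE.continuousAt).tendsto.comp ht).eventually_lt_const
        (by simp [h0])
    obtain ⟨t, ht1, ht2, ht3, ht4, ht5⟩ := (right_mem.and ((ht.eventually hcoord).and
      ((ht.eventually hnb).and (h3.and (pos_of_curve hE hasDerivAt_right h00 Complex.reCLM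
        (by simp [h0]) h1))))).exists
    refine ⟨⟨_, rightSide_subset ht1⟩, ht1, _, ht5, ht4, ?_⟩
    rcases Q.right ⟨_, rightSide_subset ht1⟩ ht1 with h3 | h3
    · obtain ⟨a, ha⟩ := mem_iUnion.1 h3
      have h4 := ht2 (rightSide_subset ht1)
      have h5 := h4.im_eq_zero_of_alpha ha (ht3 _)
      rwa [Complex.reCLM_apply, show (((E ((Real.sin t : ℂ) + (Real.cos t : ℂ) * I)).re : ℝ) : ℂ) =
        E ((Real.sin t : ℂ) + (Real.cos t : ℂ) * I) from Complex.ext rfl (by rw [h5]; rfl)]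
    · exact absurd h3 (ht3 _)
  -- The diagonal from `i` in the direction `1 - i` lies in the interior of the half disk. Its image
  -- starts into the lower right quadrant, which belongs to the hexagon of `Z.s⁻¹ p'`.
  obtain ⟨j, hj, hjp⟩ : ∃ j < σ.length, Z.s⁻¹ p' = (Z.s ^ j) p := by
    have h00 : I + ((0 : ℝ) : ℂ) * (1 - I) = I := by simp
    have ht := htend hasDerivAt_diagonal h00
    obtain ⟨t, ht1, ht2, ht3, ht4⟩ := (diagonal_mem.and ((ht.eventually hcoord).and
      ((pos_of_curve hE hasDerivAt_diagonal h00 Complex.reCLM (by simp [h0])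
        (by simp [hLI, h1])).and (pos_of_curve hE hasDerivAt_diagonal h00 (-Complex.imCLM)
        (by simp [h0]) (by simp [hL1, h2]))))).exists
    have hin : (⟨_, innerPlane_subset ht1⟩ : halfDisk) ∈ inner := ht1
    exact Q.exists_of_hexSet hF ⟨_, (ht2 _).mem_hexSet' (Q.notMem_boundary_of_inner hin) ht3
      (by simpa using ht4), _, hin, rfl⟩
  have hp' : p' = (Z.s ^ (j + 1)) p := by
    rw [pow_succ', Equiv.Perm.mul_apply, ← hjp, Equiv.Perm.inv_def, Equiv.apply_symm_apply]
  subst hp'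
  -- An edge strictly inside the strip is covered by inner points, but this one contains the image
  -- of a point of the right side.
  rcases (show j + 1 ≤ σ.length from hj).lt_or_eq with hlt | heq
  · have h3 := image_mono (fun w hw => hw.1)
      (mem_strip_image_of_alphaEdge (Nat.succ_pos j) hlt hva)
    rw [← Q.image_inner hF hx hy] at h3
    obtain ⟨u, hu, huv⟩ := h3
    exact (Q.disjoint_image_inner hF hu (notMem_inner_of_right hv) huv).elim
  · rwa [heq] at hyc

end Polygon

end Bordered.ArcDiagram

namespace Bordered.ArcDiagram

open Complex (I)
open Set Filter Topology

variable {P : Type*} {Z : ArcDiagram P}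

/-! ## Extending a homeomorphism of the interior -/

section Extension
variable {X F : Type*} [MetricSpace X] [CompactSpace X] [TopologicalSpace F] [T2Space F]

/-- The closure of the graph of the partial correspondence `f u = g w` on `N`. -/
def graphClosure (N : Set X) (f g : X → F) : Set (X × X) :=
  closure {u | u.1 ∈ N ∧ u.2 ∈ N ∧ f u.1 = g u.2}

variable {N : Set X} {f g : X → F}

theorem graphClosure_swap {v w : X} (h : (v, w) ∈ graphClosure N f g) :
    (w, v) ∈ graphClosure N g f := by
  refine map_mem_closure (f := Prod.swap) continuous_swap h ?_
  rintro ⟨a, b⟩ ⟨h1, h2, h3⟩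
  exact ⟨h2, h1, h3.symm⟩

theorem eq_of_mem_graphClosure (hf : Continuous f) (hg : Continuous g) {v w : X}
    (h : (v, w) ∈ graphClosure N f g) : f v = g w := by
  have h1 : IsClosed {u : X × X | f u.1 = g u.2} :=
    isClosed_eq (hf.comp continuous_fst) (hg.comp continuous_snd)
  exact closure_minimal (fun u hu => hu.2.2) h1 h

/-- The projection of the compact closed graph is closed and contains the dense set `N`. -/
theorem exists_mem_graphClosure (hN : Dense N) (hfg : f '' N ⊆ g '' N) (v : X) :
    ∃ w, (v, w) ∈ graphClosure N f g := by
  have h1 : IsClosed (Prod.fst '' graphClosure N f g) :=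
    (isClosed_closure.isCompact.image continuous_fst).isClosed
  have h2 : N ⊆ Prod.fst '' graphClosure N f g := by
    intro u hu
    obtain ⟨w, hw, h⟩ := hfg ⟨u, hu, rfl⟩
    exact ⟨(u, w), subset_closure ⟨hu, hw, h.symm⟩, rfl⟩
  obtain ⟨⟨_, w⟩, h, rfl⟩ := closure_minimal h2 h1 (hN v)
  exact ⟨w, h⟩

/-- Suppose that the homeomorphism `g⁻¹ f` of `N` had two limit values `c` and `c'` at `v`. Points
of `N` near `v` form a connected set whose image approaches both values, so it has to cross every
sphere around `c` of radius less than `dist c c'`. For a suitable radius this is impossible. -/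
theorem graphClosure_unique (hN : ∀ v r, IsPreconnected (N ∩ Metric.ball v r))
    (hf : Continuous f) (hg : Continuous g) (hgN : InjOn g N)
    (hgo : ∀ U, IsOpen U → IsOpen (g '' (U ∩ N))) (hfg : f '' N ⊆ g '' N)
    (hgc : ∀ z, (g ⁻¹' {z}).Countable) {v c c' : X} (h : (v, c) ∈ graphClosure N f g)
    (h' : (v, c') ∈ graphClosure N f g) : c = c' := by
  by_contra hne
  have hd : 0 < dist c c' := dist_pos.2 hne
  -- The fibre of `g` over `f v` is countable, so some sphere around `c` avoids it; by compactness
  -- `f` stays away from the image of that sphere near `v`.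
  obtain ⟨r, hr, hr'⟩ : ∃ r ∈ Ioo 0 (dist c c'), r ∉ (fun w => dist w c) '' (g ⁻¹' {f v}) := by
    have h1 : ¬ Ioo 0 (dist c c') ⊆ (fun w => dist w c) '' (g ⁻¹' {f v}) := fun h2 =>
      (Cardinal.Real.Ioo_countable_iff.not.2 (not_le.2 hd)) (((hgc _).image _).mono h2)
    exact Set.not_subset.1 h1
  have hS : IsClosed (f ⁻¹' (g '' Metric.sphere c r)) :=
    ((Metric.isClosed_sphere.isCompact.image hg).isClosed).preimage hf
  have hv : v ∉ f ⁻¹' (g '' Metric.sphere c r) := by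
    rintro ⟨w, hw, h2⟩
    exact hr' ⟨w, h2, hw⟩
  obtain ⟨δ, hδ, hδs⟩ := Metric.isOpen_iff.1 hS.isOpen_compl v hv
  choose! k hkN hk using fun u (hu : u ∈ N) => hfg ⟨u, hu, rfl⟩
  have hkc : ContinuousOn k N := by
    rw [continuousOn_iff']
    intro U hU
    refine ⟨f ⁻¹' (g '' (U ∩ N)), (hgo U hU).preimage hf, ?_⟩
    ext u
    constructor
    · rintro ⟨h1, h2⟩
      exact ⟨⟨k u, ⟨h1, hkN u h2⟩, hk u h2⟩, h2⟩
    · rintro ⟨⟨w, ⟨hw, hwN⟩, h1⟩, h2⟩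
      refine ⟨?_, h2⟩
      rw [mem_preimage, hgN (hkN u h2) hwN ((hk u h2).trans h1.symm)]
      exact hw
  have hcon := (hN v δ).image k (hkc.mono inter_subset_left)
  have hmeet : ∀ {c₁ : X} {U : Set X}, IsOpen U → c₁ ∈ U → (v, c₁) ∈ graphClosure N f g →
      (k '' (N ∩ Metric.ball v δ) ∩ U).Nonempty := by
    intro c₁ U hU hc hvc
    obtain ⟨⟨a, b⟩, ⟨h1, h2⟩, h3, h4, h5⟩ := mem_closure_iff.1 hvc
      (Metric.ball v δ ×ˢ U) (Metric.isOpen_ball.prod hU) ⟨Metric.mem_ball_self hδ, hc⟩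
    dsimp only at h1 h2 h3 h4 h5
    have h6 : k a = b := hgN (hkN a h3) h4 ((hk a h3).trans h5)
    exact ⟨b, ⟨a, ⟨h3, h1⟩, h6⟩, h2⟩
  have hU1 : IsOpen {w | dist w c < r} := isOpen_lt (by fun_prop) (by fun_prop)
  have hU2 : IsOpen {w | r < dist w c} := isOpen_lt (by fun_prop) (by fun_prop)
  have hdis : Disjoint {w | dist w c < r} {w | r < dist w c} := by
    rw [Set.disjoint_left]
    exact fun w h1 h2 => lt_asymm (show dist w c < r from h1) h2
  have hsub : k '' (N ∩ Metric.ball v δ) ⊆ {w | dist w c < r} ∪ {w | r < dist w c} := by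
    rintro _ ⟨u, ⟨hu, hu'⟩, rfl⟩
    rcases lt_trichotomy (dist (k u) c) r with h1 | h1 | h1
    · exact Or.inl h1
    · exact absurd ⟨k u, h1, hk u hu⟩ (hδs hu')
    · exact Or.inr h1
  have h2 := hcon.subset_left_of_subset_union hU1 hU2 hdis hsub
    (hmeet hU1 (by simpa using hr.1) h)
  obtain ⟨w, hw1, hw2⟩ := hmeet hU2 (show r < dist c' c by rw [dist_comm]; exact hr.2) h'
  exact hdis.le_bot ⟨h2 hw1, hw2⟩

/-- The closed graph is single valued in both directions, so it defines mutually inverse maps; a map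
with closed graph into a compact space is continuous. -/
theorem exists_homeomorph (hN : ∀ v r, IsPreconnected (N ∩ Metric.ball v r)) (hd : Dense N)
    (hf : Continuous f) (hg : Continuous g) (hfN : InjOn f N) (hgN : InjOn g N)
    (hfo : ∀ U, IsOpen U → IsOpen (f '' (U ∩ N))) (hgo : ∀ U, IsOpen U → IsOpen (g '' (U ∩ N)))
    (hfg : f '' N = g '' N) (hfc : ∀ z, (f ⁻¹' {z}).Countable)
    (hgc : ∀ z, (g ⁻¹' {z}).Countable) :
    ∃ h : X ≃ₜ X, (∀ v, f v = g (h v)) ∧ ∀ v, v ∈ N → h v ∈ N := by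
  choose h hh using exists_mem_graphClosure hd hfg.subset
  choose k hk using exists_mem_graphClosure hd hfg.symm.subset
  have hu : ∀ {v c}, (v, c) ∈ graphClosure N f g → c = h v := fun hc =>
    graphClosure_unique hN hf hg hgN hgo hfg.subset hgc hc (hh _)
  have hu' : ∀ {v c}, (v, c) ∈ graphClosure N g f → c = k v := fun hc =>
    graphClosure_unique hN hg hf hfN hfo hfg.symm.subset hfc hc (hk _)
  have hcont : Continuous h := by
    rw [continuous_iff_isClosed]
    intro C hC
    have h1 : h ⁻¹' C = Prod.fst '' (graphClosure N f g ∩ Prod.snd ⁻¹' C) := by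
      ext v
      constructor
      · exact fun hv => ⟨(v, h v), ⟨hh v, hv⟩, rfl⟩
      · rintro ⟨⟨a, b⟩, ⟨h1, h2⟩, rfl⟩
        rw [mem_preimage, ← hu h1]
        exact h2
    rw [h1]
    exact ((isClosed_closure.inter (hC.preimage continuous_snd)).isCompact.image
      continuous_fst).isClosed
  let e : X ≃ X :=
    { toFun := h
      invFun := k
      left_inv := fun v => (hu' (graphClosure_swap (hh v))).symm
      right_inv := fun v => (hu (graphClosure_swap (hk v))).symm }
  refine ⟨Continuous.homeoOfEquivCompactToT2 (f := e) hcont, fun v =>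
    eq_of_mem_graphClosure hf hg (hh v), fun v hv => ?_⟩
  obtain ⟨w, hw, hw'⟩ := hfg.subset ⟨v, hv, rfl⟩
  have h1 : w = h v := hu (subset_closure ⟨hv, hw, hw'.symm⟩)
  change h v ∈ N
  exact h1 ▸ hw

end Extension

/-! ## Uniqueness of polygons -/

theorem dense_inner : Dense inner := fun v => mem_closure_iff_frequently.2 (frequently_inner v)

namespace Polygon

section Fibre
variable {β : Z.Arc → Set Z.Surface} {x y : Z.Surface} {σ : List Z.dual.Chord} {ρ : List Z.Chord}
  (Q : Z.Polygon β x y σ ρ)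

/-- Only finitely many points are marked. At all others an immersion is locally injective, so that
part of the fibre is discrete and is covered by countably many neighbourhoods with at most one of
its points in each. -/
theorem countable_fibre (z : Z.Surface) : (Q.toFun ⁻¹' {z}).Countable := by
  set K : Set halfDisk := Q.toFun ⁻¹' {z} \ {v | (v : ℂ) ∈ Q.marked} with hK
  have h1 : K.Countable := by
    choose! N hN hNi using fun (v : halfDisk) (hv : v ∈ K) => (Q.immersionAt hv.2).injOn
    obtain ⟨t, hts, ht, htc⟩ := TopologicalSpace.countable_cover_nhdsWithin (s := K) (f := N)
      fun v hv => mem_nhdsWithin_of_mem_nhds (hN v hv)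
    refine (ht.biUnion fun v hv => ?_ : (⋃ v ∈ t, N v ∩ K).Countable).mono fun u hu => ?_
    · refine Subsingleton.countable fun a ha b hb => hNi v (hts hv) ha.1 hb.1 ?_
      exact ha.2.1.trans hb.2.1.symm
    · obtain ⟨v, hv, huv⟩ := mem_iUnion₂.1 (htc hu)
      exact mem_iUnion₂.2 ⟨v, hv, huv, hu⟩
  have h2 : {v : halfDisk | (v : ℂ) ∈ Q.marked}.Countable :=
    (((finite_range Q.p).union (finite_range Q.q)).countable).preimage Subtype.val_injective
  refine (h1.union h2).mono fun v hv => ?_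
  by_cases h3 : (v : ℂ) ∈ Q.marked
  · exact Or.inr h3
  · exact Or.inl ⟨hv, h3⟩

theorem isOpen_image_inter {U : Set halfDisk} (hU : IsOpen U) : IsOpen (Q.toFun '' (U ∩ inner)) := by
  rw [isOpen_iff_mem_nhds]
  rintro _ ⟨v, ⟨hv, hv'⟩, rfl⟩
  exact (Q.immersionAt_inner hv').nhds_le hv'
    (image_mem_map ((hU.inter isOpen_inner).mem_nhds ⟨hv, hv'⟩))

end Fibre

section Pair
variable {x y x' y' : Z.Surface} {σ σ' : List Z.dual.Chord} {ρ ρ' : List Z.Chord}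
  (Q : Z.Polygon Z.eta x y σ ρ) (R : Z.Polygon Z.eta x' y' σ' ρ')

/-- In charts the homeomorphism is the inverse of one local diffeomorphism, composed with an affine
transition map and another local diffeomorphism. -/
theorem smoothAt_of_comp (h : halfDisk ≃ₜ halfDisk) (hQR : ∀ v, R.toFun v = Q.toFun (h v))
    {v : halfDisk} (hv : (v : ℂ) ∉ R.marked) (hv' : (h v : ℂ) ∉ Q.marked) : SmoothAt h v := by
  obtain ⟨p₁, e₁, hs₁, -, he₁, -, hf₁⟩ := (R.immersionAt hv).exists_diffeo
  obtain ⟨p₂, e₂, hs₂, -, -, he₂, hf₂⟩ := (Q.immersionAt hv').exists_diffeo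
  have hc₁ := hf₁ v hs₁
  have hc₂ := hf₂ (h v) hs₂
  rw [← hQR] at hc₂
  obtain ⟨ε, c, -, hab, hev⟩ := hc₁.transition hc₂
  have hcont₁ : ContinuousAt e₁ v := e₁.continuousAt hs₁
  have hcont₂ : ContinuousAt e₂ (h v) := e₂.continuousAt hs₂
  have h1 : ∀ᶠ u : halfDisk in 𝓝 v, (h u : ℂ) = e₂.symm (ε * e₁ u + c) := by
    have h2 : Tendsto (fun u : halfDisk => (e₁ u, e₂ (h u))) (𝓝 v) (𝓝 (e₁ v, e₂ (h v))) :=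
      (hcont₁.tendsto.comp (continuous_subtype_val.tendsto v)).prodMk_nhds
        (hcont₂.tendsto.comp ((continuous_subtype_val.comp h.continuous).tendsto v))
    have h3 : ∀ᶠ u : halfDisk in 𝓝 v, (u : ℂ) ∈ e₁.source :=
      continuous_subtype_val.continuousAt.eventually_mem (e₁.open_source.mem_nhds hs₁)
    have h4 : ∀ᶠ u : halfDisk in 𝓝 v, (h u : ℂ) ∈ e₂.source :=
      (continuous_subtype_val.comp h.continuous).continuousAt.eventually_mem
        (e₂.open_source.mem_nhds hs₂)
    filter_upwards [h2.eventually hev, h3, h4] with u h5 h6 h7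
    have h8 := h5 (R.toFun u) (hf₁ u h6) (hQR u ▸ hf₂ (h u) h7)
    rw [← h8, e₂.left_inv h7]
  rw [nhds_subtype, eventually_comap] at h1
  obtain ⟨V, hV, hVo, hvV⟩ := mem_nhds_iff.1 h1
  have hW : IsOpen (e₁.source ∩ (fun u => ε * e₁ u + c) ⁻¹' e₂.target) := by
    refine ContinuousOn.isOpen_inter_preimage ?_ e₁.open_source e₂.open_target
    exact (continuousOn_const.mul e₁.continuousOn).add continuousOn_const
  refine ⟨V ∩ (e₁.source ∩ (fun u => ε * e₁ u + c) ⁻¹' e₂.target),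
    fun u => e₂.symm (ε * e₁ u + c), hVo.inter hW, ⟨hvV, hs₁, ?_⟩, ?_, ?_⟩
  · rw [mem_preimage, ← hab]
    exact e₂.map_source hs₂
  · intro u hu
    refine ContDiffAt.contDiffWithinAt ?_
    exact (he₂ _ hu.2.2).comp u ((contDiffAt_const.mul (he₁ u hu.2.1)).add contDiffAt_const)
  · intro u hu
    exact hV hu.1 u rfl

/-- `mem_marked_iff` describes the marked points topologically, in terms of the rim and of the
preimage of the boundary, and both are preserved by the homeomorphism. -/
theorem marked_iff {p₁ p₂ p₁' p₂' : P} (hx : Z.HasCoord p₁ 0 x)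
    (hy : Z.HasCoord p₂ 0 y) (hx' : Z.HasCoord p₁' 0 x') (hy' : Z.HasCoord p₂' 0 y') {h : halfDisk ≃ₜ halfDisk} (h1 : ∀ v, R.toFun v = Q.toFun (h v))
    (h2 : ∀ v, v ∈ inner ↔ h v ∈ inner) (v : halfDisk) :
    (v : ℂ) ∈ R.marked ↔ (h v : ℂ) ∈ Q.marked := by
  rw [R.mem_marked_iff (notMem_boundary_of_zero hx') (notMem_boundary_of_zero hy'),
    Q.mem_marked_iff (notMem_boundary_of_zero hx) (notMem_boundary_of_zero hy), h1,
    ← h.map_nhds_eq, frequently_map]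
  refine and_congr_right fun _ => frequently_congr (Eventually.of_forall fun u => ?_)
  rw [h1 u, h2 u]

variable {p p₁ p₂ p₁' p₂' : P} (hF : Z.Follows p σ) (hx : Z.HasCoord p₁ 0 x)
  (hy : Z.HasCoord p₂ 0 y) (hF' : Z.Follows p σ') (hx' : Z.HasCoord p₁' 0 x')
  (hy' : Z.HasCoord p₂' 0 y') (hσ : σ.length = σ'.length)
include hF hx hy hF' hx' hy' hσ

/-- By `image_inner` the image of the interior depends only on `p` and on the number of dual chords.
The chords of `Z` play no role, so polygons with different chord lists can be compared. -/
theorem exists_homeomorph_comp : ∃ h : halfDisk ≃ₜ halfDisk,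
    (∀ v, R.toFun v = Q.toFun (h v)) ∧ ∀ v, v ∈ inner ↔ h v ∈ inner := by
  have himg : R.toFun '' inner = Q.toFun '' inner := by
    rw [Q.image_inner hF hx hy, R.image_inner hF' hx' hy', hσ]
  obtain ⟨h, h1, h2⟩ := exists_homeomorph isPreconnected_inner_inter_ball dense_inner
    R.continuous Q.continuous (R.injOn_inner hF') (Q.injOn_inner hF)
    (fun _ => R.isOpen_image_inter) (fun _ => Q.isOpen_image_inter) himg R.countable_fibre
    Q.countable_fibre
  refine ⟨h, h1, fun v => ⟨h2 v, fun hv => ?_⟩⟩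
  by_contra hv'
  obtain ⟨u, hu, hu'⟩ := himg.symm.subset ⟨h v, hv, rfl⟩
  exact R.disjoint_image_inner hF' hu hv' (hu'.trans (h1 v).symm)

end Pair

theorem equivalent {x y : Z.Surface} {σ : List Z.dual.Chord} {ρ : List Z.Chord}
    (Q R : Z.Polygon Z.eta x y σ ρ) {p p₁ p₂ : P} (hF : Z.Follows p σ) (hx : Z.HasCoord p₁ 0 x)
    (hy : Z.HasCoord p₂ 0 y) : Q.Equivalent R := by
  obtain ⟨h, h1, h2⟩ := Q.exists_homeomorph_comp R hF hx hy hF hx hy rfl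
  have h3 := Q.marked_iff R hx hy hx hy h1 h2
  refine ⟨h, h1, fun v hv => ?_, fun v hv => ?_⟩
  · exact Q.smoothAt_of_comp R h h1 (v := ⟨v, hv.1⟩) hv.2 ((h3 _).not.1 hv.2)
  · refine R.smoothAt_of_comp Q h.symm (fun v => by rw [h1, h.apply_symm_apply])
      (v := ⟨v, hv.1⟩) hv.2 ?_
    rw [h3, h.apply_symm_apply]
    exact hv.2

end Polygon

end Bordered.ArcDiagram

namespace Bordered.ArcDiagram

open Complex (I)
open Set Filter Topology

/-! ## A model of the half disk -/

/-- The product of the defining functions of the circles around the points `(k + 1/2) i`. -/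
noncomputable def gapProd (n : ℕ) (x t : ℝ) : ℝ :=
  ∏ k ∈ Finset.range n, (x ^ 2 + (t - k - 1 / 2) ^ 2 - 1 / 16)

theorem gapProd_one_pos (n : ℕ) (t : ℝ) : 0 < gapProd n 1 t :=
  Finset.prod_pos fun k _ => by nlinarith [sq_nonneg (t - k - 1 / 2)]

theorem gapProd_pos {n : ℕ} {x t : ℝ} (h : ∀ k < n, 1 / 16 < x ^ 2 + (t - k - 1 / 2) ^ 2) :
    0 < gapProd n x t :=
  Finset.prod_pos fun k hk => sub_pos.2 (h k (Finset.mem_range.1 hk))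

theorem gapProd_eq_zero {n : ℕ} {x t : ℝ} : gapProd n x t = 0 ↔
    ∃ k < n, x ^ 2 + (t - k - 1 / 2) ^ 2 = 1 / 16 := by
  simp only [gapProd, Finset.prod_eq_zero_iff, Finset.mem_range, sub_eq_zero]

theorem gapProd_nonneg {n : ℕ} {w : ℂ} (h : w ∈ region n) : 0 ≤ gapProd n w.re w.im :=
  Finset.prod_nonneg fun k _ => sub_nonneg.2 (h.2.2.2.2 k)

/-- On a horizontal line to the right of the circles every factor is nonnegative and increasing.
This makes the first coordinate of `toRect` strictly increasing along the line. -/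
theorem mul_gapProd_lt {n : ℕ} {x x' t : ℝ} (h0 : 0 ≤ x) (hx : x < x')
    (h : ∀ k < n, 1 / 16 ≤ x ^ 2 + (t - k - 1 / 2) ^ 2) :
    x * gapProd n x t < x' * gapProd n x' t := by
  have h1 : x ^ 2 < x' ^ 2 := by nlinarith
  have h2 : gapProd n x t ≤ gapProd n x' t :=
    Finset.prod_le_prod (fun k hk => sub_nonneg.2 (h k (Finset.mem_range.1 hk)))
      fun k _ => by linarith
  have h3 : 0 < gapProd n x' t := gapProd_pos fun k hk => by linarith [h k hk]
  nlinarith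

theorem hasDerivAt_gapProd (n : ℕ) (x t : ℝ) : HasDerivAt (fun x => gapProd n x t)
    (∑ k ∈ Finset.range n, (∏ j ∈ (Finset.range n).erase k,
      (x ^ 2 + (t - j - 1 / 2) ^ 2 - 1 / 16)) * (2 * x)) x := by
  have h := HasDerivAt.fun_finsetProd (u := Finset.range n) (x := x)
    (f := fun (k : ℕ) (x : ℝ) => x ^ 2 + (t - k - 1 / 2) ^ 2 - 1 / 16)
    (f' := fun _ => 2 * x) fun k _ => by
      have := ((hasDerivAt_pow 2 x).add_const ((t - k - 1 / 2) ^ 2)).sub_const (1 / 16)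
      simpa using this
  simpa only [smul_eq_mul, gapProd] using h

/-- All terms of the product rule are nonnegative. Off the circles the term `gapProd` is positive.
On a circle its own factor has derivative `2 * x`, while the other factors are positive because the
circles are disjoint; `hc` excludes the corners, where `x = 0`. -/
theorem mul_gapProd_deriv_pos {n : ℕ} {x t : ℝ} (h0 : 0 ≤ x)
    (h : ∀ k < n, 1 / 16 ≤ x ^ 2 + (t - k - 1 / 2) ^ 2)
    (hc : ∀ k < n, x = 0 → (t - k - 1 / 2) ^ 2 ≠ 1 / 16) :
    ∃ c, 0 < c ∧ HasDerivAt (fun x => x * gapProd n x t) c x := by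
  refine ⟨_, ?_, (hasDerivAt_id x).mul (hasDerivAt_gapProd n x t)⟩
  have h1 : 0 ≤ gapProd n x t :=
    Finset.prod_nonneg fun k hk => sub_nonneg.2 (h k (Finset.mem_range.1 hk))
  have hterm : ∀ k ∈ Finset.range n, 0 ≤ (∏ j ∈ (Finset.range n).erase k,
      (x ^ 2 + (t - j - 1 / 2) ^ 2 - 1 / 16)) * (2 * x) := fun k _ =>
    mul_nonneg (Finset.prod_nonneg fun j hj =>
      sub_nonneg.2 (h j (Finset.mem_range.1 (Finset.mem_of_mem_erase hj)))) (by linarith)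
  simp only [id, one_mul]
  rcases h1.lt_or_eq with h2 | h2
  · have := mul_nonneg h0 (Finset.sum_nonneg hterm)
    linarith
  · obtain ⟨k, hk, hkx⟩ := gapProd_eq_zero.1 h2.symm
    have hx : 0 < x := lt_of_le_of_ne h0 fun h3 => hc k hk h3.symm (by
      rw [← h3] at hkx
      linarith)
    rw [← h2, zero_add]
    refine mul_pos hx (Finset.sum_pos' hterm ⟨k, Finset.mem_range.2 hk, ?_⟩)
    refine mul_pos (Finset.prod_pos fun j hj => ?_) (by linarith)
    have hjk := Finset.ne_of_mem_erase hj
    have hkt : (t - k - 1 / 2) ^ 2 ≤ 1 / 16 := by nlinarith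
    have h5 : -(1 / 4) ≤ t - k - 1 / 2 ∧ t - k - 1 / 2 ≤ 1 / 4 := by
      constructor <;> nlinarith
    rcases lt_or_gt_of_ne hjk with h6 | h6
    · have : (j : ℝ) + 1 ≤ k := by exact_mod_cast h6
      nlinarith [h5.1, h5.2]
    · have : (k : ℝ) + 1 ≤ j := by exact_mod_cast h6
      nlinarith [h5.1, h5.2]

/-- A map from `region n` to a rectangle. -/
noncomputable def toRect (n : ℕ) (w : ℂ) : ℂ :=
  ⟨w.re * gapProd n w.re w.im / gapProd n 1 w.im, 2 * w.im / n - 1⟩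

/-- A map from the rectangle `[0, 1] × [-1, 1]` to the half disk. -/
noncomputable def toDisk (w : ℂ) : ℂ := ⟨w.re * √(1 - w.im ^ 2 / 2), w.im * √(1 - w.re ^ 2 / 2)⟩

/-- The rectangle `[0, 1] × [-1, 1]`. -/
def rect : Set ℂ := {w | 0 ≤ w.re ∧ w.re ≤ 1 ∧ -1 ≤ w.im ∧ w.im ≤ 1}

theorem toRect_mem {n : ℕ} (hn : 0 < n) {w : ℂ} (h : w ∈ region n) : toRect n w ∈ rect := by
  have hn' : (0 : ℝ) < n := by exact_mod_cast hn
  have h1 := gapProd_one_pos n w.im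
  refine ⟨div_nonneg (mul_nonneg h.1 (gapProd_nonneg h)) h1.le, ?_, ?_, ?_⟩
  · rw [toRect, div_le_one h1]
    rcases h.2.1.lt_or_eq with h2 | h2
    · have := mul_gapProd_lt (n := n) h.1 h2 fun k _ => h.2.2.2.2 k
      linarith
    · rw [h2, one_mul]
  · have : 0 ≤ 2 * w.im / n := div_nonneg (by linarith [h.2.2.1]) hn'.le
    simp only [toRect]
    linarith
  · have : 2 * w.im / n ≤ 2 := (div_le_iff₀ hn').2 (by linarith [h.2.2.2.1])
    simp only [toRect]
    linarith

theorem toRect_injOn {n : ℕ} (hn : 0 < n) : InjOn (toRect n) (region n) := by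
  intro w hw w' hw' h
  have hn' : (n : ℝ) ≠ 0 := by exact_mod_cast hn.ne'
  have h1 := congrArg Complex.re h
  have h2 := congrArg Complex.im h
  simp only [toRect] at h1 h2
  have h3 : w.im = w'.im := by
    field_simp at h2
    linarith
  rw [h3, div_left_inj' (gapProd_one_pos n _).ne'] at h1
  refine Complex.ext ?_ h3
  rcases lt_trichotomy w.re w'.re with h4 | h4 | h4
  · exact absurd h1 (mul_gapProd_lt hw.1 h4 fun k _ => h3 ▸ hw.2.2.2.2 k).ne
  · exact h4
  · exact absurd h1 (mul_gapProd_lt hw'.1 h4 fun k _ => hw'.2.2.2.2 k).ne'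

/-- The left end of a horizontal line in `region n`. -/
theorem exists_left_end {n : ℕ} {t : ℝ} (h0 : 0 ≤ t) (hn : t ≤ n) :
    ∃ x₀ ∈ Icc (0 : ℝ) 1, x₀ * gapProd n x₀ t = 0 ∧
      ∀ x ∈ Icc x₀ 1, (⟨x, t⟩ : ℂ) ∈ region n := by
  by_cases h : ∃ k < n, (t - k - 1 / 2) ^ 2 ≤ 1 / 16
  -- The line meets the `k`-th removed disk and starts on its circle; the other circles are too far
  -- away to matter.
  · obtain ⟨k, hk, hkt⟩ := h
    have hs : √(1 / 16 - (t - k - 1 / 2) ^ 2) ^ 2 = 1 / 16 - (t - k - 1 / 2) ^ 2 :=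
      Real.sq_sqrt (by linarith)
    have hs0 := Real.sqrt_nonneg (1 / 16 - (t - k - 1 / 2) ^ 2)
    set s := √(1 / 16 - (t - k - 1 / 2) ^ 2)
    refine ⟨s, ⟨hs0, by nlinarith [sq_nonneg (t - k - 1 / 2)]⟩, ?_, ?_⟩
    · rw [gapProd_eq_zero.2 ⟨k, hk, by rw [hs]; ring⟩, mul_zero]
    · intro x hx
      refine ⟨hs0.trans hx.1, hx.2, h0, hn, fun j => ?_⟩
      dsimp only
      have h5 : -(1 / 4) ≤ t - k - 1 / 2 ∧ t - k - 1 / 2 ≤ 1 / 4 := by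
        constructor <;> nlinarith
      have h7 : s ^ 2 ≤ x ^ 2 := by nlinarith [hx.1]
      rcases lt_trichotomy j k with h6 | h6 | h6
      · have : (j : ℝ) + 1 ≤ k := by exact_mod_cast h6
        nlinarith [h5.1, h5.2]
      · rw [h6]
        linarith
      · have : (k : ℝ) + 1 ≤ j := by exact_mod_cast h6
        nlinarith [h5.1, h5.2]
  · push Not at h
    refine ⟨0, by simp, by simp, fun x hx => ⟨hx.1, hx.2, h0, hn, fun k => ?_⟩⟩
    dsimp only
    rcases Nat.lt_or_ge k n with h6 | h6
    · have := h k h6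
      nlinarith [sq_nonneg x]
    · have : (n : ℝ) ≤ k := by exact_mod_cast h6
      nlinarith [sq_nonneg x]

/-- The height determines the horizontal line; along it the first coordinate runs continuously from
`0` at the left end to `1`. -/
theorem exists_toRect {n : ℕ} (hn : 0 < n) {v : ℂ} (hv : v ∈ rect) :
    ∃ w ∈ region n, toRect n w = v := by
  have hn' : (0 : ℝ) < n := by exact_mod_cast hn
  obtain ⟨h1, h2, h3, h4⟩ := hv
  set t : ℝ := n * (v.im + 1) / 2 with ht
  have ht0 : 0 ≤ t := by
    have := mul_nonneg hn'.le (by linarith : 0 ≤ v.im + 1)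
    linarith
  have htn : t ≤ n := by nlinarith
  obtain ⟨x₀, hx₀, hz, hreg⟩ := exists_left_end ht0 htn
  have hB := gapProd_one_pos n t
  have hcont : ContinuousOn (fun x => x * gapProd n x t / gapProd n 1 t) (Icc x₀ 1) := by
    unfold gapProd
    fun_prop
  have hmem := intermediate_value_Icc hx₀.2 hcont
  have : v.re ∈ Icc (x₀ * gapProd n x₀ t / gapProd n 1 t) (1 * gapProd n 1 t / gapProd n 1 t) := by
    rw [hz, zero_div, one_mul, div_self hB.ne']
    exact ⟨h1, h2⟩
  obtain ⟨x, hx, hxv⟩ := hmem this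
  refine ⟨⟨x, t⟩, hreg x hx, Complex.ext hxv ?_⟩
  simp only [toRect, ht]
  field_simp
  ring

/-- This factorization shows that exactly the edges with `re = 1` or `im = ±1` of the rectangle are
mapped to the unit circle. -/
theorem toDisk_norm {w : ℂ} (hw : w ∈ rect) :
    ‖toDisk w‖ ^ 2 = 1 - (1 - w.re ^ 2) * (1 - w.im ^ 2) := by
  obtain ⟨h1, h2, h3, h4⟩ := hw
  rw [Complex.sq_norm, Complex.normSq_apply, toDisk]
  have h5 : √(1 - w.im ^ 2 / 2) ^ 2 = 1 - w.im ^ 2 / 2 := Real.sq_sqrt (by nlinarith)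
  have h6 : √(1 - w.re ^ 2 / 2) ^ 2 = 1 - w.re ^ 2 / 2 := Real.sq_sqrt (by nlinarith)
  linear_combination w.re ^ 2 * h5 + w.im ^ 2 * h6

theorem toDisk_mem {w : ℂ} (hw : w ∈ rect) : toDisk w ∈ halfDisk := by
  have h := toDisk_norm hw
  obtain ⟨h1, h2, h3, h4⟩ := hw
  refine ⟨mul_nonneg h1 (Real.sqrt_nonneg _), ?_⟩
  rw [← abs_of_nonneg (norm_nonneg (toDisk w)), ← sq_le_one_iff_abs_le_one, h]
  have : 0 ≤ (1 - w.re ^ 2) * (1 - w.im ^ 2) := mul_nonneg (by nlinarith) (by nlinarith)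
  linarith

theorem sq_le_one_of_mem {s : ℝ} (h : -1 ≤ s) (h' : s ≤ 1) : s ^ 2 ≤ 1 := by nlinarith

theorem sq_sqrt_of_mem {s : ℝ} (h : -1 ≤ s) (h' : s ≤ 1) :
    √(1 - s ^ 2 / 2) ^ 2 = 1 - s ^ 2 / 2 :=
  Real.sq_sqrt (by linarith [sq_le_one_of_mem h h'])

theorem sqrt_pos_of_rect {s : ℝ} (h : -1 ≤ s) (h' : s ≤ 1) : 0 < √(1 - s ^ 2 / 2) :=
  Real.sqrt_pos.2 (by nlinarith)

/-- The two equations differ by `a - b = a' - b'`. If `a ≠ a'`, substitution gives `a + b' = 2 = a'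
+ b`, which forces all four numbers to be `1`. -/
theorem eq_of_squares {a b a' b' : ℝ} (ha : a ≤ 1) (hb : b ≤ 1) (ha' : a' ≤ 1) (hb' : b' ≤ 1)
    (e₁ : a * (1 - b / 2) = a' * (1 - b' / 2)) (e₂ : b * (1 - a / 2) = b' * (1 - a' / 2)) :
    a = a' ∧ b = b' := by
  have f1 : a - a' = b - b' := by linarith
  have f2 : (a - a') * (2 - (a + b')) = 0 := by linear_combination 2 * e₁ - a * f1
  have f3 : (a - a') * (2 - (a' + b)) = 0 := by linear_combination 2 * e₁ - a' * f1
  have f4 : a = a' := by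
    rcases mul_eq_zero.1 f2 with f | f
    · linarith
    · rcases mul_eq_zero.1 f3 with g | g
      · linarith
      · linarith
  exact ⟨f4, by linarith⟩

theorem toDisk_injOn : InjOn toDisk rect := by
  intro w hw w' hw' h
  obtain ⟨a1, a2, a3, a4⟩ := hw
  obtain ⟨b1, b2, b3, b4⟩ := hw'
  have h1 := congrArg Complex.re h
  have h2 := congrArg Complex.im h
  simp only [toDisk] at h1 h2
  have p1 := sqrt_pos_of_rect a3 a4
  have p2 := sqrt_pos_of_rect (by linarith : -1 ≤ w.re) a2
  have p3 := sqrt_pos_of_rect b3 b4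
  have p4 := sqrt_pos_of_rect (by linarith : -1 ≤ w'.re) b2
  have s1 : √(1 - w.im ^ 2 / 2) ^ 2 = 1 - w.im ^ 2 / 2 := sq_sqrt_of_mem a3 a4
  have s2 : √(1 - w.re ^ 2 / 2) ^ 2 = 1 - w.re ^ 2 / 2 := sq_sqrt_of_mem (by linarith) a2
  have s3 : √(1 - w'.im ^ 2 / 2) ^ 2 = 1 - w'.im ^ 2 / 2 := sq_sqrt_of_mem b3 b4
  have s4 : √(1 - w'.re ^ 2 / 2) ^ 2 = 1 - w'.re ^ 2 / 2 := sq_sqrt_of_mem (by linarith) b2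
  have e1 : w.re ^ 2 * (1 - w.im ^ 2 / 2) = w'.re ^ 2 * (1 - w'.im ^ 2 / 2) := by
    rw [← s1, ← s3, ← mul_pow, ← mul_pow, h1]
  have e2 : w.im ^ 2 * (1 - w.re ^ 2 / 2) = w'.im ^ 2 * (1 - w'.re ^ 2 / 2) := by
    rw [← s2, ← s4, ← mul_pow, ← mul_pow, h2]
  have c1 : w.re ^ 2 ≤ 1 := sq_le_one_of_mem (by linarith) a2
  have c2 : w.im ^ 2 ≤ 1 := sq_le_one_of_mem a3 a4
  have c3 : w'.re ^ 2 ≤ 1 := sq_le_one_of_mem (by linarith) b2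
  have c4 : w'.im ^ 2 ≤ 1 := sq_le_one_of_mem b3 b4
  have key := eq_of_squares (a := w.re ^ 2) (a' := w'.re ^ 2) c1 c2 c3 c4 e1 e2
  have hre : w.re = w'.re := (sq_eq_sq₀ a1 b1).1 key.1
  refine Complex.ext hre ?_
  rw [hre] at h2
  exact mul_right_cancel₀ p4.ne' h2

/-- For the squares `a`, `b` of the coordinates sought, the equations are `a (1 - b/2) = (re v)²`
and `b (1 - a/2) = (im v)²`. Their difference is `a - b = d`, so one equation in `a` remains; the
sign of the imaginary part is chosen at the end. -/
theorem exists_toDisk {v : ℂ} (hv : v ∈ halfDisk) : ∃ w ∈ rect, toDisk w = v := by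
  have hAB : v.re ^ 2 + v.im ^ 2 ≤ 1 := by
    have h1 := Complex.sq_norm v
    rw [Complex.normSq_apply] at h1
    nlinarith [hv.2, norm_nonneg v]
  set d := v.re ^ 2 - v.im ^ 2 with hd
  have hA := sq_nonneg v.re
  have hB := sq_nonneg v.im
  have hcont : Continuous fun a : ℝ => a * (1 - (a - d) / 2) := by fun_prop
  -- The interval expresses that both `a` and `b = a - d` lie in `[0, 1]`. The intermediate value
  -- theorem applies since `(re v)² + (im v)² ≤ 1`.
  obtain ⟨a, ha, haA⟩ : ∃ a ∈ Icc (max 0 d) (min 1 (1 + d)), a * (1 - (a - d) / 2) = v.re ^ 2 := by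
    have hle : max 0 d ≤ min 1 (1 + d) := by
      simp only [max_le_iff, le_min_iff]
      refine ⟨⟨?_, ?_⟩, ?_, ?_⟩ <;> linarith
    refine intermediate_value_Icc hle hcont.continuousOn ⟨?_, ?_⟩
    · rcases le_total 0 d with h | h
      · rw [max_eq_right h]; linarith
      · rw [max_eq_left h]; linarith
    · rcases le_total 0 d with h | h
      · rw [min_eq_left (by linarith)]; linarith
      · rw [min_eq_right (by linarith)]; linarith
  have ha0 : 0 ≤ a := (le_max_left _ _).trans ha.1
  have had : 0 ≤ a - d := sub_nonneg.2 ((le_max_right _ _).trans ha.1)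
  have ha1 : a ≤ 1 := ha.2.trans (min_le_left _ _)
  have hb1 : a - d ≤ 1 := by linarith [ha.2.trans (min_le_right _ _)]
  have hsa : √a ≤ 1 := Real.sqrt_le_one.2 ha1
  have hsb : √(a - d) ≤ 1 := Real.sqrt_le_one.2 hb1
  have key : ∀ s : ℝ, s ^ 2 = 1 → (⟨√a, s * √(a - d)⟩ : ℂ) ∈ rect ∧
      (toDisk ⟨√a, s * √(a - d)⟩).re = v.re ∧
      (toDisk ⟨√a, s * √(a - d)⟩).im = s * |v.im| := by
    intro s hs
    have hss : s = 1 ∨ s = -1 := by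
      rcases mul_eq_zero.1 (show (s - 1) * (s + 1) = 0 by linear_combination hs) with f | f
      · exact Or.inl (by linarith)
      · exact Or.inr (by linarith)
    refine ⟨⟨Real.sqrt_nonneg _, hsa, ?_, ?_⟩, ?_, ?_⟩
    · rcases hss with rfl | rfl <;> simp only <;> linarith [Real.sqrt_nonneg (a - d)]
    · rcases hss with rfl | rfl <;> simp only <;> linarith [Real.sqrt_nonneg (a - d)]
    · simp only [toDisk]
      rw [mul_pow, hs, one_mul, Real.sq_sqrt had, ← Real.sqrt_mul ha0, haA, Real.sqrt_sq hv.1]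
    · simp only [toDisk]
      rw [Real.sq_sqrt ha0, mul_assoc, ← Real.sqrt_mul had,
        show (a - d) * (1 - a / 2) = v.im ^ 2 by linear_combination haA - hd, Real.sqrt_sq_eq_abs]
  rcases le_total 0 v.im with h | h
  · obtain ⟨k1, k2, k3⟩ := key 1 (by norm_num)
    exact ⟨_, k1, Complex.ext k2 (by rw [k3, abs_of_nonneg h, one_mul])⟩
  · obtain ⟨k1, k2, k3⟩ := key (-1) (by norm_num)
    exact ⟨_, k1, Complex.ext k2 (by rw [k3, abs_of_nonpos h]; ring)⟩

/-- The map from `region n` to the half disk. -/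
noncomputable def flatten (n : ℕ) (w : ℂ) : ℂ := toDisk (toRect n w)

theorem flatten_mem {n : ℕ} (hn : 0 < n) {w : ℂ} (h : w ∈ region n) : flatten n w ∈ halfDisk :=
  toDisk_mem (toRect_mem hn h)

theorem contDiffAt_mk {f g : ℂ → ℝ} {a : ℂ} (hf : ContDiffAt ℝ ∞ f a) (hg : ContDiffAt ℝ ∞ g a) :
    ContDiffAt ℝ ∞ (fun w => (⟨f w, g w⟩ : ℂ)) a :=
  Complex.equivRealProdCLM.symm.contDiff.contDiffAt.comp a (hf.prodMk hg)

theorem contDiffAt_re (a : ℂ) : ContDiffAt ℝ ∞ Complex.re a :=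
  Complex.reCLM.contDiff.contDiffAt

theorem contDiffAt_im (a : ℂ) : ContDiffAt ℝ ∞ Complex.im a :=
  Complex.imCLM.contDiff.contDiffAt

theorem contDiffAt_toRect (n : ℕ) (a : ℂ) : ContDiffAt ℝ ∞ (toRect n) a := by
  have h : ∀ {f : ℂ → ℝ}, ContDiffAt ℝ ∞ f a → ContDiffAt ℝ ∞ (fun w => gapProd n (f w) w.im) a :=
    fun hf => contDiffAt_prod fun k _ => (((hf.pow 2).add
      ((((contDiffAt_im a).sub contDiffAt_const).sub contDiffAt_const).pow 2)).sub contDiffAt_const)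
  exact contDiffAt_mk (((contDiffAt_re a).mul (h (contDiffAt_re a))).div (h contDiffAt_const)
    (gapProd_one_pos n _).ne') (((contDiffAt_const.mul (contDiffAt_im a)).div_const _).sub
      contDiffAt_const)

theorem contDiffAt_toDisk {a : ℂ} (h : a.re ^ 2 < 2) (h' : a.im ^ 2 < 2) :
    ContDiffAt ℝ ∞ toDisk a := by
  have key : ∀ {f : ℂ → ℝ}, ContDiffAt ℝ ∞ f a → f a ^ 2 < 2 →
      ContDiffAt ℝ ∞ (fun w => √(1 - f w ^ 2 / 2)) a := fun hf hfa =>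
    (contDiffAt_const.sub ((hf.pow 2).div_const 2)).sqrt (by linarith)
  exact contDiffAt_mk ((contDiffAt_re a).mul (key (contDiffAt_im a) h'))
    ((contDiffAt_im a).mul (key (contDiffAt_re a) h))

end Bordered.ArcDiagram

/-! ### Jacobians of the model maps, and the immersion of a strip -/

namespace Bordered.ArcDiagram

open Complex (I)
open Set Filter Topology

variable {P : Type*} {Z : ArcDiagram P}

theorem hasDerivAt_line (a d : ℂ) : HasDerivAt (fun t : ℝ => a + (t : ℂ) * d) d 0 := by
  have h1 := ((hasDerivAt_id (0 : ℝ)).ofReal_comp.mul_const d).const_add a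
  simpa using h1

theorem apply_eq_of_line {F : ℂ → ℂ} {L : ℂ →L[ℝ] ℂ} {a : ℂ} (hF : HasFDerivAt F L a)
    (φ : ℂ →L[ℝ] ℝ) {d : ℂ} {c : ℝ} (h : HasDerivAt (fun t : ℝ => φ (F (a + t * d))) c 0) :
    φ (L d) = c :=
  (hasDerivAt_comp_curve hF (hasDerivAt_line a d) (by simp) φ).unique h

/-- `toRect` preserves horizontal lines, so its differential is triangular, and only the derivative
along the line needs an argument. -/
theorem det_toRect_pos {n : ℕ} (hn : 0 < n) {w : ℂ} (hw : w ∈ region n)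
    (hc : ∀ k < n, w.re = 0 → (w.im - k - 1 / 2) ^ 2 ≠ 1 / 16) :
    0 < (fderiv ℝ (toRect n) w).det := by
  have hF : HasFDerivAt (toRect n) (fderiv ℝ (toRect n) w) w :=
    ((contDiffAt_toRect n w).differentiableAt (by simp)).hasFDerivAt
  have hn' : (0 : ℝ) < n := by exact_mod_cast hn
  obtain ⟨c, hc0, hcd⟩ := mul_gapProd_deriv_pos (n := n) hw.1 (fun k _ => hw.2.2.2.2 k) hc
  have h1 : Complex.reCLM (fderiv ℝ (toRect n) w 1) = c / gapProd n 1 w.im := by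
    refine apply_eq_of_line hF _ ?_
    have h2 : HasDerivAt (fun t : ℝ => w.re + t) 1 0 := by
      simpa using (hasDerivAt_id (0 : ℝ)).const_add w.re
    have h3 : HasDerivAt (fun x => x * gapProd n x w.im) c (w.re + 0) := by rwa [add_zero]
    have h4 := (h3.comp 0 h2).div_const (gapProd n 1 w.im)
    rw [mul_one] at h4
    refine h4.congr_of_eventuallyEq (Eventually.of_forall fun t => ?_)
    simp [toRect]
  have h2 : Complex.imCLM (fderiv ℝ (toRect n) w 1) = 0 := by
    refine apply_eq_of_line hF _ ?_
    refine (hasDerivAt_const (0 : ℝ) (2 * w.im / n - 1)).congr_of_eventuallyEq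
      (Eventually.of_forall fun t => ?_)
    simp [toRect]
  have h3 : Complex.imCLM (fderiv ℝ (toRect n) w I) = 2 / n := by
    refine apply_eq_of_line hF _ ?_
    have h4 : HasDerivAt (fun t : ℝ => 2 * (w.im + t) / n - 1) (2 * 1 / n) 0 :=
      ((((hasDerivAt_id (0 : ℝ)).const_add w.im).const_mul 2).div_const (n : ℝ)).sub_const 1
    rw [mul_one] at h4
    refine h4.congr_of_eventuallyEq (Eventually.of_forall fun t => ?_)
    simp [toRect]
  simp only [Complex.reCLM_apply, Complex.imCLM_apply] at h1 h2 h3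
  rw [clm_det, h1, h2, h3, mul_zero, sub_zero]
  exact mul_pos (div_pos hc0 (gapProd_one_pos n _)) (div_pos two_pos hn')

theorem hasDerivAt_sqrt_line {s : ℝ} (hs : s ^ 2 < 2) :
    HasDerivAt (fun t : ℝ => √(1 - (s + t) ^ 2 / 2)) (-s / (2 * √(1 - s ^ 2 / 2))) 0 := by
  have h1 : HasDerivAt (fun t : ℝ => 1 - (s + t) ^ 2 / 2) (-s) 0 := by
    have h2 := ((((hasDerivAt_id (0 : ℝ)).const_add s).pow 2).div_const 2).const_sub 1
    exact h2.congr_deriv (by simp)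
  have h3 := h1.sqrt (by simp only [add_zero]; linarith)
  simpa only [add_zero] using h3

/-- The determinant is `1 - (re² + im²)/2` divided by the product of the two square roots. Within
the rectangle it vanishes only at the two corners on the right. -/
theorem det_toDisk_pos {w : ℂ} (h : w.re ^ 2 + w.im ^ 2 < 2) :
    0 < (fderiv ℝ toDisk w).det := by
  have hx : w.re ^ 2 < 2 := by nlinarith [sq_nonneg w.im]
  have hy : w.im ^ 2 < 2 := by nlinarith [sq_nonneg w.re]
  have hF : HasFDerivAt toDisk (fderiv ℝ toDisk w) w :=
    ((contDiffAt_toDisk hx hy).differentiableAt (by simp)).hasFDerivAt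
  have hid : ∀ s : ℝ, HasDerivAt (fun t : ℝ => s + t) 1 0 := fun s => by
    simpa using (hasDerivAt_id (0 : ℝ)).const_add s
  have h1 : Complex.reCLM (fderiv ℝ toDisk w 1) = √(1 - w.im ^ 2 / 2) := by
    refine apply_eq_of_line hF _ ?_
    have h4 := (hid w.re).mul_const √(1 - w.im ^ 2 / 2)
    rw [one_mul] at h4
    refine h4.congr_of_eventuallyEq (Eventually.of_forall fun t => ?_)
    simp [toDisk]
  have h2 : Complex.imCLM (fderiv ℝ toDisk w 1) =
      w.im * (-w.re / (2 * √(1 - w.re ^ 2 / 2))) := by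
    refine apply_eq_of_line hF _ ?_
    refine ((hasDerivAt_sqrt_line hx).const_mul w.im).congr_of_eventuallyEq
      (Eventually.of_forall fun t => ?_)
    simp [toDisk]
  have h3 : Complex.imCLM (fderiv ℝ toDisk w I) = √(1 - w.re ^ 2 / 2) := by
    refine apply_eq_of_line hF _ ?_
    have h4 := (hid w.im).mul_const √(1 - w.re ^ 2 / 2)
    rw [one_mul] at h4
    refine h4.congr_of_eventuallyEq (Eventually.of_forall fun t => ?_)
    simp [toDisk]
  have h4 : Complex.reCLM (fderiv ℝ toDisk w I) =
      w.re * (-w.im / (2 * √(1 - w.im ^ 2 / 2))) := by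
    refine apply_eq_of_line hF _ ?_
    refine ((hasDerivAt_sqrt_line hy).const_mul w.re).congr_of_eventuallyEq
      (Eventually.of_forall fun t => ?_)
    simp [toDisk]
  simp only [Complex.reCLM_apply, Complex.imCLM_apply] at h1 h2 h3 h4
  rw [clm_det, h1, h2, h3, h4]
  have ha : 0 < √(1 - w.im ^ 2 / 2) := Real.sqrt_pos.2 (by linarith)
  have hb : 0 < √(1 - w.re ^ 2 / 2) := Real.sqrt_pos.2 (by linarith)
  have ha2 : √(1 - w.im ^ 2 / 2) ^ 2 = 1 - w.im ^ 2 / 2 := Real.sq_sqrt (by linarith)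
  have hb2 : √(1 - w.re ^ 2 / 2) ^ 2 = 1 - w.re ^ 2 / 2 := Real.sq_sqrt (by linarith)
  set a := √(1 - w.im ^ 2 / 2)
  set b := √(1 - w.re ^ 2 / 2)
  have h5 : a * b - w.re * (-w.im / (2 * a)) * (w.im * (-w.re / (2 * b))) =
      (1 - (w.re ^ 2 + w.im ^ 2) / 2) / (a * b) := by
    field_simp
    linear_combination 4 * b ^ 2 * ha2 + 4 * (1 - w.im ^ 2 / 2) * hb2
  rw [h5]
  exact div_pos (by linarith) (mul_pos ha hb)

theorem toRect_re_eq_one {n : ℕ} {w : ℂ} (hw : w ∈ region n) :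
    (toRect n w).re = 1 ↔ w.re = 1 := by
  have hB := gapProd_one_pos n w.im
  rw [toRect, div_eq_one_iff_eq hB.ne']
  constructor
  · intro h
    rcases hw.2.1.lt_or_eq with h1 | h1
    · have := mul_gapProd_lt (n := n) hw.1 h1 fun k _ => hw.2.2.2.2 k
      linarith
    · exact h1
  · intro h
    rw [h, one_mul]

theorem toRect_re_eq_zero {n : ℕ} {w : ℂ} : (toRect n w).re = 0 ↔
    w.re = 0 ∨ ∃ k < n, w.re ^ 2 + (w.im - k - 1 / 2) ^ 2 = 1 / 16 := by
  simp only [toRect, div_eq_zero_iff, (gapProd_one_pos n w.im).ne', or_false, mul_eq_zero,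
    gapProd_eq_zero]

/-- The corners of `region n` at which `flatten n` is not an immersion. -/
def Corner (n : ℕ) (w : ℂ) : Prop :=
  (∃ k < n, w.re = 0 ∧ (w.im - k - 1 / 2) ^ 2 = 1 / 16) ∨ w.re = 1 ∧ (w.im = 0 ∨ w.im = n)

/-- The sum of squares equals `2` only at the right corners of the rectangle, which are the images
of the right corners of the strip. -/
theorem toRect_sq_lt {n : ℕ} (hn : 0 < n) {w : ℂ} (hw : w ∈ region n) (hc : ¬ Corner n w) :
    (toRect n w).re ^ 2 + (toRect n w).im ^ 2 < 2 := by
  have hn' : (0 : ℝ) < n := by exact_mod_cast hn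
  obtain ⟨h1, h2, h3, h4⟩ := toRect_mem hn hw
  have h5 := sq_le_one_of_mem h3 h4
  rcases h2.lt_or_eq with h6 | h6
  · nlinarith
  · have h7 : w.re = 1 := (toRect_re_eq_one hw).1 h6
    rw [h6]
    have h8 : (toRect n w).im ^ 2 ≠ 1 := by
      intro h8
      refine hc (Or.inr ⟨h7, ?_⟩)
      have h9 : ((toRect n w).im - 1) * ((toRect n w).im + 1) = 0 := by linear_combination h8
      have h10 : (toRect n w).im = 2 * w.im / n - 1 := rfl
      rw [h10] at h9
      rcases mul_eq_zero.1 h9 with h | h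
      · right
        field_simp at h
        linarith
      · left
        field_simp at h
        linarith
    have := lt_of_le_of_ne h5 h8
    linarith

/-- `flatten n` is locally a diffeomorphism away from the corners. -/
theorem exists_flatten_diffeo {n : ℕ} (hn : 0 < n) {w : ℂ} (hw : w ∈ region n)
    (hc : ¬ Corner n w) : ∃ e : OpenPartialHomeomorph ℂ ℂ, w ∈ e.source ∧ ⇑e = flatten n ∧
      (∀ a ∈ e.target, ContDiffAt ℝ ∞ e.symm a) ∧
      0 < (fderiv ℝ e.symm (flatten n w)).det := by
  set V : Set ℂ := {w | (toRect n w).re ^ 2 < 2 ∧ (toRect n w).im ^ 2 < 2} with hV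
  have hcont : Continuous (toRect n) :=
    continuous_iff_continuousAt.2 fun a => (contDiffAt_toRect n a).continuousAt
  have hVo : IsOpen V :=
    (isOpen_lt ((Complex.continuous_re.comp hcont).pow 2) continuous_const).inter
      (isOpen_lt ((Complex.continuous_im.comp hcont).pow 2) continuous_const)
  have hlt := toRect_sq_lt hn hw hc
  have hwV : w ∈ V := ⟨by nlinarith [sq_nonneg (toRect n w).im],
    by nlinarith [sq_nonneg (toRect n w).re]⟩
  have hsm : ∀ a ∈ V, ContDiffAt ℝ ∞ (flatten n) a := fun a ha =>
    (contDiffAt_toDisk ha.1 ha.2).comp a (contDiffAt_toRect n a)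
  have hdet : 0 < (fderiv ℝ (flatten n) w).det := by
    have h1 : fderiv ℝ (flatten n) w =
        (fderiv ℝ toDisk (toRect n w)).comp (fderiv ℝ (toRect n) w) :=
      fderiv_comp w ((contDiffAt_toDisk hwV.1 hwV.2).differentiableAt (by simp))
        ((contDiffAt_toRect n w).differentiableAt (by simp))
    rw [h1]
    have h2 := mul_pos (det_toDisk_pos hlt) (det_toRect_pos hn hw fun k hk h0 h => hc
      (Or.inl ⟨k, hk, h0, h⟩))
    exact h2.trans_eq (LinearMap.det_comp _ _).symm
  obtain ⟨e, hwe, heV, he, hes⟩ := exists_openPartialHomeomorph hVo hwV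
    (fun a ha => (hsm a ha).contDiffWithinAt) hdet
  refine ⟨e, hwe, he, hes, ?_⟩
  have hwt : flatten n w ∈ e.target := he ▸ e.map_source hwe
  have h1 : HasFDerivAt e (fderiv ℝ e w) w := by
    rw [he]
    exact ((hsm w hwV).differentiableAt (by simp)).hasFDerivAt
  have h2 : HasFDerivAt e.symm (fderiv ℝ e.symm (flatten n w)) (e w) := by
    rw [he]
    exact ((hes _ hwt).differentiableAt (by simp)).hasFDerivAt
  -- The chain rule for the identity makes the two determinants inverse to each other, so the
  -- inverse map preserves the orientation too.
  have h3 : HasFDerivAt (fun u => e.symm (e u)) (ContinuousLinearMap.id ℝ ℂ) w := by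
    refine (hasFDerivAt_id w).congr_of_eventuallyEq ?_
    filter_upwards [e.open_source.mem_nhds hwe] with u hu using e.left_inv hu
  have h4 := (h2.comp w h1).unique h3
  have h5 : (fderiv ℝ e.symm (flatten n w)).det * (fderiv ℝ e w).det = 1 := by
    have h6 := congrArg ContinuousLinearMap.det h4
    have h7 : (ContinuousLinearMap.id ℝ ℂ).det = 1 := LinearMap.det_id
    rw [h7] at h6
    exact (LinearMap.det_comp _ _).symm.trans h6
  rw [he] at h5
  exact pos_of_mul_pos_left (h5 ▸ one_pos) hdet.le

theorem continuousOn_flatten {n : ℕ} : Continuous (flatten n) := by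
  have hcont : Continuous (toRect n) :=
    continuous_iff_continuousAt.2 fun a => (contDiffAt_toRect n a).continuousAt
  have h : Continuous toDisk := by
    have h1 : Continuous fun w : ℂ => (w.re * √(1 - w.im ^ 2 / 2), w.im * √(1 - w.re ^ 2 / 2)) := by
      fun_prop
    exact Complex.equivRealProdCLM.symm.continuous.comp h1
  exact h.comp hcont

/-- The homeomorphism from `region n` to the half disk. -/
noncomputable def regionHomeo {n : ℕ} (hn : 0 < n) : region n ≃ₜ halfDisk :=
  haveI : CompactSpace (region n) := isCompact_iff_compactSpace.1 (isCompact_region n)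
  Continuous.homeoOfEquivCompactToT2
    (f := Equiv.ofBijective (fun w : region n => (⟨flatten n w, flatten_mem hn w.2⟩ : halfDisk))
      ⟨fun w w' h => Subtype.ext (toRect_injOn hn w.2 w'.2 (toDisk_injOn (toRect_mem hn w.2)
          (toRect_mem hn w'.2) (congrArg Subtype.val h))), fun v => by
        obtain ⟨r, hr, hrv⟩ := exists_toDisk v.2
        obtain ⟨w, hw, rfl⟩ := exists_toRect hn hr
        exact ⟨⟨w, hw⟩, Subtype.ext hrv⟩⟩)
    ((continuousOn_flatten.comp continuous_subtype_val).subtype_mk _)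

theorem coe_regionHomeo {n : ℕ} (hn : 0 < n) (w : region n) :
    (regionHomeo hn w : ℂ) = flatten n w := rfl

theorem flatten_symm {n : ℕ} (hn : 0 < n) (v : halfDisk) :
    flatten n ((regionHomeo hn).symm v) = v := by
  rw [← coe_regionHomeo hn, Homeomorph.apply_symm_apply]

variable (Z) in
/-- The map from the half disk to the surface which covers a strip. -/
noncomputable def stripMap (p : P) {n : ℕ} (hn : 0 < n) (v : halfDisk) : Z.Surface :=
  Z.strip p ((regionHomeo hn).symm v)

theorem continuous_stripMap (p : P) {n : ℕ} (hn : 0 < n) : Continuous (Z.stripMap p hn) :=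
  (continuousOn_iff_continuous_domRestrict.1 (continuousOn_strip p n)).comp
    (regionHomeo hn).symm.continuous

/-- In a chart of the strip the map is the smooth inverse of `flatten n` followed by a translation.
-/
theorem immersionAt_stripMap (p : P) {n : ℕ} (hn : 0 < n) {v : halfDisk}
    (hc : ¬ Corner n ((regionHomeo hn).symm v)) : Z.ImmersionAt (Z.stripMap p hn) v := by
  set w := (regionHomeo hn).symm v with hw
  obtain ⟨e, hwe, he, hes, hdet⟩ := exists_flatten_diffeo hn w.2 hc
  obtain ⟨k, hk⟩ := exists_abs_sub_lt w.2.2.2.1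
  have hv : flatten n w = v := flatten_symm hn v
  have h1 : ∀ᶠ u : halfDisk in 𝓝 v, ((regionHomeo hn).symm u : ℂ) ∈ e.source ∧
      |((regionHomeo hn).symm u : ℂ).im - k| < 3 / 4 := by
    have hcont : ContinuousAt (fun u => ((regionHomeo hn).symm u : ℂ)) v :=
      (continuous_subtype_val.comp (regionHomeo hn).symm.continuous).continuousAt
    exact hcont.eventually ((e.open_source.eventually_mem hwe).and (eventually_abs_sub_lt hk))
  rw [nhds_subtype, eventually_comap] at h1
  obtain ⟨V, hV, hVo, hvV⟩ := mem_nhds_iff.1 h1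
  have hvt : (v : ℂ) ∈ e.target := by
    rw [← hv, ← he]
    exact e.map_source hwe
  refine ⟨(Z.s ^ k) p, V ∩ e.target, fun u => e.symm u - k * I, hVo.inter e.open_target,
    ⟨hvV, hvt⟩, fun a ha => ((hes a ha.2).sub contDiffAt_const).contDiffWithinAt, ?_, ?_⟩
  · intro u hu
    obtain ⟨h2, h3⟩ := hV hu.1 u rfl
    have h4 : e.symm u = (regionHomeo hn).symm u := by
      have h5 := e.left_inv h2
      rwa [he, flatten_symm] at h5
    dsimp only
    rw [h4]
    exact strip_hasCoord p (Subtype.coe_prop _) h3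
  · rw [fderiv_sub_const, ← hv]
    exact hdet

end Bordered.ArcDiagram

namespace Bordered.ArcDiagram

open Complex (I)
open Set Filter Topology

variable {P : Type*} {Z : ArcDiagram P}

/-! ## The sides of a strip -/

theorem add_mem_region {n i : ℕ} (hi : i < n) {w : ℂ} (h : w ∈ region 1) :
    w + i * I ∈ region n := by
  obtain ⟨h1, h2, h3, h4, h5⟩ := h
  have h6 : (i : ℝ) + 1 ≤ n := by exact_mod_cast hi
  have h7 : (0 : ℝ) ≤ i := i.cast_nonneg
  simp only [Nat.cast_one] at h4
  refine ⟨by simpa, by simpa, by simp; linarith, by simp; linarith, fun k => ?_⟩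
  rcases Nat.lt_or_ge k i with h | h
  · have h8 : (k : ℝ) + 1 ≤ i := by exact_mod_cast h
    have := h5 0
    simp at this ⊢
    nlinarith
  · obtain ⟨j, rfl⟩ := Nat.exists_eq_add_of_le h
    have := h5 j
    simp at this ⊢
    convert this using 3
    ring

theorem strip_add (p : P) {n i : ℕ} (hi : i < n) {w : ℂ} (h : w ∈ region 1) :
    Z.strip p (w + i * I) = Z.strip ((Z.s ^ i) p) w := by
  obtain ⟨k, hk⟩ := exists_abs_sub_lt h.2.2.1
  have h1 := strip_hasCoord (Z := Z) ((Z.s ^ i) p) h hk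
  have h2 := strip_hasCoord (Z := Z) p (add_mem_region hi h) (k := k + i) (by
    simp only [Complex.add_im, Complex.mul_im, Complex.natCast_re, Complex.I_im, mul_one,
      Complex.natCast_im, Complex.I_re, mul_zero, add_zero, Nat.cast_add]
    rwa [add_sub_add_right_eq_sub])
  rw [pow_add, Equiv.Perm.mul_apply, show w + i * I - ((k + i : ℕ) : ℂ) * I = w - k * I by
    push_cast; ring] at h2
  exact h2.unique h1

/-- The half circles on the boundary of a strip. -/
theorem strip_image_arc (p : P) {n i : ℕ} (hi : i < n) :
    Z.strip p '' {w | w ∈ region n ∧ w.re ^ 2 + (w.im - i - 1 / 2) ^ 2 = 1 / 16} =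
      Z.innerInterval ((Z.s ^ i) p) := by
  rw [innerInterval_eq]
  ext x
  constructor
  · rintro ⟨w, ⟨hw, h⟩, rfl⟩
    have h1 : (w - i * I).re = w.re := by simp
    have h2 : (w - i * I).im = w.im - i := by simp
    obtain ⟨h3, h4⟩ := arcPoint_unique (w := w - i * I) (by rw [h1]; exact hw.1)
      (by rw [h1, h2]; exact h)
    refine ⟨_, h3, ?_⟩
    rw [innerPath, ← strip_add p hi (arcPoint_mem_region h3), h4]
    simp
  · rintro ⟨t, ht, rfl⟩
    refine ⟨arcPoint t + i * I, ⟨add_mem_region hi (arcPoint_mem_region ht), ?_⟩,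
      strip_add p hi (arcPoint_mem_region ht)⟩
    have h1 : (arcPoint t + i * I).re = (arcPoint t).re := by simp
    have h2 : (arcPoint t + i * I).im = t + i := by simp [arcPoint_im]
    rw [h1, h2, ← arcPoint_circle ht]
    ring

/-- The outer side of a strip. -/
theorem strip_image_outer (p : P) {n : ℕ} (hn : 0 < n) :
    Z.strip p '' {w | w ∈ region n ∧ w.re = 1} = ⋃ i < n, Z.outerInterval ((Z.s ^ i) p) := by
  -- Here `i = n` is admitted for the single height `0`, which is the top corner of the strip.
  have key : ∀ {i : ℕ} {w : ℂ}, i ≤ n → 0 ≤ w.im → w.im < 1 → (i = n → w.im = 0) → w.re = 1 →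
      w + i * I ∈ region n ∧ Z.nf (Z.strip p (w + i * I)) = .inl ((Z.s ^ i) p, w) := by
    intro i w hi h0 h1 h2 h3
    have hreg : w + i * I ∈ region n := by
      refine ⟨by simp [h3], by simp [h3], by simp; linarith [(i.cast_nonneg : (0 : ℝ) ≤ i)], ?_,
        fun k => by simp [h3]; nlinarith [sq_nonneg (w.im + i - k - 1 / 2)]⟩
      rcases hi.lt_or_eq with h | h
      · have : (i : ℝ) + 1 ≤ n := by exact_mod_cast h
        simp
        linarith
      · simp [h2 h, h]
    refine ⟨hreg, ?_⟩
    rw [nf_strip p hreg (by simp [h3]) (k := i) (by simpa) (by simp; linarith)]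
    simp
  ext x
  simp only [mem_iUnion, exists_prop]
  constructor
  · rintro ⟨w, ⟨hw, h⟩, rfl⟩
    obtain ⟨k, hk, hk'⟩ := exists_floor hw.2.2.1
    have hnf := nf_strip (Z := Z) p hw (by rw [h]; exact one_pos) hk hk'
    have hkn : k ≤ n := by exact_mod_cast hk.trans hw.2.2.2.1
    rcases hkn.lt_or_eq with h1 | h1
    · exact ⟨k, h1, mem_outerInterval_iff.2 (Or.inl ⟨_, hnf, by simpa using h⟩)⟩
    · refine ⟨k - 1, by omega, mem_outerInterval_iff.2 (Or.inr ?_)⟩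
      rw [hnf, ← Equiv.Perm.mul_apply, ← pow_succ', show k - 1 + 1 = k by omega]
      have h2 : w.im = k := le_antisymm (h1 ▸ hw.2.2.2.1) hk
      rw [show w - k * I = 1 from Complex.ext (by simp [h]) (by simp [h2])]
  · rintro ⟨i, hi, h⟩
    rcases mem_outerInterval_iff.1 h with ⟨w, h1, h2⟩ | h1
    · have h3 : 0 ≤ w.im ∧ w.im < 1 := by
        rcases nf_cases x with ⟨q, -, h4⟩ | ⟨q, w', -, h5, -, -, h4⟩ | ⟨q, w', h5, h4, -⟩ <;>
          rw [h1] at h4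
        · simp at h4
        · simp only [Sum.inl.injEq, Prod.mk.injEq] at h4
          rw [h4.2, h5] at h2
          exact absurd h2 zero_ne_one
        · simp only [Sum.inl.injEq, Prod.mk.injEq] at h4
          rw [h4.2]
          exact ⟨h5.2.2.1, h5.2.2.2.1⟩
      obtain ⟨h4, h5⟩ := key hi.le h3.1 h3.2 (fun h => absurd h hi.ne) h2
      exact ⟨_, ⟨h4, by simpa using h2⟩, nf_injective (h5.trans h1.symm)⟩
    · obtain ⟨h4, h5⟩ := key (i := i + 1) (w := 1) hi (by simp) (by simp) (fun _ => by simp)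
        (by simp)
      refine ⟨_, ⟨h4, by simp⟩, nf_injective (h5.trans ?_)⟩
      rw [h1, pow_succ', Equiv.Perm.mul_apply]

theorem strip_notMem_boundary (p : P) {n : ℕ} {w : ℂ} (hw : w ∈ region n) (h1 : w.re ≠ 1)
    (h2 : ∀ k < n, w.re ^ 2 + (w.im - k - 1 / 2) ^ 2 ≠ 1 / 16) : Z.strip p w ∉ Z.boundary := by
  have h3 : ∀ k : ℕ, w.re ^ 2 + (w.im - k - 1 / 2) ^ 2 ≠ 1 / 16 := by
    intro k
    rcases Nat.lt_or_ge k n with h | h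
    · exact h2 k h
    · have : (n : ℝ) ≤ k := by exact_mod_cast h
      have := hw.2.2.2.1
      nlinarith [sq_nonneg w.re]
  obtain ⟨k, hk⟩ := exists_abs_sub_lt hw.2.2.1
  rw [(strip_hasCoord p hw hk).mem_boundary_iff, BoundaryCoord]
  simp only [Complex.sub_re, Complex.mul_re, Complex.natCast_re, Complex.I_re, mul_zero,
    Complex.natCast_im, Complex.I_im, mul_one, sub_self, sub_zero, Complex.sub_im, Complex.mul_im,
    add_zero, abs_of_nonneg hw.1]
  rintro (h | h | h)
  · exact h1 h
  · exact h3 k h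
  · rcases Nat.eq_zero_or_pos k with h4 | h4
    · rw [h4, Nat.cast_zero, sub_zero] at h
      nlinarith [hw.2.2.1, sq_nonneg w.re]
    · refine h3 (k - 1) ?_
      rw [← h, Nat.cast_sub h4]
      push_cast
      ring

theorem flatten_mem_leftSide {n : ℕ} (hn : 0 < n) {w : ℂ} (hw : w ∈ region n) :
    flatten n w ∈ leftSide ↔ (toRect n w).re = 0 := by
  have h := toRect_mem hn hw
  have h1 := (sqrt_pos_of_rect h.2.2.1 h.2.2.2).ne'
  constructor
  · intro h2
    have h3 := h2.1
    rw [flatten, toDisk, mul_eq_zero] at h3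
    exact h3.resolve_right h1
  · intro h2
    exact ⟨by rw [flatten, toDisk, h2, zero_mul], (flatten_mem hn hw).2⟩

theorem flatten_im_of_left {n : ℕ} {w : ℂ} (h : (toRect n w).re = 0) :
    (flatten n w).im = 2 * w.im / n - 1 := by
  rw [flatten, toDisk, h]
  simp [toRect]

theorem flatten_mem_rightSide {n : ℕ} (hn : 0 < n) {w : ℂ} (hw : w ∈ region n) :
    flatten n w ∈ rightSide ↔ w.re = 1 ∨ w.im = 0 ∨ w.im = n := by
  have hn' : (n : ℝ) ≠ 0 := by exact_mod_cast hn.ne'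
  have h := toRect_mem hn hw
  have h1 := toDisk_norm h
  have h2 : flatten n w ∈ rightSide ↔
      (1 - (toRect n w).re ^ 2) * (1 - (toRect n w).im ^ 2) = 0 := by
    constructor
    · intro h3
      have h4 : ‖toDisk (toRect n w)‖ = 1 := h3.2
      rw [h4] at h1
      linarith
    · intro h3
      rw [h3, sub_zero, pow_eq_one_iff_of_nonneg (norm_nonneg _) two_ne_zero] at h1
      exact ⟨(flatten_mem hn hw).1, h1⟩
  have h3 : 1 - (toRect n w).re ^ 2 = 0 ↔ w.re = 1 := by
    rw [← toRect_re_eq_one hw, sub_eq_zero, eq_comm,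
      pow_eq_one_iff_of_nonneg h.1 two_ne_zero]
  have h4 : 1 - (toRect n w).im ^ 2 = 0 ↔ w.im = 0 ∨ w.im = n := by
    have h5 : 1 - (toRect n w).im ^ 2 = 4 * w.im * (n - w.im) / n ^ 2 := by
      simp only [toRect]
      field_simp
      ring
    rw [h5, div_eq_zero_iff, mul_eq_zero, sub_eq_zero]
    constructor
    · rintro ((h6 | h6) | h6)
      · exact Or.inl (by linarith)
      · exact Or.inr h6.symm
      · exact absurd h6 (pow_ne_zero 2 hn')
    · rintro (h6 | h6)
      · exact Or.inl (Or.inl (by rw [h6, mul_zero]))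
      · exact Or.inl (Or.inr h6.symm)
  rw [h2, mul_eq_zero, h3, h4]

theorem flatten_im_of_right {n : ℕ} {w : ℂ} (hw : w ∈ region n) (h : w.re = 1) :
    (flatten n w).im = (2 * w.im / n - 1) * √(1 / 2) := by
  rw [flatten, toDisk, (toRect_re_eq_one hw).2 h]
  norm_num [toRect]

/-- The points of the right side which belong to the outer side of a strip. -/
theorem right_iff {n : ℕ} (hn : 0 < n) {w : ℂ} (hw : w ∈ region n) :
    flatten n w ∈ rightSide ∧ -√(1 / 2) ≤ (flatten n w).im ∧ (flatten n w).im ≤ √(1 / 2) ↔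
      w.re = 1 := by
  have hn' : (0 : ℝ) < n := by exact_mod_cast hn
  have h := toRect_mem hn hw
  have hs : 0 < √(1 / 2 : ℝ) := Real.sqrt_pos.2 (by norm_num)
  constructor
  · rintro ⟨h1, h2, h3⟩
    by_contra h4
    have h5 := ((flatten_mem_rightSide hn hw).1 h1).resolve_left h4
    have h6 : (toRect n w).re < 1 := lt_of_le_of_ne h.2.1 ((toRect_re_eq_one hw).not.2 h4)
    -- The right edge of the rectangle goes to the part of the circle with `|im| ≤ √(1 / 2)`. On the
    -- horizontal edges `|im|` is larger, with equality only at the corners; this explains the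
    -- position of the marked points.
    have h7 : √(1 / 2) < √(1 - (toRect n w).re ^ 2 / 2) :=
      Real.sqrt_lt_sqrt (by norm_num) (by nlinarith [h.1])
    have h8 : (flatten n w).im = (toRect n w).im * √(1 - (toRect n w).re ^ 2 / 2) := rfl
    rcases h5 with h5 | h5
    · have h9 : (toRect n w).im = -1 := by simp [toRect, h5]
      rw [h8, h9] at h2
      linarith
    · have h9 : (toRect n w).im = 1 := by
        simp only [toRect, h5]
        field_simp
        norm_num
      rw [h8, h9] at h3
      linarith
  · intro h1
    refine ⟨(flatten_mem_rightSide hn hw).2 (Or.inl h1), ?_⟩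
    rw [flatten_im_of_right hw h1]
    have h2 : -1 ≤ 2 * w.im / n - 1 ∧ 2 * w.im / n - 1 ≤ 1 := h.2.2
    constructor <;> nlinarith [h2.1, h2.2]

/-! ## Existence of polygons -/

/-- The marked points on the left side. -/
noncomputable def leftMark (n j : ℕ) : ℂ := leftPoint (2 * ((j : ℝ) / 2 + 1 / 4) / n - 1)

theorem leftMark_im (n j : ℕ) : (leftMark n j).im = 2 * ((j : ℝ) / 2 + 1 / 4) / n - 1 :=
  leftPoint_im _

theorem leftMark_mem {n j : ℕ} (h : j < 2 * n) : leftMark n j ∈ leftSide := by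
  have h1 : (j : ℝ) + 1 ≤ 2 * n := by exact_mod_cast h
  have h2 : (0 : ℝ) ≤ j := j.cast_nonneg
  have hn : (0 : ℝ) < n := by linarith
  refine leftPoint_mem ⟨?_, ?_⟩
  · have : 0 ≤ 2 * ((j : ℝ) / 2 + 1 / 4) / n := by positivity
    linarith
  · have : 2 * ((j : ℝ) / 2 + 1 / 4) / n ≤ 2 := (div_le_iff₀ hn).2 (by linarith)
    linarith

/-- The numbers `j / 2 + 1 / 4` are the heights of the ends of the half circles, two in each
hexagon, and `2 * t / n - 1` is the position on the left side which corresponds to the height `t`.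
-/
theorem leftMark_le {n : ℕ} (hn : 0 < n) {j : ℕ} {t : ℝ} :
    (leftMark n j).im ≤ 2 * t / n - 1 ↔ (j : ℝ) / 2 + 1 / 4 ≤ t := by
  have hn' : (0 : ℝ) < n := by exact_mod_cast hn
  rw [leftMark_im, sub_le_sub_iff_right, div_le_div_iff_of_pos_right hn',
    mul_le_mul_iff_right₀ two_pos]

theorem le_leftMark {n : ℕ} (hn : 0 < n) {j : ℕ} {t : ℝ} :
    2 * t / n - 1 ≤ (leftMark n j).im ↔ t ≤ (j : ℝ) / 2 + 1 / 4 := by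
  have hn' : (0 : ℝ) < n := by exact_mod_cast hn
  rw [leftMark_im, sub_le_sub_iff_right, div_le_div_iff_of_pos_right hn',
    mul_le_mul_iff_right₀ two_pos]

/-- The marked points on the right side. -/
noncomputable def rightMark (j : ℕ) : ℂ := rightPoint (if j = 0 then -√(1 / 2) else √(1 / 2))

theorem sqrt_half_le : √(1 / 2 : ℝ) ≤ 1 := Real.sqrt_le_one.2 (by norm_num)

theorem rightMark_mem (j : ℕ) : rightMark j ∈ rightSide := by
  have h := Real.sqrt_nonneg (1 / 2 : ℝ)
  refine rightPoint_mem ?_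
  split_ifs
  · exact ⟨by linarith [sqrt_half_le], by linarith⟩
  · exact ⟨by linarith, sqrt_half_le⟩

/-- The left chords of a strip. -/
theorem left_iff {n : ℕ} (hn : 0 < n) {i : ℕ} (hi : i < n) {w : ℂ} (hw : w ∈ region n) :
    flatten n w ∈ between leftSide (leftMark n (2 * i)) (leftMark n (2 * i + 1)) ↔
      w.re ^ 2 + (w.im - i - 1 / 2) ^ 2 = 1 / 16 := by
  have h0 := hw.2.2.2.2 i
  constructor
  · rintro ⟨h1, h2, h3⟩
    have h4 := (flatten_mem_leftSide hn hw).1 h1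
    rw [flatten_im_of_left h4, leftMark_le hn] at h2
    rw [flatten_im_of_left h4, le_leftMark hn] at h3
    push_cast at h2 h3
    rcases toRect_re_eq_zero.1 h4 with h5 | ⟨k, hk, h5⟩
    · rw [h5] at h0 ⊢
      nlinarith
    · have h6 : k = i := by
        by_contra h6
        rcases lt_or_gt_of_ne h6 with h7 | h7
        · have : (k : ℝ) + 1 ≤ i := by exact_mod_cast h7
          nlinarith [sq_nonneg w.re]
        · have : (i : ℝ) + 1 ≤ k := by exact_mod_cast h7
          nlinarith [sq_nonneg w.re]
      rwa [h6] at h5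
  · intro h
    have h4 : (toRect n w).re = 0 := toRect_re_eq_zero.2 (Or.inr ⟨i, hi, h⟩)
    have h5 : (w.im - i - 1 / 2) ^ 2 ≤ 1 / 16 := by nlinarith [sq_nonneg w.re]
    refine ⟨(flatten_mem_leftSide hn hw).2 h4, ?_, ?_⟩
    · rw [flatten_im_of_left h4, leftMark_le hn]
      push_cast
      nlinarith
    · rw [flatten_im_of_left h4, le_leftMark hn]
      push_cast
      nlinarith

/-- The images of the corners are marked. -/
theorem flatten_corner {n : ℕ} (hn : 0 < n) {w : ℂ} (hw : w ∈ region n) (hc : Corner n w) :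
    (∃ j < 2 * n, flatten n w = leftMark n j) ∨ ∃ j < 2, flatten n w = rightMark j := by
  have hn' : (n : ℝ) ≠ 0 := by exact_mod_cast hn.ne'
  rcases hc with ⟨k, hk, h0, h1⟩ | ⟨h0, h1⟩
  · left
    have h2 : (toRect n w).re = 0 := toRect_re_eq_zero.2 (Or.inl h0)
    have h3 : flatten n w ∈ leftSide := (flatten_mem_leftSide hn hw).2 h2
    have h4 : (w.im - (k + 1 / 4)) * (w.im - (k + 3 / 4)) = 0 := by linear_combination h1
    rcases mul_eq_zero.1 h4 with h5 | h5
    · refine ⟨2 * k, by omega, leftSide_ext h3 (leftMark_mem (by omega)) ?_⟩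
      rw [flatten_im_of_left h2, leftMark_im, sub_eq_zero.1 h5]
      push_cast
      ring
    · refine ⟨2 * k + 1, by omega, leftSide_ext h3 (leftMark_mem (by omega)) ?_⟩
      rw [flatten_im_of_left h2, leftMark_im, sub_eq_zero.1 h5]
      push_cast
      ring
  · right
    have h3 : flatten n w ∈ rightSide := (flatten_mem_rightSide hn hw).2 (Or.inl h0)
    rcases h1 with h1 | h1
    · refine ⟨0, by omega, rightSide_ext h3 (rightMark_mem 0) ?_⟩
      rw [flatten_im_of_right hw h0, rightMark, rightPoint_im, h1]
      simp
    · refine ⟨1, by omega, rightSide_ext h3 (rightMark_mem 1) ?_⟩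
      rw [flatten_im_of_right hw h0, rightMark, rightPoint_im, h1]
      field_simp
      norm_num

end Bordered.ArcDiagram

/-! ### The polygon carried by a strip -/

namespace Bordered.ArcDiagram

open Complex (I)
open Set Filter Topology

variable {P : Type*} {Z : ArcDiagram P}

/-- The long chord which starts at `p` and consists of `n` intervals. -/
def longChord (p : P) (n : ℕ) (hn : 0 < n) (h : ∀ i < n, ¬ Z.z ((Z.s ^ i) p)) : Z.Chord where
  start := p
  len := n
  pos := hn
  avoid := h

theorem natCast_mul_I_mem_region (n : ℕ) : (n * I : ℂ) ∈ region n := by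
  refine ⟨by simp, by simp, by simp, by simp, fun k => ?_⟩
  have h2 : (n * I : ℂ).re = 0 := by simp
  have h3 : (n * I : ℂ).im = n := by simp
  rw [h2, h3]
  rcases Nat.lt_or_ge k n with h | h
  · have : (k : ℝ) + 1 ≤ n := by exact_mod_cast h
    nlinarith
  · have : (n : ℝ) ≤ k := by exact_mod_cast h
    nlinarith

theorem hasCoord_strip_nat (p : P) (n : ℕ) : Z.HasCoord ((Z.s ^ n) p) 0 (Z.strip p (n * I)) := by
  have h2 := strip_hasCoord (Z := Z) p (natCast_mul_I_mem_region n) (k := n) (by simp)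
  rwa [sub_self] at h2

theorem stripMap_eq (p : P) {n : ℕ} (hn : 0 < n) {v : halfDisk} {w : ℂ} (hw : w ∈ region n)
    (h : (v : ℂ) = flatten n w) : Z.stripMap p hn v = Z.strip p w := by
  have h1 : v = regionHomeo hn ⟨w, hw⟩ := Subtype.ext h
  rw [stripMap, h1, Homeomorph.symm_apply_apply]

/-- The images under `stripMap` of subsets of the half disk. -/
theorem stripMap_image (p : P) {n : ℕ} (hn : 0 < n) {A : Set ℂ} {R : ℂ → Prop}
    (h : ∀ w ∈ region n, flatten n w ∈ A ↔ R w) :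
    Z.stripMap p hn '' {v | (v : ℂ) ∈ A} = Z.strip p '' {w | w ∈ region n ∧ R w} := by
  ext x
  constructor
  · rintro ⟨v, hv, rfl⟩
    have hw := ((regionHomeo hn).symm v).2
    refine ⟨_, ⟨hw, (h _ hw).1 ?_⟩, rfl⟩
    rw [flatten_symm]
    exact hv
  · rintro ⟨w, ⟨hw, hR⟩, rfl⟩
    exact ⟨⟨flatten n w, flatten_mem hn hw⟩, (h w hw).2 hR, stripMap_eq p hn hw rfl⟩

theorem toDisk_corner {s : ℝ} : toDisk ⟨0, s⟩ = s * I := by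
  apply Complex.ext <;> simp [toDisk]

variable {p : P} {σ : List Z.dual.Chord}

/-- The polygon which covers a strip. -/
noncomputable def stripPolygon (hF : Z.Follows p σ) (hn : 0 < σ.length) {x y : Z.Surface}
    (hx : Z.HasCoord p 0 x) (hy : Z.HasCoord ((Z.s ^ σ.length) p) 0 y) :
    Z.Polygon Z.eta x y σ [longChord p σ.length hn hF.avoid] where
  toFun := Z.stripMap p hn
  p j := leftMark σ.length j
  q j := rightMark j
  continuous := continuous_stripMap p hn
  p_mem j := leftMark_mem j.2
  q_mem j := rightMark_mem j
  p_mono i j hij := by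
    have h1 : (0 : ℝ) < σ.length := by exact_mod_cast hn
    have h2 : ((i : ℕ) : ℝ) < (j : ℕ) := by exact_mod_cast hij
    simp only [leftMark_im]
    gcongr
  q_mono i j hij := by
    have h1 : 0 < √(1 / 2 : ℝ) := Real.sqrt_pos.2 (by norm_num)
    have h2 : (i : ℕ) = 0 := by
      have h3 : (i : ℕ) < (j : ℕ) := hij
      have h4 : (j : ℕ) < 2 := j.2
      omega
    have h3 : (j : ℕ) ≠ 0 := by
      have h3 : (i : ℕ) < (j : ℕ) := hij
      omega
    simp only [rightMark, rightPoint_im, h2, h3, if_true, if_false]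
    linarith
  left v hv := by
    have hw := ((regionHomeo hn).symm v).2
    rw [← flatten_symm hn v, flatten_mem_leftSide hn hw] at hv
    -- The left side of the half disk corresponds to the left axis, which lies on dual arcs,
    -- together with the half circles, which lie on the inner boundary.
    rcases toRect_re_eq_zero.1 hv with h | ⟨k, hk, h⟩
    · left
      obtain ⟨k, hk⟩ := exists_abs_sub_lt hw.2.2.1
      exact mem_iUnion.2 ⟨_, _, _, rfl, by simpa using h, strip_hasCoord p hw hk⟩
    · right
      refine innerInterval_subset ((Z.s ^ k) p) ?_
      rw [← strip_image_arc p hk]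
      exact ⟨_, ⟨hw, h⟩, rfl⟩
  right v hv := by
    have hw := ((regionHomeo hn).symm v).2
    rw [← flatten_symm hn v, flatten_mem_rightSide hn hw] at hv
    rcases hv with h | h
    · right
      have h1 : Z.stripMap p hn v ∈ ⋃ i < σ.length, Z.outerInterval ((Z.s ^ i) p) := by
        rw [← strip_image_outer p hn]
        exact ⟨_, ⟨hw, h⟩, rfl⟩
      simp only [mem_iUnion] at h1
      obtain ⟨i, -, h2⟩ := h1
      exact outerInterval_subset _ h2
    -- The bottom and top of the strip have integral height, so they lie on arcs.
    · left
      obtain ⟨k, hk⟩ : ∃ k : ℕ, ((regionHomeo hn).symm v : ℂ).im = k := by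
        rcases h with h | h
        · exact ⟨0, by simpa using h⟩
        · exact ⟨_, h⟩
      exact mem_iUnion.2 ⟨_, _, _, rfl, by simp [hk], strip_hasCoord p hw (k := k) (by simp [hk])⟩
  immersion := by
    rintro v ⟨hv, hvm⟩
    refine immersionAt_stripMap p hn (v := ⟨v, hv⟩) fun hc => hvm ?_
    rcases flatten_corner hn ((regionHomeo hn).symm ⟨v, hv⟩).2 hc with ⟨j, hj, h⟩ | ⟨j, hj, h⟩
    · rw [flatten_symm] at h
      exact Or.inl ⟨⟨j, hj⟩, h.symm⟩
    · rw [flatten_symm] at h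
      exact Or.inr ⟨⟨j, hj⟩, h.symm⟩
  start v hv := by
    have h0 : (0 : ℂ) ∈ region σ.length := by
      refine ⟨by simp, by simp, by simp, by simp, fun k => ?_⟩
      have : (0 : ℝ) ≤ k := k.cast_nonneg
      simp
      nlinarith
    rw [stripMap_eq p hn h0]
    · have h1 := hasCoord_strip_nat (Z := Z) p 0
      simp only [pow_zero, Equiv.Perm.coe_one, id, Nat.cast_zero, zero_mul] at h1
      exact h1.unique hx
    · rw [hv, flatten, show toRect σ.length 0 = ⟨0, -1⟩ from by simp [toRect], toDisk_corner]
      simp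
  terminal v hv := by
    have h1 : (0 : ℝ) < σ.length := by exact_mod_cast hn
    rw [stripMap_eq p hn (natCast_mul_I_mem_region _)]
    · exact (hasCoord_strip_nat (Z := Z) p σ.length).unique hy
    · rw [hv, flatten, show toRect σ.length (σ.length * I) = ⟨0, 1⟩ from Complex.ext (by simp [toRect])
        (by simp [toRect]; field_simp; norm_num), toDisk_corner]
      simp
  left_chord i := by
    rw [hF.image, ← strip_image_arc p i.2]
    exact stripMap_image p hn fun w hw => left_iff hn i.2 hw
  right_chord i := by
    obtain rfl : i = ⟨0, by simp⟩ := Fin.ext (Nat.lt_one_iff.1 i.2)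
    change _ = ⋃ i < σ.length, Z.outerInterval ((Z.s ^ i) p)
    rw [← strip_image_outer p hn]
    refine stripMap_image p hn fun w hw => (and_congr_right fun _ => ?_).trans (right_iff hn hw)
    simp [rightMark, rightPoint_im]
  interior v hl hr := by
    have hw := ((regionHomeo hn).symm v).2
    refine strip_notMem_boundary p hw (fun h => ?_) fun k hk h => ?_
    · refine hr ⟨0, by simp⟩ ?_
      have h1 := (right_iff hn hw).2 h
      rw [flatten_symm] at h1
      refine ⟨h1.1, ?_⟩
      simpa [rightMark, rightPoint_im] using h1.2
    · refine hl ⟨k, hk⟩ ?_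
      have h1 := (left_iff hn hk hw).2 h
      rwa [flatten_symm] at h1

end Bordered.ArcDiagram

namespace Bordered.ArcDiagram

open Complex (I)
open Set Filter Topology

variable {P : Type*} {Z : ArcDiagram P}

/-! ## Chords are determined by their images -/

theorem outerMid_mem : (1 + I / 2 : ℂ) ∈ chartDomain := by
  rw [mem_chartDomain]
  norm_num

variable (Z) in
/-- The middle of an outer interval. -/
noncomputable def outerMid (q : P) : Z.Surface := Z.chart q ⟨1 + I / 2, outerMid_mem⟩

theorem outerMid_mem_iff {q q' : P} : Z.outerMid q ∈ Z.outerInterval q' ↔ q = q' := by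
  have h : Z.nf (Z.outerMid q) = .inl (q, 1 + I / 2) := by
    rw [outerMid, nf_chart, normal_right (by simp) (by simp)]
  rw [mem_outerInterval_iff, h]
  constructor
  · rintro (⟨w, h1, -⟩ | h1)
    · simp only [Sum.inl.injEq, Prod.mk.injEq] at h1
      exact h1.1
    · simp at h1
  · rintro rfl
    exact Or.inl ⟨_, rfl, by simp⟩

theorem outerMid_mem_chordImage {q : P} {ρ : Z.Chord} :
    Z.outerMid q ∈ Z.chordImage ρ ↔ ∃ i < ρ.len, q = (Z.s ^ i) ρ.start := by
  simp only [chordImage, mem_iUnion, outerMid_mem_iff, exists_prop]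

/-- The middles of the outer intervals recover the set of intervals of a chord. If the first
interval of `ρ` were a later one of `ρ'`, the interval before it would belong to `ρ` too and the run
of `ρ` would close up. If one chord were longer, its extra interval would repeat an earlier one.
Both contradict `pow_injOn`. -/
theorem chordImage_injective : Function.Injective (Z.chordImage) := by
  intro ρ ρ' h
  have key : ∀ {ρ ρ' : Z.Chord}, Z.chordImage ρ = Z.chordImage ρ' → ∀ i < ρ.len,
      ∃ j < ρ'.len, (Z.s ^ i) ρ.start = (Z.s ^ j) ρ'.start := fun {ρ ρ'} h i hi => by
    rw [← outerMid_mem_chordImage, ← h, outerMid_mem_chordImage]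
    exact ⟨i, hi, rfl⟩
  have hstart : ρ.start = ρ'.start := by
    obtain ⟨i, hi, h1⟩ := key h 0 ρ.pos
    rw [pow_zero, Equiv.Perm.coe_one, id] at h1
    rcases Nat.eq_zero_or_pos i with h2 | h2
    · rw [h1, h2, pow_zero, Equiv.Perm.coe_one, id]
    · obtain ⟨j, hj, h3⟩ := key h.symm (i - 1) (by omega)
      have h4 : (Z.s ^ (j + 1)) ρ.start = (Z.s ^ 0) ρ.start := by
        rw [pow_succ', Equiv.Perm.mul_apply, ← h3, ← Equiv.Perm.mul_apply, ← pow_succ',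
          show i - 1 + 1 = i by omega, ← h1, pow_zero, Equiv.Perm.coe_one, id]
      have := pow_injOn ρ.avoid (show j + 1 ≤ ρ.len from hj) (Nat.zero_le _) h4
      omega
  have hlen : ∀ {ρ ρ' : Z.Chord}, Z.chordImage ρ = Z.chordImage ρ' → ρ.start = ρ'.start →
      ¬ ρ.len < ρ'.len := fun {ρ ρ'} h hs hlt => by
    obtain ⟨j, hj, h1⟩ := key h.symm _ hlt
    rw [← hs] at h1
    exact hj.ne' (pow_injOn ρ.avoid le_rfl hj.le h1)
  exact Chord.ext hstart (le_antisymm (not_lt.1 (hlen h.symm hstart.symm))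
    (not_lt.1 (hlen h hstart)))

/-! ## The number of polygons -/

namespace Polygon

variable {x y : Z.Surface} {σ : List Z.dual.Chord} {ρ : List Z.Chord}
  (Q : Z.Polygon Z.eta x y σ ρ) {p : P} (hF : Z.Follows p σ)
include hF

theorem mem_outer_iff {v : halfDisk} :
    (∃ q, Q.toFun v ∈ Z.outerInterval q) ↔ ∃ i, (v : ℂ) ∈ Q.rightSegment i := by
  constructor
  · rintro ⟨q, hq⟩
    rcases Q.mem_boundary_iff.1 (outerInterval_subset q hq) with ⟨i, hi⟩ | h
    · have h1 := Q.image_leftSegment hi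
      rw [hF.image] at h1
      exact (inner_disjoint_outer h1 hq).elim
    · exact h
  · rintro ⟨i, hi⟩
    have h1 := Q.image_rightSegment hi
    simp only [chordImage, mem_iUnion] at h1
    obtain ⟨j, -, hj⟩ := h1
    exact ⟨_, hj⟩

/-- If the preimage of the outer boundary is connected, then there is exactly one chord of `Z`. -/
theorem exists_eq_singleton (hA : IsPreconnected {v | ∃ q, Q.toFun v ∈ Z.outerInterval q})
    (hne : {v | ∃ q, Q.toFun v ∈ Z.outerInterval q}.Nonempty) :
    ∃ ρ₀, ρ = [ρ₀] ∧ Z.chordImage ρ₀ = Q.toFun '' {v | ∃ q, Q.toFun v ∈ Z.outerInterval q} := by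
  have h1 : ρ.length = 1 := by
    refine le_antisymm ?_ ?_
    · by_contra h2
      have h3 : 1 < ρ.length := not_le.1 h2
      have hmem : ∀ j : Fin (2 * ρ.length), ∃ v : halfDisk, (v : ℂ) = Q.q j ∧
          v ∈ {v | ∃ q, Q.toFun v ∈ Z.outerInterval q} := fun j =>
        ⟨⟨Q.q j, rightSide_subset (Q.q_mem j)⟩, rfl,
          (Q.mem_outer_iff hF).2 (Q.q_mem_rightSegment j)⟩
      obtain ⟨u, hu, hu'⟩ := hmem ⟨1, by omega⟩
      obtain ⟨u', hu1, hu1'⟩ := hmem ⟨2, by omega⟩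
      have hlt : (Q.q ⟨1, by omega⟩).im < (Q.q ⟨2, by omega⟩).im :=
        Q.q_mono (show (⟨1, _⟩ : Fin (2 * ρ.length)) < ⟨2, _⟩ by simp)
      obtain ⟨t, ht⟩ := exists_between hlt
      -- With two chords, connectedness would place a point of the outer boundary at a height
      -- strictly between the end of one segment and the start of the next.
      have h4 := (hA.image (fun v : halfDisk => (v : ℂ).im)
        (Complex.continuous_im.comp continuous_subtype_val).continuousOn).Icc_subset
        (mem_image_of_mem _ hu') (mem_image_of_mem _ hu1')
      rw [hu, hu1] at h4
      obtain ⟨v, hv, rfl⟩ := h4 ⟨ht.1.le, ht.2.le⟩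
      obtain ⟨i, -, h5, h6⟩ := (Q.mem_outer_iff hF).1 hv
      have h7 := Q.q_mono.lt_iff_lt.1 (ht.1.trans_le h6)
      have h8 := Q.q_mono.lt_iff_lt.1 (h5.trans_lt ht.2)
      rw [Fin.lt_def] at h7 h8
      dsimp only at h7 h8
      omega
    · obtain ⟨v, hv⟩ := hne
      obtain ⟨i, -⟩ := (Q.mem_outer_iff hF).1 hv
      exact i.pos
  obtain ⟨ρ₀, rfl⟩ := List.length_eq_one_iff.1 h1
  refine ⟨ρ₀, rfl, ?_⟩
  have h2 := Q.right_chord ⟨0, by simp⟩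
  refine h2.symm.trans (congrArg _ ?_)
  ext v
  rw [mem_ofPred_eq, mem_ofPred_eq, Q.mem_outer_iff hF]
  constructor
  · exact fun h => ⟨_, h⟩
  · rintro ⟨i, hi⟩
    obtain rfl : i = ⟨0, by simp⟩ := Fin.ext (Nat.lt_one_iff.1 i.2)
    exact hi

include Q in
-- The homeomorphism to the strip polygon carries the preimage of the outer boundary to a single arc
-- of the rim. So this preimage is connected and there is one chord, which has the same image as the
-- long chord.
theorem eq_longChord (hx : Z.HasCoord p 0 x) {p₂ : P} (hy : Z.HasCoord p₂ 0 y)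
    (hn : 0 < σ.length) : ρ = [longChord p σ.length hn hF.avoid] := by
  have hy' := Q.hasCoord_terminal hF hx hy
  set R := stripPolygon hF hn hx hy'
  obtain ⟨h, h1, -⟩ := R.exists_homeomorph_comp Q hF hx hy hF hx hy rfl
  set B : Set halfDisk := {v | ∃ q, R.toFun v ∈ Z.outerInterval q} with hB
  have hA : {v | ∃ q, Q.toFun v ∈ Z.outerInterval q} = h.symm '' B := by
    ext v
    rw [Homeomorph.image_symm, mem_preimage, hB, mem_ofPred_eq, mem_ofPred_eq, h1]
  have hB' : B = {v : halfDisk | (v : ℂ) ∈ R.rightSegment ⟨0, by simp⟩} := by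
    ext v
    rw [hB, mem_ofPred_eq, mem_ofPred_eq, R.mem_outer_iff hF]
    constructor
    · rintro ⟨i, hi⟩
      obtain rfl : i = ⟨0, by simp⟩ := Fin.ext (Nat.lt_one_iff.1 i.2)
      exact hi
    · exact fun h => ⟨_, h⟩
  have hBc : IsPreconnected B := by
    have h2 : B = rightCurve '' Icc (R.q ⟨0, by simp⟩).im (R.q ⟨1, by simp⟩).im := by
      rw [hB']
      ext v
      constructor
      · rintro ⟨h3, h4, h5⟩
        exact ⟨_, ⟨h4, h5⟩, rightCurve_of_mem h3⟩
      · rintro ⟨t, ht, rfl⟩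
        have h3 : t ∈ Icc (-1 : ℝ) 1 :=
          ⟨(im_le_one (rightSide_subset (R.q_mem _))).1.trans ht.1,
            ht.2.trans (im_le_one (rightSide_subset (R.q_mem _))).2⟩
        refine ⟨rightCurve_mem t, ?_⟩
        rw [rightCurve_im h3]
        exact ht
    rw [h2]
    exact isPreconnected_Icc.image _ continuous_rightCurve.continuousOn
  have hBne : B.Nonempty := by
    have h2 := R.q_mem_rightSegment ⟨0, by simp⟩
    exact ⟨⟨R.q ⟨0, by simp⟩, rightSide_subset (R.q_mem _)⟩, (R.mem_outer_iff hF).2 h2⟩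
  obtain ⟨ρ₀, rfl, h2⟩ := Q.exists_eq_singleton hF
    (hA ▸ hBc.image _ h.symm.continuous.continuousOn) (hA ▸ hBne.image _)
  have h3 : Z.chordImage (longChord p σ.length hn hF.avoid) = R.toFun '' B := by
    rw [hB']
    exact (R.right_chord ⟨0, by simp⟩).symm
  congr 1
  apply chordImage_injective
  rw [h2, h3, hA, image_image]
  refine image_congr fun v _ => ?_
  rw [h1, h.apply_symm_apply]

end Polygon

variable {x y : Z.Surface} {σ : List Z.dual.Chord} {ρ : List Z.Chord} {p p₂ : P}

theorem polygonCount_eq_one (hF : Z.Follows p σ) (hn : 0 < σ.length) (hx : Z.HasCoord p 0 x)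
    (hy : Z.HasCoord ((Z.s ^ σ.length) p) 0 y) :
    Z.polygonCount Z.eta x y σ [longChord p σ.length hn hF.avoid] = 1 := by
  have h : Nat.card (Quot (Polygon.Equivalent (Z := Z) (β := Z.eta) (x := x) (y := y) (σ := σ)
      (ρ := [longChord p σ.length hn hF.avoid]))) = 1 := by
    rw [Nat.card_eq_one_iff_unique]
    refine ⟨⟨fun a b => ?_⟩, ⟨Quot.mk _ (stripPolygon hF hn hx hy)⟩⟩
    induction a using Quot.ind
    induction b using Quot.ind
    exact Quot.sound (Polygon.equivalent _ _ hF hx hy)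
  rw [polygonCount, h, Nat.cast_one]

theorem polygonCount_eq_zero (hF : Z.Follows p σ) (hx : Z.HasCoord p 0 x) (hy : Z.HasCoord p₂ 0 y)
    (h : ¬ ∃ hn : 0 < σ.length, Z.HasCoord ((Z.s ^ σ.length) p) 0 y ∧
      ρ = [longChord p σ.length hn hF.avoid]) :
    Z.polygonCount Z.eta x y σ ρ = 0 := by
  have h1 : IsEmpty (Z.Polygon Z.eta x y σ ρ) := ⟨fun Q => by
    have hn := Q.length_pos hF hx hy
    exact h ⟨hn, Q.hasCoord_terminal hF hx hy, Q.eq_longChord hF hx hy hn⟩⟩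
  have h2 : IsEmpty (Quot (Polygon.Equivalent (Z := Z) (β := Z.eta) (x := x) (y := y) (σ := σ)
      (ρ := ρ))) := ⟨fun a => by
    induction a using Quot.ind with | _ a => exact h1.false a⟩
  rw [polygonCount, Nat.card_of_isEmpty, Nat.cast_zero]

end Bordered.ArcDiagram

namespace Bordered

/-! ### Maps induced on tensor products over the ground ring -/

section KTensorMap
variable {ι : Type*} [Fintype ι] [DecidableEq ι]
  {A M N : Type*} [AddCommGroup A] [Module F2 A] [KBimodule ι A]
  [AddCommGroup M] [Module F2 M] [KBimodule ι M] [AddCommGroup N] [Module F2 N] [KBimodule ι N]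

theorem KTensor.left_tmul (i : ι) (v : A) (w : M) :
    KBimodule.left i (KTensor.mk ι A M (v ⊗ₜ w)) = KTensor.mk ι A M (KBimodule.left i v ⊗ₜ w) :=
  KTensor.left_mk ι A M i v w

theorem KTensor.right_tmul (i : ι) (v : A) (w : M) :
    KBimodule.right i (KTensor.mk ι A M (v ⊗ₜ w)) = KTensor.mk ι A M (v ⊗ₜ KBimodule.right i w) :=
  KTensor.right_mk ι A M i v w

variable (A) in
/-- The map `A ⊗_k M → A ⊗_k N` induced by a map `M → N`. -/
noncomputable def KTensor.mapRight (f : M →ₗ[F2] N) : KTensor ι A M →ₗ[F2] KTensor ι A N :=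
  KTensor.mk ι A N ∘ₗ f.lTensor A ∘ₗ KTensor.unpack ι A M

theorem KTensor.mapRight_mk {f : M →ₗ[F2] N}
    (hf : ∀ (i : ι) x, f (KBimodule.left i x) = KBimodule.left i (f x)) (a : A) (x : M) :
    KTensor.mapRight A f (KTensor.mk ι A M (a ⊗ₜ x)) = KTensor.mk ι A N (a ⊗ₜ f x) := by
  simp only [mapRight, LinearMap.comp_apply, unpack_mk, map_sum, LinearMap.lTensor_tmul, hf,
    mk_right_tmul, KBimodule.left_left, if_true]
  rw [← map_sum, ← TensorProduct.tmul_sum, KBimodule.sum_left]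

end KTensorMap

/-! ### Invariance of the structure equations under isomorphism -/

section Transport
variable {ι : Type*} [Fintype ι] [DecidableEq ι]
  {A B M N : Type*} [Ring A] [Algebra F2 A] [KAlgebra ι A] [Ring B] [Algebra F2 B] [KAlgebra ι B]
  [AddCommGroup M] [Module F2 M] [KBimodule ι M] [AddCommGroup N] [Module F2 N] [KBimodule ι N]

/-- `mulδ` inserts the idempotents twice through `unpack`. If `δ` is left linear, those in the outer
tensor product can be moved into `δ` and summed to `1`. -/
theorem mulδ_mk (D : DAMap ι A M B) (hD : ∀ (i : ι) x t,
      D.δ (KBimodule.left i x) t = KBimodule.left i (D.δ x t)) (t : T B) (a : A) (x : M) :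
    D.mulδ t (KTensor.mk ι A M (a ⊗ₜ x)) = KTensor.mk ι A M
      ((TensorProduct.lift (LinearMap.mul F2 A)).rTensor M
        ((TensorProduct.assoc F2 A A M).symm (a ⊗ₜ KTensor.unpack ι A M (D.δ x t)))) := by
  have key : ∀ (i : ι) (b : A) (u : A ⊗[F2] M),
      (TensorProduct.lift (LinearMap.mul F2 A)).rTensor M
        ((TensorProduct.assoc F2 A A M).symm (KBimodule.right i b ⊗ₜ u)) =
      (TensorProduct.lift (LinearMap.mul F2 A)).rTensor M
        ((TensorProduct.assoc F2 A A M).symm (b ⊗ₜ (KBimodule.left (ι := ι) i).rTensor M u)) := by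
    intro i b u
    induction u with
    | zero => simp
    | add u v hu hv => simp only [TensorProduct.tmul_add, map_add, hu, hv]
    | tmul c y =>
      simp only [TensorProduct.assoc_symm_tmul, LinearMap.rTensor_tmul, TensorProduct.lift.tmul,
        LinearMap.mul_apply']
      congr 1
      exact mul_assoc _ _ _
  have hun : ∀ (i : ι) (u : KTensor ι A M), (KBimodule.left (ι := ι) i).rTensor M
      (KTensor.unpack ι A M u) = KTensor.unpack ι A M (KBimodule.left i u) := by
    intro i u
    refine KTensor.ext_apply ι (f := (KBimodule.left (ι := ι) i).rTensor M ∘ₗ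
      KTensor.unpack ι A M) (g := KTensor.unpack ι A M ∘ₗ KBimodule.left i) (fun v w => ?_) u
    simp only [LinearMap.comp_apply, KTensor.left_tmul, KTensor.unpack_mk, map_sum,
      LinearMap.rTensor_tmul, KBimodule.left_right]
  simp only [DAMap.mulδ, LinearMap.comp_apply, KTensor.unpack_mk, map_sum,
    LinearMap.lTensor_tmul, LinearMap.flip_apply, LinearEquiv.coe_coe, key, hun, ← hD,
    KBimodule.left_left, if_true]
  rw [← map_sum, ← map_sum, ← map_sum, ← TensorProduct.tmul_sum, ← map_sum, ← LinearMap.sum_apply,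
    ← map_sum, KBimodule.sum_left]

theorem DAMap.mulδ_mapRight {D : DAMap ι A M B} {E : DAMap ι A N B} {f : M →ₗ[F2] N}
    (hf : ∀ (i : ι) x, f (KBimodule.left i x) = KBimodule.left i (f x))
    (hD : ∀ (i : ι) x t, D.δ (KBimodule.left i x) t = KBimodule.left i (D.δ x t))
    (hE : ∀ (i : ι) x t, E.δ (KBimodule.left i x) t = KBimodule.left i (E.δ x t))
    (h : ∀ x t, E.δ (f x) t = KTensor.mapRight A f (D.δ x t)) (t : T B) (y : KTensor ι A M) :
    E.mulδ t (KTensor.mapRight A f y) = KTensor.mapRight A f (D.mulδ t y) := by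
  refine KTensor.ext_apply ι (f := E.mulδ t ∘ₗ KTensor.mapRight A f)
    (g := KTensor.mapRight A f ∘ₗ D.mulδ t) (fun a x => ?_) y
  simp only [LinearMap.comp_apply]
  rw [KTensor.mapRight_mk hf, mulδ_mk E hE, mulδ_mk D hD, h]
  generalize D.δ x t = u
  refine KTensor.ext_apply ι
    (f := KTensor.mk ι A N ∘ₗ (TensorProduct.lift (LinearMap.mul F2 A)).rTensor N ∘ₗ
      (TensorProduct.assoc F2 A A N).symm.toLinearMap ∘ₗ TensorProduct.mk F2 A (A ⊗[F2] N) a ∘ₗ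
      KTensor.unpack ι A N ∘ₗ KTensor.mapRight A f)
    (g := KTensor.mapRight A f ∘ₗ KTensor.mk ι A M ∘ₗ
      (TensorProduct.lift (LinearMap.mul F2 A)).rTensor M ∘ₗ
      (TensorProduct.assoc F2 A A M).symm.toLinearMap ∘ₗ TensorProduct.mk F2 A (A ⊗[F2] M) a ∘ₗ
      KTensor.unpack ι A M) (fun c z => ?_) u
  simp only [LinearMap.comp_apply, KTensor.mapRight_mk hf, KTensor.unpack_mk, map_sum,
    TensorProduct.mk_apply, LinearEquiv.coe_coe, TensorProduct.assoc_symm_tmul,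
    LinearMap.rTensor_tmul, TensorProduct.lift.tmul, LinearMap.mul_apply', hf]

/-- The structure equations of a type `DA` bimodule are invariant under isomorphisms. -/
theorem DAIso.isTypeDA {D : DAMap ι A M B} {E : DAMap ι A N B} (F : DAIso D E)
    (hE : E.IsTypeDA) : D.IsTypeDA := by
  set Θ : M →ₗ[F2] N := F.toEquiv.toLinearMap
  have hl : ∀ (i : ι) x, Θ (KBimodule.left i x) = KBimodule.left i (Θ x) := F.map_left
  have hr : ∀ (i : ι) x, Θ (KBimodule.right i x) = KBimodule.right i (Θ x) := F.map_right
  have hl' : ∀ (i : ι) x, F.toEquiv.symm (KBimodule.left i x) =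
      KBimodule.left i (F.toEquiv.symm x) := fun i x => by
    rw [LinearEquiv.symm_apply_eq, F.map_left, LinearEquiv.apply_symm_apply]
  have hδ : ∀ x t, KTensor.mapRight A Θ (D.δ x t) = E.δ (Θ x) t := fun x t => (F.map_δ x t).symm
  -- All equations for `D` may now be checked after applying the injective map induced by `Θ`, where
  -- they become equations for `E`.
  have hinj : Function.Injective (KTensor.mapRight (ι := ι) A Θ) := by
    refine Function.LeftInverse.injective
      (g := KTensor.mapRight (ι := ι) A F.toEquiv.symm.toLinearMap) fun u => ?_
    refine KTensor.ext_apply ι (f := KTensor.mapRight A F.toEquiv.symm.toLinearMap ∘ₗ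
      KTensor.mapRight A Θ) (g := LinearMap.id) (fun a x => ?_) u
    rw [LinearMap.comp_apply, KTensor.mapRight_mk hl, KTensor.mapRight_mk hl']
    simp [Θ]
  have hL : ∀ (i : ι) u, KTensor.mapRight A Θ (KBimodule.left i u) =
      KBimodule.left i (KTensor.mapRight A Θ u) := fun i u => by
    refine KTensor.ext_apply ι (f := KTensor.mapRight A Θ ∘ₗ KBimodule.left i)
      (g := KBimodule.left i ∘ₗ KTensor.mapRight A Θ) (fun a x => ?_) u
    simp only [LinearMap.comp_apply, KTensor.left_tmul, KTensor.mapRight_mk hl]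
  have hR : ∀ (i : ι) u, KTensor.mapRight A Θ (KBimodule.right i u) =
      KBimodule.right i (KTensor.mapRight A Θ u) := fun i u => by
    refine KTensor.ext_apply ι (f := KTensor.mapRight A Θ ∘ₗ KBimodule.right i)
      (g := KBimodule.right i ∘ₗ KTensor.mapRight A Θ) (fun a x => ?_) u
    simp only [LinearMap.comp_apply, KTensor.right_tmul, KTensor.mapRight_mk hl, hr]
  have hD : ∀ (i : ι) x t, D.δ (KBimodule.left i x) t = KBimodule.left i (D.δ x t) :=
    fun i x t => hinj (by rw [hδ, hl, hE.left_linear, hL, hδ])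
  refine ⟨hD, fun i x => hinj ?_, fun i x t b => hinj ?_, fun i x b t => hinj ?_,
    fun i x t b c t' => hinj ?_, fun x bs => hinj ?_⟩
  · rw [hδ, hr, hE.right_linear_nil, hR, hδ]
  · rw [hδ, hE.right_linear, hR, hδ]
  · rw [hδ, hr, hE.balanced_nil, hδ]
  · rw [hδ, hE.balanced, hδ]
  · have h : ∀ t y, KTensor.mapRight A Θ (D.mulδ t y) = E.mulδ t (KTensor.mapRight A Θ y) :=
      fun t y => (DAMap.mulδ_mapRight hl hD hE.left_linear (fun x t => (hδ x t).symm) t y).symm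
    simp only [map_add, map_sum, h, hδ, map_zero]
    exact hE.structure_eq (Θ x) bs

end Transport

/-! ### The identity bimodule satisfies the structure equations -/

section Identity
variable {ι : Type*} [Fintype ι] [DecidableEq ι] {A : Type*} [Ring A] [Algebra F2 A]
  [KAlgebra ι A]

/-- `ιInv` is the second component of the homomorphism to the trivial square zero extension, whose
product obeys the Leibniz rule. It follows that `ιInv` kills all words of length other than one. -/
theorem ιInv_mul (s t : T A) : TensorAlgebra.ιInv (s * t) =
    TensorAlgebra.algebraMapInv s • TensorAlgebra.ιInv t +
      TensorAlgebra.algebraMapInv t • TensorAlgebra.ιInv s := by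
  let : Module F2ᵐᵒᵖ A := Module.compHom _ ((RingHom.id F2).fromOpposite mul_comm)
  have : IsCentralScalar F2 A := ⟨fun r m => rfl⟩
  have h : ∀ t : T A, (TensorAlgebra.toTrivSqZeroExt t).fst = TensorAlgebra.algebraMapInv t := by
    intro t
    have : (TrivSqZeroExt.fstHom F2 F2 A).comp TensorAlgebra.toTrivSqZeroExt =
        TensorAlgebra.algebraMapInv := by
      ext; simp [TensorAlgebra.algebraMapInv]
    exact DFunLike.congr_fun this t
  change (TensorAlgebra.toTrivSqZeroExt (s * t)).snd = _
  rw [map_mul, TrivSqZeroExt.snd_mul, h, h, op_smul_eq_smul]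
  rfl

theorem ιInv_one : TensorAlgebra.ιInv (1 : T A) = 0 := by
  have h := ιInv_mul (1 : T A) 1
  rw [map_one, one_smul, mul_one] at h
  exact left_eq_add.1 h

theorem algebraMapInv_ι (b : A) : TensorAlgebra.algebraMapInv (TensorAlgebra.ι F2 b) = 0 := by
  simp [TensorAlgebra.algebraMapInv]

theorem ιInv_mul_ι (t : T A) (b : A) :
    TensorAlgebra.ιInv (t * TensorAlgebra.ι F2 b) = TensorAlgebra.algebraMapInv t • b := by
  rw [ιInv_mul, algebraMapInv_ι, zero_smul, add_zero, TensorAlgebra.ι_leftInverse]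

theorem ιInv_ι_mul (t : T A) (b : A) :
    TensorAlgebra.ιInv (TensorAlgebra.ι F2 b * t) = TensorAlgebra.algebraMapInv t • b := by
  rw [ιInv_mul, algebraMapInv_ι, zero_smul, zero_add, TensorAlgebra.ι_leftInverse]

theorem ιInv_ι_mul_ι_mul (t : T A) (b c : A) : TensorAlgebra.ιInv
    (TensorAlgebra.ι F2 b * (TensorAlgebra.ι F2 c * t)) = 0 := by
  rw [ιInv_ι_mul, map_mul, algebraMapInv_ι, zero_mul, zero_smul]

theorem groundMap_mul (x y : ι → F2) :
    groundMap ι A (x * y) = groundMap ι A x * groundMap ι A y := by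
  have hc := KAlgebra.complete (ι := ι) (A := A)
  simp only [groundMap, Fintype.linearCombination_apply, Finset.sum_mul, Finset.mul_sum,
    smul_mul_smul_comm, hc.mul_eq]
  simp [Pi.mul_apply]

theorem groundMap_single (i : ι) : groundMap ι A (Pi.single i 1) = KAlgebra.e i := by
  simp [groundMap]

theorem groundMap_one : groundMap ι A 1 = 1 := by
  simpa [groundMap, Fintype.linearCombination_apply] using
    (KAlgebra.complete (ι := ι) (A := A)).complete

theorem identityDA_δ (x : ι → F2) (t : T A) : (identityDA ι A).δ x t =
    KTensor.mk ι A (ι → F2) ((groundMap ι A x * TensorAlgebra.ιInv t) ⊗ₜ 1) := rfl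

theorem groundMap_left (i : ι) (x : ι → F2) :
    groundMap ι A (KBimodule.left i x) = KAlgebra.e i * groundMap ι A x := by
  rw [← groundMap_single, ← groundMap_mul]; rfl

theorem groundMap_right (i : ι) (x : ι → F2) :
    groundMap ι A (KBimodule.right i x) = groundMap ι A x * KAlgebra.e i := by
  rw [← groundMap_single, ← groundMap_mul]; rfl

theorem identityDA_left (i : ι) (x : ι → F2) (t : T A) :
    (identityDA ι A).δ (KBimodule.left i x) t = KBimodule.left i ((identityDA ι A).δ x t) := by
  rw [identityDA_δ, identityDA_δ, KTensor.left_tmul, groundMap_left, mul_assoc]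
  rfl

theorem identityDA_mulδ (a c : A) (x : ι → F2) : (identityDA ι A).mulδ (TensorAlgebra.ι F2 c)
    (KTensor.mk ι A (ι → F2) (a ⊗ₜ x)) =
      KTensor.mk ι A (ι → F2) ((a * groundMap ι A x * c) ⊗ₜ 1) := by
  rw [mulδ_mk _ identityDA_left, identityDA_δ, KTensor.unpack_mk, TensorAlgebra.ι_leftInverse]
  simp only [TensorProduct.tmul_sum, map_sum, TensorProduct.assoc_symm_tmul,
    LinearMap.rTensor_tmul, TensorProduct.lift.tmul, LinearMap.mul_apply']
  have h : ∀ i : ι, a * KBimodule.right i (groundMap ι A x * c) =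
    KBimodule.right i (a * groundMap ι A x * c) := fun i => by
      change a * (_ * _) = _ * _
      simp only [mul_assoc]
  simp only [h, KTensor.mk_right_tmul, KBimodule.left_left, if_true]
  rw [← map_sum, ← TensorProduct.tmul_sum, KBimodule.sum_left]

theorem add_self_eq_zero_of_module {V : Type*} [AddCommGroup V] [Module F2 V] (v : V) :
    v + v = 0 := by
  rw [← two_smul F2 v, show (2 : F2) = 0 from rfl, zero_smul]

variable (ι A) in
-- The operation vanishes on words of length other than one, so only words of two letters give a
-- nontrivial equation. For `b ⊗ c` both terms are `x b c ⊗ 1`, and they cancel modulo two.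
theorem identityDA_isTypeDA : (identityDA ι A).IsTypeDA := by
  refine ⟨identityDA_left, fun i x => ?_, fun i x t b => ?_, fun i x b t => ?_,
    fun i x t b c t' => ?_, fun x bs => ?_⟩
  · simp [identityDA_δ, ιInv_one]
  · simp only [identityDA_δ, ιInv_mul_ι, KTensor.right_tmul]
    have h : KBimodule.right i (1 : ι → F2) = KBimodule.left i (1 : ι → F2) := by
      change (1 : ι → F2) * _ = _ * 1
      rw [mul_one, one_mul]
    rw [h, ← KTensor.mk_right_tmul, ← LinearMap.map_smul]
    congr 2
    exact (mul_assoc _ _ _).symm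
  · simp only [identityDA_δ, ιInv_ι_mul, groundMap_right, ← LinearMap.map_smul]
    congr 2
    exact mul_assoc _ _ _
  · have h : ∀ (t : T A) (b c : A) (t' : T A), TensorAlgebra.ιInv
        (t * TensorAlgebra.ι F2 b * TensorAlgebra.ι F2 c * t') = 0 := by
      intro t b c t'
      rw [ιInv_mul, ιInv_mul_ι]
      simp [algebraMapInv_ι]
    simp only [identityDA_δ, h]
  · have h0 : ∀ x, (identityDA ι A).δ x 1 = 0 := fun x => by simp [identityDA_δ, ιInv_one]
    have h2 : ∀ x b c t, (identityDA ι A).δ x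
        (TensorAlgebra.ι F2 b * (TensorAlgebra.ι F2 c * t)) = 0 := fun x b c t => by
      simp [identityDA_δ, ιInv_ι_mul_ι_mul]
    have hm : ∀ t, (∀ x, (identityDA ι A).δ x t = 0) → ∀ y, (identityDA ι A).mulδ t y = 0 := by
      intro t ht y
      refine KTensor.ext_apply ι (f := (identityDA ι A).mulδ t) (g := 0) (fun a x => ?_) y
      rw [mulδ_mk _ identityDA_left, ht]
      simp
    have hw : ∀ b c (l : List A), word (b :: c :: l) =
        TensorAlgebra.ι F2 b * (TensorAlgebra.ι F2 c * word l) := fun b c l => by simp [word]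
    match bs with
    | [] => simp [barD, word, h0]
    | [b] =>
      rw [List.length_singleton, Finset.sum_range_succ, Finset.sum_range_one]
      simp [barD, word, h0, hm 1 h0]
    | [b, c] =>
      simp only [List.length_cons, List.length_nil, Finset.sum_range_succ, Finset.sum_range_zero,
        List.take, List.drop, zero_add, word, List.map_nil, List.prod_nil, h0, map_zero,
        hm 1 h0, add_zero, barD, List.map_cons, List.prod_cons, mul_one, mul_zero]
      rw [identityDA_δ, identityDA_δ, identityDA_mulδ, groundMap_one, TensorAlgebra.ι_leftInverse,
        TensorAlgebra.ι_leftInverse, mul_one, mul_assoc]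
      exact add_self_eq_zero_of_module _
    | b :: c :: d :: l =>
      have hb : (identityDA ι A).δ x (barD (b :: c :: d :: l)) = 0 := by
        rw [barD, map_add, hw, h2, zero_add]
        cases l with
        | nil => simpa [barD, word] using h2 x b (c * d) 1
        | cons e l =>
          rw [barD, mul_add, map_add, hw, h2, zero_add, barD]
          exact h2 _ _ _ _
      rw [hb, zero_add]
      -- With at least three letters one of the two parts always has length other than one: for `k =
      -- 1` it is the second part, otherwise the first.
      refine Finset.sum_eq_zero fun k hk => ?_
      rcases k with _ | _ | k
      · simp [word, h0]
      · exact hm _ (fun x => by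
          simp only [zero_add, List.drop_succ_cons, List.drop_zero]; rw [hw, h2]) _
      · rw [List.take_succ_cons, List.take_succ_cons, hw, h2, map_zero]

end Identity

end Bordered

namespace Bordered.ArcDiagram

open Set

variable {P : Type*} {Z : ArcDiagram P}

/-! ## The operations of `M(𝕀)` -/

theorem nf_ne_zero {x : Z.Surface} {q : P} {w : ℂ} (h : Z.nf x = .inl (q, w)) : w ≠ 0 := by
  rintro rfl
  rcases nf_cases x with ⟨p, -, h'⟩ | ⟨p, w, -, -, h1, -, h'⟩ | ⟨p, w, h1, h', -⟩
  · rw [h] at h'; cases h'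
  · obtain ⟨-, rfl⟩ := Prod.mk.inj (Sum.inl.inj (h.symm.trans h'))
    simp at h1
  · obtain ⟨-, rfl⟩ := Prod.mk.inj (Sum.inl.inj (h.symm.trans h'))
    simpa using h1.1

theorem hasCoord_zero_iff {q : P} {x : Z.Surface} :
    Z.HasCoord q 0 x ↔ Z.nf x = .inr (Z.arc q) := by
  refine ⟨fun h => by rw [h.nf, normal_zero], fun h => ?_⟩
  have h' : x = Z.chart q ⟨0, zero_mem_chartDomain⟩ :=
    nf_injective (by rw [h, nf_chart, normal_zero])
  exact h' ▸ ⟨zero_mem_chartDomain, rfl⟩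

/-- Away from crossings a point on both kinds of arcs would have the normal coordinate `0`, which
`nf_ne_zero` excludes. -/
theorem nf_eq_of_mem {x : Z.Surface} {a b : Z.Arc} (ha : x ∈ Z.alpha a) (hb : x ∈ Z.eta b) :
    Z.nf x = .inr a ∧ a = b := by
  rw [mem_alpha_iff] at ha
  rw [mem_eta_iff] at hb
  rcases ha with ha | ⟨q, w, ha, h1, -⟩ <;> rcases hb with hb | ⟨q', w', hb, h2, -⟩
  · exact ⟨ha, Sum.inr.inj (ha.symm.trans hb)⟩
  · rw [ha] at hb; cases hb
  · rw [ha] at hb; cases hb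
  · obtain ⟨-, rfl⟩ := Prod.mk.inj (Sum.inl.inj (ha.symm.trans hb))
    exact absurd (Complex.ext h2 h1) (nf_ne_zero ha)

theorem exists_arc_eq (i : Z.Arc) : ∃ p, Z.arc p = i := Quotient.exists_rep i

variable (Z) in
/-- The intersection point of `α_i` and `η_i`. -/
noncomputable def crossing (i : Z.Arc) : Z.Crossing Z.eta where
  a := i
  b := i
  pt := Z.chart (Quotient.out i) ⟨0, zero_mem_chartDomain⟩
  mem_alpha := ⟨_, 0, Quotient.out_eq i, rfl, zero_mem_chartDomain, rfl⟩
  mem_beta := ⟨_, 0, Quotient.out_eq i, rfl, zero_mem_chartDomain, rfl⟩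

theorem nf_crossing (i : Z.Arc) : Z.nf (Z.crossing i).pt = .inr i :=
  (nf_eq_of_mem (Z.crossing i).mem_alpha (Z.crossing i).mem_beta).1

theorem eq_crossing (x : Z.Crossing Z.eta) : x = Z.crossing x.a := by
  obtain ⟨h1, h2⟩ := nf_eq_of_mem x.mem_alpha x.mem_beta
  obtain ⟨a, b, pt, ha, hb⟩ := x
  obtain rfl : a = b := h2
  obtain rfl : pt = (Z.crossing a).pt := nf_injective (h1.trans (nf_crossing a).symm)
  rfl

variable (Z) in
/-- The generators of `M(𝕀)` correspond to the arcs. -/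
noncomputable def crossingEquiv : Z.Arc ≃ Z.Crossing Z.eta where
  toFun := Z.crossing
  invFun := Crossing.a
  left_inv _ := rfl
  right_inv x := (eq_crossing x).symm

theorem hasCoord_crossing (p : P) : Z.HasCoord p 0 (Z.crossing (Z.arc p)).pt :=
  hasCoord_zero_iff.2 (nf_crossing _)

theorem chords?_map (σ : List Z.Chord) : Z.chords? (σ.map .chord) = some σ := by
  induction σ with
  | nil => rfl
  | cons ρ σ ih => simp_all [chords?]

theorem chords?_eq_some {L : List Z.Gen} {σ : List Z.Chord} (h : Z.chords? L = some σ) :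
    L = σ.map .chord := by
  induction L generalizing σ with
  | nil => simp_all [chords?]
  | cons g L ih =>
    rcases g with i | ρ
    · simp [chords?] at h
    · cases h' : Z.chords? L with
      | none => simp_all [chords?]
      | some τ =>
        obtain rfl : ρ :: τ = σ := by simp_all [chords?]
        rw [ih h', List.map_cons]

/-- The short dual chords opposite to the intervals of a chord. -/
def dualRun (p : P) (n : ℕ) (h : ∀ i < n, ¬ Z.z ((Z.s ^ i) p)) : List Z.dual.Chord :=
  List.ofFn fun i : Fin n => Z.dualShort ⟨(Z.s ^ (i : ℕ)) p, h i i.2⟩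

theorem length_dualRun (p : P) (n : ℕ) (h : ∀ i < n, ¬ Z.z ((Z.s ^ i) p)) :
    (dualRun p n h).length = n := List.length_ofFn

theorem follows_dualRun (p : P) (n : ℕ) (h : ∀ i < n, ¬ Z.z ((Z.s ^ i) p)) :
    Z.Follows p (dualRun p n h) where
  image i := by
    revert i
    rw [dualRun]
    intro i
    rw [List.get_ofFn]
    exact Set.ext fun x => by simp [dualChordImage, dualShort]; rfl
  avoid i hi := h i (by rwa [length_dualRun] at hi)

theorem dualRun_succ (p : P) (n : ℕ) (h : ∀ i < n + 1, ¬ Z.z ((Z.s ^ i) p)) :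
    dualRun p (n + 1) h = Z.dualShort ⟨p, h 0 n.succ_pos⟩ ::
      dualRun (Z.s p) n fun i hi => by
        simpa [pow_succ] using h (i + 1) (Nat.succ_lt_succ hi) := by
  rw [dualRun, List.ofFn_succ]
  rfl

section Operations
variable [Finite P]

theorem MOp_chords (σ : List Z.dual.Chord) (x : Z.Crossing Z.eta) (ρ : List Z.Chord) :
    Z.MOp Z.eta (σ.reverse.map .chord) x (ρ.map .chord) =
      ∑ᶠ y : Z.Crossing Z.eta, Z.polygonCount Z.eta x.pt y.pt σ ρ • FreeKB.basis _ _ y := by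
  unfold MOp
  split
  · rename_i h _
    simp [List.map_eq_cons_iff] at h
  · rename_i h
    simp [List.map_eq_cons_iff] at h
  · rw [← List.map_reverse, List.reverse_reverse, chords?_map, chords?_map]

/-- A word with an idempotent acts by zero unless it is the unit action itself; the hypothesis `h`
excludes exactly that case. -/
theorem MOp_of_chords?_eq_none (σ : List Z.dual.Chord) (x : Z.Crossing Z.eta) {R : List Z.Gen}
    (hR : Z.chords? R = none) (h : σ ≠ [] ∨ ∀ i, R ≠ [.idem i]) :
    Z.MOp Z.eta (σ.reverse.map .chord) x R = 0 := by
  unfold MOp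
  split
  · simp [chords?] at hR
  · rename_i h'
    simp at h' h
    exact absurd h' h
  · rw [hR]
    split <;> simp_all

/-- All geometry enters here: the polygon counts leave at most one chord list and one end point,
with coefficient one. -/
theorem sum_polygonCount (p : P) (n : ℕ) (h : ∀ i < n, ¬ Z.z ((Z.s ^ i) p)) (hn : 0 < n)
    (ρ : List Z.Chord) [Decidable (ρ = [longChord p n hn h])] :
    ∑ᶠ y : Z.Crossing Z.eta, Z.polygonCount Z.eta (Z.crossing (Z.arc p)).pt y.pt
        (dualRun p n h) ρ • (FreeKB.basis _ _ y : Z.MSpace Z.eta) =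
      if ρ = [longChord p n hn h] then
        FreeKB.basis _ _ (Z.crossing (Z.arc ((Z.s ^ n) p))) else 0 := by
  have hF := follows_dualRun p n h
  have hl : ∀ hn', longChord p (dualRun p n h).length hn' hF.avoid = longChord p n hn h :=
    fun _ => Chord.ext rfl (length_dualRun p n h)
  have hn' : 0 < (dualRun p n h).length := by rwa [length_dualRun]
  split_ifs with hρ
  · subst hρ
    rw [finsum_eq_single _ (Z.crossing (Z.arc ((Z.s ^ n) p))), ← hl hn', polygonCount_eq_one hF hn'
      (hasCoord_crossing p) (by rw [length_dualRun]; exact hasCoord_crossing _), one_smul]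
    intro y hy
    obtain ⟨q, hq⟩ := exists_arc_eq y.a
    rw [polygonCount_eq_zero hF (hasCoord_crossing p)
      (p₂ := q) (hasCoord_zero_iff.2 ((nf_eq_of_mem y.mem_alpha y.mem_beta).1.trans
        (congrArg _ hq.symm))), zero_smul]
    rintro ⟨-, h1, -⟩
    rw [length_dualRun, hasCoord_zero_iff, (nf_eq_of_mem y.mem_alpha y.mem_beta).1] at h1
    exact hy ((eq_crossing y).trans (congrArg _ (Sum.inr.inj h1)))
  · refine finsum_eq_zero_of_forall_eq_zero fun y => ?_
    obtain ⟨q, hq⟩ := exists_arc_eq y.a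
    rw [polygonCount_eq_zero hF (hasCoord_crossing p)
      (p₂ := q) (hasCoord_zero_iff.2 ((nf_eq_of_mem y.mem_alpha y.mem_beta).1.trans
        (congrArg _ hq.symm))), zero_smul]
    rintro ⟨h1, -, h2⟩
    exact hρ (h2.trans (by rw [hl h1]))

open Classical in
-- Words of chords are handled by the polygon count, and words containing an idempotent act by zero
-- since the run on the left is not empty.
theorem MOp_dualRun (p : P) (n : ℕ) (h : ∀ i < n, ¬ Z.z ((Z.s ^ i) p)) (hn : 0 < n)
    (R : List Z.Gen) :
    Z.MOp Z.eta ((dualRun p n h).reverse.map .chord) (Z.crossing (Z.arc p)) R =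
      if R = [.chord (longChord p n hn h)] then
        FreeKB.basis _ _ (Z.crossing (Z.arc ((Z.s ^ n) p))) else 0 := by
  cases hR : Z.chords? R with
  | none =>
    rw [MOp_of_chords?_eq_none _ _ hR, if_neg]
    · rintro rfl
      simp [chords?] at hR
    · left
      rw [← List.length_pos_iff, length_dualRun]
      exact hn
  | some ρ =>
    obtain rfl := chords?_eq_some hR
    rw [MOp_chords, sum_polygonCount p n h hn]
    refine if_congr ⟨fun h => by rw [h]; rfl, fun h => ?_⟩ rfl rfl
    have h' := congrArg Z.chords? h
    rw [hR] at h'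
    exact Option.some.inj (h'.trans (chords?_map [longChord p n hn _]))

open Classical in
-- The empty list is the dual run of length zero, and polygons exist only for runs of positive
-- length. So nothing but the action of the idempotent remains.
theorem MOp_nil (i : Z.Arc) (R : List Z.Gen) : Z.MOp Z.eta [] (Z.crossing i) R =
    if R = [.idem i] then FreeKB.basis _ _ (Z.crossing i) else 0 := by
  by_cases h : ∃ j, R = [.idem j]
  · obtain ⟨j, rfl⟩ := h
    simp only [MOp, List.cons.injEq, Gen.idem.injEq, and_true]
    exact if_congr ⟨Eq.symm, Eq.symm⟩ rfl rfl
  · rw [if_neg fun h' => h ⟨i, h'⟩]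
    cases hR : Z.chords? R with
    | none => exact MOp_of_chords?_eq_none [] _ hR (.inr fun i hi => h ⟨i, hi⟩)
    | some ρ =>
      obtain rfl := chords?_eq_some hR
      obtain ⟨p, rfl⟩ := exists_arc_eq i
      refine (MOp_chords [] _ _).trans (finsum_eq_zero_of_forall_eq_zero fun y => ?_)
      obtain ⟨q, hq⟩ := exists_arc_eq y.a
      rw [polygonCount_eq_zero (σ := []) (follows_dualRun p 0 (by simp)) (hasCoord_crossing p)
        (p₂ := q) (hasCoord_zero_iff.2 ((nf_eq_of_mem y.mem_alpha y.mem_beta).1.trans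
          (congrArg _ hq.symm))), zero_smul]
      rintro ⟨h1, -⟩
      exact absurd h1 (lt_irrefl 0)

theorem basisFreeMonoid_apply {κ : Type*} (L : FreeMonoid κ) :
    FreeAlgebra.basisFreeMonoid F2 κ L = FreeMonoid.lift (FreeAlgebra.ι F2) L := by
  have h : FreeAlgebra.basisFreeMonoid F2 κ L =
      FreeAlgebra.equivMonoidAlgebraFreeMonoid.symm (MonoidAlgebra.of F2 _ L) := rfl
  rw [h]
  exact (MonoidAlgebra.lift_of _ _)

theorem tensorAlgebra_basis_apply {κ B : Type*} [Ring B] [Algebra F2 B]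
    (b : Module.Basis κ F2 B) (L : FreeMonoid κ) :
    b.tensorAlgebra L = word (L.toList.map b) := by
  rw [Module.Basis.tensorAlgebra, Module.Basis.map_apply, basisFreeMonoid_apply,
    FreeMonoid.lift_apply]
  simp [word, map_list_prod, Function.comp_def]

theorem MId_m (L : List Z.dual.Gen) (x : Z.Crossing Z.eta) (R : List Z.Gen) :
    Z.MId.m (word (L.map Z.dual.basis)) (FreeKB.basis _ _ x) (word (R.map Z.basis)) =
      Z.MOp Z.eta L x R := by
  have h1 := tensorAlgebra_basis_apply Z.dual.basis (FreeMonoid.ofList L)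
  have h2 := tensorAlgebra_basis_apply Z.basis (FreeMonoid.ofList R)
  rw [FreeMonoid.toList_ofList] at h1 h2
  rw [← h1, ← h2]
  simp [MId, M, Module.Basis.constr_basis]

end Operations

end Bordered.ArcDiagram

/-! ### Reduction of the box product to iterates of `δ¹` on generators -/

namespace Bordered

section
variable {ι : Type*} [Fintype ι] [DecidableEq ι] {A X B N C : Type*} [Ring A] [Algebra F2 A]
  [KAlgebra ι A] [Ring B] [Algebra F2 B] [KAlgebra ι B] [Ring C] [Algebra F2 C] [KAlgebra ι C]
  [AddCommGroup X] [Module F2 X] [KBimodule ι X] [AddCommGroup N] [Module F2 N] [KBimodule ι N]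

/-- The iterates of `δ¹`, with the outputs in `A` multiplied together. -/
noncomputable def DDMap.iterMul (D : DDMap ι A X B) (n : ℕ) : X →ₗ[F2] (A ⊗[F2] X) ⊗[F2] T B :=
  ((TensorAlgebra.lift F2 (LinearMap.id : A →ₗ[F2] A)).toLinearMap.rTensor X).rTensor (T B) ∘ₗ
    D.iter n

/-- Multiplication by `a` on the left and by `b` on the right. -/
noncomputable def outerAct (a : A) (b : B) : (A ⊗[F2] X) ⊗[F2] T B →ₗ[F2] (A ⊗[F2] X) ⊗[F2] T B :=
  TensorProduct.map ((LinearMap.mulLeft F2 a).rTensor X)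
    (LinearMap.mulRight F2 (TensorAlgebra.ι F2 b))

theorem outerAct_tmul (a a' : A) (x : X) (b : B) (t : T B) :
    outerAct a b ((a' ⊗ₜ x) ⊗ₜ t) = ((a * a') ⊗ₜ[F2] x) ⊗ₜ[F2] (t * TensorAlgebra.ι F2 b) := by
  simp [outerAct]

/-- Multiplying the outputs together is an algebra homomorphism from the tensor algebra, so it can
be done at each stage of the iteration. -/
theorem lift_outerMul (a : A) (u : (T A ⊗[F2] X) ⊗[F2] T B) (b : B) :
    ((TensorAlgebra.lift F2 (LinearMap.id : A →ₗ[F2] A)).toLinearMap.rTensor X).rTensor (T B)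
      (outerMul ((a ⊗ₜ u) ⊗ₜ b)) = outerAct a b
    (((TensorAlgebra.lift F2 (LinearMap.id : A →ₗ[F2] A)).toLinearMap.rTensor X).rTensor (T B)
      u) := by
  induction u with
  | zero => simp
  | add u v hu hv => simp only [TensorProduct.tmul_add, TensorProduct.add_tmul, map_add, hu, hv]
  | tmul v t =>
    induction v with
    | zero => simp
    | add u v hu hv => simp only [TensorProduct.tmul_add, TensorProduct.add_tmul, map_add, hu, hv]
    | tmul c x => simp [outerMul, outerAct]

theorem DDMap.iterMul_zero (D : DDMap ι A X B) (x : X) : D.iterMul 0 x = (1 ⊗ₜ x) ⊗ₜ 1 := by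
  simp [iterMul, iter]

theorem DDMap.iterMul_succ (D : DDMap ι A X B) {x : X} {κ : Type*} (s : Finset κ) (a : κ → A)
    (y : κ → X) (b : κ → B) (h : (KTensor.unpack ι A X).rTensor B
      (KTensor.unpack ι (KTensor ι A X) B (D.δ x)) = ∑ k ∈ s, (a k ⊗ₜ y k) ⊗ₜ b k) (n : ℕ) :
    D.iterMul (n + 1) x = ∑ k ∈ s, outerAct (a k) (b k) (D.iterMul n (y k)) := by
  simp only [iterMul, iter, LinearMap.comp_apply, h, map_sum, LinearMap.rTensor_tmul,
    LinearMap.lTensor_tmul, lift_outerMul]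

/-- Feeding the outputs in `T*(B)` to `m`. -/
noncomputable def AAMap.feed (E : AAMap B N C) (x : N) (t : T C) :
    (A ⊗[F2] X) ⊗[F2] T B →ₗ[F2] KTensor ι A (KTensor ι X N) :=
  KTensor.mk ι A (KTensor ι X N) ∘ₗ (KTensor.mk ι X N).lTensor A ∘ₗ
    (TensorProduct.assoc F2 A X N).toLinearMap ∘ₗ
    (LinearMap.applyₗ t ∘ₗ E.m.flip x).lTensor (A ⊗[F2] X)

theorem AAMap.feed_tmul (E : AAMap B N C) (x : N) (t : T C) (a : A) (w : X) (b : T B) :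
    E.feed x t ((a ⊗ₜ w) ⊗ₜ b) =
      KTensor.mk ι A (KTensor ι X N) (a ⊗ₜ KTensor.mk ι X N (w ⊗ₜ E.m b x t)) := by
  simp [feed]

/-- The hypothesis says that `w ⊗ x` is its own canonical representative, so that no sum over
idempotents appears. -/
theorem boxTerm_mk (D : DDMap ι A X B) (E : AAMap B N C) (n : ℕ) {w : X} {x : N}
    (h : KTensor.unpack ι X N (KTensor.mk ι X N (w ⊗ₜ x)) = w ⊗ₜ x) (t : T C) :
    boxTerm D E n (KTensor.mk ι X N (w ⊗ₜ x)) t = E.feed x t (D.iterMul n w) := by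
  change KTensor.mk ι A (KTensor ι X N)
    (TensorProduct.map (TensorAlgebra.lift F2 (LinearMap.id : A →ₗ[F2] A)).toLinearMap
      (KTensor.mk ι X N) (TensorProduct.assoc F2 (T A) X N
        ((TensorProduct.lift (E.m.compr₂ (LinearMap.applyₗ t))).lTensor (T A ⊗[F2] X)
          (TensorProduct.assoc F2 (T A ⊗[F2] X) (T B) N ((D.iter n).rTensor N
            (KTensor.unpack ι X N (KTensor.mk ι X N (w ⊗ₜ x)))))))) = _
  rw [h, LinearMap.rTensor_tmul, DDMap.iterMul, LinearMap.comp_apply]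
  generalize D.iter n w = u
  induction u with
  | zero => simp
  | add u v hu hv => simp only [TensorProduct.add_tmul, map_add, hu, hv]
  | tmul v b =>
    induction v with
    | zero => simp
    | add u v hu hv => simp only [TensorProduct.add_tmul, map_add, hu, hv]
    | tmul c y => simp [AAMap.feed]

end

namespace ArcDiagram

variable {P : Type*} {Z : ArcDiagram P} [Finite P]

variable (Z) in
/-- The generator `w_i` of `DD(𝕀/2)`. -/
noncomputable def ddGen (i : Z.Arc) : Z.DDSpace := FreeKB.basis _ _ (Z.crossing i)

variable (Z) in
/-- The generator `x_i` of `M(𝕀)`. -/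
noncomputable def mGen (i : Z.Arc) : Z.MSpace Z.eta := FreeKB.basis _ _ (Z.crossing i)

theorem left_ddGen (i j : Z.Arc) :
    KBimodule.left i (Z.ddGen j) = if j = i then Z.ddGen j else 0 :=
  FreeKB.proj_basis _ _ _ _ _

theorem right_ddGen (i j : Z.Arc) :
    KBimodule.right i (Z.ddGen j) = if j = i then Z.ddGen j else 0 :=
  FreeKB.proj_basis _ _ _ _ _

theorem left_mGen (i j : Z.Arc) :
    KBimodule.left i (Z.mGen j) = if j = i then Z.mGen j else 0 :=
  FreeKB.proj_basis _ _ _ _ _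

theorem right_mGen (i j : Z.Arc) :
    KBimodule.right i (Z.mGen j) = if j = i then Z.mGen j else 0 :=
  FreeKB.proj_basis _ _ _ _ _

variable (Z) in
/-- The generator `w_i ⊗ x_i` of `DD(𝕀/2) ⊠ M(𝕀)`. -/
noncomputable def boxGen (i : Z.Arc) : KTensor Z.Arc Z.DDSpace (Z.MSpace Z.eta) :=
  KTensor.mk _ _ _ (Z.ddGen i ⊗ₜ Z.mGen i)

theorem unpack_boxGen (i : Z.Arc) :
    KTensor.unpack _ _ _ (Z.boxGen i) = Z.ddGen i ⊗ₜ[F2] Z.mGen i := by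
  rw [boxGen, KTensor.unpack_mk, Finset.sum_eq_single i]
  · rw [right_ddGen, left_mGen, if_pos rfl, if_pos rfl]
  · intro j _ hj
    rw [right_ddGen, if_neg hj.symm, TensorProduct.zero_tmul]
  · simp

theorem mk_ddGen_mGen (i j : Z.Arc) :
    KTensor.mk Z.Arc _ _ (Z.ddGen i ⊗ₜ Z.mGen j) = if i = j then Z.boxGen i else 0 := by
  split_ifs with h
  · rw [h, boxGen]
  · have h1 : Z.ddGen i = KBimodule.right i (Z.ddGen i) := by rw [right_ddGen, if_pos rfl]
    rw [h1, KTensor.mk_right_tmul, left_mGen, if_neg (Ne.symm h), TensorProduct.tmul_zero,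
      map_zero]

theorem dd_ext {V : Type*} [AddCommGroup V] [Module F2 V] {f g : Z.DDSpace →ₗ[F2] V}
    (h : ∀ i, f (Z.ddGen i) = g (Z.ddGen i)) : f = g :=
  (FreeKB.basis _ _).ext fun x => by rw [eq_crossing x]; exact h x.a

theorem m_ext {V : Type*} [AddCommGroup V] [Module F2 V] {f g : Z.MSpace Z.eta →ₗ[F2] V}
    (h : ∀ i, f (Z.mGen i) = g (Z.mGen i)) : f = g :=
  (FreeKB.basis _ _).ext fun x => by rw [eq_crossing x]; exact h x.a

theorem box_ext {V : Type*} [AddCommGroup V] [Module F2 V]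
    {f g : KTensor Z.Arc Z.DDSpace (Z.MSpace Z.eta) →ₗ[F2] V}
    (h : ∀ i, f (Z.boxGen i) = g (Z.boxGen i)) : f = g := by
  refine LinearMap.ext (KTensor.ext_apply _ fun v w => ?_)
  have h1 : (TensorProduct.mk F2 _ _).compr₂ (f ∘ₗ KTensor.mk _ _ _) =
      (TensorProduct.mk F2 _ _).compr₂ (g ∘ₗ KTensor.mk _ _ _) := by
    refine dd_ext fun i => m_ext fun j => ?_
    simp only [LinearMap.compr₂_apply, TensorProduct.mk_apply, LinearMap.comp_apply,
      mk_ddGen_mGen]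
    split_ifs
    · exact h i
    · simp
  exact LinearMap.congr_fun (LinearMap.congr_fun h1 v) w

variable (Z) in
theorem basis_mul (a b : Z.Gen) : Z.basis a * Z.basis b = Z.genMul a b := Z.mulHom_basis a b

theorem idem_mul_short (i : Z.Arc) (p : {p : P // ¬ Z.z p}) :
    Z.idem i * Z.basis (.chord (Z.short p)) =
      if Z.arc p = i then Z.basis (.chord (Z.short p)) else 0 := by
  rw [idem, basis_mul]; rfl

theorem short_mul_idem (i : Z.Arc) (p : {p : P // ¬ Z.z p}) :
    Z.basis (.chord (Z.short p)) * Z.idem i =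
      if Z.arc (Z.s p) = i then Z.basis (.chord (Z.short p)) else 0 := by
  rw [idem, basis_mul]; rfl

theorem idem_mul_dualShort (i : Z.Arc) (p : {p : P // ¬ Z.z p}) :
    Z.dual.idem i * Z.dual.basis (.chord (Z.dualShort p)) =
      if Z.arc (Z.s p) = i then Z.dual.basis (.chord (Z.dualShort p)) else 0 := by
  exact Z.dual.basis_mul (.idem i) (.chord (Z.dualShort p))

/-- In the dual diagram the chord ends at `Z.m p`, which lies on the same arc as `p`. It thus runs
from the arc of `Z.s p` to that of `p`, opposite to the short chord. -/
theorem dualShort_mul_idem (i : Z.Arc) (p : {p : P // ¬ Z.z p}) :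
    Z.dual.basis (.chord (Z.dualShort p)) * Z.dual.idem i =
      if Z.arc p = i then Z.dual.basis (.chord (Z.dualShort p)) else 0 := by
  refine (Z.dual.basis_mul (.chord (Z.dualShort p)) (.idem i)).trans ?_
  have h : Z.dual.arc (Z.dualShort p).terminal = Z.arc p := by
    have h1 : (Z.dualShort p).terminal = Z.m p := by simp [Chord.terminal, dualShort]
    rw [h1]
    exact arc_m Z _
  simp only [genMul]
  split_ifs with h1 h2 h2
  · rfl
  · exact absurd (h.symm.trans h1) h2
  · exact absurd (h.trans h2) h1
  · rfl

open Classical in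
-- In the double sum defining `δ¹` the idempotents select the short chords starting on the arc `i`,
-- and the tensor product over the ground ring leaves a single generator for each, namely that of
-- the arc where the chord ends.
theorem unpack_DDHalfId [Fintype P] (i : Z.Arc) :
    (KTensor.unpack Z.Arc Z.Alg Z.DDSpace).rTensor Z.dual.Alg
      (KTensor.unpack Z.Arc (KTensor Z.Arc Z.Alg Z.DDSpace) Z.dual.Alg
        (Z.DDHalfId.δ (Z.ddGen i))) =
    ∑ p : {p : {p : P // ¬ Z.z p} // Z.arc p = i},
      (Z.basis (.chord (Z.short p)) ⊗ₜ[F2] Z.ddGen (Z.arc (Z.s p))) ⊗ₜ[F2]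
        Z.dual.basis (.chord (Z.dualShort p)) := by
  have key : ∀ (j : Z.Arc) (p : {p : P // ¬ Z.z p}),
      (KTensor.unpack Z.Arc Z.Alg Z.DDSpace).rTensor Z.dual.Alg
        (KTensor.unpack Z.Arc (KTensor Z.Arc Z.Alg Z.DDSpace) Z.dual.Alg
        (KTensor.mk Z.Arc (KTensor Z.Arc Z.Alg Z.DDSpace) Z.dual.Alg
        (KTensor.mk Z.Arc Z.Alg Z.DDSpace
            ((Z.idem i * Z.basis (.chord (Z.short p))) ⊗ₜ Z.ddGen j) ⊗ₜ
          (Z.dual.basis (.chord (Z.dualShort p)) * Z.dual.idem i)))) =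
      if Z.arc p = i then if Z.arc (Z.s p) = j then
        (Z.basis (.chord (Z.short p)) ⊗ₜ[F2] Z.ddGen (Z.arc (Z.s p))) ⊗ₜ[F2]
        Z.dual.basis (.chord (Z.dualShort p)) else 0 else 0 := by
    intro j p
    rw [idem_mul_short, dualShort_mul_idem]
    by_cases h1 : Z.arc p = i
    · simp only [if_pos h1]
      have hb : ∀ k : Z.Arc, KBimodule.left k (Z.dual.basis (.chord (Z.dualShort p))) =
          if Z.arc (Z.s p) = k then Z.dual.basis (.chord (Z.dualShort p)) else 0 :=
        fun k => idem_mul_dualShort k p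
      have ha : ∀ k : Z.Arc, KBimodule.right k (Z.basis (.chord (Z.short p))) =
          if Z.arc (Z.s p) = k then Z.basis (.chord (Z.short p)) else 0 :=
        fun k => short_mul_idem k p
      rw [KTensor.unpack_mk, Finset.sum_eq_single (Z.arc (Z.s p))]
      · rw [hb, if_pos rfl, KTensor.right_tmul, right_ddGen, LinearMap.rTensor_tmul]
        by_cases h2 : Z.arc (Z.s p) = j
        · subst h2
          rw [if_pos rfl, if_pos rfl, KTensor.unpack_mk, Finset.sum_eq_single (Z.arc (Z.s p))]
          · rw [ha, left_ddGen, if_pos rfl, if_pos rfl]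
          · intro k _ hk
            rw [ha, if_neg hk.symm, TensorProduct.zero_tmul]
          · simp
        · rw [if_neg h2, if_neg (Ne.symm h2), TensorProduct.tmul_zero, map_zero, map_zero,
            TensorProduct.zero_tmul]
      · intro k _ hk
        rw [hb, if_neg hk.symm, TensorProduct.tmul_zero]
      · simp
    · simp [if_neg h1]
  have hδ : Z.DDHalfId.δ (Z.ddGen i) = ∑ j : Z.Arc, ∑ p : {p : P // ¬ Z.z p},
      (KTensor.mk Z.Arc (KTensor Z.Arc Z.Alg Z.DDSpace) Z.dual.Alg
        (KTensor.mk Z.Arc Z.Alg Z.DDSpace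
            ((Z.idem i * Z.basis (.chord (Z.short p))) ⊗ₜ Z.ddGen j) ⊗ₜ
          (Z.dual.basis (.chord (Z.dualShort p)) * Z.dual.idem i))) := by
    rw [DDHalfId, ddGen, Module.Basis.constr_basis, ← finsum_comp_equiv Z.crossingEquiv,
      finsum_eq_sum_of_fintype]
    exact Finset.sum_congr rfl fun j _ => finsum_eq_sum_of_fintype _
  rw [hδ]
  simp only [map_sum, key]
  rw [Finset.sum_comm]
  simp only [Finset.sum_ite_irrel, Finset.sum_ite_eq, Finset.mem_univ, if_true,
    Finset.sum_const_zero]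
  rw [← Finset.sum_filter]
  exact Finset.sum_subtype _ (by simp) _

end ArcDiagram

end Bordered

/-! ### The structure map of the box product on generators -/

namespace Bordered.ArcDiagram

variable {P : Type*} {Z : ArcDiagram P}

section Iterates
variable [Finite P]

open Classical in
/-- The contribution of the chord of length `n + 1` which starts at `p` to the iterates of
`δ¹`. -/
noncomputable def runTerm (n : ℕ) (p : P) : (Z.Alg ⊗[F2] Z.DDSpace) ⊗[F2] T Z.dual.Alg :=
  if h : ∀ i < n + 1, ¬ Z.z ((Z.s ^ i) p) then
    (Z.basis (.chord (longChord p (n + 1) n.succ_pos h)) ⊗ₜ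
      Z.ddGen (Z.arc ((Z.s ^ (n + 1)) p))) ⊗ₜ
      word (((dualRun p (n + 1) h).reverse.map .chord).map Z.dual.basis)
  else 0

theorem runTerm_of_z {n : ℕ} {p : P} (h : Z.z p) : runTerm (Z := Z) n p = 0 :=
  dif_neg fun h' => h' 0 n.succ_pos h

/-- A short chord can be concatenated only with a chord that starts at its end point; all other
products vanish. The dual output is multiplied on the right, which puts the chord of the earliest
interval last. -/
theorem outerAct_runTerm (p : {p : P // ¬ Z.z p}) (n : ℕ) (q : P) [Decidable (q = Z.s p)] :
    outerAct (Z.basis (.chord (Z.short p))) (Z.dual.basis (.chord (Z.dualShort p)))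
      (runTerm (Z := Z) n q) = if q = Z.s p then runTerm (n + 1) (p : P) else 0 := by
  by_cases hq : q = Z.s p
  · subst hq
    rw [if_pos rfl, runTerm, runTerm]
    have hiff : (∀ i < n + 1, ¬ Z.z ((Z.s ^ i) (Z.s p))) ↔
        ∀ i < n + 1 + 1, ¬ Z.z ((Z.s ^ i) (p : P)) := by
      rw [Nat.forall_lt_succ_left' (n := n + 1)]
      simp [pow_succ, p.2]
    by_cases h : ∀ i < n + 1, ¬ Z.z ((Z.s ^ i) (Z.s p))
    · rw [dif_pos h, dif_pos (hiff.1 h), outerAct_tmul, Z.basis_mul]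
      have h1 : (Z.short p).terminal = (longChord (Z.s p) (n + 1) n.succ_pos h).start := rfl
      rw [genMul, dif_pos h1]
      have h2 : (Z.short p).concat _ h1 =
          longChord (p : P) (n + 1 + 1) (n + 1).succ_pos (hiff.1 h) :=
        Chord.ext rfl (Nat.add_comm _ _)
      rw [h2, dualRun_succ (p : P) (n + 1)]
      simp [word, pow_succ]
    · rw [dif_neg h, dif_neg fun h' => h (hiff.2 h'), map_zero]
  · rw [if_neg hq, runTerm]
    split_ifs with h
    · rw [outerAct_tmul, Z.basis_mul, genMul, dif_neg (fun h' => hq h'.symm),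
        TensorProduct.zero_tmul, TensorProduct.zero_tmul]
    · rw [map_zero]

open Classical in
-- By induction, `δ¹` prepends one short chord to the runs of the previous stage. Runs through a
-- base point contribute zero, so the sum may be taken over all points.
theorem iterMul_DDHalfId [Fintype P] (n : ℕ) (i : Z.Arc) :
    Z.DDHalfId.iterMul (n + 1) (Z.ddGen i) =
      ∑ p : P, if Z.arc p = i then runTerm n p else 0 := by
  have hsum : ∀ (n : ℕ) (i : Z.Arc), ∑ p : P, (if Z.arc p = i then runTerm (Z := Z) n p else 0) =
      ∑ p : {p : {p : P // ¬ Z.z p} // Z.arc p = i}, runTerm n (p : P) := by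
    intro n i
    have h1 := Finset.sum_subtype (F := inferInstance) (p := fun p => ¬ Z.z p) (Finset.univ.filter fun p => ¬ Z.z p)
      (by simp) fun p => if Z.arc p = i then runTerm (Z := Z) n p else 0
    rw [Finset.sum_filter_of_ne] at h1
    · rw [h1, ← Finset.sum_filter]
      exact Finset.sum_subtype _ (by simp) _
    · intro p _ hp hz
      exact hp (by rw [runTerm_of_z hz, ite_self])
  induction n generalizing i with
  | zero =>
    rw [DDMap.iterMul_succ _ _ _ _ _ (unpack_DDHalfId i), hsum]
    refine Finset.sum_congr rfl fun p _ => ?_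
    rw [DDMap.iterMul_zero, outerAct_tmul, mul_one, one_mul, runTerm, dif_pos]
    · simp only [zero_add, pow_one, dualRun_succ]
      simp [word, dualRun]
      rfl
    · intro j hj
      obtain rfl : j = 0 := by omega
      exact p.1.2
  | succ n ih =>
    rw [DDMap.iterMul_succ _ _ _ _ _ (unpack_DDHalfId i), hsum]
    refine Finset.sum_congr rfl fun p _ => ?_
    rw [ih, map_sum, Finset.sum_eq_single (Z.s p.1)]
    · rw [if_pos rfl, outerAct_runTerm, if_pos rfl]
    · intro q _ hq
      split_ifs
      · rw [outerAct_runTerm, if_neg hq]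
      · rw [map_zero]
    · simp

open Classical in
theorem boxTerm_zero (i : Z.Arc) (R : List Z.Gen) :
    boxTerm Z.DDHalfId Z.MId 0 (Z.boxGen i) (word (R.map Z.basis)) =
      if R = [.idem i] then KTensor.mk _ _ _ (1 ⊗ₜ Z.boxGen i) else 0 := by
  rw [boxGen, boxTerm_mk _ _ _ (unpack_boxGen i), DDMap.iterMul_zero, AAMap.feed_tmul]
  have h := (MId_m [] (Z.crossing i) R).trans (MOp_nil i R)
  rw [List.map_nil, word, List.map_nil, List.prod_nil] at h
  rw [mGen, h]
  split_ifs
  · rfl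
  · simp

open Classical in
theorem boxTerm_succ [Fintype P] (n : ℕ) (i : Z.Arc) (R : List Z.Gen) :
    boxTerm Z.DDHalfId Z.MId (n + 1) (Z.boxGen i) (word (R.map Z.basis)) =
      ∑ p : P, if Z.arc p = i then
        if h : ∀ i < n + 1, ¬ Z.z ((Z.s ^ i) p) then
          if R = [.chord (longChord p (n + 1) n.succ_pos h)] then
            KTensor.mk _ _ _ (Z.basis (.chord (longChord p (n + 1) n.succ_pos h)) ⊗ₜ
              Z.boxGen (Z.arc ((Z.s ^ (n + 1)) p)))
          else 0
        else 0
      else 0 := by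
  rw [boxGen, boxTerm_mk _ _ _ (unpack_boxGen i), iterMul_DDHalfId, map_sum]
  refine Finset.sum_congr rfl fun p _ => ?_
  split_ifs with h1 h2 h3
  · rw [runTerm, dif_pos h2, AAMap.feed_tmul, mGen, ← h1, MId_m, MOp_dualRun _ _ h2 n.succ_pos,
      if_pos h3]
    rfl
  · rw [runTerm, dif_pos h2, AAMap.feed_tmul, mGen, ← h1, MId_m, MOp_dualRun _ _ h2 n.succ_pos,
      if_neg h3]
    simp
  · rw [runTerm, dif_neg h2, map_zero]
  · rw [map_zero]

theorem linearMap_T_ext {V : Type*} [AddCommGroup V] [Module F2 V] {f g : T Z.Alg →ₗ[F2] V}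
    (h : ∀ R : List Z.Gen, f (word (R.map Z.basis)) = g (word (R.map Z.basis))) : f = g :=
  Z.basis.tensorAlgebra.ext fun L => by
    rw [tensorAlgebra_basis_apply]
    exact h _

variable (Z) in
-- A run of `n + 1` intervals without base points starts at distinct points, so `n + 1` is at most
-- the number of points.
theorem boxFinite : BoxFinite Z.DDHalfId Z.MId := by
  classical
  cases nonempty_fintype P
  refine (Set.finite_Iic (Fintype.card P)).subset fun n hn => ?_
  by_contra hlt
  obtain ⟨n, rfl⟩ : ∃ m, n = m + 1 := Nat.exists_eq_succ_of_ne_zero (by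
    rintro rfl; simp at hlt)
  refine hn (box_ext fun i => linearMap_T_ext fun R => ?_)
  rw [boxTerm_succ]
  refine Finset.sum_eq_zero fun p _ => ?_
  have h : ¬ ∀ i < n + 1, ¬ Z.z ((Z.s ^ i) p) := by
    intro h
    refine hlt ?_
    have h1 := Fintype.card_le_of_injective (fun k : Fin (n + 1) => (Z.s ^ (k : ℕ)) p)
      fun j k hjk => Fin.ext (pow_injOn h j.2.le k.2.le hjk)
    simpa using h1
  rw [dif_neg h, ite_self]

theorem box_δ_apply (x : KTensor Z.Arc Z.DDSpace (Z.MSpace Z.eta)) (t : T Z.Alg) :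
    (box Z.DDHalfId Z.MId).δ x t = ∑ᶠ n, boxTerm Z.DDHalfId Z.MId n x t := by
  have h := (boxFinite Z)
  have h1 := AddMonoidHom.map_finsum
    ((LinearMap.applyₗ t ∘ₗ LinearMap.applyₗ x : (KTensor Z.Arc Z.DDSpace (Z.MSpace Z.eta) →ₗ[F2]
      T Z.Alg →ₗ[F2] KTensor Z.Arc Z.Alg (KTensor Z.Arc Z.DDSpace (Z.MSpace Z.eta))) →ₗ[F2]
      KTensor Z.Arc Z.Alg (KTensor Z.Arc Z.DDSpace (Z.MSpace Z.eta))).toAddMonoidHom)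
    (f := boxTerm Z.DDHalfId Z.MId) h
  exact h1

/-- Only `δ⁰` contributes, with output `1`; the generator is fixed by its own idempotent, so `1` may
be replaced by it in the tensor product. -/
theorem box_δ_idem (i j : Z.Arc) :
    (box Z.DDHalfId Z.MId).δ (Z.boxGen i) (TensorAlgebra.ι F2 (Z.idem j)) =
      if j = i then KTensor.mk _ _ _ (Z.idem i ⊗ₜ Z.boxGen i) else 0 := by
  classical
  cases nonempty_fintype P
  have hw : TensorAlgebra.ι F2 (Z.idem j) = word ([Gen.idem j].map Z.basis) := by
    simp [word, idem]
  rw [box_δ_apply, hw, finsum_eq_single _ 0]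
  · rw [boxTerm_zero]
    simp only [List.cons.injEq, Gen.idem.injEq, and_true]
    split_ifs
    · have h : Z.boxGen i = KBimodule.left i (Z.boxGen i) := by
        rw [boxGen, KTensor.left_tmul, left_ddGen, if_pos rfl]
      rw [h, ← KTensor.mk_right_tmul, ← KTensor.mk_right_tmul]
      congr 2
      change 1 * Z.idem i = Z.idem i * Z.idem i
      rw [one_mul]
      exact ((Z.idem_mul_idem i i).trans (if_pos rfl)).symm
    · rfl
  · intro n hn
    obtain ⟨n, rfl⟩ := Nat.exists_eq_succ_of_ne_zero hn
    rw [Nat.succ_eq_add_one, boxTerm_succ]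
    simp

/-- Only the term whose index is the length of the chord contributes, and in it only the run which
starts where the chord starts. -/
theorem box_δ_chord (i : Z.Arc) (ρ : Z.Chord) :
    (box Z.DDHalfId Z.MId).δ (Z.boxGen i) (TensorAlgebra.ι F2 (Z.basis (.chord ρ))) =
      if Z.arc ρ.start = i then
        KTensor.mk _ _ _ (Z.basis (.chord ρ) ⊗ₜ Z.boxGen (Z.arc ρ.terminal)) else 0 := by
  classical
  cases nonempty_fintype P
  have hw : TensorAlgebra.ι F2 (Z.basis (.chord ρ)) = word ([Gen.chord ρ].map Z.basis) := by
    simp [word]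
  rw [box_δ_apply, hw, finsum_eq_single _ ρ.len]
  · obtain ⟨p, _ | n, hn, h⟩ := ρ
    · exact absurd hn (lt_irrefl 0)
    dsimp only
    rw [boxTerm_succ, Finset.sum_eq_single p]
    · refine if_congr Iff.rfl ?_ rfl
      rw [dif_pos h]
      exact if_pos rfl
    · intro q _ hq
      split_ifs with h1 h2 h3
      · simp only [List.cons.injEq, Gen.chord.injEq, and_true] at h3
        exact absurd (congrArg Chord.start h3).symm hq
      all_goals rfl
    · simp
  · intro n hn
    rcases n with _ | n
    · rw [boxTerm_zero, if_neg (by simp)]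
    · rw [boxTerm_succ]
      refine Finset.sum_eq_zero fun q _ => ?_
      split_ifs with h1 h2 h3
      · simp only [List.cons.injEq, Gen.chord.injEq, and_true] at h3
        exact absurd (congrArg Chord.len h3).symm hn
      all_goals rfl

theorem box_δ_word (i : Z.Arc) {R : List Z.Gen} (hR : R.length ≠ 1) :
    (box Z.DDHalfId Z.MId).δ (Z.boxGen i) (word (R.map Z.basis)) = 0 := by
  classical
  cases nonempty_fintype P
  rw [box_δ_apply]
  refine finsum_eq_zero_of_forall_eq_zero fun n => ?_
  rcases n with _ | n
  · rw [boxTerm_zero, if_neg]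
    rintro rfl
    exact hR rfl
  · rw [boxTerm_succ]
    refine Finset.sum_eq_zero fun q _ => ?_
    split_ifs with h1 h2 h3
    · exact absurd (congrArg List.length h3) hR
    all_goals rfl

end Iterates

/-! ## The isomorphism with the identity bimodule -/

section Isomorphism
variable [Finite P]

open Classical in
variable (Z) in
/-- The isomorphism `DD(𝕀/2) ⊠ M(𝕀) → k`. -/
noncomputable def boxEquiv : KTensor Z.Arc Z.DDSpace (Z.MSpace Z.eta) ≃ₗ[F2] (Z.Arc → F2) := by
  refine LinearEquiv.ofLinearMap
    (KTensor.lift Z.Arc (TensorProduct.lift ((FreeKB.basis _ _).constr F2 fun x =>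
      (FreeKB.basis _ _).constr F2 fun y => if x.b = y.b then Pi.single x.b 1 else 0))
      fun i v w => ?_)
    (Fintype.linearCombination F2 Z.boxGen) ?_ ?_
  · simp only [TensorProduct.lift.tmul]
    have h : ((FreeKB.basis Crossing.a Crossing.b).constr F2 fun x : Z.Crossing Z.eta =>
          (FreeKB.basis Crossing.b Crossing.a).constr F2 fun y : Z.Crossing Z.eta =>
            if x.b = y.b then (Pi.single x.b 1 : Z.Arc → F2) else 0) ∘ₗ
          FreeKB.proj _ _ Crossing.b i =
        ((FreeKB.basis Crossing.a Crossing.b).constr F2 fun x : Z.Crossing Z.eta =>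
          (FreeKB.basis Crossing.b Crossing.a).constr F2 fun y : Z.Crossing Z.eta =>
            if x.b = y.b then (Pi.single x.b 1 : Z.Arc → F2) else 0).compl₂
          (FreeKB.proj _ _ Crossing.b i) := by
      refine dd_ext fun j => m_ext fun k => ?_
      have h1 : FreeKB.proj _ _ Crossing.b i (Z.ddGen j) = if j = i then Z.ddGen j else 0 :=
        right_ddGen i j
      have h2 : FreeKB.proj _ _ Crossing.b i (Z.mGen k) = if k = i then Z.mGen k else 0 :=
        left_mGen i k
      rw [LinearMap.comp_apply, LinearMap.compl₂_apply, h1, h2]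
      by_cases h1 : j = i <;> by_cases h2 : k = i
      · rw [if_pos h1, if_pos h2]
      · rw [if_pos h1, if_neg h2, map_zero, ddGen, mGen, Module.Basis.constr_basis,
          Module.Basis.constr_basis]
        exact if_neg fun h => h2 ((Eq.symm h).trans h1)
      · rw [if_neg h1, if_pos h2, map_zero, LinearMap.zero_apply, ddGen, mGen,
          Module.Basis.constr_basis, Module.Basis.constr_basis]
        exact (if_neg fun h => h1 (Eq.trans h h2)).symm
      · rw [if_neg h1, if_neg h2, map_zero, map_zero, LinearMap.zero_apply]
    exact LinearMap.congr_fun (LinearMap.congr_fun h v) w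
  · refine LinearMap.pi_ext' fun i => LinearMap.ext_ring ?_
    simp [boxGen, KTensor.lift_mk, ddGen, mGen, Module.Basis.constr_basis, crossing]
  · refine box_ext fun i => ?_
    simp [boxGen, KTensor.lift_mk, ddGen, mGen, Module.Basis.constr_basis, crossing]

theorem boxEquiv_symm_single (i : Z.Arc) : Z.boxEquiv.symm (Pi.single i 1) = Z.boxGen i := by
  simp [boxEquiv]

theorem boxEquiv_boxGen (i : Z.Arc) : Z.boxEquiv (Z.boxGen i) = Pi.single i 1 := by
  rw [← boxEquiv_symm_single, LinearEquiv.apply_symm_apply]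

theorem boxEquiv_left (i : Z.Arc) (x) :
    Z.boxEquiv (KBimodule.left i x) = KBimodule.left i (Z.boxEquiv x) := by
  refine LinearMap.congr_fun (f := Z.boxEquiv.toLinearMap ∘ₗ KBimodule.left i)
    (g := KBimodule.left i ∘ₗ Z.boxEquiv.toLinearMap) (box_ext fun j => ?_) x
  have h : KBimodule.left i (Z.boxGen j) = if j = i then Z.boxGen j else 0 := by
    rw [boxGen, KTensor.left_tmul, left_ddGen]
    split_ifs <;> simp
  change Z.boxEquiv (KBimodule.left i (Z.boxGen j)) =
    (Pi.single i 1 : Z.Arc → F2) * Z.boxEquiv (Z.boxGen j)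
  rw [h, boxEquiv_boxGen]
  split_ifs with hij
  · rw [boxEquiv_boxGen, hij, ← Pi.single_mul, one_mul]
  · rw [map_zero]
    ext k
    by_cases hk : k = i
    · subst hk
      simp [Ne.symm hij]
    · simp [Pi.single_apply, hk]

/-- On the generators both actions are given by the same idempotent, and the ground ring is
commutative, so the claim reduces to the left action. -/
theorem boxEquiv_right (i : Z.Arc) (x) :
    Z.boxEquiv (KBimodule.right i x) = KBimodule.right i (Z.boxEquiv x) := by
  have h1 : KBimodule.right i x = KBimodule.left i x := by
    refine LinearMap.congr_fun (box_ext fun j => ?_) x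
    rw [boxGen, KTensor.left_tmul, left_ddGen, KTensor.right_tmul, right_mGen]
    split_ifs <;> simp
  rw [h1, boxEquiv_left]
  exact mul_comm _ _

/-- The identity bimodule outputs `a ⊗ 1`, the box product `a ⊗ e_i` with `i` the terminal arc of
`a`; the two agree over the ground ring. -/
theorem mk_one (a : Z.Alg) (i : Z.Arc) (h : KBimodule.right i a = a) :
    KTensor.mk Z.Arc Z.Alg (Z.Arc → F2) (a ⊗ₜ 1) =
      KTensor.mk Z.Arc Z.Alg (Z.Arc → F2) (a ⊗ₜ Pi.single i 1) := by
  rw [← h, KTensor.mk_right_tmul, KTensor.mk_right_tmul]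
  congr 2
  change (Pi.single i 1 : Z.Arc → F2) * 1 = Pi.single i 1 * Pi.single i 1
  rw [mul_one, ← Pi.single_mul, one_mul]

variable (Z) in
/-- `DD(𝕀/2) ⊠ M(𝕀)` is isomorphic to the identity bimodule. -/
noncomputable def boxIso : DAIso (box Z.DDHalfId Z.MId) (identityDA Z.Arc Z.Alg) where
  toEquiv := Z.boxEquiv
  map_left := boxEquiv_left
  map_right := boxEquiv_right
  map_δ x t := by
    have hf : ∀ (i : Z.Arc) x, Z.boxEquiv.toLinearMap (KBimodule.left i x) =
      KBimodule.left i (Z.boxEquiv.toLinearMap x) := boxEquiv_left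
    have h : (identityDA Z.Arc Z.Alg).δ ∘ₗ Z.boxEquiv.toLinearMap =
        (box Z.DDHalfId Z.MId).δ.compr₂ (KTensor.mapRight Z.Alg Z.boxEquiv.toLinearMap) := by
      refine box_ext fun i => linearMap_T_ext fun R => ?_
      rw [LinearMap.comp_apply, LinearMap.compr₂_apply, LinearEquiv.coe_coe, boxEquiv_boxGen,
        identityDA_δ, groundMap_single]
      -- Both structure maps vanish on the empty word and on words with at least two letters, so
      -- single basis elements remain.
      rcases R with _ | ⟨g, _ | ⟨g', R⟩⟩
      · rw [box_δ_word i (by simp)]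
        simp [word, ιInv_one]
      · have hw : word ([g].map Z.basis) = TensorAlgebra.ι F2 (Z.basis g) := by simp [word]
        rw [hw, TensorAlgebra.ι_leftInverse]
        rcases g with j | ρ
        · have h1 := box_δ_idem i j
          rw [idem] at h1
          rw [h1]
          have h2 : KAlgebra.e i * Z.basis (.idem j) = if i = j then Z.idem i else 0 :=
            Z.idem_mul_idem i j
          rw [h2]
          by_cases hij : i = j
          · rw [if_pos hij, if_pos hij.symm, KTensor.mapRight_mk hf, LinearEquiv.coe_coe,
              boxEquiv_boxGen]
            exact mk_one _ _ ((Z.idem_mul_idem i i).trans (if_pos rfl))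
          · rw [if_neg hij, if_neg (Ne.symm hij)]
            simp
        · rw [box_δ_chord]
          have h2 : KAlgebra.e i * Z.basis (.chord ρ) =
              if Z.arc ρ.start = i then Z.basis (.chord ρ) else 0 := Z.basis_mul (.idem i) _
          rw [h2]
          split_ifs
          · rw [KTensor.mapRight_mk hf, LinearEquiv.coe_coe, boxEquiv_boxGen]
            exact mk_one _ _ ((Z.basis_mul (.chord ρ) (.idem _)).trans (if_pos rfl))
          · simp
      · rw [box_δ_word i (by simp)]
        have hw : word ((g :: g' :: R).map Z.basis) = TensorAlgebra.ι F2 (Z.basis g) *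
            (TensorAlgebra.ι F2 (Z.basis g') * word (R.map Z.basis)) := by simp [word]
        rw [hw, ιInv_ι_mul_ι_mul]
        simp
    exact LinearMap.congr_fun (LinearMap.congr_fun h x) t

end Isomorphism

end Bordered.ArcDiagram

/-- For every arc diagram `Z`, the type `DA` bimodule `DD(𝕀/2) ⊠ M(𝕀)` over `𝓑(Z)` is isomorphic
to the identity type `DA` bimodule of `𝓑(Z)`. -/
theorem mainTheorem3 {P : Type*} [Finite P] (Z : Bordered.ArcDiagram P) :
    Bordered.BoxFinite Z.DDHalfId Z.MId ∧
    (Bordered.box Z.DDHalfId Z.MId).IsTypeDA ∧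
    (Bordered.identityDA Z.Arc Z.Alg).IsTypeDA ∧
    Nonempty (Bordered.DAIso (Bordered.box Z.DDHalfId Z.MId)
      (Bordered.identityDA Z.Arc Z.Alg)) := by
  exact ⟨Z.boxFinite, Z.boxIso.isTypeDA (Bordered.identityDA_isTypeDA _ _),
    Bordered.identityDA_isTypeDA _ _, ⟨Z.boxIso⟩⟩
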